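/- Let $n\ge 1$, $m\ge 2$. For $j=0,1,2$ let $P_{m-j}(\partial_t,\partial_x)=\sum_{k+|\alpha|=m-j}c_{k,\alpha}\,\partial_t^k\partial_x^\alpha$ be constant-coefficient homogeneous operators of order $m-j$ on $\mathbb R_t\times\mathbb R^n_x$ with $c_{m,0}=1$, $c_{m-1,0}>0$ and $c_{m-2,0}>0$ ($P_{m-2}$ is used only in part 2, where $m\ge 3$). Such an operator is called strictly hyperbolic if for each $\xi'\in S^{n-1}=\{\xi\in\mathbb R^n:|\xi|=1\}$ the roots of $\lambda\mapsto P_{m-j}(\lambda,\xi')$ are real and simple. Polynomials $p,q$ of degree $d$ and $d+1$ with real roots $b_1\le\dots\le b_d$ and $a_1\le\dots\le a_{d+1}$ strictly interlace if $a_1<b_1<a_2<b_2<\dots<b_d<a_{d+1}$. For a root $b$ of a polynomial $p$ put $\check p_b(\lambda)=p(\lambda)/(\lambda-b)$. Write $\hat f(\xi)=\int_{\mathbb R^n} e^{-ix\cdot\xi}f(x)\,dx$, $\xi'=\xi/|\xi|$, $\|f\|_{\dot H^s}=\||\xi|^s\hat f\|_{L^2}$, and $\widehat{I_af}=|\xi|^{-a}\hat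 f$. Assume that $P_m$ and $P_{m-1}$ are strictly hyperbolic, that $P_{m-1}(\lambda,\xi')$ and $P_m(\lambda,\xi')$ strictly interlace for every $\xi'\in S^{n-1}$, and that $u_j\in H^{s_0-j}(\mathbb R^n)\cap L^1(\mathbb R^n)$, $j=0,\dots,m-1$, for some real $s_0\ge m-1$. Below, a solution of $Q(\partial_t,\partial_x)u=0$ for $t\ge 0$ with $\partial_t^ju(0,\cdot)=u_j$, $j=0,\dots,m-1$, is a function $u\in\bigcap_{j=0}^{m-1}C^j([0,\infty),H^{s_0-j})$ that has these initial data and for which, for every Schwartz function $\varphi$ on $\mathbb R^n$, the function $t\mapsto\langle u(t,\cdot),\varphi\rangle$ is of class $C^m$ on $[0,\infty)$ and $\langle Q(\partial_t,\partial_x)u(t,\cdot),\varphi\rangle=0$ for all $t\ge 0$. The symbol $o(\cdot)$ refers to $t\to\infty$. 1. Let $u$ be a solution with $Q=P_m+P_{m-1}$, let $M=\int_{\mathbb R^n}(u_{m-1}+c_{m-1,0}u_{m-2})\,dx$, let $b_1(\xi'),\dots,b_{m-1}(\xi')$ be the roots of $P_{m-1}(\cdot,\xi')$, and, for $t>0$,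 let $$\hat v(t,\xi)=M\sum_{j=1}^{m-1}\frac{\exp\Big(i|\xi|b_j(\xi')t+|\xi|^2\frac{P_m(b_j(\xi'),\xi')}{\check P_{m-1,j}(b_j(\xi'),\xi')}t\Big)}{i^{m-2}\check P_{m-1,j}(b_j(\xi'),\xi')},$$ where $\check P_{m-1,j}$ is $\check p_b$ for $p=P_{m-1}(\cdot,\xi')$, $b=b_j(\xi')$. Then, for all integers $k\ge0$ and reals $s\ge 0$ with $k+s\le s_0$ and $\frac n2+k+s>m-2$, one has $u\in C^k([0,\infty),L^2)$, the quantity below is finite for every $t>0$, and $$\big\|\partial_t^k\big(u(t,\cdot)-I_{m-2}v(t,\cdot)\big)\big\|_{\dot H^s}=o\Big((1+t)^{-\frac n4-\frac{k+s-(m-2)}2}\Big).$$ 2. Let $m\ge 3$ and assume, moreover, that $P_{m-2}$ is strictly hyperbolic and that $P_{m-2}(\lambda,\xi')$ and $P_{m-1}(\lambda,\xi')$ strictly interlace for every $\xi'\in S^{n-1}$. Let $u$ be a solution with $Q=P_m+P_{m-1}+P_{m-2}$, let $M=\int_{\mathbb R^n}(u_{m-1}+c_{m-1,0}u_{m-2}+c_{m-2,0}u_{m-3})\,dx$,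 let $d_1(\xi'),\dots,d_{m-2}(\xi')$ be the roots of $P_{m-2}(\cdot,\xi')$, and, for $t>0$, let $$\hat w(t,\xi)=M\sum_{j=1}^{m-2}\frac{\exp\Big(i|\xi|d_j(\xi')t+|\xi|^2\frac{P_{m-1}(d_j(\xi'),\xi')}{\check P_{m-2,j}(d_j(\xi'),\xi')}t\Big)}{i^{m-3}\check P_{m-2,j}(d_j(\xi'),\xi')},$$ where $\check P_{m-2,j}$ is $\check p_b$ for $p=P_{m-2}(\cdot,\xi')$, $b=d_j(\xi')$. Then, for all integers $k\ge0$ and reals $s\ge0$ with $k+s\le s_0$ and $\frac n2+k+s>m-3$, one has $u\in C^k([0,\infty),L^2)$, the quantity below is finite for every $t>0$, and $$\big\|\partial_t^k\big(u(t,\cdot)-I_{m-3}w(t,\cdot)\big)\big\|_{\dot H^s}=o\Big((1+t)^{-\frac n4-\frac{k+s-(m-3)}2}\Big).$$ In both parts the decay rate is optimal when $M\ne0$: let $r=m-2$ in part 1 and $r=m-3$ in part 2, and let $k,s$ be as there. If $M\neq0$, and if $k=0$ or $P_{r+1}(\cdot,\xi')$ has a nonzero root for some $\xi'\in S^{n-1}$,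 then there is $c>0$ with $\|\partial_t^ku(t,\cdot)\|_{\dot H^s}\ge c\,(1+t)^{-\frac n4-\frac{k+s-r}2}$ for all sufficiently large $t$. -/

import Mathlib

open MeasureTheory Filter Topology Set Asymptotics
open scoped SchwartzMap FourierTransform LineDeriv

noncomputable section

/-- The space `ℝⁿ` with its Euclidean norm. -/
abbrev RSpace (n : ℕ) : Type := EuclideanSpace ℝ (Fin n)

/-- The space `L²(ℝⁿ)` of complex-valued functions. -/
abbrev L2Space (n : ℕ) : Type := Lp ℂ 2 (volume : Measure (RSpace n))

/-! ### Constant coefficient operators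

A polynomial `P = ∑ c_{k,α} λ^k ξ^α` in the variables `λ` (index `none`) and `ξ₁, …, ξₙ`
(indices `some i`) stands for the operator `P(∂ₜ, ∂ₓ) = ∑ c_{k,α} ∂ₜ^k ∂ₓ^α`. -/

/-- Constant coefficient differential operators in `t` and `x ∈ ℝⁿ`, given by their polynomial. -/
abbrev DiffOp (n : ℕ) : Type := MvPolynomial (Option (Fin n)) ℂ

/-- The coefficient `c_{k,0}` of `∂ₜ^k`. -/
def timeCoeff {n : ℕ} (P : DiffOp n) (k : ℕ) : ℂ :=
  MvPolynomial.coeff (Finsupp.single none k) P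

/-- The polynomial `λ ↦ P(λ, ξ)`, for fixed `ξ ∈ ℝⁿ`. -/
def symbolAt {n : ℕ} (P : DiffOp n) (ξ : RSpace n) : Polynomial ℂ :=
  MvPolynomial.aeval
    (fun o : Option (Fin n) => o.elim Polynomial.X (fun i => Polynomial.C ((ξ i : ℝ) : ℂ))) P

/-- `P(∂ₜ, ∂ₓ)` is homogeneous of order `d`, with `c_{d,0} > 0`, and strictly hyperbolic: for
every `ξ'` in the unit sphere, the roots of `λ ↦ P(λ, ξ')` are real and simple. -/
structure IsStrictlyHyperbolic {n : ℕ} (P : DiffOp n) (d : ℕ) : Prop where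
  homogeneous : P.IsHomogeneous d
  coeff_pos : 0 < (timeCoeff P d).re ∧ (timeCoeff P d).im = 0
  real_roots : ∀ ξ' ∈ Metric.sphere (0 : RSpace n) 1, ∀ z : ℂ,
    (symbolAt P ξ').IsRoot z → z.im = 0
  simple_roots : ∀ ξ' ∈ Metric.sphere (0 : RSpace n) 1, (symbolAt P ξ').roots.Nodup

/-- `p` (of degree `d`, with real roots `b₀ ≤ … ≤ b_{d-1}`) and `q` (of degree `d + 1`, with
real roots `a₀ ≤ … ≤ a_d`) strictly interlace: `a₀ < b₀ < a₁ < b₁ < … < b_{d-1} < a_d`. -/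
def StrictlyInterlace (d : ℕ) (p q : Polynomial ℂ) : Prop :=
  p.natDegree = d ∧ q.natDegree = d + 1 ∧
    ∃ (b : Fin d → ℝ) (a : Fin (d + 1) → ℝ),
      p.roots = (Finset.univ : Finset (Fin d)).val.map (fun i => ((b i : ℝ) : ℂ)) ∧
      q.roots = (Finset.univ : Finset (Fin (d + 1))).val.map (fun i => ((a i : ℝ) : ℂ)) ∧
      ∀ i : Fin d, a i.castSucc < b i ∧ b i < a i.succ

/-! ### The Cauchy problem -/

/-- The distributional derivative `∂ₓ^α T` of a tempered distribution. -/
def multiDeriv {n : ℕ} (α : Fin n → ℕ) (T : 𝓢'(RSpace n, ℂ)) : 𝓢'(RSpace n, ℂ) :=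
  (List.finRange n).foldr
    (fun i S => (fun R : 𝓢'(RSpace n, ℂ) => ∂_{EuclideanSpace.single i (1 : ℝ)} R)^[α i] S) T

/-- The `L²`-valued time derivative `∂ₜ^k u(t, ·)`, `t ≥ 0` (one-sided at `t = 0`). -/
def timeDeriv {n : ℕ} (k : ℕ) (u : ℝ → L2Space n) (t : ℝ) : L2Space n :=
  iteratedDerivWithin k u (Ici 0) t

/-- `f ∈ C([0,∞), H^σ(ℝⁿ))`. -/
def ContinuousInSobolev {n : ℕ} (σ : ℝ) (f : ℝ → L2Space n) : Prop :=
  ∃ g : ℝ → L2Space n, ContinuousOn g (Ici 0) ∧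
    ∀ t ∈ Ici (0 : ℝ), TemperedDistribution.besselPotential (RSpace n) ℂ σ
      (f t : 𝓢'(RSpace n, ℂ)) = (g t : 𝓢'(RSpace n, ℂ))

/-- `u` is a solution to the Cauchy problem `Q(∂ₜ, ∂ₓ) u = 0` on `[0,∞) × ℝⁿ`,
`∂ₜ^j u(0, ·) = u₀ j` for `j < m`, where `Q` has order `m`:
* `u ∈ C^j([0,∞), H^{s₀-j})` for `j = 0, …, m-1`;
* `t ↦ ⟨u(t,·), φ⟩` is of class `C^m` on `[0,∞)` for every test function `φ`, and the equation
  `∑ c_{k,α} ∂ₜ^k ∂ₓ^α u(t,·) = 0` holds in the sense of distributions for every `t ≥ 0`. -/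
structure IsCauchySolution {n : ℕ} (m : ℕ) (Q : DiffOp n) (s₀ : ℝ) (u₀ : ℕ → L2Space n)
    (u : ℝ → L2Space n) : Prop where
  contDiffOn : ContDiffOn ℝ ((m - 1 : ℕ) : WithTop ℕ∞) u (Ici 0)
  sobolev : ∀ j < m, ContinuousInSobolev (s₀ - j) (timeDeriv j u)
  weak_contDiffOn : ∀ φ : 𝓢(RSpace n, ℂ),
    ContDiffOn ℝ (m : WithTop ℕ∞) (fun t => (u t : 𝓢'(RSpace n, ℂ)) φ) (Ici 0)
  equation : ∀ φ : 𝓢(RSpace n, ℂ), ∀ t ∈ Ici (0 : ℝ),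
    (∑ d ∈ Q.support, MvPolynomial.coeff d Q *
      iteratedDerivWithin (d none)
        (fun τ => multiDeriv (fun i => d (some i)) (u τ : 𝓢'(RSpace n, ℂ)) φ) (Ici 0) t) = 0
  initial : ∀ j < m, timeDeriv j u 0 = u₀ j

/-! ### Fourier transform and homogeneous Sobolev quantities -/

/-- The `L²` Fourier transform `f̂(ξ) = ∫ exp(-i x·ξ) f(x) dx`, so that `∂ₓ` becomes `iξ` and
`f̂(0) = ∫ f` for integrable `f`. -/
def hatFn {n : ℕ} (f : L2Space n) (ξ : RSpace n) : ℂ :=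
  (𝓕 f : L2Space n) ((2 * Real.pi)⁻¹ • ξ)

/-- The function `|ξ|^s g(ξ)`; its `L²` norm is the `Ḣ^s` norm of the object with Fourier
transform `g`. -/
def weighted {n : ℕ} (s : ℝ) (g : RSpace n → ℂ) (ξ : RSpace n) : ℂ :=
  ((‖ξ‖ ^ s : ℝ) : ℂ) * g ξ

/-- The quantity `‖ |ξ|^s g ‖_{L²}`. -/
def dotNorm {n : ℕ} (s : ℝ) (g : RSpace n → ℂ) : ℝ :=
  (eLpNorm (weighted s g) 2 volume).toReal

/-! ### The asymptotic profile -/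

/-- `p̌_b(b)`, where `p̌_b(λ) = p(λ) / (λ - b)`, for a root `b` of `p`. -/
def checkEval (p : Polynomial ℂ) (b : ℂ) : ℂ :=
  (p.divByMonic (Polynomial.X - Polynomial.C b)).eval b

/-- The function
`M ∑_b exp(i|ξ| b t + |ξ|² (P(b,ξ') / p̌_b(b,ξ')) t) / (i^r p̌_b(b,ξ'))`, where `ξ' = ξ/|ξ|` and
`b` runs over the roots of `p(·, ξ')`. -/
def profileHat {n : ℕ} (r : ℕ) (p P : DiffOp n) (M : ℂ) (t : ℝ) (ξ : RSpace n) : ℂ :=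
  let ξ' : RSpace n := ‖ξ‖⁻¹ • ξ
  M * ((symbolAt p ξ').roots.map (fun b =>
    Complex.exp (Complex.I * (‖ξ‖ : ℂ) * b * (t : ℂ)
        + (‖ξ‖ : ℂ) ^ 2 * ((symbolAt P ξ').eval b / checkEval (symbolAt p ξ') b) * (t : ℂ))
      / (Complex.I ^ r * checkEval (symbolAt p ξ') b))).sum

/-- The Fourier transform of the `k`-th time derivative of the Riesz potential of order `r` of the
profile, `∂ₜ^k ( |ξ|^{-r} v̂(t,ξ) )`. -/
def rieszProfileDeriv {n : ℕ} (r : ℕ) (p P : DiffOp n) (M : ℂ) (k : ℕ) (t : ℝ)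
    (ξ : RSpace n) : ℂ :=
  iteratedDeriv k (fun τ : ℝ => ((‖ξ‖ ^ (-(r : ℝ)) : ℝ) : ℂ) * profileHat r p P M τ ξ) t

/-- The asymptotic profile statement for the solution `u`, with profile `I_r v` built from the roots
of `p`, and smoothness index `s₀`, together with the optimality of the decay rate when `M ≠ 0`. -/
def HasAsymptoticProfile {n : ℕ} (r : ℕ) (p P : DiffOp n) (M : ℂ) (s₀ : ℝ)
    (u : ℝ → L2Space n) : Prop :=
  ∀ (k : ℕ) (s : ℝ), 0 ≤ s → (k : ℝ) + s ≤ s₀ → (r : ℝ) < (n : ℝ) / 2 + k + s →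
    ContDiffOn ℝ (k : WithTop ℕ∞) u (Ici 0) ∧
    (∀ t : ℝ, 0 < t → MemLp (weighted s (fun ξ =>
      hatFn (timeDeriv k u t) ξ - rieszProfileDeriv r p P M k t ξ)) 2 volume) ∧
    (fun t : ℝ => dotNorm s (fun ξ =>
        hatFn (timeDeriv k u t) ξ - rieszProfileDeriv r p P M k t ξ))
      =o[atTop] (fun t : ℝ => (1 + t) ^ (-(n : ℝ) / 4 - ((k : ℝ) + s - r) / 2)) ∧
    (M ≠ 0 →
      (k = 0 ∨ ∃ ξ' ∈ Metric.sphere (0 : RSpace n) 1, ∃ b : ℂ,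
        b ≠ 0 ∧ (symbolAt p ξ').IsRoot b) →
      ∃ c : ℝ, 0 < c ∧ ∀ᶠ t : ℝ in atTop,
        c * (1 + t) ^ (-(n : ℝ) / 4 - ((k : ℝ) + s - r) / 2)
          ≤ dotNorm s (hatFn (timeDeriv k u t)))

end

/-!
Both asymptotic statements are instances of one, about a `DampedSystem`: an equation
`(R₀ + R₁ + R₂) u = 0` whose parts of order `r + 1`, `r + 2` and, possibly, `r + 3` are strictly
hyperbolic and strictly interlace. The first statement is the case of two parts, the second one that
of three.

**Reduction to ordinary differential equations.** The Fourier transform of a weak solution solves,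
for almost every `ξ`, an ordinary differential equation in `t` with characteristic polynomial
`λ ↦ Q(λ, iξ)`. This identifies it with `solJet`, the solution given by the matrix exponential
(`DampedSystem.fourier_eq_solJet`), and the estimates below show that the time derivatives exist in
`L²` (`DampedSystem.regularity`). All that remains is the study of `solHat`.

**Location of the characteristic roots.** Interlacing means that `R₁/R₀` and `R₂/R₁` map the upper
half plane to itself, which excludes characteristic roots with nonnegative real part
(`DampedSystem.re_root_neg`). Near infinity the roots are perturbations of those of the part of
highest order, with real part bounded away from zero; by compactness, the solutions decay
exponentially in time away from `ξ = 0` (`DampedSystem.outer_estimate`). Near `ξ = 0`, with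
`ξ = ρω`, there are `r + 1` slow roots `iρb + ρ² R₁(b)/R₀'(b) + O(ρ³)`, one for each root `b` of
`R₀(·, ω)`, and the other one or two have real part bounded away from zero
(`DampedSystem.exists_low`). Accordingly a solution is a sum of slow modes, with amplitudes of size
`ρ^(-r)`, and an exponentially decaying remainder (`DampedSystem.low_decomposition`). At leading
order the amplitudes are proportional to the mass of the data, a value at `ξ = 0` that exists
because the data are integrable (`DampedSystem.mass_eq`).

**Upper bound.** In the diffusive variable `η = √t ξ` the norm of the difference of solution and
profile becomes the claimed power of `t` times an `L²` norm (`dotNorm_eq_rescale`). The phases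
`i√t|η|b` have no limit, but the rescaled solution minus an oscillating `limitProfile` tends to zero
pointwise and is dominated by a square integrable function, the condition `n/2 + k + s > r` making
`|η|^(k+s-r)` square integrable near `0` (`DampedSystem.tendsto_rescale_solHat`). The same holds for
the profile, whence `DampedSystem.isLittleO_dotNorm_sub_profile`.

**Lower bound.** It suffices to bound the `L²` norm of `limitProfile` from below. On a ray through
`η` the profile is a sum of oscillations `exp(iτ|η|√t b)` with distinct real `b`. Testing it against
one of them on `τ ∈ [1, 2]`, the others disappear as `t → ∞` by the Riemann–Lebesgue lemma
(`exists_eLpNorm_oscillation_bound`). Averaging over dilations and Fatou's lemma turn this into a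
bound on the whole space (`DampedSystem.exists_limitProfile_lower_bound`), as soon as some root `b`
has `b^k ≠ 0`.
-/

/-! ### Quantitative perturbation of simple roots -/

/-- The polynomials of degree at most `N` all of whose coefficients are bounded by `A`. Estimates
that depend on `N` and `A` only are uniform over directions of the frequency variable. -/
structure CoeffBound (N : ℕ) (A : ℝ) (p : Polynomial ℂ) : Prop where
  natDegree_le : p.natDegree ≤ N
  coeff_le : ∀ i, ‖p.coeff i‖ ≤ A

namespace CoeffBound

variable {N : ℕ} {A : ℝ} {p : Polynomial ℂ}

lemma nonneg (h : CoeffBound N A p) : 0 ≤ A := (norm_nonneg _).trans (h.coeff_le 0)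

lemma mono {N' : ℕ} {A' : ℝ} (h : CoeffBound N A p) (hN : N ≤ N') (hA : A ≤ A') :
    CoeffBound N' A' p := ⟨h.1.trans hN, fun i => (h.2 i).trans hA⟩

lemma norm_eval_le (h : CoeffBound N A p) {R : ℝ} {z : ℂ} (hz : ‖z‖ ≤ R) :
    ‖p.eval z‖ ≤ A * ∑ i ∈ Finset.range (N + 1), R ^ i := by
  rw [Polynomial.eval_eq_sum_range' (Nat.lt_succ_of_le h.1), Finset.mul_sum]
  refine (norm_sum_le _ _).trans (Finset.sum_le_sum fun i _ => ?_)
  rw [norm_mul, norm_pow]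
  exact mul_le_mul (h.2 i) (pow_le_pow_left₀ (norm_nonneg _) hz i) (by positivity) h.nonneg

lemma derivative (h : CoeffBound N A p) : CoeffBound N (N * A) p.derivative := by
  refine ⟨(Polynomial.natDegree_derivative_le p).trans ((Nat.sub_le _ _).trans h.1), fun i => ?_⟩
  rw [Polynomial.coeff_derivative]
  by_cases hi : i + 1 ≤ N
  · rw [norm_mul, mul_comm]
    refine mul_le_mul ?_ (h.2 _) (norm_nonneg _) (Nat.cast_nonneg _)
    have : ‖((i : ℂ) + 1)‖ = (i : ℝ) + 1 := by
      rw [← Nat.cast_succ, Complex.norm_natCast]; simp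
    rw [this]; exact_mod_cast hi
  · rw [Polynomial.coeff_eq_zero_of_natDegree_lt (h.1.trans_lt (not_le.1 hi))]
    simpa using mul_nonneg (Nat.cast_nonneg (α := ℝ) N) h.nonneg

lemma add {B : ℝ} {q : Polynomial ℂ} (hp : CoeffBound N A p) (hq : CoeffBound N B q) :
    CoeffBound N (A + B) (p + q) :=
  ⟨(Polynomial.natDegree_add_le _ _).trans (max_le hp.1 hq.1), fun i => by
    rw [Polynomial.coeff_add]; exact (norm_add_le _ _).trans (add_le_add (hp.2 i) (hq.2 i))⟩

lemma C_mul (h : CoeffBound N A p) {a : ℂ} {B : ℝ} (ha : ‖a‖ ≤ B) :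
    CoeffBound N (B * A) (Polynomial.C a * p) :=
  ⟨(Polynomial.natDegree_C_mul_le _ _).trans h.1, fun i => by
    rw [Polynomial.coeff_C_mul, norm_mul]
    exact mul_le_mul ha (h.2 i) (norm_nonneg _) ((norm_nonneg _).trans ha)⟩

lemma norm_eval_sub_le (h : CoeffBound N A p) {R : ℝ} {z w : ℂ} (hz : ‖z‖ ≤ R) (hw : ‖w‖ ≤ R) :
    ‖p.eval z - p.eval w‖ ≤ N * A * (∑ i ∈ Finset.range (N + 1), R ^ i) * ‖z - w‖ := by
  refine Convex.norm_image_sub_le_of_norm_deriv_le (s := Metric.closedBall (0 : ℂ) R)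
    (f := fun z => p.eval z) (fun x _ => p.differentiableAt) (fun x hx => ?_)
    (convex_closedBall _ _) (by simpa using hw) (by simpa using hz)
  rw [Polynomial.deriv]
  exact h.derivative.norm_eval_le (by simpa using hx)

end CoeffBound

/-- The logarithmic derivative `G'/G = ∑ 1/(b - zᵢ)` forces a root of `G` near any point at which
`G` is small compared with `G'`. -/
lemma exists_root_near {G : Polynomial ℂ} {N : ℕ} (hG : G.natDegree ≤ N) {b : ℂ}
    (hb : G.derivative.eval b ≠ 0) :
    ∃ z, G.IsRoot z ∧ ‖z - b‖ * ‖G.derivative.eval b‖ ≤ N * ‖G.eval b‖ := by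
  by_cases h0 : G.eval b = 0
  · exact ⟨b, h0, by simp [h0]⟩
  by_contra! hcon
  have hsum := (IsAlgClosed.splits G).eval_derivative_div_eval_of_ne_zero h0
  have hd : 0 < ‖G.derivative.eval b‖ := norm_pos_iff.2 hb
  have he : 0 < ‖G.eval b‖ := norm_pos_iff.2 h0
  have hG0 : G ≠ 0 := by rintro rfl; simp at h0
  set q : ℝ := ‖G.derivative.eval b‖ / ‖G.eval b‖ with hq
  have hqpos : 0 < q := div_pos hd he
  have hterm : ∀ z ∈ G.roots, ‖1 / (b - z)‖ * N < q := by
    intro z hz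
    have h1 := hcon z (Polynomial.isRoot_of_mem_roots hz)
    have hzb : 0 < ‖z - b‖ := by
      rcases (norm_nonneg (z - b)).eq_or_lt with h | h
      · exfalso
        rw [eq_comm, norm_eq_zero, sub_eq_zero] at h
        exact h0 (h ▸ Polynomial.isRoot_of_mem_roots hz)
      · exact h
    rw [norm_div, norm_one, norm_sub_rev, hq, div_mul_eq_mul_div, one_mul, div_lt_div_iff₀ hzb he]
    linarith [mul_comm ‖z - b‖ ‖G.derivative.eval b‖]
  have hbound : ∀ s : Multiset ℂ, (∀ z ∈ s, ‖1 / (b - z)‖ * N < q) →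
      ‖(s.map fun z => 1 / (b - z)).sum‖ * N ≤ Multiset.card s * q ∧
      (s ≠ 0 → ‖(s.map fun z => 1 / (b - z)).sum‖ * N < Multiset.card s * q) := by
    intro s
    induction s using Multiset.induction_on with
    | empty => intro _; simp
    | cons a s ih =>
      intro hs
      have h1 := hs a (Multiset.mem_cons_self _ _)
      have h2 := (ih fun z hz => hs z (Multiset.mem_cons_of_mem hz)).1
      have : ‖((a ::ₘ s).map fun z => 1 / (b - z)).sum‖ * N < Multiset.card (a ::ₘ s) * q := by
        rw [Multiset.map_cons, Multiset.sum_cons, Multiset.card_cons]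
        have h3 := norm_add_le (1 / (b - a)) (s.map fun z => 1 / (b - z)).sum
        have h4 := mul_le_mul_of_nonneg_right h3 (Nat.cast_nonneg (α := ℝ) N)
        push_cast
        nlinarith
      exact ⟨this.le, fun _ => this⟩
  have hroots : G.roots ≠ 0 := by
    intro h
    rw [h] at hsum
    simp only [Multiset.map_zero, Multiset.sum_zero, div_eq_zero_iff] at hsum
    exact hsum.elim hb h0
  have h5 := (hbound _ hterm).2 hroots
  rw [← hsum, norm_div, ← hq] at h5
  have h6 : (Multiset.card G.roots : ℝ) ≤ N := by
    exact_mod_cast (Polynomial.card_roots' G).trans hG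
  nlinarith

/-- The polynomial `p + a g + a² h`, a perturbation of `p` for small `a`. -/
noncomputable def perturbed (p g h : Polynomial ℂ) (a : ℂ) : Polynomial ℂ :=
  p + Polynomial.C a * g + Polynomial.C (a ^ 2) * h

lemma eval_perturbed (p g h : Polynomial ℂ) (a z : ℂ) :
    (perturbed p g h a).eval z = p.eval z + a * g.eval z + a ^ 2 * h.eval z := by
  simp [perturbed]

lemma eval_derivative_perturbed (p g h : Polynomial ℂ) (a z : ℂ) :
    (perturbed p g h a).derivative.eval z =
      p.derivative.eval z + a * g.derivative.eval z + a ^ 2 * h.derivative.eval z := by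
  simp [perturbed, Polynomial.derivative_mul, -map_pow]

lemma CoeffBound.perturbed {N : ℕ} {A : ℝ} {p g h : Polynomial ℂ} (hp : CoeffBound N A p)
    (hg : CoeffBound N A g) (hh : CoeffBound N A h) {a : ℂ} (ha : ‖a‖ ≤ 1) :
    CoeffBound N (3 * A) (perturbed p g h a) := by
  have h2 : ‖a ^ 2‖ ≤ 1 := by rw [norm_pow]; exact pow_le_one₀ (norm_nonneg _) ha
  convert! (hp.add (hg.C_mul ha)).add (hh.C_mul h2) using 1; ring

/-- Derivatives of the perturbed polynomial near `b` differ from `p'(b)` by a small amount. -/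
lemma exists_derivative_perturbed_bound (N : ℕ) (A : ℝ) : ∃ C : ℝ, 0 < C ∧
    ∀ p g h : Polynomial ℂ, CoeffBound N A p → CoeffBound N A g → CoeffBound N A h →
    ∀ b z a : ℂ, ‖b‖ ≤ A → ‖z - b‖ ≤ 1 → ‖a‖ ≤ 1 →
      ‖(perturbed p g h a).derivative.eval z - p.derivative.eval b‖ ≤ C * (‖z - b‖ + ‖a‖) := by
  set S : ℝ := ∑ i ∈ Finset.range (N + 1), (A + 1) ^ i with hS
  refine ⟨N * (N * A) * S + 2 * (N * A * S) + 1 + |N * (N * A) * S + 2 * (N * A * S)|, ?_, ?_⟩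
  · linarith [neg_abs_le (N * (N * A) * S + 2 * (N * A * S))]
  intro p g h hp hg hh b z a hb hz ha
  have hA := hp.nonneg
  have hz' : ‖z‖ ≤ A + 1 := by
    have := norm_add_le (z - b) b; rw [sub_add_cancel] at this; linarith
  have hS0 : 0 ≤ S := by positivity
  have e1 := hp.derivative.norm_eval_sub_le hz' (hb.trans (by linarith))
  have e2 := hg.derivative.norm_eval_le hz'
  have e3 := hh.derivative.norm_eval_le hz'
  rw [← hS] at e1 e2 e3
  rw [eval_derivative_perturbed]
  have e4 : ‖p.derivative.eval z + a * g.derivative.eval z + a ^ 2 * h.derivative.eval z -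
      p.derivative.eval b‖ ≤ ‖p.derivative.eval z - p.derivative.eval b‖ +
        (‖a‖ * ‖g.derivative.eval z‖ + ‖a‖ ^ 2 * ‖h.derivative.eval z‖) := by
    rw [← norm_pow, ← norm_mul, ← norm_mul]
    refine le_trans (le_of_eq ?_) ((norm_add_le _ _).trans (add_le_add le_rfl (norm_add_le _ _)))
    congr 1; ring
  have e5 : ‖a‖ ^ 2 ≤ ‖a‖ := by nlinarith [norm_nonneg a]
  have e6 : ‖a‖ * ‖g.derivative.eval z‖ ≤ ‖a‖ * (N * A * S) :=
    mul_le_mul_of_nonneg_left e2 (norm_nonneg _)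
  have e7 : ‖a‖ ^ 2 * ‖h.derivative.eval z‖ ≤ ‖a‖ * (N * A * S) :=
    mul_le_mul e5 e3 (norm_nonneg _) (norm_nonneg _)
  have p1 : 0 ≤ (N : ℝ) * (N * A) * S := by positivity
  have p2 : 0 ≤ (N : ℝ) * A * S := by positivity
  rw [abs_of_nonneg (by linarith)]
  nlinarith [norm_nonneg a, norm_nonneg (z - b), mul_nonneg p1 (norm_nonneg a),
    mul_nonneg p2 (norm_nonneg (z - b)), mul_nonneg p1 (norm_nonneg (z-b)),
    mul_nonneg p2 (norm_nonneg a)]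

/-- A simple root `b` of `p` has a neighbourhood of uniform size in which the perturbed polynomial
has at most one root, and a simple one. -/
lemma exists_isolation_radius (N : ℕ) (A : ℝ) {c : ℝ} (hc : 0 < c) : ∃ δ : ℝ, 0 < δ ∧ δ ≤ 1 ∧
    ∀ p g h : Polynomial ℂ, CoeffBound N A p → CoeffBound N A g → CoeffBound N A h →
    ∀ b a : ℂ, ‖b‖ ≤ A → c ≤ ‖p.derivative.eval b‖ → ‖a‖ ≤ δ →
      (∀ z, ‖z - b‖ ≤ δ → c / 2 ≤ ‖(perturbed p g h a).derivative.eval z‖) ∧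
      ∀ z w, ‖z - b‖ ≤ δ → ‖w - b‖ ≤ δ → (perturbed p g h a).IsRoot z →
        (perturbed p g h a).IsRoot w → z = w := by
  obtain ⟨C, hC, hbd⟩ := exists_derivative_perturbed_bound N A
  refine ⟨min 1 (c / (4 * C)), by positivity, min_le_left _ _, ?_⟩
  intro p g h hp hg hh b a hb hpb ha
  have key : ∀ z, ‖z - b‖ ≤ min 1 (c / (4 * C)) →
      ‖(perturbed p g h a).derivative.eval z - p.derivative.eval b‖ ≤ c / 2 := by
    intro z hz
    refine (hbd p g h hp hg hh b z a hb (hz.trans (min_le_left _ _))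
      (ha.trans (min_le_left _ _))).trans ?_
    have h1 := hz.trans (min_le_right _ _)
    have h2 := ha.trans (min_le_right _ _)
    calc C * (‖z - b‖ + ‖a‖) ≤ C * (c / (4 * C) + c / (4 * C)) := by gcongr
      _ = c / 2 := by field_simp; ring
  refine ⟨fun z hz => ?_, fun z w hz hw hGz hGw => ?_⟩
  · have := key z hz
    have h3 := norm_sub_norm_le (p.derivative.eval b) ((perturbed p g h a).derivative.eval z)
    rw [norm_sub_rev] at h3
    linarith
  · by_contra hne
    have hmv := Convex.norm_image_sub_le_of_norm_deriv_le
      (s := Metric.closedBall b (min 1 (c / (4 * C))))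
      (f := fun z => (perturbed p g h a).eval z - p.derivative.eval b * z) (C := c / 2)
      (fun x _ => by fun_prop) (fun x hx => ?_) (convex_closedBall _ _)
      (x := w) (y := z) (by simpa [dist_eq_norm] using hw) (by simpa [dist_eq_norm] using hz)
    · have e1 : (perturbed p g h a).eval z = 0 := hGz
      have e2 : (perturbed p g h a).eval w = 0 := hGw
      simp only [e1, e2] at hmv
      have e3 : (0 - p.derivative.eval b * z - (0 - p.derivative.eval b * w) : ℂ) =
        -(p.derivative.eval b * (z - w)) := by ring
      rw [e3, norm_neg, norm_mul] at hmv
      have : 0 < ‖z - w‖ := norm_pos_iff.2 (sub_ne_zero.2 hne)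
      nlinarith
    · have e : deriv (fun z => (perturbed p g h a).eval z - p.derivative.eval b * z) x =
          (perturbed p g h a).derivative.eval x - p.derivative.eval b := by
        have := ((perturbed p g h a).hasDerivAt x).sub ((hasDerivAt_id x).const_mul
          (p.derivative.eval b))
        rw [mul_one] at this
        exact this.deriv
      rw [e]
      exact key x (by simpa [dist_eq_norm] using hx)

/-- A simple root `b` of `p` moves to `b - a g(b)/p'(b) + O(a²)`, with constants that depend only
on bounds for the coefficients and a lower bound for `|p'(b)|`. -/
lemma exists_perturbed_root (N : ℕ) (A : ℝ) {c : ℝ} (hc : 0 < c) :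
    ∃ δ C : ℝ, 0 < δ ∧ δ ≤ 1 ∧ 0 < C ∧
    ∀ p g h : Polynomial ℂ, CoeffBound N A p → CoeffBound N A g → CoeffBound N A h →
    ∀ b a : ℂ, ‖b‖ ≤ A → p.IsRoot b → c ≤ ‖p.derivative.eval b‖ → ‖a‖ ≤ δ →
      ∃ z, (perturbed p g h a).IsRoot z ∧ ‖z - b‖ ≤ C * ‖a‖ ∧
        ‖z - b + a * (g.eval b / p.derivative.eval b)‖ ≤ C * ‖a‖ ^ 2 := by
  rcases lt_or_ge A 0 with hA | hA
  · exact ⟨1, 1, one_pos, le_rfl, one_pos, fun p _ _ hp => absurd hp.nonneg (not_le.2 hA)⟩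
  obtain ⟨δ₁, hδ₁, hδ₁1, hiso⟩ := exists_isolation_radius N A hc
  set S : ℝ := ∑ i ∈ Finset.range (N + 1), (A + 1) ^ i with hS
  have hS0 : 0 ≤ S := by positivity
  obtain ⟨C₀, hC₀, hder⟩ := exists_derivative_perturbed_bound N A
  set C₁ : ℝ := N * (2 * (A * S)) * (2 / c) + 1 with hC₁
  have hC₁p : 0 < C₁ := by positivity
  set C₂ : ℝ := (C₀ * (C₁ + 1) * C₁ + A * S) / c with hC₂
  have hC₂p : 0 ≤ C₂ := by positivity
  refine ⟨min δ₁ (1 / C₁), C₁ + C₂, by positivity, (min_le_left _ _).trans hδ₁1, by positivity, ?_⟩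
  intro p g h hp hg hh b a hb hpb hpb' ha
  have ha1 : ‖a‖ ≤ 1 := ha.trans ((min_le_left _ _).trans hδ₁1)
  have haC : C₁ * ‖a‖ ≤ 1 := by
    have := ha.trans (min_le_right _ _)
    rw [le_div_iff₀ hC₁p] at this; linarith
  have ha2 : ‖a‖ ^ 2 ≤ ‖a‖ := by nlinarith [norm_nonneg a]
  have hGd := (hiso p g h hp hg hh b a hb hpb' (ha.trans (min_le_left _ _))).1 b
    (by simpa using hδ₁.le)
  have hb' : ‖b‖ ≤ A + 1 := by linarith
  have hpb0 : p.eval b = 0 := hpb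
  have eg := hg.norm_eval_le hb'
  have eh := hh.norm_eval_le hb'
  rw [← hS] at eg eh
  have hG : ‖(perturbed p g h a).eval b‖ ≤ 2 * (A * S) * ‖a‖ := by
    rw [eval_perturbed, hpb0, zero_add]
    refine (norm_add_le _ _).trans ?_
    rw [norm_mul, norm_mul, norm_pow]
    have := mul_le_mul_of_nonneg_left eg (norm_nonneg a)
    have := mul_le_mul ha2 eh (norm_nonneg _) (norm_nonneg _)
    linarith
  obtain ⟨z, hz, hzb⟩ := exists_root_near (hp.perturbed hg hh ha1).1
    (b := b) (fun h => by rw [h, norm_zero] at hGd; linarith)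
  have hzb1 : ‖z - b‖ ≤ C₁ * ‖a‖ := by
    have h1 : ‖z - b‖ * (c / 2) ≤ N * (2 * (A * S) * ‖a‖) :=
      (mul_le_mul_of_nonneg_left hGd (norm_nonneg _)).trans
        (hzb.trans (mul_le_mul_of_nonneg_left hG (Nat.cast_nonneg _)))
    have h2 : ‖z - b‖ ≤ N * (2 * (A * S) * ‖a‖) * (2 / c) := by
      rw [mul_div_assoc', le_div_iff₀ hc]; linarith
    rw [hC₁]; nlinarith [norm_nonneg a]
  refine ⟨z, hz, hzb1.trans (by nlinarith [norm_nonneg a]), ?_⟩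
  have hzb2 : ‖z - b‖ ≤ 1 := hzb1.trans haC
  -- First order Taylor expansion at `b` of the perturbed polynomial, which vanishes at `z`.
  have hmv := Convex.norm_image_sub_le_of_norm_deriv_le
      (s := Metric.closedBall b ‖z - b‖)
      (f := fun z => (perturbed p g h a).eval z - p.derivative.eval b * z)
      (C := C₀ * (C₁ * ‖a‖ + ‖a‖))
      (fun x _ => by fun_prop) (fun x hx => ?_) (convex_closedBall _ _)
      (x := b) (y := z) (by simp) (by simp [dist_eq_norm])
  · have e1 : (perturbed p g h a).eval z = 0 := hz
    have e2 : (perturbed p g h a).eval b = a * g.eval b + a ^ 2 * h.eval b := by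
      rw [eval_perturbed, hpb0, zero_add]
    simp only [e1, e2] at hmv
    have hp0 : p.derivative.eval b ≠ 0 := fun h => by rw [h, norm_zero] at hpb'; linarith
    have e3 : z - b + a * (g.eval b / p.derivative.eval b) =
        -((0 - p.derivative.eval b * z - (a * g.eval b + a ^ 2 * h.eval b -
          p.derivative.eval b * b)) + a ^ 2 * h.eval b) / p.derivative.eval b := by
      field_simp; ring
    rw [e3, norm_div, norm_neg, div_le_iff₀ (lt_of_lt_of_le hc hpb')]
    have e4 : ‖a ^ 2 * h.eval b‖ ≤ ‖a‖ ^ 2 * (A * S) := by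
      rw [norm_mul, norm_pow]; exact mul_le_mul_of_nonneg_left eh (by positivity)
    refine (norm_add_le _ _).trans ((add_le_add hmv e4).trans ?_)
    have e5 : C₀ * (C₁ * ‖a‖ + ‖a‖) * ‖z - b‖ ≤ C₀ * (C₁ * ‖a‖ + ‖a‖) * (C₁ * ‖a‖) := by gcongr
    have e6 : C₂ * ‖a‖ ^ 2 * c = (C₀ * (C₁ + 1) * C₁ + A * S) * ‖a‖ ^ 2 := by
      rw [hC₂]; field_simp
    have e7 : (C₁ + C₂) * ‖a‖ ^ 2 * c ≤ (C₁ + C₂) * ‖a‖ ^ 2 * ‖p.derivative.eval b‖ := by gcongr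
    have e8 : 0 ≤ C₁ * ‖a‖ ^ 2 * c := by positivity
    nlinarith
  · have e : deriv (fun z => (perturbed p g h a).eval z - p.derivative.eval b * z) x =
        (perturbed p g h a).derivative.eval x - p.derivative.eval b := by
      have := ((perturbed p g h a).hasDerivAt x).sub ((hasDerivAt_id x).const_mul
        (p.derivative.eval b))
      rw [mul_one] at this
      exact this.deriv
    rw [e]
    have hx' : ‖x - b‖ ≤ ‖z - b‖ := by simpa [dist_eq_norm] using hx
    refine (hder p g h hp hg hh b x a hb (hx'.trans hzb2) ha1).trans ?_
    gcongr
    exact hx'.trans hzb1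

/-! ### Interlacing polynomials -/

lemma eq_C_mul_prod_of_roots {d : ℕ} {q : Polynomial ℂ} {a : Fin d → ℝ}
    (h : q.roots = (Finset.univ : Finset (Fin d)).val.map (fun i => ((a i : ℝ) : ℂ))) :
    q = Polynomial.C q.leadingCoeff * ∏ i, (Polynomial.X - Polynomial.C ((a i : ℝ) : ℂ)) := by
  conv_lhs => rw [(IsAlgClosed.splits q).eq_prod_roots, h, Multiset.map_map]
  rfl

/-- If `p` and `q` strictly interlace and have positive leading coefficients, then `p / q` is a sum
`∑ rᵢ / (λ - aᵢ)` over the roots of `q` with positive residues. The quotients `q / (λ - aᵢ)` are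
written `e i`. -/
lemma StrictlyInterlace.exists_partialFractions {d : ℕ} {p q : Polynomial ℂ}
    (h : StrictlyInterlace d p q) {α β : ℝ} (hα : 0 < α) (hβ : 0 < β)
    (hp : p.leadingCoeff = α) (hq : q.leadingCoeff = β) :
    ∃ (a r : Fin (d + 1) → ℝ) (e : Fin (d + 1) → Polynomial ℂ),
      (∀ z, q.IsRoot z ↔ ∃ i, z = a i) ∧ Function.Injective a ∧ (∀ i, 0 < r i) ∧
      (∀ i, q = (Polynomial.X - Polynomial.C ((a i : ℝ) : ℂ)) * e i) ∧
      (∀ i, (e i).eval ((a i : ℝ) : ℂ) ≠ 0) ∧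
      p = ∑ i, Polynomial.C ((r i : ℝ) : ℂ) * e i := by
  obtain ⟨hpd, hqd, b, a, hb, ha, hab⟩ := h
  have hpe := eq_C_mul_prod_of_roots hb
  have hqe := eq_C_mul_prod_of_roots ha
  rw [hp] at hpe
  rw [hq] at hqe
  have hmono : StrictMono a := Fin.strictMono_iff_lt_succ.2 fun i => (hab i).1.trans (hab i).2
  have hq0 : q ≠ 0 := by rintro rfl; simp at hqd
  set e : Fin (d + 1) → Polynomial ℂ := fun i => Polynomial.C ((β : ℝ) : ℂ) *
    ∏ j : Fin d, (Polynomial.X - Polynomial.C ((a (i.succAbove j) : ℝ) : ℂ)) with he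
  have hqei : ∀ i, q = (Polynomial.X - Polynomial.C ((a i : ℝ) : ℂ)) * e i := by
    intro i
    rw [hqe, Fin.prod_univ_succAbove _ i, he]
    ring
  have hee : ∀ i z, (e i).eval z = β * ∏ j : Fin d, (z - (a (i.succAbove j) : ℂ)) := by
    intro i z
    simp [he, Polynomial.eval_prod]
  have hratio : ∀ i (j : Fin d), 0 < (a i - b j) / (a i - a (i.succAbove j)) := by
    intro i j
    rcases lt_or_ge j.castSucc i with hj | hj
    · rw [Fin.succAbove_of_castSucc_lt _ _ hj]
      have h1 : a j.succ ≤ a i := hmono.monotone (by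
        rw [Fin.le_def, Fin.val_succ]; exact hj)
      exact div_pos (by linarith [(hab j).2]) (by linarith [(hab j).1, (hab j).2])
    · rw [Fin.succAbove_of_le_castSucc _ _ hj]
      have h1 : a i ≤ a j.castSucc := hmono.monotone hj
      exact div_pos_of_neg_of_neg (by linarith [(hab j).1]) (by linarith [(hab j).1, (hab j).2])
  set r : Fin (d + 1) → ℝ := fun i => α / β * ∏ j : Fin d, (a i - b j) / (a i - a (i.succAbove j))
    with hr
  have hne : ∀ i, (e i).eval ((a i : ℝ) : ℂ) ≠ 0 := by
    intro i
    rw [hee]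
    refine mul_ne_zero (by exact_mod_cast hβ.ne') (Finset.prod_ne_zero_iff.2 fun j _ => ?_)
    rw [← Complex.ofReal_sub]
    exact_mod_cast sub_ne_zero.2 (hmono.injective.ne (Fin.succAbove_ne i j).symm)
  have hpa : ∀ i, p.eval ((a i : ℝ) : ℂ) = r i * (e i).eval ((a i : ℝ) : ℂ) := by
    intro i
    rw [hee, hpe, hr]
    simp only [Polynomial.eval_mul, Polynomial.eval_C, Polynomial.eval_prod, Polynomial.eval_sub,
      Polynomial.eval_X]
    norm_cast
    rw [show α / β * (∏ j : Fin d, (a i - b j) / (a i - a (i.succAbove j))) *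
      (β * ∏ j : Fin d, (a i - a (i.succAbove j))) = α / β * β *
      ((∏ j : Fin d, (a i - b j) / (a i - a (i.succAbove j))) *
      ∏ j : Fin d, (a i - a (i.succAbove j))) by ring, ← Finset.prod_mul_distrib,
      div_mul_cancel₀ _ hβ.ne']
    congr 1
    refine Finset.prod_congr rfl fun j _ => ?_
    rw [div_mul_cancel₀]
    exact sub_ne_zero.2 (hmono.injective.ne (Fin.succAbove_ne i j).symm)
  refine ⟨a, r, e, fun z => ?_, hmono.injective, fun i => ?_, hqei, hne, ?_⟩
  · rw [← Polynomial.mem_roots hq0, ha]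
    simp only [Multiset.mem_map, Finset.mem_val, Finset.mem_univ, true_and, eq_comm]
  · exact mul_pos (div_pos hα hβ) (Finset.prod_pos fun j _ => hratio i j)
  · have hinj : Function.Injective fun i => ((a i : ℝ) : ℂ) :=
      Complex.ofReal_injective.comp hmono.injective
    -- Both sides have degree at most `d` and agree at the `d + 1` roots of `q`.
    have hdeg : ∀ i, (e i).natDegree ≤ d := by
      intro i
      have h1 := hqei i
      have h2 : e i ≠ 0 := fun h => hne i (by rw [h]; simp)
      have h3 := congrArg Polynomial.natDegree h1
      rw [Polynomial.natDegree_mul (Polynomial.X_sub_C_ne_zero _) h2,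
        Polynomial.natDegree_X_sub_C, hqd] at h3
      omega
    refine Polynomial.eq_of_degrees_lt_of_eval_finset_eq
      (Finset.univ.image fun i => ((a i : ℝ) : ℂ)) ?_ ?_ ?_
    · rw [Finset.card_image_of_injective _ hinj, Finset.card_univ, Fintype.card_fin]
      refine Polynomial.degree_le_natDegree.trans_lt ?_
      rw [hpd]; exact_mod_cast Nat.lt_succ_self d
    · rw [Finset.card_image_of_injective _ hinj, Finset.card_univ, Fintype.card_fin]
      refine Polynomial.degree_le_natDegree.trans_lt ?_
      have : (∑ i, Polynomial.C ((r i : ℝ) : ℂ) * e i).natDegree ≤ d :=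
        Polynomial.natDegree_sum_le_of_forall_le _ _ fun i _ =>
          (Polynomial.natDegree_C_mul_le _ _).trans (hdeg i)
      exact_mod_cast Nat.lt_succ_of_le this
    · intro x hx
      obtain ⟨i, -, rfl⟩ := Finset.mem_image.1 hx
      rw [hpa i, Polynomial.eval_finsetSum, Finset.sum_eq_single i]
      · simp
      · intro j _ hj
        have h1 := congrArg (Polynomial.eval ((a i : ℝ) : ℂ)) ((hqei j).symm.trans (hqei i))
        simp only [Polynomial.eval_mul, Polynomial.eval_sub, Polynomial.eval_X, Polynomial.eval_C,
          sub_self, zero_mul] at h1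
        have h2 : (e j).eval ((a i : ℝ) : ℂ) = 0 := by
          refine (mul_eq_zero.1 h1).resolve_left ?_
          rw [← Complex.ofReal_sub]
          exact_mod_cast sub_ne_zero.2 (hmono.injective.ne hj.symm)
        simp [h2]
      · simp

/-- At a root of the polynomial of higher degree, the quotient of the two is a positive multiple of
the derivative. -/
lemma StrictlyInterlace.eval_at_upper_root {d : ℕ} {p q : Polynomial ℂ}
    (h : StrictlyInterlace d p q) {α β : ℝ} (hα : 0 < α) (hβ : 0 < β)
    (hp : p.leadingCoeff = α) (hq : q.leadingCoeff = β) {a : ℂ} (ha : q.IsRoot a) :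
    q.derivative.eval a ≠ 0 ∧ ∃ r : ℝ, 0 < r ∧ p.eval a = r * q.derivative.eval a := by
  obtain ⟨a', r, e, hroot, hinj, hr, hqe, hne, hpe⟩ := h.exists_partialFractions hα hβ hp hq
  obtain ⟨i, rfl⟩ := (hroot a).1 ha
  have hd : q.derivative.eval ((a' i : ℝ) : ℂ) = (e i).eval ((a' i : ℝ) : ℂ) := by
    rw [hqe i]; simp
  refine ⟨hd ▸ hne i, r i, hr i, ?_⟩
  rw [hd, hpe, Polynomial.eval_finsetSum, Finset.sum_eq_single i]
  · simp
  · intro j _ hj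
    have h1 := congrArg (Polynomial.eval ((a' i : ℝ) : ℂ)) ((hqe j).symm.trans (hqe i))
    simp only [Polynomial.eval_mul, Polynomial.eval_sub, Polynomial.eval_X, Polynomial.eval_C,
      sub_self, zero_mul] at h1
    have h2 : (e j).eval ((a' i : ℝ) : ℂ) = 0 := by
      refine (mul_eq_zero.1 h1).resolve_left ?_
      rw [← Complex.ofReal_sub]
      exact_mod_cast sub_ne_zero.2 (hinj.ne hj.symm)
    simp [h2]
  · simp

lemma StrictlyInterlace.not_isRoot_both {d : ℕ} {p q : Polynomial ℂ}
    (h : StrictlyInterlace d p q) {α β : ℝ} (hα : 0 < α) (hβ : 0 < β)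
    (hp : p.leadingCoeff = α) (hq : q.leadingCoeff = β) {a : ℂ} (ha : q.eval a = 0) :
    p.eval a ≠ 0 := by
  obtain ⟨h1, r, hr, h2⟩ := h.eval_at_upper_root hα hβ hp hq ha
  rw [h2]
  exact mul_ne_zero (by exact_mod_cast hr.ne') h1

/-- At a root of the polynomial `p` of lower degree, the other polynomial is a negative multiple of
`p'`: the derivative of `p / q = ∑ rᵢ / (λ - aᵢ)` is negative on the real line. -/
lemma StrictlyInterlace.eval_at_lower_root {d : ℕ} {p q : Polynomial ℂ}
    (h : StrictlyInterlace d p q) {α β : ℝ} (hα : 0 < α) (hβ : 0 < β)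
    (hp : p.leadingCoeff = α) (hq : q.leadingCoeff = β) {b : ℂ} (hb : p.IsRoot b)
    (hbim : b.im = 0) :
    p.derivative.eval b ≠ 0 ∧ ∃ r : ℝ, 0 < r ∧ q.eval b = -(r * p.derivative.eval b) := by
  have hqb : q.eval b ≠ 0 := fun h0 => h.not_isRoot_both hα hβ hp hq h0 hb
  obtain ⟨a, r, e, hroot, hinj, hr, hqe, hne, hpe⟩ := h.exists_partialFractions hα hβ hp hq
  obtain ⟨x, rfl⟩ : ∃ x : ℝ, b = x := ⟨b.re, by apply Complex.ext <;> simp [hbim]⟩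
  have hxa : ∀ i, x - a i ≠ 0 := fun i h0 => hqb ((hroot _).2 ⟨i, by rw [sub_eq_zero.1 h0]⟩)
  have hxa' : ∀ i, (x : ℂ) - a i ≠ 0 := fun i => by exact_mod_cast hxa i
  have he : ∀ i, (e i).eval (x : ℂ) = q.eval (x : ℂ) / (x - a i) := by
    intro i
    rw [eq_div_iff (hxa' i)]
    conv_rhs => rw [hqe i]
    simp [mul_comm]
  have hde : ∀ i, (e i).derivative.eval (x : ℂ) =
      q.derivative.eval (x : ℂ) / q.eval (x : ℂ) * (e i).eval (x : ℂ) -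
        q.eval (x : ℂ) / (x - a i) ^ 2 := by
    intro i
    have h1 : q.derivative.eval (x : ℂ) = (e i).eval (x : ℂ) +
        (x - a i) * (e i).derivative.eval (x : ℂ) := by
      conv_lhs => rw [hqe i]
      simp
    have h2 : (e i).derivative.eval (x : ℂ) =
        (q.derivative.eval (x : ℂ) - (e i).eval (x : ℂ)) / (x - a i) := by
      rw [eq_div_iff (hxa' i), h1]; ring
    rw [h2, he i]
    have := hxa' i
    field_simp
  set T : ℝ := ∑ i, r i / (x - a i) ^ 2 with hT
  have hTpos : 0 < T := Finset.sum_pos (fun i _ => div_pos (hr i)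
    (by have := hxa i; positivity)) ⟨0, Finset.mem_univ _⟩
  have hp0 : ∑ i, (r i : ℂ) * (e i).eval (x : ℂ) = 0 := by
    have h1 : p.eval (x : ℂ) = 0 := hb
    rw [hpe, Polynomial.eval_finsetSum] at h1
    simpa using h1
  have hpd : p.derivative.eval (x : ℂ) = -(q.eval (x : ℂ) * T) := by
    rw [hpe]
    simp only [Polynomial.derivative_sum, Polynomial.derivative_C_mul, Polynomial.eval_finsetSum,
      Polynomial.eval_mul, Polynomial.eval_C, hde, mul_sub, Finset.sum_sub_distrib]
    have h1 : ∑ i, (r i : ℂ) * (q.derivative.eval (x : ℂ) / q.eval (x : ℂ) *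
        (e i).eval (x : ℂ)) = 0 := by
      rw [← mul_zero (q.derivative.eval (x : ℂ) / q.eval (x : ℂ)), ← hp0, Finset.mul_sum]
      exact Finset.sum_congr rfl fun i _ => by ring
    rw [h1, zero_sub, hT]
    push_cast
    rw [Finset.mul_sum]
    congr 1
    exact Finset.sum_congr rfl fun i _ => by ring
  have hT' : (T : ℂ) ≠ 0 := by exact_mod_cast hTpos.ne'
  refine ⟨?_, T⁻¹, inv_pos.2 hTpos, ?_⟩
  · rw [hpd]
    exact neg_ne_zero.2 (mul_ne_zero hqb hT')
  · rw [hpd]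
    push_cast
    field_simp

/-- The Herglotz property of `q / p`: it maps the upper half plane to itself. -/
lemma StrictlyInterlace.im_mul_conj_pos {d : ℕ} {p q : Polynomial ℂ}
    (h : StrictlyInterlace d p q) {α β : ℝ} (hα : 0 < α) (hβ : 0 < β)
    (hp : p.leadingCoeff = α) (hq : q.leadingCoeff = β) {z : ℂ} (hz : z.im ≠ 0) :
    0 < (q.eval z * (starRingEnd ℂ) (p.eval z)).im * z.im := by
  obtain ⟨a, r, e, hroot, hinj, hr, hqe, hne, hpe⟩ := h.exists_partialFractions hα hβ hp hq
  have hza : ∀ i, z - a i ≠ 0 := fun i h0 => hz (by rw [sub_eq_zero.1 h0]; simp)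
  have hqz : q.eval z ≠ 0 := by
    intro h0
    obtain ⟨i, hi⟩ := (hroot z).1 h0
    exact hz (by rw [hi]; simp)
  have he : ∀ i, (e i).eval z = q.eval z * (z - a i)⁻¹ := by
    intro i
    rw [← div_eq_mul_inv, eq_div_iff (hza i)]
    conv_rhs => rw [hqe i]
    simp [mul_comm]
  have hpz : p.eval z = q.eval z * ∑ i, (r i : ℂ) * (z - a i)⁻¹ := by
    conv_lhs => rw [hpe]
    rw [Polynomial.eval_finsetSum, Finset.mul_sum]
    refine Finset.sum_congr rfl fun i _ => ?_
    rw [Polynomial.eval_mul, Polynomial.eval_C, he]; ring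
  rw [hpz, map_mul, ← mul_assoc, Complex.mul_conj]
  have him : (∑ i, (r i : ℂ) * (z - a i)⁻¹).im =
      -(z.im * ∑ i, r i / Complex.normSq (z - a i)) := by
    rw [Complex.im_sum, Finset.mul_sum, ← Finset.sum_neg_distrib]
    refine Finset.sum_congr rfl fun i _ => ?_
    rw [Complex.im_ofReal_mul, Complex.inv_im, Complex.sub_im, Complex.ofReal_im, sub_zero]
    ring
  rw [Complex.im_ofReal_mul, Complex.conj_im, him]
  have hT : 0 < ∑ i, r i / Complex.normSq (z - a i) := Finset.sum_pos (fun i _ =>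
    div_pos (hr i) (Complex.normSq_pos.2 (hza i))) ⟨0, Finset.mem_univ _⟩
  have h1 : 0 < Complex.normSq (q.eval z) := Complex.normSq_pos.2 hqz
  have h2 : 0 < z.im * z.im := mul_self_pos.2 hz
  have := mul_pos (mul_pos h1 hT) h2
  linarith

/-! ### Symbols -/

/-- The polynomial `λ ↦ P(λ, g)` for a complex covector `g`. -/
noncomputable def complexSymbol {n : ℕ} (P : DiffOp n) (g : Fin n → ℂ) : Polynomial ℂ :=
  MvPolynomial.aeval (fun o : Option (Fin n) => o.elim Polynomial.X (fun i => Polynomial.C (g i))) P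

/-- The characteristic polynomial `λ ↦ Q(λ, iξ)` of the ordinary differential equation satisfied by
the Fourier transform of a solution at the frequency `ξ`. -/
noncomputable def charPoly {n : ℕ} (Q : DiffOp n) (ξ : RSpace n) : Polynomial ℂ :=
  complexSymbol Q (fun i => Complex.I * ((ξ i : ℝ) : ℂ))

section Symbols

variable {n : ℕ}

lemma symbolAt_eq (P : DiffOp n) (ξ : RSpace n) :
    symbolAt P ξ = complexSymbol P (fun i => ((ξ i : ℝ) : ℂ)) := rfl

lemma charPoly_add (P Q : DiffOp n) (ξ : RSpace n) :
    charPoly (P + Q) ξ = charPoly P ξ + charPoly Q ξ := map_add _ _ _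

lemma complexSymbol_zero (g : Fin n → ℂ) : complexSymbol (0 : DiffOp n) g = 0 := map_zero _

lemma complexSymbol_eq_sum (P : DiffOp n) (g : Fin n → ℂ) :
    complexSymbol P g = ∑ d ∈ P.support, Polynomial.C (P.coeff d * ∏ i, g i ^ d (some i)) *
      Polynomial.X ^ d none := by
  rw [complexSymbol, MvPolynomial.aeval_def, MvPolynomial.eval₂_eq']
  refine Finset.sum_congr rfl fun d _ => ?_
  rw [Fintype.prod_option]
  simp only [Option.elim_none, Option.elim_some, map_mul, map_prod, map_pow,
    Polynomial.algebraMap_eq]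
  ring

lemma coeff_complexSymbol (P : DiffOp n) (g : Fin n → ℂ) (k : ℕ) :
    (complexSymbol P g).coeff k =
      ∑ d ∈ P.support, if k = d none then P.coeff d * ∏ i, g i ^ d (some i) else 0 := by
  rw [complexSymbol_eq_sum, Polynomial.finsetSum_coeff]
  exact Finset.sum_congr rfl fun d _ => Polynomial.coeff_C_mul_X_pow _ _ _

lemma continuous_coeff_complexSymbol (P : DiffOp n) (k : ℕ) :
    Continuous fun g => (complexSymbol P g).coeff k := by
  simp only [coeff_complexSymbol]
  refine continuous_finsetSum _ fun d _ => ?_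
  split_ifs <;> fun_prop

lemma continuous_coeff_symbolAt (P : DiffOp n) (k : ℕ) :
    Continuous fun ξ => (symbolAt P ξ).coeff k :=
  (continuous_coeff_complexSymbol P k).comp (by fun_prop)

lemma continuous_coeff_charPoly (P : DiffOp n) (k : ℕ) :
    Continuous fun ξ => (charPoly P ξ).coeff k :=
  (continuous_coeff_complexSymbol P k).comp (by fun_prop)

lemma sum_option_degree {e : ℕ} {R : DiffOp n} (h : R.IsHomogeneous e) {d : Option (Fin n) →₀ ℕ}
    (hd : d ∈ R.support) : d none + ∑ i, d (some i) = e := by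
  have h1 := h (MvPolynomial.mem_support_iff.1 hd)
  rw [← h1, Finsupp.weight_apply, Finsupp.sum_fintype _ _ (by simp), Fintype.sum_option]
  simp

lemma natDegree_complexSymbol_le {e : ℕ} {R : DiffOp n} (h : R.IsHomogeneous e)
    (g : Fin n → ℂ) : (complexSymbol R g).natDegree ≤ e := by
  rw [complexSymbol_eq_sum]
  refine Polynomial.natDegree_sum_le_of_forall_le _ _ fun d hd => ?_
  refine (Polynomial.natDegree_C_mul_X_pow_le _ _).trans ?_
  have := sum_option_degree h hd
  omega

lemma coeff_complexSymbol_top {e : ℕ} {R : DiffOp n} (h : R.IsHomogeneous e)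
    (g : Fin n → ℂ) : (complexSymbol R g).coeff e = timeCoeff R e := by
  have key : ∀ d ∈ R.support, e = d none → d = Finsupp.single none e := by
    intro d hd he
    have h1 := sum_option_degree h hd
    have h2 : ∑ i, d (some i) = 0 := by omega
    ext o
    cases o with
    | none => simp [he]
    | some i => simpa using (Finset.sum_eq_zero_iff.1 h2) i (Finset.mem_univ i)
  rw [coeff_complexSymbol, timeCoeff]
  by_cases hs : Finsupp.single none e ∈ R.support
  · rw [Finset.sum_eq_single_of_mem _ hs]
    · simp
    · intro d hd hne
      rw [if_neg fun he => hne (key d hd he)]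
  · rw [MvPolynomial.notMem_support_iff.1 hs]
    refine Finset.sum_eq_zero fun d hd => ?_
    rw [if_neg fun he => hs (key d hd he ▸ hd)]

lemma coeff_complexSymbol_smul {e : ℕ} {R : DiffOp n} (h : R.IsHomogeneous e) (c : ℂ)
    (g : Fin n → ℂ) {k : ℕ} (hk : k ≤ e) :
    (complexSymbol R (fun i => c * g i)).coeff k = c ^ (e - k) * (complexSymbol R g).coeff k := by
  rw [coeff_complexSymbol, coeff_complexSymbol, Finset.mul_sum]
  refine Finset.sum_congr rfl fun d hd => ?_
  split_ifs with hkd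
  · have h1 := sum_option_degree h hd
    have h2 : e - k = ∑ i, d (some i) := by omega
    simp only [mul_pow, Finset.prod_mul_distrib, Finset.prod_pow_eq_pow_sum, h2]
    ring
  · simp

lemma complexSymbol_smul_comp {e : ℕ} {R : DiffOp n} (h : R.IsHomogeneous e) (c : ℂ)
    (g : Fin n → ℂ) :
    (complexSymbol R (fun i => c * g i)).comp (Polynomial.C c * Polynomial.X) =
      Polynomial.C (c ^ e) * complexSymbol R g := by
  ext k
  rw [Polynomial.coeff_C_mul]
  rw [Polynomial.comp_C_mul_X_coeff]
  rcases le_or_gt k e with hk | hk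
  · rw [coeff_complexSymbol_smul h c g hk, ← pow_sub_mul_pow c hk]
    ring
  · rw [Polynomial.coeff_eq_zero_of_natDegree_lt ((natDegree_complexSymbol_le h _).trans_lt hk),
      Polynomial.coeff_eq_zero_of_natDegree_lt ((natDegree_complexSymbol_le h _).trans_lt hk)]
    simp

lemma charPoly_smul_comp {e : ℕ} {R : DiffOp n} (h : R.IsHomogeneous e) (ρ : ℝ) (ω : RSpace n) :
    (charPoly R (ρ • ω)).comp (Polynomial.C (Complex.I * ρ) * Polynomial.X) =
      Polynomial.C ((Complex.I * ρ) ^ e) * symbolAt R ω := by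
  rw [symbolAt_eq, ← complexSymbol_smul_comp h, charPoly]
  congr 2
  ext i
  simp [mul_assoc]

lemma coeff_charPoly_zero {e : ℕ} {R : DiffOp n} (h : R.IsHomogeneous e) (k : ℕ) :
    (charPoly R 0).coeff k = if k = e then timeCoeff R e else 0 := by
  split_ifs with hk
  · rw [hk, charPoly, coeff_complexSymbol_top h]
  · rcases lt_or_gt_of_ne hk with hk | hk
    · have h1 := coeff_complexSymbol_smul h 0 (fun _ => 0) hk.le
      simp only [zero_pow (show e - k ≠ 0 by omega), zero_mul] at h1
      rw [← h1, charPoly]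
      simp
    · exact Polynomial.coeff_eq_zero_of_natDegree_lt
        ((natDegree_complexSymbol_le h _).trans_lt hk)

lemma exists_coeffBound_sphere {e : ℕ} {R : DiffOp n} (h : R.IsHomogeneous e) :
    ∃ A : ℝ, 0 < A ∧ ∀ ω ∈ Metric.sphere (0 : RSpace n) 1, CoeffBound e A (symbolAt R ω) := by
  have h1 : ∀ k, ∃ A : ℝ, ∀ ω ∈ Metric.sphere (0 : RSpace n) 1, ‖(symbolAt R ω).coeff k‖ ≤ A :=
    fun k => (isCompact_sphere _ _).exists_bound_of_continuousOn
      (continuous_coeff_symbolAt R k).continuousOn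
  choose A hA using h1
  refine ⟨∑ k ∈ Finset.range (e + 1), |A k| + 1, by positivity, fun ω hω =>
    ⟨natDegree_complexSymbol_le h _, fun k => ?_⟩⟩
  rcases le_or_gt k e with hk | hk
  · have h2 := Finset.single_le_sum (f := fun k => |A k|) (fun i _ => abs_nonneg _)
      (Finset.mem_range_succ_iff.2 hk)
    have h3 := (hA k ω hω).trans (le_abs_self _)
    linarith
  · rw [symbolAt_eq,
      Polynomial.coeff_eq_zero_of_natDegree_lt ((natDegree_complexSymbol_le h _).trans_lt hk),
      norm_zero]
    positivity

lemma CoeffBound.norm_root_le {N : ℕ} {A : ℝ} {p : Polynomial ℂ} (h : CoeffBound N A p)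
    (hc : p.coeff N ≠ 0) {z : ℂ} (hz : p.IsRoot z) : ‖z‖ ≤ 1 + N * A / ‖p.coeff N‖ := by
  have hc' : 0 < ‖p.coeff N‖ := norm_pos_iff.2 hc
  have hA := h.nonneg
  rcases le_or_gt ‖z‖ 1 with hz1 | hz1
  · have : 0 ≤ N * A / ‖p.coeff N‖ := by positivity
    linarith
  have h0 : p.eval z = 0 := hz
  rw [Polynomial.eval_eq_sum_range' (Nat.lt_succ_of_le h.1), Finset.sum_range_succ] at h0
  rcases N with _ | N
  · simp at h0; simp [h0] at hc
  have h1 : ‖p.coeff (N + 1)‖ * ‖z‖ ^ (N + 1) ≤ (N + 1 : ℕ) * A * ‖z‖ ^ N := by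
    rw [← norm_pow, ← norm_mul, eq_neg_of_add_eq_zero_right h0, norm_neg]
    refine (norm_sum_le _ _).trans ?_
    rw [mul_assoc, ← nsmul_eq_mul, ← Finset.card_range (N + 1), ← Finset.sum_const,
      Finset.card_range]
    refine Finset.sum_le_sum fun i hi => ?_
    rw [norm_mul, norm_pow]
    exact mul_le_mul (h.2 i) (pow_le_pow_right₀ hz1.le (Finset.mem_range_succ_iff.1 hi))
      (by positivity) hA
  have h2 : ‖p.coeff (N + 1)‖ * ‖z‖ ≤ (N + 1 : ℕ) * A := by
    have : 0 < ‖z‖ ^ N := by positivity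
    rw [pow_succ] at h1
    nlinarith
  have h3 : ‖z‖ ≤ (N + 1 : ℕ) * A / ‖p.coeff (N + 1)‖ := by
    rw [le_div_iff₀ hc']; linarith
  linarith

end Symbols

section PolynomialFamilies

variable {X : Type*} [TopologicalSpace X]

lemma continuous_eval_family {N : ℕ} {p : X → Polynomial ℂ} (hN : ∀ x, (p x).natDegree ≤ N)
    (hp : ∀ k, Continuous fun x => (p x).coeff k) :
    Continuous fun y : X × ℂ => (p y.1).eval y.2 := by
  have : (fun y : X × ℂ => (p y.1).eval y.2) =
      fun y => ∑ k ∈ Finset.range (N + 1), (p y.1).coeff k * y.2 ^ k := by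
    ext y
    exact Polynomial.eval_eq_sum_range' (Nat.lt_succ_of_le (hN _)) _
  rw [this]
  exact continuous_finsetSum _ fun k _ =>
    ((hp k).comp continuous_fst).mul (continuous_snd.pow k)

lemma continuous_eval_derivative_family {N : ℕ} {p : X → Polynomial ℂ}
    (hN : ∀ x, (p x).natDegree ≤ N) (hp : ∀ k, Continuous fun x => (p x).coeff k) :
    Continuous fun y : X × ℂ => (p y.1).derivative.eval y.2 :=
  continuous_eval_family (N := N) (p := fun x => (p x).derivative)
    (fun x => (Polynomial.natDegree_derivative_le _).trans ((Nat.sub_le _ _).trans (hN x)))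
    fun k => by
      simp only [Polynomial.coeff_derivative]
      exact (hp _).mul continuous_const

/-- The roots of a bounded family of polynomials over a compact set form a compact set. -/
lemma isCompact_root_family {N : ℕ} {p : X → Polynomial ℂ} (hN : ∀ x, (p x).natDegree ≤ N)
    (hp : ∀ k, Continuous fun x => (p x).coeff k) {K : Set X} (hK : IsCompact K) {A : ℝ}
    (hA : ∀ x ∈ K, ∀ z, (p x).IsRoot z → ‖z‖ ≤ A) :
    IsCompact {y : X × ℂ | y.1 ∈ K ∧ (p y.1).IsRoot y.2} := by
  have h1 : {y : X × ℂ | y.1 ∈ K ∧ (p y.1).IsRoot y.2} =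
      (K ×ˢ Metric.closedBall (0 : ℂ) A) ∩ {y : X × ℂ | (p y.1).eval y.2 = 0} := by
    ext y
    simp only [mem_ofPred_eq, mem_inter_iff, mem_prod, mem_closedBall_zero_iff, Polynomial.IsRoot]
    exact ⟨fun h => ⟨⟨h.1, hA _ h.1 _ h.2⟩, h.2⟩, fun h => ⟨h.1.1, h.2⟩⟩
  rw [h1]
  exact (hK.prod (isCompact_closedBall _ _)).inter_right
    (isClosed_singleton.preimage (continuous_eval_family hN hp))

end PolynomialFamilies

/-! ### Characteristic roots -/

/-- The hypotheses of both parts: operators of consecutive orders `r + 1`, `r + 2` and possibly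
`r + 3` whose symbols strictly interlace, the operator of the highest order `m` being normalized. If
only two operators occur, then `R₂ = 0`. The operator `R₀` of the lowest order governs the low
frequencies. -/
structure DampedSystem {n : ℕ} (r m : ℕ) (R₀ R₁ R₂ : DiffOp n) : Prop where
  hyp₀ : IsStrictlyHyperbolic R₀ (r + 1)
  hyp₁ : IsStrictlyHyperbolic R₁ (r + 2)
  int₀₁ : ∀ ω ∈ Metric.sphere (0 : RSpace n) 1,
    StrictlyInterlace (r + 1) (symbolAt R₀ ω) (symbolAt R₁ ω)
  top : (m = r + 2 ∧ R₂ = 0 ∧ timeCoeff R₁ (r + 2) = 1) ∨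
    (m = r + 3 ∧ IsStrictlyHyperbolic R₂ (r + 3) ∧ timeCoeff R₂ (r + 3) = 1 ∧
      ∀ ω ∈ Metric.sphere (0 : RSpace n) 1,
        StrictlyInterlace (r + 2) (symbolAt R₁ ω) (symbolAt R₂ ω))

section Branches

variable {n : ℕ}

lemma IsStrictlyHyperbolic.timeCoeff_eq {d : ℕ} {P : DiffOp n} (h : IsStrictlyHyperbolic P d) :
    timeCoeff P d = ((timeCoeff P d).re : ℂ) :=
  Complex.ext (by simp) (by simp [h.coeff_pos.2])

lemma IsStrictlyHyperbolic.natDegree_symbolAt {d : ℕ} {P : DiffOp n}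
    (h : IsStrictlyHyperbolic P d) (ω : RSpace n) : (symbolAt P ω).natDegree = d := by
  refine le_antisymm (natDegree_complexSymbol_le h.homogeneous _)
    (Polynomial.le_natDegree_of_ne_zero ?_)
  rw [symbolAt_eq, coeff_complexSymbol_top h.homogeneous, h.timeCoeff_eq]
  exact_mod_cast h.coeff_pos.1.ne'

lemma IsStrictlyHyperbolic.leadingCoeff_symbolAt {d : ℕ} {P : DiffOp n}
    (h : IsStrictlyHyperbolic P d) (ω : RSpace n) :
    (symbolAt P ω).leadingCoeff = ((timeCoeff P d).re : ℂ) := by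
  rw [Polynomial.leadingCoeff, h.natDegree_symbolAt, symbolAt_eq,
    coeff_complexSymbol_top h.homogeneous, h.timeCoeff_eq, Complex.ofReal_re]

lemma IsStrictlyHyperbolic.symbolAt_ne_zero {d : ℕ} {P : DiffOp n}
    (h : IsStrictlyHyperbolic P d) (ω : RSpace n) : symbolAt P ω ≠ 0 := by
  rw [← Polynomial.leadingCoeff_ne_zero, h.leadingCoeff_symbolAt]
  exact_mod_cast h.coeff_pos.1.ne'

lemma IsStrictlyHyperbolic.isCompact_roots {d : ℕ} {P : DiffOp n}
    (h : IsStrictlyHyperbolic P d) : (∃ A : ℝ, 0 < A ∧ ∀ ω ∈ Metric.sphere (0 : RSpace n) 1,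
      CoeffBound d A (symbolAt P ω) ∧ ∀ z, (symbolAt P ω).IsRoot z → ‖z‖ ≤ A) ∧
    IsCompact {y : RSpace n × ℂ | y.1 ∈ Metric.sphere (0 : RSpace n) 1 ∧
      (symbolAt P y.1).IsRoot y.2} := by
  obtain ⟨A, hA, hbd⟩ := exists_coeffBound_sphere h.homogeneous
  have hr : ∀ ω ∈ Metric.sphere (0 : RSpace n) 1, ∀ z, (symbolAt P ω).IsRoot z →
      ‖z‖ ≤ 1 + d * A / ‖timeCoeff P d‖ := by
    intro ω hω z hz
    have h1 : (symbolAt P ω).coeff d = timeCoeff P d := coeff_complexSymbol_top h.homogeneous _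
    rw [← h1]
    refine (hbd ω hω).norm_root_le ?_ hz
    rw [h1, h.timeCoeff_eq]
    exact_mod_cast h.coeff_pos.1.ne'
  refine ⟨⟨A + (1 + d * A / ‖timeCoeff P d‖), by positivity, fun ω hω =>
    ⟨(hbd ω hω).mono le_rfl (by linarith [show 0 ≤ d * A / ‖timeCoeff P d‖ by positivity]),
      fun z hz => (hr ω hω z hz).trans (by linarith)⟩⟩, ?_⟩
  exact isCompact_root_family (N := d) (fun ω => natDegree_complexSymbol_le h.homogeneous _)
    (continuous_coeff_symbolAt P) (isCompact_sphere _ _) hr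

/-- Uniform first order expansion of the roots of a perturbed hyperbolic symbol. The sign `σ` tells
to which side the real roots of the symbol move. -/
lemma exists_branches {e e' e'' : ℕ} {R R' R'' : DiffOp n} (h : IsStrictlyHyperbolic R e)
    (h' : R'.IsHomogeneous e') (h'' : R''.IsHomogeneous e'') (σ : ℝ)
    (hd : ∀ ω ∈ Metric.sphere (0 : RSpace n) 1, ∀ b, (symbolAt R ω).IsRoot b →
      (symbolAt R ω).derivative.eval b ≠ 0 ∧
      0 < σ * ((symbolAt R' ω).eval b / (symbolAt R ω).derivative.eval b).re) :
    ∃ δ c C : ℝ, 0 < δ ∧ 0 < c ∧ 0 < C ∧ ∀ ω ∈ Metric.sphere (0 : RSpace n) 1,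
      (∀ b, (symbolAt R ω).IsRoot b → c ≤ ‖(symbolAt R ω).derivative.eval b‖ ∧ ‖b‖ ≤ C ∧
        c ≤ σ * ((symbolAt R' ω).eval b / (symbolAt R ω).derivative.eval b).re ∧
        ‖(symbolAt R' ω).eval b / (symbolAt R ω).derivative.eval b‖ ≤ C) ∧
      ∀ a : ℂ, ‖a‖ ≤ δ → ∃ z : ℂ → ℂ, InjOn z {b | (symbolAt R ω).IsRoot b} ∧
        ∀ b, (symbolAt R ω).IsRoot b →
          (perturbed (symbolAt R ω) (symbolAt R' ω) (symbolAt R'' ω) a).IsRoot (z b) ∧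
          ‖z b - b‖ ≤ C * ‖a‖ ∧
          ‖z b - b + a * ((symbolAt R' ω).eval b / (symbolAt R ω).derivative.eval b)‖
            ≤ C * ‖a‖ ^ 2 ∧
          c ≤ ‖(perturbed (symbolAt R ω) (symbolAt R' ω) (symbolAt R'' ω) a).derivative.eval (z b)‖ ∧
          ‖(perturbed (symbolAt R ω) (symbolAt R' ω) (symbolAt R'' ω) a).derivative.eval (z b) -
            (symbolAt R ω).derivative.eval b‖ ≤ C * ‖a‖ ∧
          ‖z b‖ ≤ C ∧
          ∀ w, (perturbed (symbolAt R ω) (symbolAt R' ω) (symbolAt R'' ω) a).IsRoot w →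
            ‖w - b‖ ≤ δ → w = z b := by
  obtain ⟨⟨A₀, hA₀, hb₀⟩, hcomp⟩ := h.isCompact_roots
  obtain ⟨A₁, hA₁, hb₁⟩ := exists_coeffBound_sphere h'
  obtain ⟨A₂, hA₂, hb₂⟩ := exists_coeffBound_sphere h''
  set N := e + e' + e'' with hN
  set A := A₀ + A₁ + A₂ with hA
  have hcont : Continuous fun y : RSpace n × ℂ => (symbolAt R y.1).derivative.eval y.2 :=
    continuous_eval_derivative_family (fun ω => natDegree_complexSymbol_le h.homogeneous _)
      (continuous_coeff_symbolAt R)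
  have hcont' : Continuous fun y : RSpace n × ℂ => (symbolAt R' y.1).eval y.2 :=
    continuous_eval_family (fun ω => natDegree_complexSymbol_le h' _) (continuous_coeff_symbolAt R')
  have hquot : ContinuousOn (fun y : RSpace n × ℂ =>
      (symbolAt R' y.1).eval y.2 / (symbolAt R y.1).derivative.eval y.2)
      {y : RSpace n × ℂ | y.1 ∈ Metric.sphere (0 : RSpace n) 1 ∧ (symbolAt R y.1).IsRoot y.2} :=
    hcont'.continuousOn.div hcont.continuousOn fun y hy => (hd _ hy.1 _ hy.2).1
  obtain ⟨c₁, hc₁, hle₁⟩ := hcomp.exists_forall_le' (f := fun y : RSpace n × ℂ =>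
    ‖(symbolAt R y.1).derivative.eval y.2‖) hcont.norm.continuousOn (a := 0)
    fun y hy => norm_pos_iff.2 (hd _ hy.1 _ hy.2).1
  obtain ⟨c₂, hc₂, hle₂⟩ := hcomp.exists_forall_le' (f := fun y : RSpace n × ℂ =>
    σ * ((symbolAt R' y.1).eval y.2 / (symbolAt R y.1).derivative.eval y.2).re)
    (continuousOn_const.mul (Complex.continuous_re.comp_continuousOn hquot)) (a := 0)
    fun y hy => (hd _ hy.1 _ hy.2).2
  obtain ⟨Cq, hCq⟩ := hcomp.exists_bound_of_continuousOn hquot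
  obtain ⟨δ₁, hδ₁, hδ₁1, hiso⟩ := exists_isolation_radius N A hc₁
  obtain ⟨δ₂, C₂, hδ₂, hδ₂1, hC₂, hroot⟩ := exists_perturbed_root N A hc₁
  obtain ⟨C₃, hC₃, hder⟩ := exists_derivative_perturbed_bound N A
  set C := C₂ + C₃ * (C₂ + 1) + (A + C₂) + |Cq| with hC
  have hCpos : 0 < C := by positivity
  have hδpos : 0 < min (min δ₁ δ₂) (min (1 / C₂) (δ₁ / (2 * C₂))) := by positivity
  refine ⟨min (min δ₁ δ₂) (min (1 / C₂) (δ₁ / (2 * C₂))), min (c₁ / 2) c₂, C, hδpos,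
    by positivity, hCpos, fun ω hω => ?_⟩
  have B₀ : CoeffBound N A (symbolAt R ω) := (hb₀ ω hω).1.mono (by omega) (by linarith)
  have B₁ : CoeffBound N A (symbolAt R' ω) := (hb₁ ω hω).mono (by omega) (by linarith)
  have B₂ : CoeffBound N A (symbolAt R'' ω) := (hb₂ ω hω).mono (by omega) (by linarith)
  have hbA : ∀ b, (symbolAt R ω).IsRoot b → ‖b‖ ≤ A := fun b hb =>
    ((hb₀ ω hω).2 b hb).trans (by linarith)
  refine ⟨fun b hb => ⟨((min_le_left _ _).trans (by linarith)).trans (hle₁ (ω, b) ⟨hω, hb⟩),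
    (hbA b hb).trans (by
      have : 0 < C₂ + C₃ * (C₂ + 1) := by positivity
      have := abs_nonneg Cq
      linarith), (min_le_right _ _).trans (hle₂ (ω, b) ⟨hω, hb⟩),
    (hCq (ω, b) ⟨hω, hb⟩).trans ((le_abs_self _).trans (by
      have : 0 < C₂ + C₃ * (C₂ + 1) + (A + C₂) := by positivity
      linarith))⟩, fun a ha => ?_⟩
  have haδ₁ : ‖a‖ ≤ δ₁ := ha.trans ((min_le_left _ _).trans (min_le_left _ _))
  have haδ₂ : ‖a‖ ≤ δ₂ := ha.trans ((min_le_left _ _).trans (min_le_right _ _))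
  have haC : C₂ * ‖a‖ ≤ 1 := by
    have := ha.trans ((min_le_right _ _).trans (min_le_left _ _))
    rw [le_div_iff₀ hC₂] at this; linarith
  have haC' : 2 * (C₂ * ‖a‖) ≤ δ₁ := by
    have := ha.trans ((min_le_right _ _).trans (min_le_right _ _))
    rw [le_div_iff₀ (by positivity)] at this; linarith
  have ha1 : ‖a‖ ≤ 1 := haδ₁.trans hδ₁1
  have hex : ∀ b, ∃ z, (symbolAt R ω).IsRoot b →
      (perturbed (symbolAt R ω) (symbolAt R' ω) (symbolAt R'' ω) a).IsRoot z ∧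
        ‖z - b‖ ≤ C₂ * ‖a‖ ∧
        ‖z - b + a * ((symbolAt R' ω).eval b / (symbolAt R ω).derivative.eval b)‖
          ≤ C₂ * ‖a‖ ^ 2 := by
    intro b
    by_cases hb : (symbolAt R ω).IsRoot b
    · obtain ⟨z, hz⟩ := hroot _ _ _ B₀ B₁ B₂ b a (hbA b hb) hb (hle₁ (ω, b) ⟨hω, hb⟩) haδ₂
      exact ⟨z, fun _ => hz⟩
    · exact ⟨0, fun hb' => absurd hb' hb⟩
  choose z hz using hex
  have hp0 : perturbed (symbolAt R ω) (symbolAt R' ω) (symbolAt R'' ω) 0 = symbolAt R ω := by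
    simp [perturbed]
  refine ⟨z, ?_, fun b hb => ?_⟩
  · intro b hb b' hb' hbb'
    have h1 : ‖b - b'‖ ≤ δ₁ := by
      have e1 := (hz b hb).2.1
      have e2 := (hz b' hb').2.1
      rw [norm_sub_rev] at e1
      have e3 := norm_add_le (b - z b) (z b' - b')
      rw [hbb', sub_add_sub_cancel] at e3
      rw [hbb'] at e1
      linarith
    refine ((hiso _ _ _ B₀ B₁ B₂ b' 0 (hbA b' hb') (hle₁ (ω, b') ⟨hω, hb'⟩)
      (by simpa using hδ₁.le)).2 b b' h1 (by simpa using hδ₁.le) ?_ ?_)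
    · rw [hp0]; exact hb
    · rw [hp0]; exact hb'
  · obtain ⟨h1, h2, h3⟩ := hz b hb
    have hzb : ‖z b - b‖ ≤ δ₁ := h2.trans (by
      have : 0 ≤ C₂ * ‖a‖ := by positivity
      linarith)
    have hI := hiso _ _ _ B₀ B₁ B₂ b a (hbA b hb) (hle₁ (ω, b) ⟨hω, hb⟩) haδ₁
    have hCC : C₂ ≤ C := by
      have : 0 < C₃ * (C₂ + 1) + (A + C₂) := by positivity
      linarith [abs_nonneg Cq]
    refine ⟨h1, h2.trans (by gcongr), h3.trans (by gcongr), (min_le_left _ _).trans (hI.1 _ hzb),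
      ?_, ?_, fun w hw hwb => ?_⟩
    · refine (hder _ _ _ B₀ B₁ B₂ b (z b) a (hbA b hb) (h2.trans haC) ha1).trans ?_
      have e1 : C₃ * (‖z b - b‖ + ‖a‖) ≤ C₃ * (C₂ + 1) * ‖a‖ := by
        have : ‖z b - b‖ + ‖a‖ ≤ (C₂ + 1) * ‖a‖ := by linarith
        rw [mul_assoc]
        exact mul_le_mul_of_nonneg_left this hC₃.le
      refine e1.trans (mul_le_mul_of_nonneg_right ?_ (norm_nonneg _))
      have : 0 < A + C₂ := by positivity
      linarith [abs_nonneg Cq]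
    · have e1 := norm_add_le (z b - b) b
      rw [sub_add_cancel] at e1
      have e2 := hbA b hb
      have e3 : C₂ * ‖a‖ ≤ C₂ := by nlinarith
      have e4 : 0 < C₂ + C₃ * (C₂ + 1) := by positivity
      linarith [abs_nonneg Cq]
    · exact hI.2 w (z b) (hwb.trans ((min_le_left _ _).trans (min_le_left _ _))) hzb hw h1

/-- Splitting off a set of roots from a monic polynomial. -/
lemma exists_factor_of_roots {Q : Polynomial ℂ} (hQ : Q.Monic) (Λ : Finset ℂ)
    (hΛ : ∀ l ∈ Λ, Q.IsRoot l) :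
    ∃ F : Polynomial ℂ, F.Monic ∧ Q = (∏ l ∈ Λ, (Polynomial.X - Polynomial.C l)) * F ∧
      F.natDegree + Λ.card = Q.natDegree := by
  have hm : (∏ l ∈ Λ, (Polynomial.X - Polynomial.C l)).Monic :=
    Polynomial.monic_prod_of_monic _ _ fun l _ => Polynomial.monic_X_sub_C l
  have hdvd : (∏ l ∈ Λ, (Polynomial.X - Polynomial.C l)) ∣ Q := by
    refine Finset.prod_dvd_of_coprime (fun a _ b _ hab => ?_) fun l hl =>
      Polynomial.dvd_iff_isRoot.2 (hΛ l hl)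
    exact Polynomial.isCoprime_X_sub_C_of_isUnit_sub (sub_ne_zero.2 hab).isUnit
  obtain ⟨F, hF⟩ := hdvd
  refine ⟨F, hm.of_mul_monic_left (hF ▸ hQ), hF, ?_⟩
  have hF0 : F ≠ 0 := by rintro rfl; rw [mul_zero] at hF; exact hQ.ne_zero hF
  rw [hF, hm.natDegree_mul' hF0, Polynomial.natDegree_prod_of_monic _ _ fun l _ =>
    Polynomial.monic_X_sub_C l]
  simp [add_comm]

lemma not_isRoot_of_derivative_ne_zero {Q F : Polynomial ℂ} {Λ : Finset ℂ}
    (hQ : Q = (∏ l ∈ Λ, (Polynomial.X - Polynomial.C l)) * F) {l : ℂ} (hl : l ∈ Λ)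
    (hd : Q.derivative.eval l ≠ 0) : F.eval l ≠ 0 := by
  intro hF
  apply hd
  rw [hQ, Polynomial.derivative_mul, Polynomial.eval_add, Polynomial.eval_mul,
    Polynomial.eval_mul, hF, mul_zero, zero_add, Polynomial.eval_prod,
    Finset.prod_eq_zero hl (by simp), zero_mul]

end Branches

section Stability

variable {n r m : ℕ} {R₀ R₁ R₂ : DiffOp n}

namespace DampedSystem

lemma homogeneous₂ (H : DampedSystem r m R₀ R₁ R₂) : R₂.IsHomogeneous (r + 3) := by
  rcases H.top with ⟨-, h, -⟩ | ⟨-, h, -⟩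
  · rw [h]; exact MvPolynomial.isHomogeneous_zero _ _ _
  · exact h.homogeneous

lemma le_order (H : DampedSystem r m R₀ R₁ R₂) : r + 2 ≤ m ∧ m ≤ r + 3 := by
  rcases H.top with ⟨h, -⟩ | ⟨h, -⟩ <;> omega

lemma natDegree_charPoly_le (H : DampedSystem r m R₀ R₁ R₂) (ξ : RSpace n) :
    (charPoly (R₀ + R₁ + R₂) ξ).natDegree ≤ m := by
  rw [charPoly_add, charPoly_add]
  have h0 : (charPoly R₀ ξ).natDegree ≤ r + 1 := natDegree_complexSymbol_le H.hyp₀.homogeneous _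
  have h1 : (charPoly R₁ ξ).natDegree ≤ r + 2 := natDegree_complexSymbol_le H.hyp₁.homogeneous _
  have h01 := (Polynomial.natDegree_add_le (charPoly R₀ ξ) (charPoly R₁ ξ)).trans
    (max_le (h0.trans (by omega)) h1)
  rcases H.top with ⟨h, h2, -⟩ | ⟨h, h2, -⟩
  · rw [h2, show charPoly (0 : DiffOp n) ξ = 0 from map_zero _, add_zero, h]; exact h01
  · have h3 : (charPoly R₂ ξ).natDegree ≤ r + 3 := natDegree_complexSymbol_le h2.homogeneous _
    exact (Polynomial.natDegree_add_le _ _).trans (max_le (h01.trans (by omega)) (h3.trans h.ge))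

lemma coeff_charPoly_top (H : DampedSystem r m R₀ R₁ R₂) (ξ : RSpace n) :
    (charPoly (R₀ + R₁ + R₂) ξ).coeff m = 1 := by
  rw [charPoly_add, charPoly_add, Polynomial.coeff_add, Polynomial.coeff_add]
  have h0 : (charPoly R₀ ξ).coeff m = 0 := Polynomial.coeff_eq_zero_of_natDegree_lt
    ((natDegree_complexSymbol_le H.hyp₀.homogeneous _).trans_lt (by have := H.le_order; omega))
  rcases H.top with ⟨h, h2, h3⟩ | ⟨h, h2, h3, -⟩
  · rw [h2, show charPoly (0 : DiffOp n) ξ = 0 from map_zero _, h0, h, charPoly,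
      coeff_complexSymbol_top H.hyp₁.homogeneous, h3]
    simp
  · have h1 : (charPoly R₁ ξ).coeff m = 0 := Polynomial.coeff_eq_zero_of_natDegree_lt
      ((natDegree_complexSymbol_le H.hyp₁.homogeneous _).trans_lt (by omega))
    rw [h0, h1, h, charPoly, coeff_complexSymbol_top h2.homogeneous, h3]
    simp

lemma natDegree_charPoly (H : DampedSystem r m R₀ R₁ R₂) (ξ : RSpace n) :
    (charPoly (R₀ + R₁ + R₂) ξ).natDegree = m :=
  le_antisymm (H.natDegree_charPoly_le ξ)
    (Polynomial.le_natDegree_of_ne_zero (by rw [H.coeff_charPoly_top]; exact one_ne_zero))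

lemma monic_charPoly (H : DampedSystem r m R₀ R₁ R₂) (ξ : RSpace n) :
    (charPoly (R₀ + R₁ + R₂) ξ).Monic := by
  rw [Polynomial.Monic, Polynomial.leadingCoeff, H.natDegree_charPoly, H.coeff_charPoly_top]

/-- At frequency `ρ ω`, the characteristic polynomial is a rescaling of a perturbation of the
symbol of the operator of lowest order. -/
lemma charPoly_comp_low (H : DampedSystem r m R₀ R₁ R₂) (ρ : ℝ) (ω : RSpace n) :
    (charPoly (R₀ + R₁ + R₂) (ρ • ω)).comp (Polynomial.C (Complex.I * ρ) * Polynomial.X) =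
      Polynomial.C ((Complex.I * ρ) ^ (r + 1)) *
        perturbed (symbolAt R₀ ω) (symbolAt R₁ ω) (symbolAt R₂ ω) (Complex.I * ρ) := by
  rw [charPoly_add, charPoly_add, Polynomial.add_comp, Polynomial.add_comp,
    charPoly_smul_comp H.hyp₀.homogeneous, charPoly_smul_comp H.hyp₁.homogeneous,
    charPoly_smul_comp H.homogeneous₂, perturbed]
  simp only [map_pow, map_mul]
  ring

end DampedSystem

/-- Roots and derivatives under the rescaling `λ = a μ`. -/
lemma eval_of_comp_eq {Q G : Polynomial ℂ} {a s : ℂ}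
    (h : Q.comp (Polynomial.C a * Polynomial.X) = Polynomial.C s * G) (μ : ℂ) :
    Q.eval (a * μ) = s * G.eval μ ∧ a * Q.derivative.eval (a * μ) = s * G.derivative.eval μ := by
  constructor
  · have := congrArg (Polynomial.eval μ) h
    simpa using this
  · have := congrArg (fun p => (Polynomial.derivative p).eval μ) h
    simpa [Polynomial.derivative_comp] using this

lemma StrictlyInterlace.im_mul_conj_eq_zero {d : ℕ} {p q : Polynomial ℂ}
    (h : StrictlyInterlace d p q) {α β : ℝ} (hp : p.leadingCoeff = α) (hq : q.leadingCoeff = β)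
    {z : ℂ} (hz : z.im = 0) : (q.eval z * (starRingEnd ℂ) (p.eval z)).im = 0 := by
  obtain ⟨x, rfl⟩ : ∃ x : ℝ, z = x := ⟨z.re, by apply Complex.ext <;> simp [hz]⟩
  obtain ⟨-, -, b, a, hb, ha, -⟩ := h
  rw [eq_C_mul_prod_of_roots hb, eq_C_mul_prod_of_roots ha, hp, hq]
  simp only [Polynomial.eval_mul, Polynomial.eval_C, Polynomial.eval_prod, Polynomial.eval_sub,
    Polynomial.eval_X]
  norm_cast
  rw [Complex.conj_ofReal, ← Complex.ofReal_mul, Complex.ofReal_im]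

namespace DampedSystem

/-- Stability: by the Herglotz property of quotients of interlacing polynomials, all characteristic
roots at nonzero frequencies lie in the open left half plane. -/
lemma re_root_neg (H : DampedSystem r m R₀ R₁ R₂) {ξ : RSpace n} (hξ : ξ ≠ 0) {l : ℂ}
    (hl : (charPoly (R₀ + R₁ + R₂) ξ).IsRoot l) : l.re < 0 := by
  set ρ : ℝ := ‖ξ‖ with hρ
  have hρ0 : 0 < ρ := norm_pos_iff.2 hξ
  set ω : RSpace n := ρ⁻¹ • ξ with hω
  have hωS : ω ∈ Metric.sphere (0 : RSpace n) 1 := by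
    rw [mem_sphere_zero_iff_norm, hω, norm_smul, norm_inv, Real.norm_of_nonneg hρ0.le,
      inv_mul_cancel₀ hρ0.ne']
  have hξω : ξ = ρ • ω := by rw [hω, smul_inv_smul₀ hρ0.ne']
  have hρc : (ρ : ℂ) ≠ 0 := by exact_mod_cast hρ0.ne'
  have hIρ : Complex.I * ρ ≠ 0 := mul_ne_zero Complex.I_ne_zero hρc
  -- With `l = iρμ`, the claim becomes `Im μ > 0`.
  set μ : ℂ := l / (Complex.I * ρ) with hμ
  have hlμ : l = Complex.I * ρ * μ := by rw [hμ]; field_simp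
  have hG : (perturbed (symbolAt R₀ ω) (symbolAt R₁ ω) (symbolAt R₂ ω) (Complex.I * ρ)).eval μ
      = 0 := by
    have h1 := (eval_of_comp_eq (H.charPoly_comp_low ρ ω) μ).1
    rw [← hξω, ← hlμ, hl] at h1
    exact (mul_eq_zero.1 h1.symm).resolve_left (pow_ne_zero _ hIρ)
  rw [eval_perturbed] at hG
  have hre : l.re = -(ρ * μ.im) := by rw [hlμ]; simp
  rw [hre, neg_lt_zero]
  refine mul_pos hρ0 ?_
  by_contra hμim
  rw [not_lt] at hμim
  have hl0 := H.hyp₀.leadingCoeff_symbolAt ω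
  have hl1 := H.hyp₁.leadingCoeff_symbolAt ω
  have hc0 := H.hyp₀.coeff_pos.1
  have hc1 := H.hyp₁.coeff_pos.1
  have hint := H.int₀₁ ω hωS
  set x := (symbolAt R₀ ω).eval μ with hx
  set y := (symbolAt R₁ ω).eval μ with hy
  have hxy : μ.im = 0 ∨ (y * (starRingEnd ℂ) x).im < 0 := by
    rcases eq_or_lt_of_le hμim with h0 | h0
    · exact Or.inl h0
    · have := hint.im_mul_conj_pos hc0 hc1 hl0 hl1 h0.ne
      rw [← hx, ← hy] at this
      exact Or.inr (by nlinarith)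
  rcases H.top with ⟨-, h2, -⟩ | ⟨-, h2, -, hint'⟩
  · have hR2 : symbolAt R₂ ω = 0 := by rw [h2, symbolAt_eq, complexSymbol_zero]
    rw [hR2, Polynomial.eval_zero, mul_zero, add_zero] at hG
    -- The equation says that `y / x = i/ρ`, but `y / x` is not in the upper half plane if `Im μ ≤ 0`.
    have hyx : y = Complex.I * (ρ⁻¹ : ℝ) * x := by
      push_cast
      have : x = -(Complex.I * ρ * y) := eq_neg_of_add_eq_zero_left hG
      rw [this]; field_simp; simp
    have him : (y * (starRingEnd ℂ) x).im = ρ⁻¹ * Complex.normSq x := by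
      rw [hyx, mul_assoc, mul_assoc, Complex.mul_conj]; simp
    have hρi : 0 < ρ⁻¹ := inv_pos.2 hρ0
    rcases hxy with h0 | h0
    · have h3 := hint.im_mul_conj_eq_zero hl0 hl1 h0
      rw [← hx, ← hy, him] at h3
      have hx0 : x = 0 := Complex.normSq_eq_zero.1 ((mul_eq_zero.1 h3).resolve_left hρi.ne')
      exact hint.not_isRoot_both hc0 hc1 hl0 hl1 (a := μ) (by rw [← hy, hyx, hx0, mul_zero]) hx0
    · rw [him] at h0
      have := mul_nonneg hρi.le (Complex.normSq_nonneg x)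
      linarith
  · have hl2 := h2.leadingCoeff_symbolAt ω
    have hc2 := h2.coeff_pos.1
    have hint2 := hint' ω hωS
    set w := (symbolAt R₂ ω).eval μ with hw
    -- Here `w / y = x / (ρ² y) + i/ρ`. For `Im μ < 0` the right hand side lies in the upper half
    -- plane and the left hand side in the lower one. Real `μ` need a separate argument, as `y` may vanish.
    have hwx : w = ((ρ ^ 2)⁻¹ : ℝ) * x + Complex.I * (ρ⁻¹ : ℝ) * y := by
      push_cast
      have h3 : x = ρ ^ 2 * w - Complex.I * ρ * y := by
        have : (Complex.I * ρ) ^ 2 * w = -(ρ ^ 2 * w) := by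
          rw [mul_pow, Complex.I_sq]; ring
        rw [this] at hG
        linear_combination hG
      rw [h3]; field_simp; ring
    have him : (w * (starRingEnd ℂ) y).im =
        -((ρ ^ 2)⁻¹ * (y * (starRingEnd ℂ) x).im) + ρ⁻¹ * Complex.normSq y := by
      have h4 : w * (starRingEnd ℂ) y = ((ρ ^ 2)⁻¹ : ℝ) * (x * (starRingEnd ℂ) y) +
          Complex.I * ((ρ⁻¹ : ℝ) * Complex.normSq y) := by
        rw [hwx, ← Complex.mul_conj]; ring
      rw [h4, Complex.add_im, Complex.im_ofReal_mul]
      have h5 : (x * (starRingEnd ℂ) y).im = -(y * (starRingEnd ℂ) x).im := by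
        simp; ring
      rw [h5]
      simp only [Complex.I_mul_im, Complex.re_ofReal_mul, Complex.ofReal_re]
      ring
    have hρi : 0 < ρ⁻¹ := inv_pos.2 hρ0
    have hρi2 : 0 < (ρ ^ 2)⁻¹ := by positivity
    rcases eq_or_lt_of_le hμim with h0 | h0
    · have h3 := hint.im_mul_conj_eq_zero hl0 hl1 h0
      have h4 := hint2.im_mul_conj_eq_zero hl1 hl2 h0
      rw [← hx, ← hy] at h3
      rw [← hy, ← hw, him, h3, mul_zero, neg_zero, zero_add] at h4
      have hy0 : y = 0 := Complex.normSq_eq_zero.1 ((mul_eq_zero.1 h4).resolve_left hρi.ne')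
      obtain ⟨h5, r1, hr1, h6⟩ := hint.eval_at_upper_root hc0 hc1 hl0 hl1 (a := μ) hy0
      obtain ⟨-, r2, hr2, h7⟩ := hint2.eval_at_lower_root hc1 hc2 hl1 hl2 (b := μ) hy0 h0
      rw [← hx] at h6
      rw [← hw, hwx, hy0, h6, mul_zero, add_zero] at h7
      have h8 : (((ρ ^ 2)⁻¹ * r1 + r2 : ℝ) : ℂ) * (symbolAt R₁ ω).derivative.eval μ = 0 := by
        push_cast at h7 ⊢
        linear_combination h7
      have h9 : 0 < (ρ ^ 2)⁻¹ * r1 + r2 := by positivity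
      exact (mul_ne_zero (by exact_mod_cast h9.ne') h5) h8
    · have h3 := hxy.resolve_left h0.ne
      have h4 := hint2.im_mul_conj_pos hc1 hc2 hl1 hl2 h0.ne
      rw [← hy, ← hw, him] at h4
      have h5 := mul_nonneg hρi.le (Complex.normSq_nonneg y)
      have h6 := mul_pos_of_neg_of_neg h3 (neg_lt_zero.2 hρi2)
      nlinarith

/-- On bounded sets of frequencies, the coefficients and roots of the characteristic polynomial are
bounded. -/
lemma exists_root_bound (H : DampedSystem r m R₀ R₁ R₂) (R : ℝ) : ∃ A : ℝ, 0 < A ∧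
    ∀ ξ : RSpace n, ‖ξ‖ ≤ R → CoeffBound m A (charPoly (R₀ + R₁ + R₂) ξ) ∧
      ∀ l, (charPoly (R₀ + R₁ + R₂) ξ).IsRoot l → ‖l‖ ≤ A := by
  have h1 : ∀ k, ∃ A : ℝ, ∀ ξ ∈ Metric.closedBall (0 : RSpace n) R,
      ‖(charPoly (R₀ + R₁ + R₂) ξ).coeff k‖ ≤ A :=
    fun k => (isCompact_closedBall _ _).exists_bound_of_continuousOn
      (continuous_coeff_charPoly _ k).continuousOn
  choose A hA using h1
  set B : ℝ := ∑ k ∈ Finset.range (m + 1), |A k| with hB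
  have hB0 : 0 ≤ B := by positivity
  have hcb : ∀ ξ : RSpace n, ‖ξ‖ ≤ R → CoeffBound m B (charPoly (R₀ + R₁ + R₂) ξ) := by
    refine fun ξ hξ => ⟨H.natDegree_charPoly_le ξ, fun k => ?_⟩
    rcases le_or_gt k m with hk | hk
    · exact ((hA k ξ (by simpa using hξ)).trans (le_abs_self _)).trans
        (Finset.single_le_sum (f := fun k => |A k|) (fun i _ => abs_nonneg _)
          (Finset.mem_range_succ_iff.2 hk))
    · rw [Polynomial.coeff_eq_zero_of_natDegree_lt ((H.natDegree_charPoly_le ξ).trans_lt hk)]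
      simpa using hB0
  refine ⟨B + (1 + m * B), by positivity, fun ξ hξ => ⟨(hcb ξ hξ).mono le_rfl ?_, fun l hl => ?_⟩⟩
  · have : 0 ≤ m * B := by positivity
    linarith
  · have h2 := (hcb ξ hξ).norm_root_le (by rw [H.coeff_charPoly_top]; exact one_ne_zero) hl
    rw [H.coeff_charPoly_top, norm_one, div_one] at h2
    linarith

/-- Uniform stability at intermediate frequencies. -/
lemma exists_re_root_le_of_mid (H : DampedSystem r m R₀ R₁ R₂) {δ : ℝ} (hδ : 0 < δ) (R : ℝ) :
    ∃ c : ℝ, 0 < c ∧ ∀ ξ : RSpace n, δ ≤ ‖ξ‖ → ‖ξ‖ ≤ R →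
      ∀ l, (charPoly (R₀ + R₁ + R₂) ξ).IsRoot l → l.re ≤ -c := by
  obtain ⟨A, -, hA⟩ := H.exists_root_bound R
  have hK : IsCompact (Metric.closedBall (0 : RSpace n) R ∩ {ξ | δ ≤ ‖ξ‖}) :=
    (isCompact_closedBall _ _).inter_right (isClosed_le continuous_const continuous_norm)
  have hcomp := isCompact_root_family H.natDegree_charPoly_le
    (fun k => continuous_coeff_charPoly (R₀ + R₁ + R₂) k) hK
    (fun ξ hξ l hl => (hA ξ (by simpa using hξ.1)).2 l hl)
  obtain ⟨c, hc, hle⟩ := hcomp.exists_forall_le' (f := fun y : RSpace n × ℂ => -y.2.re)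
    (by fun_prop) (a := 0) fun y hy => by
      have h0 : y.1 ≠ 0 := norm_pos_iff.1 (hδ.trans_le hy.1.2)
      have := H.re_root_neg h0 hy.2
      linarith
  exact ⟨c, hc, fun ξ h1 h2 l hl => by
    have := hle (ξ, l) ⟨⟨by simpa using h2, h1⟩, hl⟩
    simp only at this
    linarith⟩

end DampedSystem

end Stability

section FrequencyRegimes

variable {n r m : ℕ} {R₀ R₁ R₂ : DiffOp n}

lemma IsStrictlyHyperbolic.card_roots {d : ℕ} {P : DiffOp n} (h : IsStrictlyHyperbolic P d)
    {ω : RSpace n} (hω : ω ∈ Metric.sphere (0 : RSpace n) 1) :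
    (symbolAt P ω).roots.toFinset.card = d := by
  rw [Multiset.toFinset_card_of_nodup (h.simple_roots ω hω),
    (Polynomial.splits_iff_card_roots.1 (IsAlgClosed.splits _)), h.natDegree_symbolAt]

lemma IsStrictlyHyperbolic.mem_roots {d : ℕ} {P : DiffOp n} (h : IsStrictlyHyperbolic P d)
    {ω : RSpace n} {b : ℂ} : b ∈ (symbolAt P ω).roots.toFinset ↔ (symbolAt P ω).IsRoot b := by
  rw [Multiset.mem_toFinset, Polynomial.mem_roots (h.symbolAt_ne_zero ω)]

namespace DampedSystem

/-- In the high frequency regime, the characteristic polynomial is a rescaling of a perturbation of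
the symbol of the operator of highest order. -/
lemma exists_top_comp (H : DampedSystem r m R₀ R₁ R₂) : ∃ (e' e'' : ℕ) (T T' T'' : DiffOp n),
    IsStrictlyHyperbolic T m ∧ T'.IsHomogeneous e' ∧ T''.IsHomogeneous e'' ∧
    (∀ ω ∈ Metric.sphere (0 : RSpace n) 1, ∀ b, (symbolAt T ω).IsRoot b →
      (symbolAt T ω).derivative.eval b ≠ 0 ∧
      0 < 1 * ((symbolAt T' ω).eval b / (symbolAt T ω).derivative.eval b).re) ∧
    ∀ ρ : ℝ, 0 < ρ → ∀ ω : RSpace n,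
      (charPoly (R₀ + R₁ + R₂) (ρ • ω)).comp (Polynomial.C (Complex.I * ρ) * Polynomial.X) =
      Polynomial.C ((Complex.I * ρ) ^ m) *
        perturbed (symbolAt T ω) (symbolAt T' ω) (symbolAt T'' ω) (Complex.I * ρ)⁻¹ := by
  have hsign : ∀ {d : ℕ} {p q : Polynomial ℂ}, StrictlyInterlace d p q → ∀ {α β : ℝ}, 0 < α →
      0 < β → p.leadingCoeff = α → q.leadingCoeff = β → ∀ b, q.IsRoot b →
      q.derivative.eval b ≠ 0 ∧ 0 < 1 * (p.eval b / q.derivative.eval b).re := by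
    intro d p q h α β hα hβ hp hq b hb
    obtain ⟨h1, s, hs, h2⟩ := h.eval_at_upper_root hα hβ hp hq hb
    refine ⟨h1, ?_⟩
    rw [h2, mul_div_assoc, div_self h1]
    simpa using hs
  have key : ∀ ρ : ℝ, 0 < ρ → ∀ k : ℕ, Polynomial.C ((Complex.I * ρ) ^ (k + 1)) *
      Polynomial.C (Complex.I * ρ)⁻¹ = Polynomial.C ((Complex.I * ρ) ^ k) := by
    intro ρ hρ k
    have : Complex.I * ρ ≠ 0 := mul_ne_zero Complex.I_ne_zero (by exact_mod_cast hρ.ne')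
    rw [← map_mul, pow_succ, mul_assoc, mul_inv_cancel₀ this, mul_one]
  rcases H.top with ⟨hm, h2, -⟩ | ⟨hm, h2, -, hint'⟩
  · refine ⟨r + 1, 0, R₁, R₀, 0, hm ▸ H.hyp₁, H.hyp₀.homogeneous,
      MvPolynomial.isHomogeneous_zero _ _ _, fun ω hω b hb =>
      hsign (H.int₀₁ ω hω) H.hyp₀.coeff_pos.1 H.hyp₁.coeff_pos.1 (H.hyp₀.leadingCoeff_symbolAt ω)
        (H.hyp₁.leadingCoeff_symbolAt ω) b hb, fun ρ hρ ω => ?_⟩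
    rw [h2, add_zero, charPoly_add, Polynomial.add_comp, charPoly_smul_comp H.hyp₀.homogeneous,
      charPoly_smul_comp H.hyp₁.homogeneous, perturbed, hm,
      show symbolAt (0 : DiffOp n) ω = 0 from map_zero _, mul_zero, add_zero, mul_add, ← mul_assoc,
      key ρ hρ, add_comm]
  · refine ⟨r + 2, r + 1, R₂, R₁, R₀, hm ▸ h2, H.hyp₁.homogeneous, H.hyp₀.homogeneous,
      fun ω hω b hb => hsign (hint' ω hω) H.hyp₁.coeff_pos.1 h2.coeff_pos.1
        (H.hyp₁.leadingCoeff_symbolAt ω) (h2.leadingCoeff_symbolAt ω) b hb, fun ρ hρ ω => ?_⟩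
    rw [charPoly_add, charPoly_add, Polynomial.add_comp, Polynomial.add_comp,
      charPoly_smul_comp H.hyp₀.homogeneous, charPoly_smul_comp H.hyp₁.homogeneous,
      charPoly_smul_comp h2.homogeneous, perturbed, hm, mul_add, mul_add, sq,
      Polynomial.C_mul (a := (Complex.I * (ρ : ℂ))⁻¹), ← mul_assoc, key ρ hρ, ← mul_assoc,
      ← mul_assoc, key ρ hρ, key ρ hρ]
    ring

lemma exists_high (H : DampedSystem r m R₀ R₁ R₂) : ∃ R c C : ℝ, 1 ≤ R ∧ 0 < c ∧ 0 < C ∧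
    ∀ ξ : RSpace n, R ≤ ‖ξ‖ → (∀ k, k ≤ m →
      ‖(charPoly (R₀ + R₁ + R₂) ξ).coeff k‖ ≤ C * ‖ξ‖ ^ (m - k)) ∧
    ∃ Λ : Finset ℂ, charPoly (R₀ + R₁ + R₂) ξ = ∏ l ∈ Λ, (Polynomial.X - Polynomial.C l) ∧
      Λ.card = m ∧
      ∀ l ∈ Λ, l.re ≤ -c ∧ ‖l‖ ≤ C * ‖ξ‖ ∧
        c * ‖ξ‖ ^ (m - 1) ≤ ‖(charPoly (R₀ + R₁ + R₂) ξ).derivative.eval l‖ := by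
  obtain ⟨e', e'', T, T', T'', hT, hT', hT'', hsign, hcomp⟩ := H.exists_top_comp
  obtain ⟨δ, c, C, hδ, hc, hC, hbr⟩ := exists_branches hT hT' hT'' 1 hsign
  obtain ⟨A₀, hA₀, hb₀⟩ := exists_coeffBound_sphere hT.homogeneous
  obtain ⟨A₁, hA₁, hb₁⟩ := exists_coeffBound_sphere hT'
  obtain ⟨A₂, hA₂, hb₂⟩ := exists_coeffBound_sphere hT''
  set A := A₀ + A₁ + A₂ with hA
  have hm : 1 ≤ m := by have := H.le_order; omega
  refine ⟨1 + δ⁻¹ + 2 * C / c, c / 2, C + 3 * A, ?_, by positivity, by positivity, fun ξ hξ => ?_⟩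
  · have : 0 ≤ δ⁻¹ + 2 * C / c := by positivity
    linarith
  set ρ : ℝ := ‖ξ‖ with hρ
  have hρ1 : 1 ≤ ρ := by
    have : 0 ≤ δ⁻¹ + 2 * C / c := by positivity
    linarith
  have hρ0 : 0 < ρ := by linarith
  set ω : RSpace n := ρ⁻¹ • ξ with hω
  have hωS : ω ∈ Metric.sphere (0 : RSpace n) 1 := by
    rw [mem_sphere_zero_iff_norm, hω, norm_smul, norm_inv, Real.norm_of_nonneg hρ0.le,
      inv_mul_cancel₀ hρ0.ne']
  have hξω : ξ = ρ • ω := by rw [hω, smul_inv_smul₀ hρ0.ne']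
  have hρc : (ρ : ℂ) ≠ 0 := by exact_mod_cast hρ0.ne'
  have hIρ : Complex.I * ρ ≠ 0 := mul_ne_zero Complex.I_ne_zero hρc
  have hnI : ‖Complex.I * (ρ : ℂ)‖ = ρ := by simp [abs_of_pos hρ0]
  have hna : ‖(Complex.I * (ρ : ℂ))⁻¹‖ = ρ⁻¹ := by rw [norm_inv, hnI]
  have hcomp' := hcomp ρ hρ0 ω
  rw [← hξω] at hcomp'
  have hρδ : ρ⁻¹ ≤ δ := by
    have : δ⁻¹ ≤ ρ := by
      have : 0 ≤ 2 * C / c := by positivity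
      linarith
    exact inv_le_of_inv_le₀ hδ this
  have hρC : C * ρ⁻¹ ≤ c / 2 := by
    have h1 : 2 * C / c ≤ ρ := by
      have : 0 ≤ δ⁻¹ := by positivity
      linarith
    rw [div_le_iff₀ hc] at h1
    rw [← div_eq_mul_inv, div_le_iff₀ hρ0]
    linarith
  set Q := charPoly (R₀ + R₁ + R₂) ξ with hQ
  set a : ℂ := (Complex.I * (ρ : ℂ))⁻¹ with ha
  refine ⟨fun k hk => ?_, ?_⟩
  · have h1 := congrArg (fun p => Polynomial.coeff p k) hcomp'
    simp only [Polynomial.comp_C_mul_X_coeff, Polynomial.coeff_C_mul] at h1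
    have h2 : Q.coeff k = (Complex.I * ρ) ^ (m - k) *
        (perturbed (symbolAt T ω) (symbolAt T' ω) (symbolAt T'' ω) a).coeff k := by
      refine mul_right_cancel₀ (pow_ne_zero k hIρ) ?_
      rw [h1, mul_right_comm, ← pow_add, Nat.sub_add_cancel hk]
    rw [h2, norm_mul, norm_pow, hnI, mul_comm]
    refine mul_le_mul_of_nonneg_right ?_ (by positivity)
    have hN := CoeffBound.perturbed (N := m + e' + e'') (A := A)
      ((hb₀ ω hωS).mono (by omega) (by linarith))
      ((hb₁ ω hωS).mono (by omega) (by linarith)) ((hb₂ ω hωS).mono (by omega) (by linarith))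
      (a := a) (by rw [hna]; exact inv_le_one_of_one_le₀ hρ1)
    exact (hN.2 k).trans (by linarith)
  · obtain ⟨hconst, hz⟩ := hbr ω hωS
    obtain ⟨z, hinj, hz⟩ := hz a (by rw [hna]; exact hρδ)
    set B := (symbolAt T ω).roots.toFinset with hB
    have hmem : ∀ b, b ∈ B ↔ (symbolAt T ω).IsRoot b := fun b => hT.mem_roots
    have hcard : (B.image fun b => Complex.I * ρ * z b).card = m := by
      rw [Finset.card_image_of_injOn, hT.card_roots hωS]
      intro b hb b' hb' h
      exact hinj ((hmem b).1 hb) ((hmem b').1 hb') (mul_left_cancel₀ hIρ h)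
    have hroot : ∀ l ∈ B.image (fun b => Complex.I * ρ * z b), Q.IsRoot l := by
      intro l hl
      obtain ⟨b, hb, rfl⟩ := Finset.mem_image.1 hl
      have h1 := (eval_of_comp_eq hcomp' (z b)).1
      rw [(hz b ((hmem b).1 hb)).1, mul_zero] at h1
      exact h1
    obtain ⟨F, hF, hQF, hdeg⟩ := exists_factor_of_roots (H.monic_charPoly ξ) _ hroot
    rw [hcard, H.natDegree_charPoly] at hdeg
    have hF1 : F = 1 := hF.natDegree_eq_zero.1 (by omega)
    rw [hF1, mul_one] at hQF
    refine ⟨_, hQF, hcard, fun l hl => ?_⟩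
    obtain ⟨b, hb, rfl⟩ := Finset.mem_image.1 hl
    obtain ⟨-, h2, h3, h4, -, h5, -⟩ := hz b ((hmem b).1 hb)
    obtain ⟨-, -, h7, -⟩ := hconst b ((hmem b).1 hb)
    rw [one_mul] at h7
    set q := (symbolAt T' ω).eval b / (symbolAt T ω).derivative.eval b with hq
    refine ⟨?_, ?_, ?_⟩
    · have hbim := hT.real_roots ω hωS b ((hmem b).1 hb)
      have e1 := (Complex.abs_im_le_norm (z b - b + a * q)).trans h3
      have e2 : (z b - b + a * q).im = (z b).im - q.re * ρ⁻¹ := by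
        rw [Complex.add_im, Complex.sub_im, hbim, sub_zero, ha, mul_inv, Complex.inv_I,
          ← Complex.ofReal_inv]
        simp; ring
      have e3 : (Complex.I * ρ * z b).re = -(ρ * (z b).im) := by simp
      rw [e2, hna] at e1
      have e4 := (abs_le.1 e1).1
      rw [e3]
      have e5 : q.re * ρ⁻¹ - C * ρ⁻¹ ^ 2 ≤ (z b).im := by linarith
      have e6 : ρ * (q.re * ρ⁻¹ - C * ρ⁻¹ ^ 2) = q.re - C * ρ⁻¹ := by field_simp
      have e7 := mul_le_mul_of_nonneg_left e5 hρ0.le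
      linarith
    · rw [norm_mul, hnI, mul_comm]
      refine mul_le_mul_of_nonneg_right (h5.trans (by linarith)) hρ0.le
    · have e1 := congrArg norm (eval_of_comp_eq hcomp' (z b)).2
      rw [norm_mul (Complex.I * (ρ : ℂ)), norm_mul (_ ^ _), hnI, norm_pow, hnI] at e1
      have e2 : ρ ^ m = ρ * ρ ^ (m - 1) := by rw [← pow_succ', Nat.sub_add_cancel hm]
      rw [e2, mul_assoc ρ (ρ ^ (m - 1))] at e1
      have e3 := mul_left_cancel₀ hρ0.ne' e1
      rw [e3, mul_comm]
      exact mul_le_mul_of_nonneg_left (by linarith) (by positivity)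

end DampedSystem

/-! ### Low frequencies -/

/-- A uniform version of the fact that `l - s` does not vanish in the closed right half plane. -/
lemma exists_linear_lower_bound {s : ℂ} (hs : s.re < 0) : ∃ κ : ℝ, 0 < κ ∧
    ∀ l : ℂ, -κ ≤ l.re → κ * (1 + ‖l‖) ≤ ‖l - s‖ := by
  set x := -s.re with hx
  have hx0 : 0 < x := by linarith
  have hD : 0 < 2 / x + 1 + 2 * ‖s‖ / x := by positivity
  refine ⟨min (x / 2) (2 / x + 1 + 2 * ‖s‖ / x)⁻¹, by positivity, fun l hl => ?_⟩
  have h1 : x / 2 ≤ ‖l - s‖ := by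
    have e1 := (Complex.re_le_norm (l - s))
    rw [Complex.sub_re] at e1
    have := min_le_left (x / 2) (2 / x + 1 + 2 * ‖s‖ / x)⁻¹
    linarith
  have h2 : 1 ≤ 2 / x * ‖l - s‖ := by
    rw [div_mul_eq_mul_div, le_div_iff₀ hx0]; linarith
  have h3 : ‖l‖ ≤ ‖l - s‖ + ‖s‖ := by
    have := norm_add_le (l - s) s; rwa [sub_add_cancel] at this
  have h4 : ‖s‖ ≤ 2 * ‖s‖ / x * ‖l - s‖ := by
    have := mul_le_mul_of_nonneg_left h2 (norm_nonneg s)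
    rw [mul_one] at this
    refine this.trans (le_of_eq ?_); ring
  have h5 : 1 + ‖l‖ ≤ (2 / x + 1 + 2 * ‖s‖ / x) * ‖l - s‖ := by linarith
  calc min (x / 2) (2 / x + 1 + 2 * ‖s‖ / x)⁻¹ * (1 + ‖l‖)
      ≤ (2 / x + 1 + 2 * ‖s‖ / x)⁻¹ * ((2 / x + 1 + 2 * ‖s‖ / x) * ‖l - s‖) := by
        gcongr; exact min_le_right _ _
    _ = ‖l - s‖ := by rw [inv_mul_cancel_left₀ hD.ne']

/-- The polynomials `c₀ + c₁ λ` and `c₀ + c₁ λ + λ²` with positive coefficients are uniformly stable: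
they do not come close to zero in a half plane that contains the closed right half plane. -/
lemma exists_stable_lower_bound {c₀ c₁ c₂ : ℝ} (h₀ : 0 < c₀) (h₁ : 0 < c₁)
    (h₂ : c₂ = 0 ∨ c₂ = 1) : ∃ κ : ℝ, 0 < κ ∧
    ∀ l : ℂ, -κ ≤ l.re → κ * (1 + ‖l‖ + c₂ * ‖l‖ ^ 2) ≤ ‖(c₀ : ℂ) + c₁ * l + c₂ * l ^ 2‖ := by
  rcases h₂ with rfl | rfl
  · obtain ⟨κ, hκ, hb⟩ := exists_linear_lower_bound (s := ((-(c₀ / c₁) : ℝ) : ℂ))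
      (by rw [Complex.ofReal_re]; have : 0 < c₀ / c₁ := by positivity
          linarith)
    refine ⟨min κ (c₁ * κ), by positivity, fun l hl => ?_⟩
    have h1 := hb l (by have := min_le_left κ (c₁ * κ); linarith)
    have h2 : (c₀ : ℂ) + c₁ * l + (0 : ℝ) * l ^ 2 = c₁ * (l - ((-(c₀ / c₁) : ℝ) : ℂ)) := by
      have : (c₁ : ℂ) ≠ 0 := by exact_mod_cast h₁.ne'
      push_cast; field_simp; ring
    rw [h2, norm_mul, Complex.norm_real, Real.norm_of_nonneg h₁.le, zero_mul, add_zero]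
    calc min κ (c₁ * κ) * (1 + ‖l‖) ≤ c₁ * κ * (1 + ‖l‖) := by gcongr; exact min_le_right _ _
      _ ≤ _ := by rw [mul_assoc]; gcongr
  · obtain ⟨s, hs⟩ := IsAlgClosed.exists_pow_nat_eq ((c₁ : ℂ) ^ 2 - 4 * c₀) (n := 2) (by norm_num)
    have hneg : ∀ l : ℂ, (c₀ : ℂ) + c₁ * l + l ^ 2 = 0 → l.re < 0 := by
      intro l hl
      by_contra hre
      rw [not_lt] at hre
      have e1 := congrArg Complex.re hl
      have e2 := congrArg Complex.im hl
      simp [sq] at e1 e2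
      have e3 : l.im * (c₁ + 2 * l.re) = 0 := by linarith
      have e4 : l.im = 0 := (mul_eq_zero.1 e3).resolve_right (by linarith)
      rw [e4] at e1
      nlinarith [mul_nonneg h₁.le hre, mul_self_nonneg l.re]
    have hfac : ∀ l : ℂ, (c₀ : ℂ) + c₁ * l + l ^ 2 =
        (l - (-c₁ + s) / 2) * (l - (-c₁ - s) / 2) := by
      intro l; linear_combination (1 / 4 : ℂ) * hs
    obtain ⟨κ₁, hκ₁, hb₁⟩ := exists_linear_lower_bound (hneg ((-c₁ + s) / 2) (by rw [hfac]; simp))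
    obtain ⟨κ₂, hκ₂, hb₂⟩ := exists_linear_lower_bound (hneg ((-c₁ - s) / 2) (by rw [hfac]; simp))
    refine ⟨min (min κ₁ κ₂) (κ₁ * κ₂), by positivity, fun l hl => ?_⟩
    have e0 := min_le_left (min κ₁ κ₂) (κ₁ * κ₂)
    have h1 := hb₁ l (by linarith [min_le_left κ₁ κ₂])
    have h2 := hb₂ l (by linarith [min_le_right κ₁ κ₂])
    rw [Complex.ofReal_one, one_mul, one_mul, hfac, norm_mul]
    calc min (min κ₁ κ₂) (κ₁ * κ₂) * (1 + ‖l‖ + ‖l‖ ^ 2)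
        ≤ (κ₁ * κ₂) * ((1 + ‖l‖) * (1 + ‖l‖)) := by
          gcongr
          · exact min_le_right _ _
          · nlinarith [norm_nonneg l]
      _ = (κ₁ * (1 + ‖l‖)) * (κ₂ * (1 + ‖l‖)) := by ring
      _ ≤ _ := by gcongr

/-- Away from the unit disc, a polynomial is close to its leading term. -/
lemma CoeffBound.norm_eval_sub_leading_le {N : ℕ} {A : ℝ} {p : Polynomial ℂ}
    (h : CoeffBound (N + 1) A p) {z : ℂ} (hz : 1 ≤ ‖z‖) :
    ‖p.eval z - p.coeff (N + 1) * z ^ (N + 1)‖ ≤ (N + 1 : ℕ) * A * ‖z‖ ^ N := by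
  rw [Polynomial.eval_eq_sum_range' (Nat.lt_succ_of_le h.1), Finset.sum_range_succ,
    add_sub_cancel_right]
  refine (norm_sum_le _ _).trans ?_
  rw [mul_assoc, ← nsmul_eq_mul, ← Finset.card_range (N + 1), ← Finset.sum_const,
    Finset.card_range]
  refine Finset.sum_le_sum fun i hi => ?_
  rw [norm_mul, norm_pow]
  exact mul_le_mul (h.2 i) (pow_le_pow_right₀ hz (Finset.mem_range_succ_iff.1 hi))
    (by positivity) h.nonneg

end FrequencyRegimes

section LowFrequencies

variable {n r m : ℕ} {R₀ R₁ R₂ : DiffOp n}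

namespace DampedSystem

/-- The characteristic roots `l = iρμ` with large `μ` are almost zeros of the stable polynomial
`c₀ + c₁ λ + c₂ λ²`, hence stay away from the imaginary axis. -/
lemma exists_fast_root_bound (H : DampedSystem r m R₀ R₁ R₂) : ∃ K c : ℝ, 1 ≤ K ∧ 0 < c ∧
    ∀ ω ∈ Metric.sphere (0 : RSpace n) 1, ∀ (ρ : ℝ) (μ : ℂ), 0 < ρ → K ≤ ‖μ‖ →
      (perturbed (symbolAt R₀ ω) (symbolAt R₁ ω) (symbolAt R₂ ω) (Complex.I * ρ)).IsRoot μ →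
      (Complex.I * ρ * μ).re ≤ -c := by
  obtain ⟨A₀, hA₀, hb₀⟩ := exists_coeffBound_sphere H.hyp₀.homogeneous
  obtain ⟨A₁, hA₁, hb₁⟩ := exists_coeffBound_sphere H.hyp₁.homogeneous
  obtain ⟨c₂, A₂, hc₂, hA₂, hc₂', hb₂⟩ : ∃ c₂ A₂ : ℝ, (c₂ = 0 ∨ c₂ = 1) ∧ 0 < A₂ ∧
      timeCoeff R₂ (r + 3) = c₂ ∧
      ∀ ω ∈ Metric.sphere (0 : RSpace n) 1, CoeffBound (r + 3) (c₂ * A₂) (symbolAt R₂ ω) := by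
    rcases H.top with ⟨-, h2, -⟩ | ⟨-, h2, h3, -⟩
    · refine ⟨0, 1, Or.inl rfl, one_pos, ?_, fun ω _ => ?_⟩
      · simp [h2, timeCoeff]
      · rw [h2, show symbolAt (0 : DiffOp n) ω = 0 from map_zero _]
        exact ⟨by simp, by simp⟩
    · obtain ⟨A₂, hA₂, hb₂⟩ := exists_coeffBound_sphere h2.homogeneous
      exact ⟨1, A₂, Or.inr rfl, hA₂, by simpa using h3, by simpa using hb₂⟩
  set c₀ := (timeCoeff R₀ (r + 1)).re with hc₀
  set c₁ := (timeCoeff R₁ (r + 2)).re with hc₁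
  obtain ⟨κ, hκ, hΦ⟩ := exists_stable_lower_bound H.hyp₀.coeff_pos.1 H.hyp₁.coeff_pos.1 hc₂
  set C : ℝ := (r + 3) * (A₀ + A₁ + A₂) with hC
  have hCp : 0 < C := by positivity
  refine ⟨1 + 2 * C / κ, κ, by linarith [show 0 < 2 * C / κ by positivity], hκ, ?_⟩
  intro ω hω ρ μ hρ hμ hroot
  have hμ1 : 1 ≤ ‖μ‖ := by linarith [show 0 < 2 * C / κ by positivity]
  have hμ0 : 0 < ‖μ‖ := by linarith
  set l := Complex.I * ρ * μ with hl
  have hnl : ‖l‖ = ρ * ‖μ‖ := by rw [hl]; simp [abs_of_pos hρ]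
  have hc2nn : 0 ≤ c₂ := by rcases hc₂ with h | h <;> simp [h]
  by_contra hcon
  rw [not_le] at hcon
  have h1 := hΦ l hcon.le
  have e0 := (hb₀ ω hω).norm_eval_sub_leading_le hμ1
  have e1 := (hb₁ ω hω).norm_eval_sub_leading_le hμ1
  have e2 := (hb₂ ω hω).norm_eval_sub_leading_le hμ1
  rw [symbolAt_eq R₀, coeff_complexSymbol_top H.hyp₀.homogeneous, ← symbolAt_eq,
    H.hyp₀.timeCoeff_eq, ← hc₀] at e0
  rw [symbolAt_eq R₁, coeff_complexSymbol_top H.hyp₁.homogeneous, ← symbolAt_eq,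
    H.hyp₁.timeCoeff_eq, ← hc₁] at e1
  rw [symbolAt_eq R₂, coeff_complexSymbol_top H.homogeneous₂, ← symbolAt_eq, hc₂'] at e2
  have hroot0 : _ = _ := hroot
  rw [eval_perturbed] at hroot0
  set x := (symbolAt R₀ ω).eval μ
  set y := (symbolAt R₁ ω).eval μ
  set w := (symbolAt R₂ ω).eval μ
  have hid : μ ^ (r + 1) * ((c₀ : ℂ) + c₁ * l + c₂ * l ^ 2) =
      -((x - c₀ * μ ^ (r + 1)) + Complex.I * ρ * (y - c₁ * μ ^ (r + 2)) +
        (Complex.I * ρ) ^ 2 * (w - c₂ * μ ^ (r + 3))) := by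
    rw [hl]
    linear_combination hroot0
  have hn := congrArg norm hid
  rw [norm_mul, norm_pow, norm_neg] at hn
  have hI : ‖Complex.I * (ρ : ℂ)‖ = ρ := by simp [abs_of_pos hρ]
  have h2 : ‖(x - c₀ * μ ^ (r + 1)) + Complex.I * ρ * (y - c₁ * μ ^ (r + 2)) +
        (Complex.I * ρ) ^ 2 * (w - c₂ * μ ^ (r + 3))‖ ≤
      C * ‖μ‖ ^ r * (1 + ‖l‖ + c₂ * ‖l‖ ^ 2) := by
    refine (norm_add₃_le).trans ?_
    rw [norm_mul, norm_mul (_ ^ 2), norm_pow, hI, hnl]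
    have g0 : ((r + 1 : ℕ) : ℝ) * A₀ * ‖μ‖ ^ r ≤ C * ‖μ‖ ^ r := by
      refine mul_le_mul_of_nonneg_right ?_ (by positivity)
      rw [hC]
      exact mul_le_mul (by push_cast; linarith) (by linarith) hA₀.le (by positivity)
    have g1 : ρ * (((r + 1 + 1 : ℕ) : ℝ) * A₁ * ‖μ‖ ^ (r + 1)) ≤ C * ‖μ‖ ^ r * (ρ * ‖μ‖) := by
      have : ρ * (((r + 1 + 1 : ℕ) : ℝ) * A₁ * ‖μ‖ ^ (r + 1)) =
        ((r + 1 + 1 : ℕ) : ℝ) * A₁ * (‖μ‖ ^ r * (ρ * ‖μ‖)) := by ring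
      rw [this, mul_assoc C]
      refine mul_le_mul_of_nonneg_right ?_ (by positivity)
      rw [hC]
      exact mul_le_mul (by push_cast; linarith) (by linarith) hA₁.le (by positivity)
    have g2 : ρ ^ 2 * (((r + 1 + 1 + 1 : ℕ) : ℝ) * (c₂ * A₂) * ‖μ‖ ^ (r + 1 + 1)) ≤
        C * ‖μ‖ ^ r * (c₂ * (ρ * ‖μ‖) ^ 2) := by
      have : ρ ^ 2 * (((r + 1 + 1 + 1 : ℕ) : ℝ) * (c₂ * A₂) * ‖μ‖ ^ (r + 1 + 1)) =
        ((r + 1 + 1 + 1 : ℕ) : ℝ) * A₂ * (‖μ‖ ^ r * (c₂ * (ρ * ‖μ‖) ^ 2)) := by ring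
      rw [this, mul_assoc C]
      refine mul_le_mul_of_nonneg_right ?_ (by positivity)
      rw [hC]
      exact mul_le_mul (by push_cast; linarith) (by linarith) hA₂.le (by positivity)
    have g1' := mul_le_mul_of_nonneg_left e1 hρ.le
    have g2' := mul_le_mul_of_nonneg_left e2 (sq_nonneg ρ)
    have e0' := e0.trans g0
    linarith [g1'.trans g1, g2'.trans g2]
  rw [← hn] at h2
  set Y := 1 + ‖l‖ + c₂ * ‖l‖ ^ 2 with hY
  have hYp : 0 < Y := by positivity
  have h3 : ‖μ‖ * (κ * Y) ≤ C * Y := by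
    have h4 : ‖μ‖ ^ r * (‖μ‖ * (κ * Y)) ≤ ‖μ‖ ^ r * (C * Y) := by
      calc ‖μ‖ ^ r * (‖μ‖ * (κ * Y)) = ‖μ‖ ^ (r + 1) * (κ * Y) := by ring
        _ ≤ ‖μ‖ ^ (r + 1) * ‖(c₀ : ℂ) + c₁ * l + c₂ * l ^ 2‖ := by gcongr
        _ ≤ C * ‖μ‖ ^ r * Y := h2
        _ = _ := by ring
    exact le_of_mul_le_mul_left h4 (by positivity)
  have h5 : ‖μ‖ * κ ≤ C := by nlinarith
  have h6 : 2 * C / κ ≤ ‖μ‖ := by linarith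
  rw [div_le_iff₀ hκ] at h6
  linarith

/-- At low frequencies `ρ ω` there are `r + 1` simple characteristic roots
`iρ z_b = iρb + ρ² R₁(b)/R₀'(b) + O(ρ³)`, one for each root `b` of the symbol of `R₀`, while the
remaining ones, the roots of `F`, stay in a half plane `Re λ ≤ -c`. -/
lemma exists_low (H : DampedSystem r m R₀ R₁ R₂) : ∃ δ c C : ℝ, 0 < δ ∧ δ ≤ 1 ∧ 0 < c ∧ 0 < C ∧
    ∀ ω ∈ Metric.sphere (0 : RSpace n) 1,
    (∀ b, (symbolAt R₀ ω).IsRoot b → c ≤ ‖(symbolAt R₀ ω).derivative.eval b‖ ∧ ‖b‖ ≤ C ∧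
        b.im = 0 ∧
        ((symbolAt R₁ ω).eval b / (symbolAt R₀ ω).derivative.eval b).re ≤ -c ∧
        ‖(symbolAt R₁ ω).eval b / (symbolAt R₀ ω).derivative.eval b‖ ≤ C) ∧
    ∀ ρ : ℝ, 0 < ρ → ρ ≤ δ → ∃ (z : ℂ → ℂ) (F : Polynomial ℂ),
      InjOn z ((symbolAt R₀ ω).roots.toFinset : Set ℂ) ∧ F.Monic ∧ F.natDegree + (r + 1) = m ∧
      charPoly (R₀ + R₁ + R₂) (ρ • ω) = (∏ l ∈ (symbolAt R₀ ω).roots.toFinset.image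
        (fun b => Complex.I * ρ * z b), (Polynomial.X - Polynomial.C l)) * F ∧
      (∀ l, F.IsRoot l → l.re ≤ -c ∧ ‖l‖ ≤ C) ∧
      ∀ b ∈ (symbolAt R₀ ω).roots.toFinset,
        ‖z b - b‖ ≤ C * ρ ∧
        ‖z b - b + Complex.I * ρ *
          ((symbolAt R₁ ω).eval b / (symbolAt R₀ ω).derivative.eval b)‖ ≤ C * ρ ^ 2 ∧
        ‖z b‖ ≤ C ∧ (Complex.I * ρ * z b).re ≤ -(c * ρ ^ 2) ∧
        c * ρ ^ r ≤ ‖(charPoly (R₀ + R₁ + R₂) (ρ • ω)).derivative.eval (Complex.I * ρ * z b)‖ ∧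
        ‖(charPoly (R₀ + R₁ + R₂) (ρ • ω)).derivative.eval (Complex.I * ρ * z b) -
          (Complex.I * ρ) ^ r * (symbolAt R₀ ω).derivative.eval b‖ ≤ C * ρ ^ (r + 1) := by
  have hsign : ∀ ω ∈ Metric.sphere (0 : RSpace n) 1, ∀ b, (symbolAt R₀ ω).IsRoot b →
      (symbolAt R₀ ω).derivative.eval b ≠ 0 ∧
      0 < (-1) * ((symbolAt R₁ ω).eval b / (symbolAt R₀ ω).derivative.eval b).re := by
    intro ω hω b hb
    obtain ⟨h1, s, hs, h2⟩ := (H.int₀₁ ω hω).eval_at_lower_root H.hyp₀.coeff_pos.1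
      H.hyp₁.coeff_pos.1 (H.hyp₀.leadingCoeff_symbolAt ω) (H.hyp₁.leadingCoeff_symbolAt ω) hb
      (H.hyp₀.real_roots ω hω b hb)
    refine ⟨h1, ?_⟩
    rw [h2, neg_div, mul_div_assoc, div_self h1]
    simpa using hs
  obtain ⟨δ, c, C, hδ, hc, hC, hbr⟩ := exists_branches H.hyp₀ H.hyp₁.homogeneous H.homogeneous₂
    (-1) hsign
  obtain ⟨K, κ, hK, hκ, hfast⟩ := H.exists_fast_root_bound
  obtain ⟨Ar, hAr, hroots⟩ := H.exists_root_bound 1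
  obtain ⟨A₁, hA₁, hb₁⟩ := exists_coeffBound_sphere H.hyp₁.homogeneous
  obtain ⟨A₂, hA₂, hb₂⟩ := exists_coeffBound_sphere H.homogeneous₂
  set c₀ := (timeCoeff R₀ (r + 1)).re with hc₀
  have hc₀p : 0 < c₀ := H.hyp₀.coeff_pos.1
  set D : ℝ := A₁ * ∑ i ∈ Finset.range (r + 2 + 1), K ^ i +
    A₂ * ∑ i ∈ Finset.range (r + 3 + 1), K ^ i with hD
  have hDp : 0 ≤ D := by positivity
  set η : ℝ := c₀ * δ ^ (r + 1) / (D + 1) / 2 with hη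
  have hηp : 0 < η := by positivity
  refine ⟨min (min δ 1) (min (c / (2 * C)) η), min (c / 2) κ, C + Ar, by positivity,
    (min_le_left _ _).trans (min_le_right _ _), by positivity, by positivity, fun ω hω => ?_⟩
  obtain ⟨hconst, hz⟩ := hbr ω hω
  refine ⟨fun b hb => ?_, fun ρ hρ hρδ => ?_⟩
  · obtain ⟨h1, h2, h3, h4⟩ := hconst b hb
    have := min_le_left (c / 2) κ
    exact ⟨by linarith, by linarith, H.hyp₀.real_roots ω hω b hb, by linarith, by linarith⟩
  have hρ1 : ρ ≤ 1 := hρδ.trans ((min_le_left _ _).trans (min_le_right _ _))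
  have hρδ' : ρ ≤ δ := hρδ.trans ((min_le_left _ _).trans (min_le_left _ _))
  have hρC : C * ρ ≤ c / 2 := by
    have := hρδ.trans ((min_le_right _ _).trans (min_le_left _ _))
    rw [le_div_iff₀ (by positivity)] at this
    linarith
  have hρη : ρ ≤ η := hρδ.trans ((min_le_right _ _).trans (min_le_right _ _))
  have hρc : (ρ : ℂ) ≠ 0 := by exact_mod_cast hρ.ne'
  have hIρ : Complex.I * ρ ≠ 0 := mul_ne_zero Complex.I_ne_zero hρc
  have hnI : ‖Complex.I * (ρ : ℂ)‖ = ρ := by simp [abs_of_pos hρ]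
  have hcomp := H.charPoly_comp_low ρ ω
  set Q := charPoly (R₀ + R₁ + R₂) (ρ • ω) with hQ
  obtain ⟨z, hinj, hz⟩ := hz (Complex.I * ρ) (by rw [hnI]; exact hρδ')
  rw [hnI] at hz
  set B := (symbolAt R₀ ω).roots.toFinset with hB
  have hmem : ∀ b, b ∈ B ↔ (symbolAt R₀ ω).IsRoot b := fun b => H.hyp₀.mem_roots
  have hinj' : InjOn z (B : Set ℂ) := fun b hb b' hb' h => hinj ((hmem b).1 hb) ((hmem b').1 hb') h
  have hcard : (B.image fun b => Complex.I * ρ * z b).card = r + 1 := by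
    rw [Finset.card_image_of_injOn, H.hyp₀.card_roots hω]
    intro b hb b' hb' h
    exact hinj' hb hb' (mul_left_cancel₀ hIρ h)
  have hroot : ∀ l ∈ B.image (fun b => Complex.I * ρ * z b), Q.IsRoot l := by
    intro l hl
    obtain ⟨b, hb, rfl⟩ := Finset.mem_image.1 hl
    have h1 := (eval_of_comp_eq hcomp (z b)).1
    rw [(hz b ((hmem b).1 hb)).1, mul_zero] at h1
    exact h1
  obtain ⟨F, hF, hQF, hdeg⟩ := exists_factor_of_roots (H.monic_charPoly (ρ • ω)) _ hroot
  rw [hcard, H.natDegree_charPoly] at hdeg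
  have hder : ∀ b ∈ B, Q.derivative.eval (Complex.I * ρ * z b) = (Complex.I * ρ) ^ r *
      (perturbed (symbolAt R₀ ω) (symbolAt R₁ ω) (symbolAt R₂ ω) (Complex.I * ρ)).derivative.eval
        (z b) := by
    intro b _
    refine mul_left_cancel₀ hIρ ?_
    rw [(eval_of_comp_eq hcomp (z b)).2]; ring
  have hnorm : ‖ρ • ω‖ ≤ 1 := by
    rw [norm_smul, mem_sphere_zero_iff_norm.1 hω, mul_one, Real.norm_of_nonneg hρ.le]; exact hρ1
  refine ⟨z, F, hinj', hF, hdeg, hQF, fun l hl => ?_, fun b hb => ?_⟩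
  · have hQl : Q.IsRoot l := by
      rw [Polynomial.IsRoot, hQ, hQF, Polynomial.eval_mul, hl, mul_zero]
    refine ⟨?_, ((hroots _ hnorm).2 l hQl).trans (by linarith)⟩
    set μ := l / (Complex.I * ρ) with hμ
    have hlμ : l = Complex.I * ρ * μ := by rw [hμ]; field_simp
    have hG : (perturbed (symbolAt R₀ ω) (symbolAt R₁ ω) (symbolAt R₂ ω)
        (Complex.I * ρ)).IsRoot μ := by
      have h1 := (eval_of_comp_eq hcomp μ).1
      rw [← hlμ, hQl] at h1
      exact (mul_eq_zero.1 h1.symm).resolve_left (pow_ne_zero _ hIρ)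
    -- A root `μ` other than the `z b` is far from all `b`. Such a root is large: otherwise
    -- `R₀(μ) = O(ρ)`, in contradiction to the lower bound for `R₀` away from its roots.
    have hfar : ∀ b ∈ B, δ < ‖μ - b‖ := by
      intro b hb
      by_contra hcon
      rw [not_lt] at hcon
      have hzb := hz b ((hmem b).1 hb)
      have h2 := hzb.2.2.2.2.2.2 μ hG hcon
      refine not_isRoot_of_derivative_ne_zero hQF (l := l)
        (Finset.mem_image.2 ⟨b, hb, by rw [hlμ, h2]⟩) ?_ hl
      rw [← hQ, hlμ, h2, hder b hb]
      refine mul_ne_zero (pow_ne_zero _ hIρ) fun h0 => ?_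
      have h3 := hzb.2.2.2.1
      rw [h0, norm_zero] at h3
      linarith
    have hKμ : K ≤ ‖μ‖ := by
      by_contra hcon
      rw [not_le] at hcon
      have h0 : _ = _ := hG
      rw [eval_perturbed] at h0
      have e1 := (hb₁ ω hω).norm_eval_le hcon.le
      have e2 := (hb₂ ω hω).norm_eval_le hcon.le
      have e3 : ‖(symbolAt R₀ ω).eval μ‖ ≤ ρ * D := by
        have : (symbolAt R₀ ω).eval μ = -(Complex.I * ρ * (symbolAt R₁ ω).eval μ +
          (Complex.I * ρ) ^ 2 * (symbolAt R₂ ω).eval μ) := by linear_combination h0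
        rw [this, norm_neg]
        refine (norm_add_le _ _).trans ?_
        rw [norm_mul, norm_mul (_ ^ 2), norm_pow, hnI, hD]
        have h5 : ρ ^ 2 ≤ ρ := by nlinarith
        have h6 := mul_le_mul_of_nonneg_left e1 hρ.le
        have h7 := mul_le_mul h5 e2 (norm_nonneg _) hρ.le
        linarith
      have e4 : c₀ * δ ^ (r + 1) ≤ ‖(symbolAt R₀ ω).eval μ‖ := by
        rw [(IsAlgClosed.splits (symbolAt R₀ ω)).eq_prod_roots,
          H.hyp₀.leadingCoeff_symbolAt, Polynomial.eval_mul, Polynomial.eval_C, norm_mul,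
          Complex.norm_real, Real.norm_of_nonneg hc₀p.le]
        refine mul_le_mul_of_nonneg_left ?_ hc₀p.le
        rw [← Multiset.dedup_eq_self.2 (H.hyp₀.simple_roots ω hω)]
        have h8 : ((symbolAt R₀ ω).roots.dedup.map
            fun a => Polynomial.X - Polynomial.C a).prod =
            ∏ b ∈ B, (Polynomial.X - Polynomial.C b) := rfl
        rw [h8, Polynomial.eval_prod, norm_prod, ← H.hyp₀.card_roots hω]
        rw [← Finset.prod_const]
        refine Finset.prod_le_prod (fun _ _ => hδ.le) fun b hb => ?_
        simpa using (hfar b hb).le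
      have e5 : ρ * D < c₀ * δ ^ (r + 1) := by
        have h9 : η * (D + 1) = c₀ * δ ^ (r + 1) / 2 := by rw [hη]; field_simp
        have h10 : ρ * D ≤ η * (D + 1) := mul_le_mul hρη (by linarith) hDp hηp.le
        have : 0 < c₀ * δ ^ (r + 1) := by positivity
        linarith
      linarith
    have := hfast ω hω ρ μ hρ hKμ hG
    rw [← hlμ] at this
    have := min_le_right (c / 2) κ
    linarith
  · obtain ⟨-, h2, h3, h4, h5, h6, -⟩ := hz b ((hmem b).1 hb)
    obtain ⟨-, -, h7, -⟩ := hconst b ((hmem b).1 hb)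
    set q := (symbolAt R₁ ω).eval b / (symbolAt R₀ ω).derivative.eval b with hq
    have hρr : 0 < ρ ^ r := by positivity
    refine ⟨h2.trans (by gcongr; linarith), h3.trans (by gcongr; linarith), by linarith, ?_, ?_, ?_⟩
    · have hbim := H.hyp₀.real_roots ω hω b ((hmem b).1 hb)
      have e1 := (Complex.abs_im_le_norm (z b - b + Complex.I * ρ * q)).trans h3
      have e2 : (z b - b + Complex.I * ρ * q).im = (z b).im + ρ * q.re := by
        rw [Complex.add_im, Complex.sub_im, hbim, sub_zero, mul_assoc]
        simp
      have e3 : (Complex.I * ρ * z b).re = -(ρ * (z b).im) := by simp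
      rw [e2] at e1
      have e4 := (abs_le.1 e1).1
      rw [e3]
      have e5 : (c - c / 2) * ρ ≤ (z b).im := by nlinarith
      have e6 := min_le_left (c / 2) κ
      have e7 : min (c / 2) κ * ρ ^ 2 ≤ c / 2 * ρ ^ 2 := by gcongr
      nlinarith
    · rw [hder b hb, norm_mul, norm_pow, hnI, mul_comm]
      refine mul_le_mul_of_nonneg_left ?_ hρr.le
      have e6 := min_le_left (c / 2) κ
      linarith
    · rw [hder b hb, ← mul_sub, norm_mul, norm_pow, hnI, pow_succ]
      have := mul_le_mul_of_nonneg_left h5 hρr.le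
      have e8 : 0 ≤ ρ ^ r * (Ar * ρ) := by positivity
      nlinarith

end DampedSystem

end LowFrequencies

/-! ### Ordinary differential equations with constant coefficients -/

/-- A sequence of functions each of which is the derivative of the preceding one: a smooth function
`Y 0` of time together with all its derivatives. -/
def IsJet (Y : ℕ → ℝ → ℂ) : Prop := ∀ k t, HasDerivAt (Y k) (Y (k + 1) t) t

/-- The shift of sequences of functions, which acts on jets as differentiation. -/
def jetShift : Module.End ℂ (ℕ → ℝ → ℂ) where
  toFun Y := fun k => Y (k + 1)
  map_add' _ _ := rfl
  map_smul' _ _ := rfl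

/-- The action `q(d/dt)` of a polynomial `q` on jets. -/
noncomputable def polyAct (q : Polynomial ℂ) (Y : ℕ → ℝ → ℂ) : ℕ → ℝ → ℂ :=
  Polynomial.aeval jetShift q Y

/-- The jet of `t ↦ exp (l t)`. -/
noncomputable def expJet (l : ℂ) : ℕ → ℝ → ℂ := fun k t => l ^ k * Complex.exp (l * t)

section Jets

lemma jetShift_pow_apply (i : ℕ) (Y : ℕ → ℝ → ℂ) (k : ℕ) : (jetShift ^ i) Y k = Y (k + i) := by
  induction i generalizing Y k with
  | zero => simp
  | succ i ih => rw [pow_succ, Module.End.mul_apply, ih]; rfl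

lemma polyAct_apply {q : Polynomial ℂ} {N : ℕ} (hN : q.natDegree ≤ N) (Y : ℕ → ℝ → ℂ) (k : ℕ)
    (t : ℝ) : polyAct q Y k t = ∑ i ∈ Finset.range (N + 1), q.coeff i * Y (k + i) t := by
  rw [polyAct, Polynomial.aeval_eq_sum_range' (Nat.lt_succ_of_le hN)]
  simp [LinearMap.sum_apply, Finset.sum_apply, jetShift_pow_apply]

lemma polyAct_mul (p q : Polynomial ℂ) (Y : ℕ → ℝ → ℂ) :
    polyAct (p * q) Y = polyAct p (polyAct q Y) := by
  simp [polyAct]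

lemma polyAct_one (Y : ℕ → ℝ → ℂ) : polyAct 1 Y = Y := by simp [polyAct]

lemma polyAct_sub_right (p : Polynomial ℂ) (Y Z : ℕ → ℝ → ℂ) :
    polyAct p (Y - Z) = polyAct p Y - polyAct p Z := by simp [polyAct]

lemma polyAct_X_sub_C (l : ℂ) (Y : ℕ → ℝ → ℂ) (k : ℕ) (t : ℝ) :
    polyAct (Polynomial.X - Polynomial.C l) Y k t = Y (k + 1) t - l * Y k t := by
  simp [polyAct, jetShift]

lemma polyAct_expJet (p : Polynomial ℂ) (l : ℂ) : polyAct p (expJet l) = p.eval l • expJet l := by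
  ext k t
  rw [polyAct_apply le_rfl, Pi.smul_apply, Pi.smul_apply, smul_eq_mul,
    Polynomial.eval_eq_sum_range, Finset.sum_mul]
  exact Finset.sum_congr rfl fun i _ => by simp only [expJet]; ring

lemma isJet_expJet (l : ℂ) : IsJet (expJet l) := by
  intro k t
  have h1 : HasDerivAt (fun t : ℝ => l * (t : ℂ)) l t := by
    simpa using (Complex.ofRealCLM.hasDerivAt (x := t)).const_mul l
  have h2 := h1.cexp.const_mul (l ^ k)
  convert! h2 using 1
  simp only [expJet]; ring

lemma IsJet.sub {Y Z : ℕ → ℝ → ℂ} (hY : IsJet Y) (hZ : IsJet Z) : IsJet (Y - Z) :=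
  fun k t => (hY k t).sub (hZ k t)

lemma IsJet.smul {Y : ℕ → ℝ → ℂ} (hY : IsJet Y) (c : ℂ) : IsJet (c • Y) :=
  fun k t => (hY k t).const_smul c

lemma IsJet.sum {ι : Type*} {s : Finset ι} {Y : ι → ℕ → ℝ → ℂ} (hY : ∀ i ∈ s, IsJet (Y i)) :
    IsJet (∑ i ∈ s, Y i) := by
  intro k t
  have h := HasDerivAt.sum (u := s) (A := fun i => Y i k) (A' := fun i => Y i (k + 1) t) (x := t)
    fun i hi => hY i hi k t
  convert! h using 1
  · simp
  · simp

lemma IsJet.polyAct_isJet {Y : ℕ → ℝ → ℂ} (hY : IsJet Y) (q : Polynomial ℂ) :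
    IsJet (polyAct q Y) := by
  intro k t
  have h := HasDerivAt.fun_sum (u := Finset.range (q.natDegree + 1))
    (A := fun i t => q.coeff i * Y (k + i) t) (A' := fun i => q.coeff i * Y (k + i + 1) t) (x := t)
    fun i _ => (hY (k + i) t).const_mul _
  have e1 : polyAct q Y k = fun t => ∑ i ∈ Finset.range (q.natDegree + 1),
      q.coeff i * Y (k + i) t := by ext t; exact polyAct_apply le_rfl Y k t
  rw [e1, polyAct_apply le_rfl]
  convert! h using 1
  exact Finset.sum_congr rfl fun i _ => by rw [add_right_comm]

lemma IsJet.shift {Y : ℕ → ℝ → ℂ} (hY : IsJet Y) (r : ℕ) : IsJet fun k => Y (r + k) :=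
  fun k t => hY (r + k) t

lemma polyAct_shift_eq_zero {q : Polynomial ℂ} {Y : ℕ → ℝ → ℂ} (h : polyAct q Y = 0) (r : ℕ) :
    polyAct q (fun k => Y (r + k)) = 0 := by
  ext k t
  have h1 := congrFun (congrFun h (r + k)) t
  rw [polyAct_apply le_rfl] at h1 ⊢
  simpa [add_assoc] using h1

lemma IsJet.eq_smul_expJet {Y : ℕ → ℝ → ℂ} (hY : IsJet Y) {l : ℂ}
    (h : polyAct (Polynomial.X - Polynomial.C l) Y = 0) : Y = Y 0 0 • expJet l := by
  have h1 : ∀ k t, Y (k + 1) t = l * Y k t := by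
    intro k t
    have := congrFun (congrFun h k) t
    rw [polyAct_X_sub_C] at this
    exact sub_eq_zero.1 this
  have h2 : ∀ t, Y 0 t = Y 0 0 * Complex.exp (l * t) := by
    intro t
    have hd : ∀ s : ℝ, HasDerivAt (fun s : ℝ => Complex.exp (-l * s) * Y 0 s) 0 s := by
      intro s
      have e1 : HasDerivAt (fun t : ℝ => -l * (t : ℂ)) (-l) s := by
        simpa using (Complex.ofRealCLM.hasDerivAt (x := s)).const_mul (-l)
      have e2 := e1.cexp.mul (hY 0 s)
      convert! e2 using 1
      rw [h1]; ring
    have hconst := is_const_of_deriv_eq_zero (fun s => (hd s).differentiableAt)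
      (fun s => (hd s).deriv) t 0
    simp only [Complex.ofReal_zero, mul_zero, Complex.exp_zero, one_mul] at hconst
    rw [← hconst, mul_right_comm, ← Complex.exp_add]
    simp
  ext k t
  induction k with
  | zero => rw [h2]; simp [expJet]
  | succ k ih =>
    rw [h1, ih]
    simp only [Pi.smul_apply, smul_eq_mul, expJet]; ring

/-- The numerator in the formula `∑ e^{lt} N(l) / Q'(l)` for the solution of `Q(d/dt) y = 0` with
initial data `v`. -/
noncomputable def amplitude (m : ℕ) (Q : Polynomial ℂ) (v : ℕ → ℂ) (l : ℂ) : ℂ :=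
  ∑ i ∈ Finset.range m, (∑ j ∈ Finset.Icc (i + 1) m, l ^ (j - (i + 1)) * Q.coeff j) * v i

lemma polyAct_divByMonic_zero {m : ℕ} {Q : Polynomial ℂ} (hQ : Q.natDegree = m) (hm : 1 ≤ m)
    (Y : ℕ → ℝ → ℂ) (l : ℂ) :
    polyAct (Q /ₘ (Polynomial.X - Polynomial.C l)) Y 0 0 = amplitude m Q (fun i => Y i 0) l := by
  have hd : (Q /ₘ (Polynomial.X - Polynomial.C l)).natDegree ≤ m - 1 := by
    rw [Polynomial.natDegree_divByMonic _ (Polynomial.monic_X_sub_C l), hQ,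
      Polynomial.natDegree_X_sub_C]
  rw [polyAct_apply hd, Nat.sub_add_cancel hm, amplitude]
  refine Finset.sum_congr rfl fun i _ => ?_
  rw [Polynomial.coeff_divByMonic_X_sub_C, hQ, zero_add]

/-- Splitting off the exponentials belonging to a set `Λ` of simple characteristic roots. The
remainder satisfies the equation of the complementary factor `F`. -/
lemma IsJet.partialFractions {m : ℕ} {Q F : Polynomial ℂ} {Λ : Finset ℂ} (hΛ : Λ.Nonempty)
    (hm : 1 ≤ m) (hQm : Q.natDegree = m)
    (hQ : Q = (∏ l ∈ Λ, (Polynomial.X - Polynomial.C l)) * F)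
    (hd : ∀ l ∈ Λ, Q.derivative.eval l ≠ 0) {Y : ℕ → ℝ → ℂ} (hY : IsJet Y)
    (hQY : polyAct Q Y = 0) :
    ∃ W : ℕ → ℝ → ℂ, IsJet W ∧ polyAct F W = 0 ∧ ∀ k t, Y k t =
      ∑ l ∈ Λ, l ^ k * Complex.exp (l * t) *
        (amplitude m Q (fun i => Y i 0) l / Q.derivative.eval l) + W k t := by
  classical
  set c : ℂ → ℂ := fun l => amplitude m Q (fun i => Y i 0) l / Q.derivative.eval l with hc
  set S : ℂ → Polynomial ℂ := fun l => ∏ j ∈ Λ.erase l, (Polynomial.X - Polynomial.C j) with hS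
  have hfac : ∀ l ∈ Λ, Q = (Polynomial.X - Polynomial.C l) * (S l * F) := by
    intro l hl
    rw [hQ, ← Finset.mul_prod_erase _ _ hl, mul_assoc]
  have hdiv : ∀ l ∈ Λ, Q /ₘ (Polynomial.X - Polynomial.C l) = S l * F := by
    intro l hl
    conv_lhs => rw [hfac l hl]
    exact Polynomial.mul_divByMonic_cancel_left _ (Polynomial.monic_X_sub_C l)
  have hder : ∀ l ∈ Λ, Q.derivative.eval l = (S l).eval l * F.eval l := by
    intro l hl
    rw [hfac l hl]
    simp
  have hSl : ∀ l ∈ Λ, (S l).eval l ≠ 0 := fun l hl h0 => hd l hl (by rw [hder l hl, h0, zero_mul])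
  have hFl : ∀ l ∈ Λ, F.eval l ≠ 0 := fun l hl h0 => hd l hl (by rw [hder l hl, h0, mul_zero])
  -- Lagrange interpolation of the constant `1` at the points of `Λ`.
  have hone : (1 : Polynomial ℂ) = ∑ l ∈ Λ, Polynomial.C ((S l).eval l)⁻¹ * S l := by
    rw [← Lagrange.sum_basis (s := Λ) (v := id) (Function.injective_id.injOn) hΛ]
    refine Finset.sum_congr rfl fun l hl => ?_
    rw [Lagrange.basis]
    simp only [Lagrange.basisDivisor, id, Finset.prod_mul_distrib]
    congr 1
    rw [hS, Polynomial.eval_prod, ← map_prod, Finset.prod_inv_distrib]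
    simp
  have hF : F = ∑ l ∈ Λ, Polynomial.C ((S l).eval l)⁻¹ * (S l * F) := by
    conv_lhs => rw [← one_mul F, hone, Finset.sum_mul]
    exact Finset.sum_congr rfl fun l _ => by rw [mul_assoc]
  -- The function `(S l * F)(d/dt) Y` solves `y' = l y`, so it is an exponential.
  have hZ : ∀ l ∈ Λ, polyAct (S l * F) Y = (c l * Q.derivative.eval l) • expJet l := by
    intro l hl
    have h1 : polyAct (Polynomial.X - Polynomial.C l) (polyAct (S l * F) Y) = 0 := by
      rw [← polyAct_mul, ← hfac l hl, hQY]
    have h2 := (hY.polyAct_isJet (S l * F)).eq_smul_expJet h1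
    rw [h2, ← hdiv l hl, polyAct_divByMonic_zero hQm hm, hc]
    simp only
    rw [div_mul_cancel₀ _ (hd l hl)]
  refine ⟨Y - ∑ l ∈ Λ, c l • expJet l, hY.sub (IsJet.sum fun l _ => (isJet_expJet l).smul _), ?_,
    fun k t => ?_⟩
  · rw [polyAct_sub_right, sub_eq_zero]
    conv_lhs => rw [hF]
    have h1 : polyAct (∑ l ∈ Λ, Polynomial.C ((S l).eval l)⁻¹ * (S l * F)) Y =
        ∑ l ∈ Λ, ((S l).eval l)⁻¹ • polyAct (S l * F) Y := by
      simp only [polyAct, map_sum, LinearMap.sum_apply]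
      refine Finset.sum_congr rfl fun l _ => ?_
      rw [← Polynomial.smul_eq_C_mul, map_smul, LinearMap.smul_apply]
    have h2 : polyAct F (∑ l ∈ Λ, c l • expJet l) = ∑ l ∈ Λ, c l • polyAct F (expJet l) := by
      simp [polyAct, map_sum]
    rw [h1, h2]
    refine Finset.sum_congr rfl fun l hl => ?_
    rw [hZ l hl, polyAct_expJet, smul_smul, smul_smul, hder l hl]
    congr 1
    have := hSl l hl
    field_simp
  · simp only [Pi.sub_apply, Finset.sum_apply, Pi.smul_apply, smul_eq_mul, expJet]
    rw [eq_comm]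
    refine (add_eq_of_eq_sub ?_)
    rw [sub_sub_cancel]
    exact Finset.sum_congr rfl fun l _ => by rw [mul_comm]

/-- Duhamel's formula: the solution of `y' = l y + z` decays like `z` if `Re l` is more negative
than the rate of decay of `z`. -/
lemma norm_le_of_first_order {y z : ℝ → ℂ} {l : ℂ} {a B Z : ℝ} (ha : 0 < a) (hl : l.re ≤ -(2 * a))
    (hy : ∀ t, HasDerivAt y (l * y t + z t) t) (hB : ‖y 0‖ ≤ B)
    (hz : ∀ t, 0 ≤ t → ‖z t‖ ≤ Z * Real.exp (-a * t)) {t : ℝ} (ht : 0 ≤ t) :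
    ‖y t‖ ≤ (B + Z / a) * Real.exp (-a * t) := by
  have hZ : 0 ≤ Z := by
    have := (norm_nonneg _).trans (hz 0 le_rfl)
    simpa using this
  set κ := -l.re - a with hκ
  have hκa : a ≤ κ := by linarith
  have hw : ∀ s : ℝ, HasDerivAt (fun s : ℝ => Complex.exp (-l * s) * y s)
      (Complex.exp (-l * s) * z s) s := by
    intro s
    have e1 : HasDerivAt (fun t : ℝ => -l * (t : ℂ)) (-l) s := by
      simpa using (Complex.ofRealCLM.hasDerivAt (x := s)).const_mul (-l)
    have e2 := e1.cexp.mul (hy s)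
    convert! e2 using 1
    ring
  have hexp : ∀ s : ℝ, ‖Complex.exp (-l * s)‖ = Real.exp (-l.re * s) := by
    intro s
    rw [Complex.norm_exp]; simp
  have hBd : ∀ s : ℝ, HasDerivAt (fun s : ℝ => B + Z / a * Real.exp (κ * s))
      (Z / a * (Real.exp (κ * s) * κ)) s := by
    intro s
    have e1 : HasDerivAt (fun s : ℝ => κ * s) κ s := by
      simpa using (hasDerivAt_id s).const_mul κ
    exact (e1.exp.const_mul (Z / a)).const_add B
  have key := image_norm_le_of_norm_deriv_right_le_deriv_boundary'
    (f := fun s : ℝ => Complex.exp (-l * s) * y s) (f' := fun s => Complex.exp (-l * s) * z s)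
    (a := 0) (b := t) (B := fun s : ℝ => B + Z / a * Real.exp (κ * s))
    (B' := fun s => Z / a * (Real.exp (κ * s) * κ))
    (fun s _ => (hw s).continuousAt.continuousWithinAt)
    (fun s _ => (hw s).hasDerivWithinAt)
    (by
      have : 0 ≤ Z / a := by positivity
      simpa using hB.trans (by linarith))
    (fun s _ => (hBd s).continuousAt.continuousWithinAt)
    (fun s _ => (hBd s).hasDerivWithinAt)
    (fun s hs => by
      rw [norm_mul, hexp]
      have h1 := hz s hs.1
      have h2 : Real.exp (-l.re * s) * (Z * Real.exp (-a * s)) = Z * Real.exp (κ * s) := by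
        rw [mul_left_comm, ← Real.exp_add]; congr 2; rw [hκ]; ring
      have h3 : Z * Real.exp (κ * s) ≤ Z / a * (Real.exp (κ * s) * κ) := by
        rw [div_mul_eq_mul_div, le_div_iff₀ ha]
        have : Z * Real.exp (κ * s) * a ≤ Z * Real.exp (κ * s) * κ := by gcongr
        linarith
      exact ((mul_le_mul_of_nonneg_left h1 (Real.exp_pos _).le).trans h2.le).trans h3)
    ⟨ht, le_rfl⟩
  rw [norm_mul, hexp] at key
  have h4 : ‖y t‖ = Real.exp (l.re * t) * (Real.exp (-l.re * t) * ‖y t‖) := by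
    rw [← mul_assoc, ← Real.exp_add]; simp
  rw [h4]
  refine (mul_le_mul_of_nonneg_left key (Real.exp_pos _).le).trans ?_
  have hB0 : 0 ≤ B := (norm_nonneg _).trans hB
  have h5 : Real.exp (l.re * t) ≤ Real.exp (-a * t) := by
    rw [Real.exp_le_exp]; nlinarith
  have h6 : Real.exp (l.re * t) * Real.exp (κ * t) = Real.exp (-a * t) := by
    rw [← Real.exp_add]; congr 1; rw [hκ]; ring
  calc Real.exp (l.re * t) * (B + Z / a * Real.exp (κ * t))
      = Real.exp (l.re * t) * B + Z / a * (Real.exp (l.re * t) * Real.exp (κ * t)) := by ring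
    _ ≤ Real.exp (-a * t) * B + Z / a * Real.exp (-a * t) := by rw [h6]; gcongr
    _ = _ := by ring

/-- Exponential decay, uniform with respect to the characteristic roots as long as these are bounded
and stay away from the imaginary axis; they need not be simple. By induction on the number `N` of
roots, since `(d/dt - l) Y` solves the equation with the root `l` removed. -/
lemma exists_decay_bound (A : ℝ) {a : ℝ} (ha : 0 < a) (N : ℕ) : ∀ k : ℕ, ∃ C : ℝ, 0 ≤ C ∧
    ∀ s : Multiset ℂ, Multiset.card s = N → (∀ l ∈ s, l.re ≤ -(2 * a) ∧ ‖l‖ ≤ A) →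
    ∀ Y : ℕ → ℝ → ℂ, IsJet Y →
      polyAct (s.map fun l => Polynomial.X - Polynomial.C l).prod Y = 0 →
      ∀ B : ℝ, 0 ≤ B → (∀ k < N, ‖Y k 0‖ ≤ B) →
      ∀ t, 0 ≤ t → ‖Y k t‖ ≤ C * B * Real.exp (-a * t) := by
  induction N with
  | zero =>
    refine fun k => ⟨0, le_rfl, fun s hs _ Y _ h B _ _ t _ => ?_⟩
    rw [Multiset.card_eq_zero] at hs
    rw [hs, Multiset.map_zero, Multiset.prod_zero, polyAct_one] at h
    simp [h]
  | succ N ih =>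
    intro k
    induction k with
    | zero =>
      obtain ⟨C, hC, hbd⟩ := ih 0
      refine ⟨1 + C * (1 + |A|) / a, by positivity, fun s hs hroots Y hY h B hB hY0 t ht => ?_⟩
      obtain ⟨l, s', rfl⟩ := Multiset.exists_mem_of_ne_zero
        (s := s) (by rintro rfl; simp at hs) |>.imp fun l hl => Multiset.exists_cons_of_mem hl
      rw [Multiset.map_cons, Multiset.prod_cons, mul_comm, polyAct_mul] at h
      have hl := hroots l (Multiset.mem_cons_self _ _)
      have hZ := hbd s' (by simpa using hs) (fun x hx => hroots x (Multiset.mem_cons_of_mem hx)) _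
        (hY.polyAct_isJet _) h ((1 + |A|) * B) (by positivity) (fun j hj => by
          rw [polyAct_X_sub_C]
          refine (norm_sub_le _ _).trans ?_
          rw [norm_mul]
          have h1 := hY0 (j + 1) (by omega)
          have h2 := hY0 j (by omega)
          have h3 := mul_le_mul (hl.2.trans (le_abs_self A)) h2 (norm_nonneg _) (abs_nonneg _)
          linarith)
      have := norm_le_of_first_order (y := Y 0)
        (z := polyAct (Polynomial.X - Polynomial.C l) Y 0) ha hl.1
        (fun s => by
          have := hY 0 s
          rw [polyAct_X_sub_C]
          simpa using this) (hY0 0 (by omega)) hZ ht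
      refine this.trans (le_of_eq ?_)
      ring
    | succ k ihk =>
      obtain ⟨C, hC, hbd⟩ := ih k
      obtain ⟨D, hD, hbd'⟩ := ihk
      refine ⟨C * (1 + |A|) + |A| * D, by positivity, fun s hs hroots Y hY h B hB hY0 t ht => ?_⟩
      have hYk := hbd' s hs hroots Y hY h B hB hY0 t ht
      obtain ⟨l, s', rfl⟩ := Multiset.exists_mem_of_ne_zero
        (s := s) (by rintro rfl; simp at hs) |>.imp fun l hl => Multiset.exists_cons_of_mem hl
      rw [Multiset.map_cons, Multiset.prod_cons, mul_comm, polyAct_mul] at h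
      have hl := hroots l (Multiset.mem_cons_self _ _)
      have hZ := hbd s' (by simpa using hs) (fun x hx => hroots x (Multiset.mem_cons_of_mem hx)) _
        (hY.polyAct_isJet _) h ((1 + |A|) * B) (by positivity) (fun j hj => by
          rw [polyAct_X_sub_C]
          refine (norm_sub_le _ _).trans ?_
          rw [norm_mul]
          have h1 := hY0 (j + 1) (by omega)
          have h2 := hY0 j (by omega)
          have h3 := mul_le_mul (hl.2.trans (le_abs_self A)) h2 (norm_nonneg _) (abs_nonneg _)
          linarith) t ht
      rw [polyAct_X_sub_C] at hZ
      have h4 := norm_add_le (Y (k + 1) t - l * Y k t) (l * Y k t)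
      rw [sub_add_cancel, norm_mul] at h4
      have h5 := mul_le_mul (hl.2.trans (le_abs_self A)) hYk (norm_nonneg _) (abs_nonneg _)
      calc ‖Y (k + 1) t‖ ≤ C * ((1 + |A|) * B) * Real.exp (-a * t) +
            |A| * (D * B * Real.exp (-a * t)) := h4.trans (add_le_add hZ h5)
        _ = _ := by ring

/-- If no characteristic root is close to zero, a derivative of a solution is controlled by the
higher ones. -/
lemma exists_backward_bound_step (A : ℝ) {a : ℝ} (ha : 0 < a) (N : ℕ) : ∃ C : ℝ, 1 ≤ C ∧
    ∀ s : Multiset ℂ, Multiset.card s = N → (∀ l ∈ s, a ≤ ‖l‖ ∧ ‖l‖ ≤ A) →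
    ∀ Y : ℕ → ℝ → ℂ, polyAct (s.map fun l => Polynomial.X - Polynomial.C l).prod Y = 0 →
      ∀ (k₀ : ℕ) (t B : ℝ), 0 ≤ B → (∀ k, k₀ < k → k ≤ k₀ + N → ‖Y k t‖ ≤ B) →
      ‖Y k₀ t‖ ≤ C * B := by
  induction N with
  | zero =>
    refine ⟨1, le_rfl, fun s hs _ Y h k₀ t B hB _ => ?_⟩
    rw [Multiset.card_eq_zero] at hs
    rw [hs, Multiset.map_zero, Multiset.prod_zero, polyAct_one] at h
    simpa [h] using hB
  | succ N ih =>
    obtain ⟨C, hC, hbd⟩ := ih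
    refine ⟨1 + (1 + C * (1 + |A|)) / a, by
      have : 0 ≤ (1 + C * (1 + |A|)) / a := by positivity
      linarith, fun s hs hroots Y h k₀ t B hB hYB => ?_⟩
    obtain ⟨l, s', rfl⟩ := Multiset.exists_mem_of_ne_zero
        (s := s) (by rintro rfl; simp at hs) |>.imp fun l hl => Multiset.exists_cons_of_mem hl
    rw [Multiset.map_cons, Multiset.prod_cons, mul_comm, polyAct_mul] at h
    have hl := hroots l (Multiset.mem_cons_self _ _)
    have hZ := hbd s' (by simpa using hs) (fun x hx => hroots x (Multiset.mem_cons_of_mem hx)) _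
      h k₀ t ((1 + |A|) * B) (by positivity) (fun j hj hj' => by
        rw [polyAct_X_sub_C]
        refine (norm_sub_le _ _).trans ?_
        rw [norm_mul]
        have h1 := hYB (j + 1) (by omega) (by omega)
        have h2 := hYB j hj (by omega)
        have h3 := mul_le_mul (hl.2.trans (le_abs_self A)) h2 (norm_nonneg _) (abs_nonneg _)
        linarith)
    rw [polyAct_X_sub_C] at hZ
    have h1 := hYB (k₀ + 1) (by omega) (by omega)
    have h2 := norm_sub_le (Y (k₀ + 1) t) (Y (k₀ + 1) t - l * Y k₀ t)
    rw [sub_sub_cancel, norm_mul] at h2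
    have h3 : a * ‖Y k₀ t‖ ≤ (1 + C * (1 + |A|)) * B := by
      have := mul_le_mul_of_nonneg_right hl.1 (norm_nonneg (Y k₀ t))
      linarith
    have h4 : ‖Y k₀ t‖ ≤ (1 + C * (1 + |A|)) / a * B := by
      rw [div_mul_eq_mul_div, le_div_iff₀ ha]; linarith
    linarith

/-- Iteration of `exists_backward_bound_step`: the derivatives of the orders `k₀ + i, …, k₀ + i + N`
control that of order `k₀`. -/
lemma exists_backward_bound (A : ℝ) {a : ℝ} (ha : 0 < a) (N i : ℕ) : ∃ C : ℝ, 1 ≤ C ∧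
    ∀ s : Multiset ℂ, Multiset.card s = N → (∀ l ∈ s, a ≤ ‖l‖ ∧ ‖l‖ ≤ A) →
    ∀ Y : ℕ → ℝ → ℂ, polyAct (s.map fun l => Polynomial.X - Polynomial.C l).prod Y = 0 →
      ∀ (k₀ : ℕ) (t B : ℝ), 0 ≤ B → (∀ k, k₀ + i ≤ k → k ≤ k₀ + i + N → ‖Y k t‖ ≤ B) →
      ‖Y k₀ t‖ ≤ C * B := by
  induction i with
  | zero => exact ⟨1, le_rfl, fun s _ _ Y _ k₀ t B _ h => by
      rw [one_mul]; exact h k₀ (by omega) (by omega)⟩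
  | succ i ih =>
    obtain ⟨C, hC, hbd⟩ := ih
    obtain ⟨D, hD, hstep⟩ := exists_backward_bound_step A ha N
    refine ⟨C * D, by nlinarith, fun s hs hroots Y h k₀ t B hB hYB => ?_⟩
    have h1 := hstep s hs hroots Y h (k₀ + i) t B hB fun k hk hk' =>
      hYB k (by omega) (by omega)
    rw [mul_assoc]
    refine hbd s hs hroots Y h k₀ t (D * B) (by positivity) fun k hk hk' => ?_
    rcases hk.eq_or_lt with h2 | h2
    · rw [← h2]; exact h1
    · exact (hYB k (by omega) (by omega)).trans (by nlinarith)

end Jets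

section FrequencyEstimates

variable {n r m : ℕ} {R₀ R₁ R₂ : DiffOp n}

lemma norm_amplitude_le (m : ℕ) (Q : Polynomial ℂ) (v : ℕ → ℂ) (l : ℂ) :
    ‖amplitude m Q v l‖ ≤ ∑ i ∈ Finset.range m,
      (∑ j ∈ Finset.Icc (i + 1) m, ‖l‖ ^ (j - (i + 1)) * ‖Q.coeff j‖) * ‖v i‖ := by
  refine (norm_sum_le _ _).trans (Finset.sum_le_sum fun i _ => ?_)
  rw [norm_mul]
  refine mul_le_mul_of_nonneg_right ((norm_sum_le _ _).trans (Finset.sum_le_sum fun j _ => ?_))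
    (norm_nonneg _)
  rw [norm_mul, norm_pow]

lemma exists_amplitude_bound {m : ℕ} (hm : 1 ≤ m) (A A' : ℝ) :
    ∃ C : ℝ, 0 < C ∧ ∀ (Q : Polynomial ℂ) (l : ℂ),
    (∀ j, ‖Q.coeff j‖ ≤ A) → ‖l‖ ≤ A' → ∀ (v : ℕ → ℂ) (V : ℝ), (∀ i < m, ‖v i‖ ≤ V) →
    ‖amplitude m Q v l‖ ≤ C * V := by
  set S := ∑ i ∈ Finset.range m, ∑ j ∈ Finset.Icc (i + 1) m, |A'| ^ (j - (i + 1)) * |A| with hS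
  refine ⟨S + 1, by positivity, fun Q l hQ hl v V hv => ?_⟩
  have hV : 0 ≤ V := (norm_nonneg _).trans (hv 0 hm)
  have h1 : ‖amplitude m Q v l‖ ≤ S * V := by
    refine (norm_amplitude_le m Q v l).trans ?_
    rw [hS, Finset.sum_mul]
    refine Finset.sum_le_sum fun i hi => ?_
    refine mul_le_mul (Finset.sum_le_sum fun j _ => ?_) (hv i (Finset.mem_range.1 hi))
      (norm_nonneg _) (by positivity)
    exact mul_le_mul (pow_le_pow_left₀ (norm_nonneg _) (hl.trans (le_abs_self _)) _)
      ((hQ j).trans (le_abs_self _)) (norm_nonneg _) (by positivity)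
  linarith

lemma eq_prod_roots_of_monic {F : Polynomial ℂ} (hF : F.Monic) :
    F = (F.roots.map fun l => Polynomial.X - Polynomial.C l).prod ∧
      Multiset.card F.roots = F.natDegree :=
  ⟨(IsAlgClosed.splits F).eq_prod_roots_of_monic hF,
    Polynomial.splits_iff_card_roots.1 (IsAlgClosed.splits _)⟩

namespace DampedSystem

/-- Splitting of the solution at low frequencies: `r + 1` slow modes, whose characteristic roots
`iρ z_b` are perturbations of the `iρ b`, and a remainder which decays exponentially. The remainder
remains bounded even for `k < r`, where the individual slow modes are unbounded as the frequency
tends to zero. -/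
lemma low_decomposition (H : DampedSystem r m R₀ R₁ R₂) : ∃ δ c C₀ : ℝ, 0 < δ ∧ δ ≤ 1 ∧ 0 < c ∧
    0 < C₀ ∧ (∀ ω ∈ Metric.sphere (0 : RSpace n) 1, ∀ b, (symbolAt R₀ ω).IsRoot b →
        c ≤ ‖(symbolAt R₀ ω).derivative.eval b‖ ∧ ‖b‖ ≤ C₀ ∧ b.im = 0 ∧
        ((symbolAt R₁ ω).eval b / (symbolAt R₀ ω).derivative.eval b).re ≤ -c ∧
        ‖(symbolAt R₁ ω).eval b / (symbolAt R₀ ω).derivative.eval b‖ ≤ C₀) ∧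
    ∀ k : ℕ, ∃ C : ℝ, 0 < C ∧ ∀ ω ∈ Metric.sphere (0 : RSpace n) 1, ∀ ρ : ℝ, 0 < ρ → ρ ≤ δ →
      ∃ z : ℂ → ℂ, (∀ b ∈ (symbolAt R₀ ω).roots.toFinset,
        ‖z b - b‖ ≤ C₀ * ρ ∧
        ‖z b - b + Complex.I * ρ *
          ((symbolAt R₁ ω).eval b / (symbolAt R₀ ω).derivative.eval b)‖ ≤ C₀ * ρ ^ 2 ∧
        ‖z b‖ ≤ C₀ ∧ (Complex.I * ρ * z b).re ≤ -(c * ρ ^ 2) ∧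
        c * ρ ^ r ≤ ‖(charPoly (R₀ + R₁ + R₂) (ρ • ω)).derivative.eval (Complex.I * ρ * z b)‖ ∧
        ‖(charPoly (R₀ + R₁ + R₂) (ρ • ω)).derivative.eval (Complex.I * ρ * z b) -
          (Complex.I * ρ) ^ r * (symbolAt R₀ ω).derivative.eval b‖ ≤ C₀ * ρ ^ (r + 1)) ∧
      ∀ Y : ℕ → ℝ → ℂ, IsJet Y → polyAct (charPoly (R₀ + R₁ + R₂) (ρ • ω)) Y = 0 →
      ∀ V : ℝ, (∀ i < m, ‖Y i 0‖ ≤ V) → ∀ t, 0 ≤ t →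
        ∃ S W : ℂ, Y k t = S + W ∧
        S = ∑ b ∈ (symbolAt R₀ ω).roots.toFinset, (Complex.I * ρ * z b) ^ k *
          Complex.exp (Complex.I * ρ * z b * t) *
          (amplitude m (charPoly (R₀ + R₁ + R₂) (ρ • ω)) (fun i => Y i 0) (Complex.I * ρ * z b) /
            (charPoly (R₀ + R₁ + R₂) (ρ • ω)).derivative.eval (Complex.I * ρ * z b)) ∧
        ‖S‖ ≤ C * V * (ρ ^ k / ρ ^ r * Real.exp (-c * ρ ^ 2 * t)) ∧
        ‖W‖ ≤ C * V * Real.exp (-c * t) := by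
  obtain ⟨δ, c, C, hδ, hδ1, hc, hC, hlow⟩ := H.exists_low
  obtain ⟨A, hA, hAb⟩ := H.exists_root_bound 1
  have hrm := H.le_order
  obtain ⟨Ca, hCa, hamp⟩ := exists_amplitude_bound (show 1 ≤ m by omega) A C
  set N := m - (r + 1) with hN
  have ha : 0 < c / 2 := by positivity
  choose D hD hdec using exists_decay_bound C ha N
  choose E hE hback using exists_backward_bound C ha N
  set S : ℕ → ℝ := fun k => (r + 1) * C ^ k * (Ca / c) with hS
  have hS0 : ∀ k, 0 ≤ S k := fun k => by positivity
  obtain ⟨B, hB0, hBS⟩ : ∃ B : ℝ, 0 < B ∧ ∀ i < m, 1 + S i ≤ B := by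
    refine ⟨1 + ∑ i ∈ Finset.range m, S i, ?_, fun i hi => ?_⟩
    · have : 0 ≤ ∑ i ∈ Finset.range m, S i := Finset.sum_nonneg fun i _ => hS0 i
      linarith
    · have := Finset.single_le_sum (f := S) (fun i _ => hS0 i) (Finset.mem_range.2 hi)
      linarith
  refine ⟨δ, c / 2, C, hδ, hδ1, ha, hC, fun ω hω b hb => ?_, fun k => ?_⟩
  · obtain ⟨h1, h2, h3, h4, h5⟩ := (hlow ω hω).1 b hb
    exact ⟨by linarith, h2, h3, by linarith, h5⟩
  obtain ⟨D', hD'0, hDk, hDN⟩ : ∃ D' : ℝ, 0 ≤ D' ∧ D (k - r) ≤ D' ∧ ∀ i < N + 1, D i ≤ D' := by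
    have h1 := Finset.sum_nonneg (s := Finset.range (N + 1)) fun j _ => hD j
    refine ⟨D (k - r) + ∑ j ∈ Finset.range (N + 1), D j, add_nonneg (hD _) h1, by linarith,
      fun i hi => ?_⟩
    have h3 := Finset.single_le_sum (f := D) (fun i _ => hD i) (Finset.mem_range.2 hi)
    have := hD (k - r)
    linarith
  have hEr : 0 ≤ E (r - k) := by linarith [hE (r - k)]
  refine ⟨S k + 1 + E (r - k) * (D' * B) + D' * B, ?_, ?_⟩
  · have := hS0 k; positivity
  intro ω hω ρ hρ hρδ
  obtain ⟨z, F, hinj, hF, hdeg, hQF, hFroots, hz⟩ := (hlow ω hω).2 ρ hρ hρδ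
  refine ⟨z, fun b hb => ?_, ?_⟩
  · obtain ⟨h1, h2, h3, h4, h5, h6⟩ := hz b hb
    have g1 : 0 ≤ c * ρ ^ 2 := by positivity
    have g2 : 0 ≤ c * ρ ^ r := by positivity
    exact ⟨h1, h2, h3, by linarith, by linarith, h6⟩
  intro Y hY hQY V hV t ht
  have hV0 : 0 ≤ V := (norm_nonneg _).trans (hV 0 (by omega))
  have hρ1 : ρ ≤ 1 := hρδ.trans hδ1
  have hnorm : ‖ρ • ω‖ ≤ 1 := by
    rw [norm_smul, mem_sphere_zero_iff_norm.1 hω, mul_one, Real.norm_of_nonneg hρ.le]; exact hρ1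
  set Q := charPoly (R₀ + R₁ + R₂) (ρ • ω) with hQ
  set Λ := (symbolAt R₀ ω).roots.toFinset.image (fun b => Complex.I * ρ * z b) with hΛ
  have hIρ : Complex.I * (ρ : ℂ) ≠ 0 :=
    mul_ne_zero Complex.I_ne_zero (by exact_mod_cast hρ.ne')
  have hcard : Λ.card = r + 1 := by
    rw [hΛ, Finset.card_image_of_injOn, H.hyp₀.card_roots hω]
    intro b hb b' hb' h
    exact hinj hb hb' (mul_left_cancel₀ hIρ h)
  have hl : ∀ l ∈ Λ, ‖l‖ ≤ C * ρ ∧ l.re ≤ -(c * ρ ^ 2) ∧ c * ρ ^ r ≤ ‖Q.derivative.eval l‖ := by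
    intro l hl
    obtain ⟨b, hb, rfl⟩ := Finset.mem_image.1 hl
    obtain ⟨-, -, h3, h4, h5, -⟩ := hz b hb
    refine ⟨?_, h4, h5⟩
    rw [norm_mul, norm_mul, Complex.norm_I, one_mul, Complex.norm_real, Real.norm_of_nonneg hρ.le,
      mul_comm]
    gcongr
  have hρr : 0 < ρ ^ r := by positivity
  have hd : ∀ l ∈ Λ, Q.derivative.eval l ≠ 0 := fun l hl' h0 => by
    have := (hl l hl').2.2
    rw [h0, norm_zero] at this
    have : 0 < c * ρ ^ r := by positivity
    linarith
  obtain ⟨W, hW, hFW, hYW⟩ := hY.partialFractions (Finset.card_pos.1 (by omega)) (by omega)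
    (H.natDegree_charPoly (ρ • ω)) hQF hd hQY
  have hslow : ∀ (k : ℕ) (s : ℝ), 0 ≤ s → ‖∑ l ∈ Λ, l ^ k * Complex.exp (l * s) *
      (amplitude m Q (fun i => Y i 0) l / Q.derivative.eval l)‖ ≤
      S k * V * (ρ ^ k / ρ ^ r * Real.exp (-(c / 2) * ρ ^ 2 * s)) := by
    intro k s hs
    have h1 : ∀ l ∈ Λ, ‖l ^ k * Complex.exp (l * s) *
      (amplitude m Q (fun i => Y i 0) l / Q.derivative.eval l)‖ ≤
        (C * ρ) ^ k * Real.exp (-(c / 2) * ρ ^ 2 * s) * (Ca * V / (c * ρ ^ r)) := by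
      intro l hl'
      obtain ⟨g1, g2, g3⟩ := hl l hl'
      rw [norm_mul, norm_mul, norm_pow, norm_div, Complex.norm_exp]
      gcongr
      · rw [Complex.re_mul_ofReal]
        have : 0 ≤ c * ρ ^ 2 * s := by positivity
        nlinarith
      · exact hamp Q l (hAb _ hnorm).1.2 (g1.trans (by nlinarith)) _ V hV
    refine (norm_sum_le _ _).trans ((Finset.sum_le_sum h1).trans (le_of_eq ?_))
    rw [Finset.sum_const, hcard, hS, nsmul_eq_mul, mul_pow]
    push_cast
    field_simp
  -- For `i ≥ r` the slow modes are bounded at time zero, hence so is the remainder. Its derivatives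
  -- of order at least `r` are then estimated forward in time, and those of lower order are
  -- recovered from the equation `F(d/dt) W = 0`, the roots of `F` being away from zero.
  have hW0 : ∀ i, r ≤ i → i < m → ‖W i 0‖ ≤ B * V := by
    intro i hri him
    have h1 := hslow i 0 le_rfl
    have h2 : W i 0 = Y i 0 - ∑ l ∈ Λ, l ^ i * Complex.exp (l * (0 : ℝ)) *
      (amplitude m Q (fun i => Y i 0) l / Q.derivative.eval l) := by rw [hYW i 0]; ring
    rw [h2]
    refine (norm_sub_le _ _).trans ?_
    have h3 : ρ ^ i / ρ ^ r ≤ 1 := by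
      rw [div_le_one hρr]; exact pow_le_pow_of_le_one hρ.le hρ1 hri
    rw [mul_zero, Real.exp_zero, mul_one] at h1
    have h4 : S i * V * (ρ ^ i / ρ ^ r) ≤ S i * V :=
      mul_le_of_le_one_right (mul_nonneg (hS0 i) hV0) h3
    have h6 := hV i him
    have h7 := mul_le_mul_of_nonneg_right (hBS i him) hV0
    linarith
  obtain ⟨hFp, hFc⟩ := eq_prod_roots_of_monic hF
  have hFN : Multiset.card F.roots = N := by rw [hFc]; omega
  have hFr : ∀ l ∈ F.roots, l.re ≤ -(2 * (c / 2)) ∧ ‖l‖ ≤ C := fun l hl => by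
    have := hFroots l (Polynomial.isRoot_of_mem_roots hl)
    exact ⟨by linarith, this.2⟩
  have hFr' : ∀ l ∈ F.roots, c / 2 ≤ ‖l‖ ∧ ‖l‖ ≤ C := fun l hl => by
    obtain ⟨h1, h2⟩ := hFr l hl
    have := (abs_le.1 (Complex.abs_re_le_norm l)).1
    exact ⟨by linarith, h2⟩
  rw [hFp] at hFW
  set e := Real.exp (-(c / 2) * t) with he
  have he0 : 0 < e := Real.exp_pos _
  have hfwd : ∀ j, ‖W (r + j) t‖ ≤ D j * (B * V) * e := fun j =>
    hdec j F.roots hFN hFr _ (hW.shift r) (polyAct_shift_eq_zero hFW r) (B * V) (by positivity)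
      (fun i hi => hW0 (r + i) (by omega) (by omega)) t ht
  have hWk : ‖W k t‖ ≤ (E (r - k) * (D' * B) + D' * B) * V * e := by
    rcases le_or_gt r k with hrk | hrk
    · have h1 := hfwd (k - r)
      rw [Nat.add_sub_cancel' hrk] at h1
      refine h1.trans ?_
      have h3 : D (k - r) * (B * V) * e ≤ D' * (B * V) * e := by gcongr
      have h4 : 0 ≤ E (r - k) * (D' * B) * V * e := by positivity
      linarith
    · have h1 := hback (r - k) F.roots hFN hFr' W hFW k t (D' * (B * V) * e) (by positivity)
        fun j hj hj' => by
          obtain ⟨i, rfl⟩ : ∃ i, j = r + i := ⟨j - r, by omega⟩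
          refine (hfwd i).trans ?_
          have h2 : D i ≤ D' := hDN i (by omega)
          gcongr
      refine h1.trans ?_
      have h4 : 0 ≤ D' * B * V * e := by positivity
      linarith
  refine ⟨_, _, hYW k t, ?_, (hslow k t ht).trans ?_, hWk.trans ?_⟩
  · rw [hΛ, Finset.sum_image]
    intro b hb b' hb' h
    exact hinj hb hb' (mul_left_cancel₀ hIρ h)
  · have g2 : 0 ≤ E (r - k) * (D' * B) + D' * B := by positivity
    gcongr; linarith
  · gcongr; linarith [hS0 k]

/-- Size of the solution at low frequencies. -/
lemma low_estimate (H : DampedSystem r m R₀ R₁ R₂) : ∃ δ c : ℝ, 0 < δ ∧ δ ≤ 1 ∧ 0 < c ∧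
    ∀ k : ℕ, ∃ C : ℝ, 0 < C ∧ ∀ ω ∈ Metric.sphere (0 : RSpace n) 1, ∀ ρ : ℝ, 0 < ρ → ρ ≤ δ →
      ∀ Y : ℕ → ℝ → ℂ, IsJet Y → polyAct (charPoly (R₀ + R₁ + R₂) (ρ • ω)) Y = 0 →
      ∀ V : ℝ, (∀ i < m, ‖Y i 0‖ ≤ V) → ∀ t, 0 ≤ t →
        ‖Y k t‖ ≤ C * V * (ρ ^ k / ρ ^ r * Real.exp (-c * ρ ^ 2 * t) + Real.exp (-c * t)) := by
  obtain ⟨δ, c, C₀, hδ, hδ1, hc, hC₀, -, hdec⟩ := H.low_decomposition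
  refine ⟨δ, c, hδ, hδ1, hc, fun k => ?_⟩
  obtain ⟨C, hC, hk⟩ := hdec k
  refine ⟨C, hC, fun ω hω ρ hρ hρδ Y hY hQY V hV t ht => ?_⟩
  obtain ⟨z, -, hz⟩ := hk ω hω ρ hρ hρδ
  obtain ⟨S, W, hSW, -, hS, hW⟩ := hz Y hY hQY V hV t ht
  rw [hSW, mul_add]
  exact (norm_add_le _ _).trans (add_le_add hS hW)

/-- Exponential decay at intermediate frequencies, where there may be multiple characteristic
roots. -/
lemma mid_estimate (H : DampedSystem r m R₀ R₁ R₂) {δ : ℝ} (hδ : 0 < δ) (R : ℝ) :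
    ∃ c : ℝ, 0 < c ∧ ∀ k : ℕ, ∃ C : ℝ, 0 ≤ C ∧ ∀ ξ : RSpace n, δ ≤ ‖ξ‖ → ‖ξ‖ ≤ R →
      ∀ Y : ℕ → ℝ → ℂ, IsJet Y → polyAct (charPoly (R₀ + R₁ + R₂) ξ) Y = 0 →
      ∀ V : ℝ, (∀ i < m, ‖Y i 0‖ ≤ V) → ∀ t, 0 ≤ t → ‖Y k t‖ ≤ C * V * Real.exp (-c * t) := by
  obtain ⟨c, hc, hroots⟩ := H.exists_re_root_le_of_mid hδ R
  obtain ⟨A, -, hA⟩ := H.exists_root_bound R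
  have hrm := H.le_order
  refine ⟨c / 2, by positivity, fun k => ?_⟩
  obtain ⟨C, hC, hdec⟩ := exists_decay_bound A (half_pos hc) m k
  refine ⟨C, hC, fun ξ h1 h2 Y hY hQY V hV t ht => ?_⟩
  obtain ⟨hQp, hQc⟩ := eq_prod_roots_of_monic (H.monic_charPoly ξ)
  rw [hQp] at hQY
  refine hdec _ (by rw [hQc, H.natDegree_charPoly]) (fun l hl => ?_) Y hY hQY V
    ((norm_nonneg _).trans (hV 0 (by omega))) hV t ht
  have hl' := Polynomial.isRoot_of_mem_roots hl
  exact ⟨by linarith [hroots ξ h1 h2 l hl'], (hA ξ h2).2 l hl'⟩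

/-- Exponential decay at high frequencies. All characteristic roots are simple and of size `|ξ|`, which
is why the derivatives of order `k` of the solution and of order `i` of the data are weighted by
`|ξ|^k` and `|ξ|^{-i}`. -/
lemma high_estimate (H : DampedSystem r m R₀ R₁ R₂) : ∃ R c : ℝ, 1 ≤ R ∧ 0 < c ∧
    ∀ k : ℕ, ∃ C : ℝ, 0 < C ∧ ∀ ξ : RSpace n, R ≤ ‖ξ‖ → ∀ Y : ℕ → ℝ → ℂ, IsJet Y →
      polyAct (charPoly (R₀ + R₁ + R₂) ξ) Y = 0 → ∀ t, 0 ≤ t →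
        ‖Y k t‖ ≤ C * Real.exp (-c * t) *
          ∑ i ∈ Finset.range m, ‖ξ‖ ^ k / ‖ξ‖ ^ i * ‖Y i 0‖ := by
  obtain ⟨R, c, C, hR, hc, hC, hhigh⟩ := H.exists_high
  have hrm := H.le_order
  set S : ℝ := ∑ j ∈ Finset.range (m + 1), (C + 1) ^ (m + 1) with hS
  have hS0 : 0 < S := Finset.sum_pos (fun _ _ => by positivity) ⟨0, by simp⟩
  have hm0 : (0 : ℝ) < m := by exact_mod_cast (show 0 < m by omega)
  clear_value S
  refine ⟨R, c, hR, hc, fun k => ⟨m * C ^ k * (S / c), by positivity, ?_⟩⟩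
  intro ξ hξ Y hY hQY t ht
  obtain ⟨hcoef, Λ, hQ, hcard, hΛ⟩ := hhigh ξ hξ
  set ρ := ‖ξ‖ with hρ
  have hρ1 : 1 ≤ ρ := hR.trans hξ
  have hρ0 : 0 < ρ := by linarith
  set Q := charPoly (R₀ + R₁ + R₂) ξ with hQdef
  have hd : ∀ l ∈ Λ, Q.derivative.eval l ≠ 0 := fun l hl h0 => by
    have := (hΛ l hl).2.2
    rw [h0, norm_zero] at this
    have : 0 < c * ρ ^ (m - 1) := by positivity
    linarith
  have hQ1 : Q = (∏ l ∈ Λ, (Polynomial.X - Polynomial.C l)) * 1 := by rw [mul_one]; exact hQ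
  obtain ⟨W, -, hW, hYW⟩ := hY.partialFractions (Finset.card_pos.1 (by omega)) (by omega)
    (H.natDegree_charPoly ξ) hQ1 hd hQY
  rw [polyAct_one] at hW
  rw [hYW k t, hW]
  simp only [Pi.zero_apply, add_zero]
  have hterm : ∀ l ∈ Λ, ‖l ^ k * Complex.exp (l * t) *
      (amplitude m Q (fun i => Y i 0) l / Q.derivative.eval l)‖ ≤
      C ^ k * Real.exp (-c * t) * (S / c) * ∑ i ∈ Finset.range m, ρ ^ k / ρ ^ i * ‖Y i 0‖ := by
    intro l hl
    obtain ⟨g1, g2, g3⟩ := hΛ l hl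
    have hA : ‖amplitude m Q (fun i => Y i 0) l‖ ≤
        ∑ i ∈ Finset.range m, S * ρ ^ (m - 1 - i) * ‖Y i 0‖ := by
      refine (norm_amplitude_le m Q _ l).trans (Finset.sum_le_sum fun i hi => ?_)
      rw [Finset.mem_range] at hi
      refine mul_le_mul_of_nonneg_right ?_ (norm_nonneg _)
      rw [hS, Finset.sum_mul]
      refine (Finset.sum_le_sum (g := fun j => (C + 1) ^ (m + 1) * ρ ^ (m - 1 - i))
        fun j hj => ?_).trans (Finset.sum_le_sum_of_subset_of_nonneg (fun j hj => ?_)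
          fun j _ _ => by positivity)
      · rw [Finset.mem_Icc] at hj
        calc ‖l‖ ^ (j - (i + 1)) * ‖Q.coeff j‖
            ≤ (C * ρ) ^ (j - (i + 1)) * (C * ρ ^ (m - j)) := by
              gcongr
              exact hcoef j hj.2
          _ = C ^ (j - (i + 1) + 1) * ρ ^ (j - (i + 1) + (m - j)) := by
              rw [mul_pow, pow_add, pow_add]; ring
          _ ≤ (C + 1) ^ (m + 1) * ρ ^ (m - 1 - i) := by
              have e1 : j - (i + 1) + (m - j) = m - 1 - i := by omega
              rw [e1]
              refine mul_le_mul_of_nonneg_right ?_ (by positivity)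
              exact (pow_le_pow_left₀ hC.le (by linarith) _).trans
                (pow_le_pow_right₀ (by linarith) (by omega))
      · rw [Finset.mem_Icc] at hj
        exact Finset.mem_range.2 (by omega)
    rw [norm_mul, norm_mul, norm_pow, norm_div, Complex.norm_exp]
    calc ‖l‖ ^ k * Real.exp (l * t).re *
          (‖amplitude m Q (fun i => Y i 0) l‖ / ‖Q.derivative.eval l‖)
        ≤ (C * ρ) ^ k * Real.exp (-c * t) *
          ((∑ i ∈ Finset.range m, S * ρ ^ (m - 1 - i) * ‖Y i 0‖) / (c * ρ ^ (m - 1))) := by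
          gcongr
          rw [Complex.re_mul_ofReal]
          nlinarith
      _ = _ := by
          rw [Finset.sum_div, Finset.mul_sum, Finset.mul_sum]
          refine Finset.sum_congr rfl fun i hi => ?_
          rw [Finset.mem_range] at hi
          have e1 : ρ ^ (m - 1) = ρ ^ (m - 1 - i) * ρ ^ i := by
            rw [← pow_add]; congr 1; omega
          rw [e1, mul_pow]
          field_simp
  refine (norm_sum_le _ _).trans ((Finset.sum_le_sum hterm).trans (le_of_eq ?_))
  rw [Finset.sum_const, hcard, nsmul_eq_mul]
  ring

/-- Exponential decay away from the zero frequency, without loss of derivatives. -/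
lemma outer_estimate (H : DampedSystem r m R₀ R₁ R₂) {δ : ℝ} (hδ : 0 < δ) :
    ∃ c : ℝ, 0 < c ∧
    ∀ k : ℕ, ∃ C : ℝ, 0 < C ∧ ∀ ξ : RSpace n, δ ≤ ‖ξ‖ → ∀ Y : ℕ → ℝ → ℂ, IsJet Y →
      polyAct (charPoly (R₀ + R₁ + R₂) ξ) Y = 0 → ∀ t, 0 ≤ t →
        ‖Y k t‖ ≤ C * Real.exp (-c * t) *
          ∑ i ∈ Finset.range m, ‖ξ‖ ^ k / ‖ξ‖ ^ i * ‖Y i 0‖ := by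
  obtain ⟨R, c₁, hR, hc₁, hhigh⟩ := H.high_estimate
  obtain ⟨c₂, hc₂, hmid⟩ := H.mid_estimate hδ R
  refine ⟨min c₁ c₂, by positivity, fun k => ?_⟩
  obtain ⟨C₁, hC₁, h1⟩ := hhigh k
  obtain ⟨C₂, hC₂, h2⟩ := hmid k
  refine ⟨C₁ + C₂ * (R ^ m / δ ^ k), by positivity, fun ξ hξ Y hY hQY t ht => ?_⟩
  have hξ0 : 0 < ‖ξ‖ := by linarith
  set T := ∑ i ∈ Finset.range m, ‖ξ‖ ^ k / ‖ξ‖ ^ i * ‖Y i 0‖ with hT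
  have hT0 : 0 ≤ T := by positivity
  rcases le_or_gt R ‖ξ‖ with hRξ | hRξ
  · refine (h1 ξ hRξ Y hY hQY t ht).trans ?_
    rw [← hT]
    have e1 : Real.exp (-c₁ * t) ≤ Real.exp (-min c₁ c₂ * t) := by
      rw [Real.exp_le_exp]; nlinarith [min_le_left c₁ c₂]
    have e2 : C₁ ≤ C₁ + C₂ * (R ^ m / δ ^ k) := by
      have : 0 ≤ C₂ * (R ^ m / δ ^ k) := by positivity
      linarith
    gcongr
  · have hV : ∀ i < m, ‖Y i 0‖ ≤ R ^ m / δ ^ k * T := by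
      intro i hi
      have e1 := Finset.single_le_sum (f := fun i => ‖ξ‖ ^ k / ‖ξ‖ ^ i * ‖Y i 0‖)
        (fun i _ => by positivity) (Finset.mem_range.2 hi)
      have e2 : δ ^ k / R ^ m * ‖Y i 0‖ ≤ T := by
        refine le_trans ?_ e1
        have e3 : ‖ξ‖ ^ i ≤ R ^ m := (pow_le_pow_left₀ hξ0.le hRξ.le i).trans
          (pow_le_pow_right₀ hR hi.le)
        gcongr
      have e4 : ‖Y i 0‖ = R ^ m / δ ^ k * (δ ^ k / R ^ m * ‖Y i 0‖) := by
        have : 0 < R := by linarith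
        field_simp
      rw [e4]
      have : 0 < R := by linarith
      gcongr
    refine (h2 ξ hξ hRξ.le Y hY hQY _ hV t ht).trans ?_
    have e1 : Real.exp (-c₂ * t) ≤ Real.exp (-min c₁ c₂ * t) := by
      rw [Real.exp_le_exp]; nlinarith [min_le_right c₁ c₂]
    calc C₂ * (R ^ m / δ ^ k * T) * Real.exp (-c₂ * t)
        ≤ C₂ * (R ^ m / δ ^ k * T) * Real.exp (-min c₁ c₂ * t) := by gcongr
      _ = (C₂ * (R ^ m / δ ^ k)) * Real.exp (-min c₁ c₂ * t) * T := by ring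
      _ ≤ _ := by gcongr; linarith

end DampedSystem

end FrequencyEstimates

/-! ### The limit of the solution in diffusive variables -/

/-- The sum
`∑_b (i b + a q_b)^k exp(i b θ + ν q_b) / (i^r p'(b))`, with `q_b = P(b) / p'(b)`, over the roots `b`
of `p`. The profile and its limit in diffusive variables are both of this form. -/
noncomputable def modeSum (r k : ℕ) (p P : Polynomial ℂ) (a θ ν : ℝ) : ℂ :=
  ∑ b ∈ p.roots.toFinset,
    (Complex.I * b + a * (P.eval b / p.derivative.eval b)) ^ k *
      Complex.exp (Complex.I * b * θ + ν * (P.eval b / p.derivative.eval b)) /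
      (Complex.I ^ r * p.derivative.eval b)

section LimitTheorem

variable {n r m : ℕ} {R₀ R₁ R₂ : DiffOp n}

lemma tendsto_amplitude {ι : Type*} {f : Filter ι} {m : ℕ} {Q : ι → Polynomial ℂ}
    {Q₀ : Polynomial ℂ} {v : ι → ℕ → ℂ} {v₀ : ℕ → ℂ} {l : ι → ℂ}
    (hQ : ∀ j, Tendsto (fun t => (Q t).coeff j) f (𝓝 (Q₀.coeff j)))
    (hv : ∀ i < m, Tendsto (fun t => v t i) f (𝓝 (v₀ i))) (hl : Tendsto l f (𝓝 0)) :
    Tendsto (fun t => amplitude m (Q t) (v t) (l t)) f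
      (𝓝 (∑ i ∈ Finset.range m, Q₀.coeff (i + 1) * v₀ i)) := by
  refine tendsto_finsetSum _ fun i hi => ?_
  have him := Finset.mem_range.1 hi
  refine Tendsto.mul ?_ (hv i him)
  have h1 : Tendsto (fun t => ∑ j ∈ Finset.Icc (i + 1) m, l t ^ (j - (i + 1)) * (Q t).coeff j) f
      (𝓝 (∑ j ∈ Finset.Icc (i + 1) m, (0 : ℂ) ^ (j - (i + 1)) * Q₀.coeff j)) :=
    tendsto_finsetSum _ fun j _ => (hl.pow _).mul (hQ j)
  convert! h1 using 2
  rw [Finset.sum_eq_single (i + 1)]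
  · simp
  · intro j hj hne
    have := (Finset.mem_Icc.1 hj).1
    rw [zero_pow (by omega), zero_mul]
  · intro h
    exact absurd (Finset.mem_Icc.2 ⟨le_rfl, him⟩) h

lemma tendsto_mul_sub_mul {ι : Type*} {f : Filter ι} {X E E' : ι → ℂ} {x : ℂ}
    (hX : Tendsto X f (𝓝 x)) (hE : ∀ᶠ t in f, ‖E t‖ ≤ 1)
    (hEE : Tendsto (fun t => E t - E' t) f (𝓝 0)) :
    Tendsto (fun t => X t * E t - x * E' t) f (𝓝 0) := by
  have h1 : Tendsto (fun t => (X t - x) * E t) f (𝓝 0) := by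
    have h2 : Tendsto (fun t => X t - x) f (𝓝 0) := by simpa using hX.sub_const x
    refine squeeze_zero_norm' ?_ (tendsto_zero_iff_norm_tendsto_zero.1 h2)
    filter_upwards [hE] with t ht
    rw [norm_mul]
    exact mul_le_of_le_one_right (norm_nonneg _) ht
  have h3 := h1.add (hEE.const_mul x)
  rw [mul_zero, add_zero] at h3
  exact h3.congr fun t => by ring

lemma tendsto_exp_sub_exp {ι : Type*} {f : Filter ι} {a b : ι → ℂ} (hb : ∀ t, (b t).re ≤ 0)
    (hab : Tendsto (fun t => a t - b t) f (𝓝 0)) :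
    Tendsto (fun t => Complex.exp (a t) - Complex.exp (b t)) f (𝓝 0) := by
  have h1 : Tendsto (fun t => Complex.exp (a t - b t) - 1) f (𝓝 0) := by
    have := (Complex.continuous_exp.tendsto 0).comp hab
    simpa using this.sub_const 1
  refine squeeze_zero_norm (fun t => ?_) (tendsto_zero_iff_norm_tendsto_zero.1 h1)
  have h2 : Complex.exp (a t) - Complex.exp (b t) =
      Complex.exp (b t) * (Complex.exp (a t - b t) - 1) := by
    rw [mul_sub, ← Complex.exp_add]; simp
  rw [h2, norm_mul]
  refine mul_le_of_le_one_left (norm_nonneg _) ?_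
  rw [Complex.norm_exp, Real.exp_le_one_iff]
  exact hb t

lemma tendsto_div_sqrt_atTop (σ : ℝ) : Tendsto (fun t : ℝ => σ / √t) atTop (𝓝 0) :=
  Real.tendsto_sqrt_atTop.const_div_atTop σ

namespace DampedSystem

/-- In the variable `ξ = σ ω / √t` the solution is asymptotic to the sum over the slow modes. -/
lemma tendsto_diffusive (H : DampedSystem r m R₀ R₁ R₂) {ω : RSpace n}
    (hω : ω ∈ Metric.sphere (0 : RSpace n) 1) {σ : ℝ} (hσ : 0 < σ) (k : ℕ)
    {Y : ℝ → ℕ → ℝ → ℂ} (hY : ∀ t, IsJet (Y t))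
    (hQY : ∀ t, polyAct (charPoly (R₀ + R₁ + R₂) ((σ / √t) • ω)) (Y t) = 0) {v : ℕ → ℂ}
    (hv : ∀ i < m, Tendsto (fun t => Y t i 0) atTop (𝓝 (v i))) :
    Tendsto (fun t : ℝ => (((σ / √t) ^ r / (σ / √t) ^ k : ℝ) : ℂ) * Y t k t -
      (∑ i ∈ Finset.range m, (charPoly (R₀ + R₁ + R₂) 0).coeff (i + 1) * v i) *
        modeSum r k (symbolAt R₀ ω) (symbolAt R₁ ω) 0 (σ * √t) (σ ^ 2)) atTop (𝓝 0) := by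
  obtain ⟨δ, c, C₀, hδ, hδ1, hc, hC₀, hroot, hdec⟩ := H.low_decomposition
  obtain ⟨C, hC, hk⟩ := hdec k
  choose! z hz hYdec using hk ω hω
  have hroot := hroot ω hω
  set ρ : ℝ → ℝ := fun t => σ / √t with hρdef
  have hρlim : Tendsto ρ atTop (𝓝 0) := tendsto_div_sqrt_atTop σ
  have hev : ∀ᶠ t in atTop, 1 ≤ t ∧ 0 < ρ t ∧ ρ t ≤ δ := by
    filter_upwards [eventually_ge_atTop (1 : ℝ), hρlim.eventually (gt_mem_nhds hδ)] with t h1 h2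
    exact ⟨h1, div_pos hσ (Real.sqrt_pos.2 (by linarith)), h2.le⟩
  set V : ℝ := ∑ i ∈ Finset.range m, (‖v i‖ + 1) with hV
  have hVev : ∀ᶠ t in atTop, ∀ i < m, ‖Y t i 0‖ ≤ V := by
    have : ∀ i ∈ Finset.range m, ∀ᶠ t in atTop, ‖Y t i 0‖ ≤ V := by
      intro i hi
      filter_upwards [(hv i (Finset.mem_range.1 hi)).norm.eventually
        (gt_mem_nhds (lt_add_one ‖v i‖))] with t ht
      exact ht.le.trans (Finset.single_le_sum (f := fun i => ‖v i‖ + 1)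
        (fun i _ => by positivity) hi)
    filter_upwards [(eventually_all_finset _).2 this] with t ht i hi
    exact ht i (Finset.mem_range.2 hi)
  set Q : ℝ → Polynomial ℂ := fun t => charPoly (R₀ + R₁ + R₂) (ρ t • ω) with hQ
  set M : ℂ := ∑ i ∈ Finset.range m, (charPoly (R₀ + R₁ + R₂) 0).coeff (i + 1) * v i with hM
  -- The contribution of the mode `b` to the rescaled solution, and the expression it is compared
  -- with.
  set T : ℂ → ℝ → ℂ := fun b t => (((ρ t) ^ r / (ρ t) ^ k : ℝ) : ℂ) *
    ((Complex.I * ρ t * z (ρ t) b) ^ k * Complex.exp (Complex.I * ρ t * z (ρ t) b * t) *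
          (amplitude m (Q t) (fun i => Y t i 0) (Complex.I * ρ t * z (ρ t) b) /
            (Q t).derivative.eval (Complex.I * ρ t * z (ρ t) b))) with hT
  set T' : ℂ → ℝ → ℂ := fun b t => M *
    ((Complex.I * b + (0 : ℝ) * ((symbolAt R₁ ω).eval b / (symbolAt R₀ ω).derivative.eval b)) ^ k *
      Complex.exp (Complex.I * b * (σ * √t : ℝ) +
        (σ ^ 2 : ℝ) * ((symbolAt R₁ ω).eval b / (symbolAt R₀ ω).derivative.eval b)) /
      (Complex.I ^ r * (symbolAt R₀ ω).derivative.eval b)) with hT'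
  have hmode : ∀ b ∈ (symbolAt R₀ ω).roots.toFinset,
      Tendsto (fun t => T b t - T' b t) atTop (𝓝 0) := by
    intro b hb
    obtain ⟨hc1, hb1, him, hre, hq1⟩ := hroot b (H.hyp₀.mem_roots.1 hb)
    set d := (symbolAt R₀ ω).derivative.eval b with hd
    set q := (symbolAt R₁ ω).eval b / d with hq
    have hd0 : d ≠ 0 := norm_pos_iff.1 (hc.trans_le hc1)
    have hρC : Tendsto (fun t => (ρ t : ℂ)) atTop (𝓝 0) := by
      simpa [Function.comp_def] using (Complex.continuous_ofReal.tendsto 0).comp hρlim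
    have hzlim : Tendsto (fun t => z (ρ t) b) atTop (𝓝 b) := by
      rw [tendsto_iff_norm_sub_tendsto_zero]
      refine squeeze_zero' (Eventually.of_forall fun t => norm_nonneg _) ?_
        (by simpa using hρlim.const_mul C₀)
      filter_upwards [hev] with t ht
      exact (hz (ρ t) ht.2.1 ht.2.2 b hb).1
    have hllim : Tendsto (fun t => Complex.I * ρ t * z (ρ t) b) atTop (𝓝 0) := by
      simpa using (hρC.const_mul Complex.I).mul hzlim
    -- As the characteristic root tends to zero, only the terms `j = i + 1` of the amplitude remain.
    have hamp : Tendsto (fun t => amplitude m (Q t) (fun i => Y t i 0)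
        (Complex.I * ρ t * z (ρ t) b)) atTop (𝓝 M) := by
      refine tendsto_amplitude (fun j => ?_) hv hllim
      have h1 : Tendsto (fun t => ρ t • ω) atTop (𝓝 0) := by
        simpa using hρlim.smul_const ω
      exact ((continuous_coeff_charPoly _ j).tendsto 0).comp h1
    have hder : Tendsto (fun t => (Q t).derivative.eval (Complex.I * ρ t * z (ρ t) b) /
        (ρ t : ℂ) ^ r) atTop (𝓝 (Complex.I ^ r * d)) := by
      rw [tendsto_iff_norm_sub_tendsto_zero]
      refine squeeze_zero' (Eventually.of_forall fun t => norm_nonneg _) ?_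
        (by simpa using hρlim.const_mul C₀)
      filter_upwards [hev] with t ht
      have h6 := (hz (ρ t) ht.2.1 ht.2.2 b hb).2.2.2.2.2
      have hρ0 : (ρ t : ℂ) ≠ 0 := by exact_mod_cast ht.2.1.ne'
      have e1 : (Q t).derivative.eval (Complex.I * ρ t * z (ρ t) b) / (ρ t : ℂ) ^ r -
          Complex.I ^ r * d = ((Q t).derivative.eval (Complex.I * ρ t * z (ρ t) b) -
            (Complex.I * ρ t) ^ r * d) / (ρ t : ℂ) ^ r := by
        rw [mul_pow]; field_simp
      rw [e1, norm_div, norm_pow, Complex.norm_real, Real.norm_of_nonneg ht.2.1.le,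
        div_le_iff₀ (pow_pos ht.2.1 r)]
      refine h6.trans (le_of_eq ?_)
      ring
    have hI : Complex.I ^ r * d ≠ 0 := mul_ne_zero (pow_ne_zero _ Complex.I_ne_zero) hd0
    have hX : Tendsto (fun t => (Complex.I * z (ρ t) b) ^ k *
        (amplitude m (Q t) (fun i => Y t i 0) (Complex.I * ρ t * z (ρ t) b) /
          ((Q t).derivative.eval (Complex.I * ρ t * z (ρ t) b) / (ρ t : ℂ) ^ r))) atTop
        (𝓝 ((Complex.I * b) ^ k * (M / (Complex.I ^ r * d)))) :=
      ((hzlim.const_mul _).pow k).mul (hamp.div hder hI)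
    have hE : ∀ᶠ t : ℝ in atTop, ‖Complex.exp (Complex.I * ρ t * z (ρ t) b * t)‖ ≤ 1 := by
      filter_upwards [hev] with t ht
      have h4 := (hz (ρ t) ht.2.1 ht.2.2 b hb).2.2.2.1
      rw [Complex.norm_exp, Real.exp_le_one_iff, Complex.re_mul_ofReal]
      have : 0 ≤ c * ρ t ^ 2 := by positivity
      exact mul_nonpos_of_nonpos_of_nonneg (by linarith) (by linarith)
    have hEE : Tendsto (fun t : ℝ => Complex.exp (Complex.I * ρ t * z (ρ t) b * t) -
        Complex.exp (Complex.I * b * (σ * √t : ℝ) + (σ ^ 2 : ℝ) * q)) atTop (𝓝 0) := by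
      refine tendsto_exp_sub_exp (fun t => ?_) ?_
      · simp only [Complex.add_re, Complex.re_mul_ofReal, Complex.re_ofReal_mul, Complex.I_mul_re,
          him]
        have : 0 ≤ σ ^ 2 := by positivity
        nlinarith
      · refine squeeze_zero_norm' ?_
          (by simpa using (tendsto_div_sqrt_atTop (C₀ * σ ^ 3)))
        filter_upwards [hev] with t ht
        have h2 := (hz (ρ t) ht.2.1 ht.2.2 b hb).2.1
        have ht0 : 0 < √t := Real.sqrt_pos.2 (by linarith)
        have hts : √t * √t = t := Real.mul_self_sqrt (by linarith)
        have hρt : ρ t * t = σ * √t := by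
          rw [hρdef]; field_simp; nlinarith
        have hρ2 : ρ t ^ 2 * t = σ ^ 2 := by
          rw [pow_two, mul_assoc, hρt, hρdef]; field_simp
        have e1 : Complex.I * ρ t * z (ρ t) b * t -
            (Complex.I * b * (σ * √t : ℝ) + (σ ^ 2 : ℝ) * q) =
            Complex.I * (ρ t * t : ℝ) * (z (ρ t) b - b + Complex.I * ρ t * q) := by
          rw [← hρ2, ← hρt]
          push_cast
          linear_combination (-(ρ t : ℂ) ^ 2 * t * q) * Complex.I_mul_I
        rw [e1, norm_mul, norm_mul, Complex.norm_I, one_mul, Complex.norm_real,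
          Real.norm_of_nonneg (by rw [hρt]; positivity)]
        refine (mul_le_mul_of_nonneg_left h2 (by rw [hρt]; positivity)).trans (le_of_eq ?_)
        have : ρ t * t * (C₀ * ρ t ^ 2) = C₀ * ρ t * (ρ t ^ 2 * t) := by ring
        rw [this, hρ2, hρdef]; ring
    refine (tendsto_mul_sub_mul hX hE hEE).congr' ?_
    filter_upwards [hev] with t ht
    have hρ0 : (ρ t : ℂ) ≠ 0 := by exact_mod_cast ht.2.1.ne'
    simp only [hT, hT']
    push_cast
    rw [zero_mul, add_zero]
    congr 1
    · rw [mul_right_comm Complex.I, mul_pow (Complex.I * z (ρ t) b)]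
      field_simp
    · ring
  have hrem : Tendsto (fun t : ℝ => ρ t ^ r / ρ t ^ k * (C * V * Real.exp (-c * t))) atTop
      (𝓝 0) := by
    have h1 := (tendsto_rpow_mul_exp_neg_mul_atTop_nhds_zero (k : ℝ) c hc).const_mul
      (σ ^ r / σ ^ k * (C * V))
    rw [mul_zero] at h1
    have hV0 : 0 ≤ V := Finset.sum_nonneg fun i _ => by positivity
    refine squeeze_zero' ?_ ?_ h1
    · filter_upwards [hev] with t ht
      have := ht.2.1
      positivity
    · filter_upwards [hev] with t ht
      have ht0 : 0 < √t := Real.sqrt_pos.2 (by linarith)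
      have ht1 : 1 ≤ √t := Real.one_le_sqrt.2 ht.1
      have h2 : √t ^ k ≤ t ^ k := by
        refine pow_le_pow_left₀ ht0.le ?_ k
        nlinarith [Real.mul_self_sqrt (show 0 ≤ t by linarith)]
      have h3 : ρ t ^ r / ρ t ^ k = σ ^ r / σ ^ k * (√t ^ k / √t ^ r) := by
        simp only [hρdef, div_pow]; field_simp
      have h4 : √t ^ k / √t ^ r ≤ t ^ k :=
        (div_le_self (by positivity) (one_le_pow₀ ht1)).trans h2
      rw [h3, Real.rpow_natCast]
      have h5 : 0 ≤ σ ^ r / σ ^ k := by positivity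
      have h6 : 0 ≤ C * V * Real.exp (-c * t) := by positivity
      calc σ ^ r / σ ^ k * (√t ^ k / √t ^ r) * (C * V * Real.exp (-c * t))
          ≤ σ ^ r / σ ^ k * t ^ k * (C * V * Real.exp (-c * t)) := by gcongr
        _ = _ := by ring
  have hsum : Tendsto (fun t => ∑ b ∈ (symbolAt R₀ ω).roots.toFinset, (T b t - T' b t)) atTop
      (𝓝 0) := by
    simpa using tendsto_finsetSum _ hmode
  have hdiff : Tendsto (fun t : ℝ => ((((ρ t) ^ r / (ρ t) ^ k : ℝ) : ℂ) * Y t k t -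
      M * modeSum r k (symbolAt R₀ ω) (symbolAt R₁ ω) 0 (σ * √t) (σ ^ 2)) -
      ∑ b ∈ (symbolAt R₀ ω).roots.toFinset, (T b t - T' b t)) atTop (𝓝 0) := by
    refine squeeze_zero_norm' ?_ hrem
    filter_upwards [hev, hVev] with t ht hVt
    obtain ⟨S, W, hSW, hS, -, hW⟩ := hYdec (ρ t) ht.2.1 ht.2.2 (Y t) (hY t) (hQY t) V hVt t
      (by linarith)
    have e1 : (((ρ t) ^ r / (ρ t) ^ k : ℝ) : ℂ) * S =
        ∑ b ∈ (symbolAt R₀ ω).roots.toFinset, T b t := by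
      rw [hS, Finset.mul_sum]
    have e2 : M * modeSum r k (symbolAt R₀ ω) (symbolAt R₁ ω) 0 (σ * √t) (σ ^ 2) =
        ∑ b ∈ (symbolAt R₀ ω).roots.toFinset, T' b t := by
      rw [modeSum, Finset.mul_sum]
    have e3 : ((((ρ t) ^ r / (ρ t) ^ k : ℝ) : ℂ) * Y t k t -
      M * modeSum r k (symbolAt R₀ ω) (symbolAt R₁ ω) 0 (σ * √t) (σ ^ 2)) -
      ∑ b ∈ (symbolAt R₀ ω).roots.toFinset, (T b t - T' b t) =
        (((ρ t) ^ r / (ρ t) ^ k : ℝ) : ℂ) * W := by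
      rw [e2, Finset.sum_sub_distrib, ← e1, hSW]; ring
    rw [e3, norm_mul, Complex.norm_real, Real.norm_of_nonneg (by have := ht.2.1; positivity)]
    have := ht.2.1
    gcongr
  have key := hdiff.add hsum
  simp only [sub_add_cancel, add_zero] at key
  exact key

end DampedSystem

end LimitTheorem

/-! ### Solution of the ordinary differential equation by the matrix exponential -/

/-- The companion matrix of `Q`, which maps `(y, y', …, y^{(m-1)})` to `(y', …, y^{(m)})` when
`Q(d/dt) y = 0` and `Q` is monic of degree `m`. -/
noncomputable def companion (m : ℕ) (Q : Polynomial ℂ) : (Fin m → ℂ) →L[ℂ] (Fin m → ℂ) :=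
  ContinuousLinearMap.pi (fun i : Fin m =>
    if h : (i : ℕ) + 1 < m then ContinuousLinearMap.proj (⟨i + 1, h⟩ : Fin m) else 0) -
  ∑ j : Fin m, Q.coeff j • ContinuousLinearMap.pi (fun i : Fin m =>
    if (i : ℕ) + 1 = m then ContinuousLinearMap.proj j else 0)

/-- The solution of `Q(d/dt) y = 0` with initial data `v`, together with all its derivatives. -/
noncomputable def solJet (m : ℕ) [NeZero m] (Q : Polynomial ℂ) (v : ℕ → ℂ) : ℕ → ℝ → ℂ :=
  fun k t => ((companion m Q ^ k) (NormedSpace.exp (t • companion m Q) (fun i => v i))) 0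

section Companion

variable {m : ℕ}

lemma companion_apply_of_lt (Q : Polynomial ℂ) (w : Fin m → ℂ) {i : Fin m}
    (h : (i : ℕ) + 1 < m) : companion m Q w i = w ⟨i + 1, h⟩ := by
  simp [companion, h, h.ne, Finset.sum_apply]

lemma companion_apply_last (Q : Polynomial ℂ) (w : Fin m → ℂ) {i : Fin m}
    (h : (i : ℕ) + 1 = m) : companion m Q w i = -∑ j : Fin m, Q.coeff j * w j := by
  simp [companion, h, Finset.sum_apply]

lemma companion_pow_apply (Q : Polynomial ℂ) (k : ℕ) (w : Fin m → ℂ) (i : Fin m)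
    (h : (i : ℕ) + k < m) : (companion m Q ^ k) w i = w ⟨i + k, h⟩ := by
  induction k generalizing w with
  | zero => simp
  | succ k ih =>
    rw [pow_succ, mul_apply_eq_comp, ih _ (by omega),
      companion_apply_of_lt Q w (show (i : ℕ) + k + 1 < m by omega)]
    rfl

lemma continuous_companion {X : Type*} [TopologicalSpace X] {Q : X → Polynomial ℂ}
    (hQ : ∀ j, Continuous fun x => (Q x).coeff j) : Continuous fun x => companion m (Q x) := by
  unfold companion
  refine continuous_const.sub (continuous_finsetSum _ fun j _ => ?_)
  exact (hQ j).smul continuous_const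

variable [NeZero m]

lemma isJet_solJet (Q : Polynomial ℂ) (v : ℕ → ℂ) : IsJet (solJet m Q v) := by
  intro k t
  have h1 := hasDerivAt_exp_smul_const' (𝕂 := ℝ) (companion m Q) t
  let L : ((Fin m → ℂ) →L[ℂ] (Fin m → ℂ)) →L[ℝ] ℂ :=
    ((ContinuousLinearMap.proj (R := ℂ) (φ := fun _ : Fin m => ℂ) 0).restrictScalars ℝ) ∘L
    ((companion m Q ^ k).restrictScalars ℝ) ∘L
    ((ContinuousLinearMap.apply ℂ (Fin m → ℂ) (fun i : Fin m => v i)).restrictScalars ℝ)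
  have h2 := L.hasFDerivAt.comp_hasDerivAt t h1
  convert! h2 using 1

lemma solJet_zero (Q : Polynomial ℂ) (v : ℕ → ℂ) {k : ℕ} (hk : k < m) :
    solJet m Q v k 0 = v k := by
  have h := companion_pow_apply Q k (fun i : Fin m => v i) 0 (by simpa using hk)
  have h0 : (0 : ℝ) • companion m Q = 0 := by ext w i; simp
  rw [solJet, h0, NormedSpace.exp_zero, one_apply_eq_self, h]
  simp

lemma polyAct_solJet {Q : Polynomial ℂ} (hQ : Q.Monic) (hm : Q.natDegree = m) (v : ℕ → ℂ) :
    polyAct Q (solJet m Q v) = 0 := by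
  have hm0 : 0 < m := Nat.pos_of_ne_zero (NeZero.ne m)
  ext k t
  have hlead : Q.coeff m = 1 := by
    have := hQ.coeff_natDegree
    rwa [hm] at this
  rw [polyAct_apply hm.le, Finset.sum_range_succ, hlead, one_mul]
  set w := (companion m Q ^ k) (NormedSpace.exp (t • companion m Q) (fun i => v i)) with hw
  have h1 : ∀ i, solJet m Q v (k + i) t = (companion m Q ^ i) w 0 := fun i => by
    rw [solJet, hw, add_comm, pow_add, mul_apply_eq_comp]
  have h2 : (companion m Q ^ m) w 0 = -∑ j : Fin m, Q.coeff j * w j := by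
    obtain ⟨N, hN⟩ : ∃ N, m = N + 1 := ⟨m - 1, by omega⟩
    have h3 : companion m Q ^ m = companion m Q ^ (m - 1) * companion m Q := by
      rw [← pow_succ, Nat.sub_add_cancel hm0]
    rw [h3, mul_apply_eq_comp, companion_pow_apply Q (m - 1) _ 0 (by simp; omega)]
    exact companion_apply_last Q w (by simp; omega)
  rw [h1 m, h2, Finset.sum_range]
  simp only [Pi.zero_apply]
  rw [add_neg_eq_zero]
  refine Finset.sum_congr rfl fun i _ => ?_
  rw [h1, companion_pow_apply Q i w 0 (by simp)]
  congr 2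
  ext; simp

lemma solJet_eq_sum (Q : Polynomial ℂ) (v : ℕ → ℂ) (k : ℕ) (t : ℝ) :
    solJet m Q v k t = ∑ i ∈ Finset.range m, v i * solJet m Q (Pi.single i 1) k t := by
  have h1 : (fun i : Fin m => v i) =
      ∑ j : Fin m, v j • (fun i : Fin m => (Pi.single (j : ℕ) (1 : ℂ) : ℕ → ℂ) i) := by
    ext i
    rw [Finset.sum_apply, Finset.sum_eq_single i]
    · simp
    · intro j _ hj
      have : (i : ℕ) ≠ j := fun h => hj (Fin.ext h.symm)
      simp [Pi.single_apply, this]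
    · simp
  rw [Finset.sum_range]
  simp only [solJet]
  rw [h1]
  simp [map_sum, Finset.sum_apply]

lemma continuous_solJet {X : Type*} [TopologicalSpace X] {Q : X → Polynomial ℂ}
    (hQ : ∀ j, Continuous fun x => (Q x).coeff j) (v : ℕ → ℂ) (k : ℕ) :
    Continuous fun y : X × ℝ => solJet m (Q y.1) v k y.2 := by
  have h1 : Continuous fun y : X × ℝ => companion m (Q y.1) :=
    (continuous_companion hQ).comp continuous_fst
  let _ : NormedAlgebra ℚ ((Fin m → ℂ) →L[ℂ] (Fin m → ℂ)) := NormedAlgebra.restrictScalars ℚ ℂ _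
  have h2 : Continuous fun y : X × ℝ => NormedSpace.exp (y.2 • companion m (Q y.1)) :=
    (NormedSpace.exp_continuous).comp (continuous_snd.smul h1)
  unfold solJet
  exact (continuous_apply 0).comp ((h1.pow k).clm_apply (h2.clm_apply continuous_const))

lemma exists_solJet_bound {X : Type*} [TopologicalSpace X] {Q : X → Polynomial ℂ}
    (hQ : ∀ j, Continuous fun x => (Q x).coeff j) {K : Set X} (hK : IsCompact K) (T : ℝ) (k : ℕ) :
    ∃ C : ℝ, 0 < C ∧ ∀ x ∈ K, ∀ t ∈ Icc (-T) T, ∀ v : ℕ → ℂ,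
      ‖solJet m (Q x) v k t‖ ≤ C * ∑ i ∈ Finset.range m, ‖v i‖ := by
  have h1 : ∀ i, ∃ C : ℝ, ∀ y ∈ K ×ˢ Icc (-T) T,
      ‖solJet m (Q y.1) (Pi.single i 1) k y.2‖ ≤ C := fun i =>
    (hK.prod isCompact_Icc).exists_bound_of_continuousOn (continuous_solJet hQ _ k).continuousOn
  choose C hC using h1
  refine ⟨1 + ∑ i ∈ Finset.range m, |C i|, by positivity, fun x hx t ht v => ?_⟩
  rw [solJet_eq_sum, Finset.mul_sum]
  refine (norm_sum_le _ _).trans (Finset.sum_le_sum fun i hi => ?_)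
  rw [norm_mul, mul_comm]
  refine mul_le_mul_of_nonneg_right ?_ (norm_nonneg _)
  have h2 := Finset.single_le_sum (f := fun i => |C i|) (fun i _ => abs_nonneg _) hi
  have h3 := (hC i (x, t) ⟨hx, ht⟩).trans (le_abs_self _)
  linarith

end Companion

/-! ### The equation on the Fourier side -/

section FourierSide

variable {n : ℕ}

/-- The bilinear pairing `∫ ψ f` of a square integrable function `ψ` with an element of `L²`. -/
noncomputable def pairing {ψ : RSpace n → ℂ} (hψ : MemLp ψ 2 volume) : L2Space n →L[ℂ] ℂ :=
  innerSL ℂ (hψ.star.toLp (star ψ))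

lemma pairing_apply {ψ : RSpace n → ℂ} (hψ : MemLp ψ 2 volume) (f : L2Space n) :
    pairing hψ f = ∫ ζ, ψ ζ * f ζ := by
  rw [pairing, innerSL_apply_apply, L2.inner_def]
  refine integral_congr_ae ?_
  filter_upwards [hψ.star.coeFn_toLp] with ζ hζ
  rw [hζ]
  simp [mul_comm]

lemma norm_pairing_le {ψ : RSpace n → ℂ} (hψ : MemLp ψ 2 volume) (f : L2Space n) :
    ‖pairing hψ f‖ ≤ (eLpNorm ψ 2 volume).toReal * ‖f‖ := by
  rw [pairing, innerSL_apply_apply]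
  refine (norm_inner_le_norm _ _).trans_eq ?_
  rw [Lp.norm_toLp, eLpNorm_star]

lemma MemLp.integrable_mul_coe {ψ : RSpace n → ℂ} (hψ : MemLp ψ 2 volume) (f : L2Space n) :
    Integrable (fun ζ => ψ ζ * f ζ) volume :=
  hψ.integrable_mul (Lp.memLp f)

lemma memLp_two_of_compactSupport {ψ : RSpace n → ℂ} (h1 : HasCompactSupport ψ)
    (h2 : Continuous ψ) : MemLp ψ 2 volume := h2.memLp_of_hasCompactSupport h1

/-- The Fourier transform changes `∂ₓ^α` into the multiplication by `(2πiζ)^α`. -/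
lemma exists_multiDeriv_fourier (α : Fin n → ℕ) (ψ : 𝓢(RSpace n, ℂ)) : ∃ ψ' : 𝓢(RSpace n, ℂ),
    (∀ ζ : RSpace n, ψ' ζ = (∏ i, (2 * Real.pi * Complex.I * (ζ i : ℂ)) ^ α i) * ψ ζ) ∧
    ∀ T : 𝓢'(RSpace n, ℂ), multiDeriv α T (𝓕 ψ) = (𝓕 T) ψ' := by
  have hstep : ∀ (i : Fin n) (ψ : 𝓢(RSpace n, ℂ)), ∃ ψ' : 𝓢(RSpace n, ℂ),
      (∀ ζ : RSpace n, ψ' ζ = (2 * Real.pi * Complex.I * (ζ i : ℂ)) * ψ ζ) ∧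
      ∀ R : 𝓢'(RSpace n, ℂ), (∂_{EuclideanSpace.single i (1 : ℝ)} R) (𝓕 ψ) = R (𝓕 ψ') := by
    intro i ψ
    have htg : (fun x : RSpace n =>
        ((inner ℝ x (EuclideanSpace.single i (1 : ℝ)) : ℝ) : ℂ)).HasTemperateGrowth := by
      fun_prop
    refine ⟨(2 * Real.pi * Complex.I) • SchwartzMap.smulLeftCLM ℂ
      (fun x : RSpace n => ((inner ℝ x (EuclideanSpace.single i (1 : ℝ)) : ℝ) : ℂ)) ψ,
      fun ζ => ?_, fun R => ?_⟩
    · rw [smul_apply, SchwartzMap.smulLeftCLM_apply_apply htg]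
      simp [EuclideanSpace.inner_single_right, mul_assoc]
    · rw [← TemperedDistribution.fourier_apply, TemperedDistribution.fourier_lineDerivOp_eq,
        ← TemperedDistribution.fourier_apply R, map_smul]
      rfl
  have hiter : ∀ (i : Fin n) (a : ℕ) (ψ : 𝓢(RSpace n, ℂ)), ∃ ψ' : 𝓢(RSpace n, ℂ),
      (∀ ζ : RSpace n, ψ' ζ = (2 * Real.pi * Complex.I * (ζ i : ℂ)) ^ a * ψ ζ) ∧
      ∀ R : 𝓢'(RSpace n, ℂ), ((fun R : 𝓢'(RSpace n, ℂ) =>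
        ∂_{EuclideanSpace.single i (1 : ℝ)} R)^[a] R) (𝓕 ψ) = R (𝓕 ψ') := by
    intro i a
    induction a with
    | zero => exact fun ψ => ⟨ψ, fun ζ => by simp, fun R => rfl⟩
    | succ a ih =>
      intro ψ
      obtain ⟨ψ₁, h1, h2⟩ := hstep i ψ
      obtain ⟨ψ₂, h3, h4⟩ := ih ψ₁
      refine ⟨ψ₂, fun ζ => ?_, fun R => ?_⟩
      · rw [h3, h1]; ring
      · rw [Function.iterate_succ_apply', h2, h4]
  have hlist : ∀ (l : List (Fin n)) (ψ : 𝓢(RSpace n, ℂ)), ∃ ψ' : 𝓢(RSpace n, ℂ),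
      (∀ ζ : RSpace n, ψ' ζ =
        (l.map fun i => (2 * Real.pi * Complex.I * (ζ i : ℂ)) ^ α i).prod * ψ ζ) ∧
      ∀ T : 𝓢'(RSpace n, ℂ), (l.foldr (fun i S => (fun R : 𝓢'(RSpace n, ℂ) =>
        ∂_{EuclideanSpace.single i (1 : ℝ)} R)^[α i] S) T) (𝓕 ψ) = T (𝓕 ψ') := by
    intro l
    induction l with
    | nil => exact fun ψ => ⟨ψ, fun ζ => by simp, fun T => rfl⟩
    | cons i l ih =>
      intro ψ
      obtain ⟨ψ₁, h1, h2⟩ := hiter i (α i) ψ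
      obtain ⟨ψ₂, h3, h4⟩ := ih ψ₁
      refine ⟨ψ₂, fun ζ => ?_, fun T => ?_⟩
      · rw [h3, h1, List.map_cons, List.prod_cons]; ring
      · rw [List.foldr_cons, h2, h4]
  obtain ⟨ψ', h1, h2⟩ := hlist (List.finRange n) ψ
  refine ⟨ψ', fun ζ => ?_, fun T => ?_⟩
  · rw [h1, Fin.prod_univ_def]
  · rw [TemperedDistribution.fourier_apply]
    exact h2 T

lemma iteratedDerivWithin_clm_comp {E F : Type*} [NormedAddCommGroup E] [NormedSpace ℝ E]
    [NormedAddCommGroup F] [NormedSpace ℝ F] (L : E →L[ℝ] F) {f : ℝ → E} {k : ℕ}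
    (hf : ContDiffOn ℝ (k : WithTop ℕ∞) f (Ici 0)) {t : ℝ} (ht : t ∈ Ici (0 : ℝ)) :
    iteratedDerivWithin k (fun τ => L (f τ)) (Ici 0) t = L (iteratedDerivWithin k f (Ici 0) t) := by
  simp only [iteratedDerivWithin]
  have := L.iteratedFDerivWithin_comp_left (hf t ht) (uniqueDiffOn_Ici 0) ht le_rfl
  rw [show (fun τ => L (f τ)) = L ∘ f from rfl, this]
  rfl

lemma coeff_charPoly_eq_sum (Q : DiffOp n) (ζ : RSpace n) (k : ℕ) :
    (charPoly Q ((2 * Real.pi) • ζ)).coeff k = ∑ d ∈ Q.support with d none = k,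
      Q.coeff d * ∏ i, (2 * Real.pi * Complex.I * (ζ i : ℂ)) ^ d (some i) := by
  rw [charPoly, coeff_complexSymbol, Finset.sum_filter]
  refine Finset.sum_congr rfl fun d _ => ?_
  simp only [eq_comm (a := k)]
  refine if_congr Iff.rfl ?_ rfl
  congr 1
  refine Finset.prod_congr rfl fun i _ => ?_
  congr 1
  simp only [PiLp.smul_apply, smul_eq_mul]
  push_cast
  ring

/-- The differential equation for the Fourier transform of a solution, tested with functions of
compact support. The highest time derivative need not belong to `L²`, so only the pairing with a
test function is differentiated once more. -/
lemma IsCauchySolution.hasDerivWithinAt_fourier {m : ℕ} (hm : 1 ≤ m) {Q : DiffOp n} {s₀ : ℝ}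
    {u₀ : ℕ → L2Space n} {u : ℝ → L2Space n} (hu : IsCauchySolution m Q s₀ u₀ u)
    (hQ : ∀ d ∈ Q.support, d none ≤ m ∧ (d none = m → d = Finsupp.single none m))
    (hQ1 : timeCoeff Q m = 1) {ψ : RSpace n → ℂ} (hψ : ContDiff ℝ (⊤ : ℕ∞) ψ)
    (hψc : HasCompactSupport ψ) {t : ℝ} (ht : 0 ≤ t) :
    HasDerivWithinAt (fun τ => ∫ ζ, ψ ζ * (𝓕 (timeDeriv (m - 1) u τ) : L2Space n) ζ)
      (-∑ k ∈ Finset.range m, ∫ ζ, ((charPoly Q ((2 * Real.pi) • ζ)).coeff k * ψ ζ) *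
        (𝓕 (timeDeriv k u t) : L2Space n) ζ) (Ici 0) t := by
  set e : Option (Fin n) →₀ ℕ := Finsupp.single none m with he
  have heN : e none = m := by simp [he]
  have heS : ∀ i, e (some i) = 0 := fun i => by simp [he]
  have hemem : e ∈ Q.support := by
    rw [MvPolynomial.mem_support_iff]
    intro h0
    rw [timeCoeff, h0] at hQ1
    exact zero_ne_one hQ1
  choose χ hχ hχT using fun d : Option (Fin n) →₀ ℕ =>
    exists_multiDeriv_fourier (fun i => d (some i)) (hψc.toSchwartzMap hψ)
  have hχL : ∀ d, MemLp (χ d) 2 volume := fun d => (χ d).memLp 2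
  have hψL : MemLp ψ 2 volume := memLp_two_of_compactSupport hψc hψ.continuous
  have hpair : ∀ d (v : L2Space n), multiDeriv (fun i => d (some i)) (v : 𝓢'(RSpace n, ℂ))
      (𝓕 (hψc.toSchwartzMap hψ)) = pairing (hχL d) (𝓕 v) := by
    intro d v
    rw [hχT, Lp.fourier_toTemperedDistribution_eq, Lp.toTemperedDistribution_apply, pairing_apply]
    rfl
  set F : L2Space n →L[ℝ] L2Space n :=
    ((Lp.fourierTransformₗᵢ (RSpace n) ℂ).toContinuousLinearEquiv.toContinuousLinearMap
      ).restrictScalars ℝ with hF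
  have hFa : ∀ v : L2Space n, F v = 𝓕 v := fun v => rfl
  have hderiv : ∀ (d : Option (Fin n) →₀ ℕ) (k : ℕ), k ≤ m - 1 → ∀ τ ∈ Ici (0 : ℝ),
      iteratedDerivWithin k (fun τ => multiDeriv (fun i => d (some i)) (u τ : 𝓢'(RSpace n, ℂ))
        (𝓕 (hψc.toSchwartzMap hψ))) (Ici 0) τ = pairing (hχL d) (𝓕 (timeDeriv k u τ)) := by
    intro d k hk τ hτ
    have h1 := iteratedDerivWithin_clm_comp (((pairing (hχL d)).restrictScalars ℝ) ∘L F)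
      (hu.contDiffOn.of_le (by exact_mod_cast hk) : ContDiffOn ℝ (k : WithTop ℕ∞) u (Ici 0)) hτ
    simp only [hpair]
    exact h1
  have hχe : ∀ v : L2Space n, pairing (hχL e) v = ∫ ζ, ψ ζ * v ζ := by
    intro v
    rw [pairing_apply]
    refine integral_congr_ae (Eventually.of_forall fun ζ => ?_)
    simp only [hχ, heS]
    simp
  -- The weak regularity of the solution provides the last derivative.
  have hdiff : HasDerivWithinAt (fun τ => ∫ ζ, ψ ζ * (𝓕 (timeDeriv (m - 1) u τ) : L2Space n) ζ)
      (iteratedDerivWithin m (fun τ => multiDeriv (fun i => e (some i)) (u τ : 𝓢'(RSpace n, ℂ))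
        (𝓕 (hψc.toSchwartzMap hψ))) (Ici 0) t) (Ici 0) t := by
    have h1 := hu.weak_contDiffOn (𝓕 (χ e))
    have h2 : (fun τ => (u τ : 𝓢'(RSpace n, ℂ)) (𝓕 (χ e))) =
        fun τ => multiDeriv (fun i => e (some i)) (u τ : 𝓢'(RSpace n, ℂ))
        (𝓕 (hψc.toSchwartzMap hψ)) := by
      ext τ
      rw [hχT, TemperedDistribution.fourier_apply]
    rw [h2] at h1
    have h3 := h1.differentiableOn_iteratedDerivWithin (m := m - 1)
      (by exact_mod_cast (show m - 1 < m by omega)) (uniqueDiffOn_Ici 0)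
    have h4 := (h3 t ht).hasDerivWithinAt
    rw [← iteratedDerivWithin_succ, Nat.sub_add_cancel hm] at h4
    refine h4.congr (fun τ hτ => ?_) ?_
    · rw [hderiv e (m - 1) le_rfl τ hτ, hχe]
    · rw [hderiv e (m - 1) le_rfl t ht, hχe]
  convert! hdiff using 1
  have heq := hu.equation (𝓕 (hψc.toSchwartzMap hψ)) t ht
  rw [← Finset.add_sum_erase _ _ hemem, heN, show Q.coeff e = 1 from hQ1, one_mul] at heq
  rw [neg_eq_iff_add_eq_zero, add_comm, ← heq]
  congr 1
  have hfib : ∀ d ∈ Q.support.erase e, d none ∈ Finset.range m := by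
    intro d hd
    obtain ⟨h1, h2⟩ := Finset.mem_erase.1 hd
    rw [Finset.mem_range]
    exact lt_of_le_of_ne (hQ d h2).1 fun h => h1 ((hQ d h2).2 h)
  rw [← Finset.sum_fiberwise_of_maps_to hfib]
  refine Finset.sum_congr rfl fun k hk => ?_
  have hkm := Finset.mem_range.1 hk
  have hset : Finset.filter (fun d => d none = k) (Q.support.erase e) =
      Finset.filter (fun d => d none = k) Q.support := by
    ext d
    simp only [Finset.mem_filter, Finset.mem_erase]
    refine ⟨fun h => ⟨h.1.2, h.2⟩, fun h => ⟨⟨fun h' => ?_, h.1⟩, h.2⟩⟩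
    rw [h', heN] at h
    omega
  rw [hset]
  have h1 : ∀ d ∈ Finset.filter (fun d => d none = k) Q.support, Q.coeff d *
      iteratedDerivWithin (d none) (fun τ => multiDeriv (fun i => d (some i))
        (u τ : 𝓢'(RSpace n, ℂ)) (𝓕 (hψc.toSchwartzMap hψ))) (Ici 0) t =
      ∫ ζ, Q.coeff d * (χ d ζ * (𝓕 (timeDeriv k u t) : L2Space n) ζ) := by
    intro d hd
    have h2 := (Finset.mem_filter.1 hd).2
    rw [h2, hderiv d k (by omega) t ht, pairing_apply, integral_const_mul]
  rw [Finset.sum_congr rfl h1, ← integral_finsetSum _ fun d _ =>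
    ((MemLp.integrable_mul_coe (hχL d) _).const_mul _)]
  refine integral_congr_ae (Eventually.of_forall fun ζ => ?_)
  simp only [coeff_charPoly_eq_sum, Finset.sum_mul, hχ]
  refine Finset.sum_congr rfl fun d _ => ?_
  have : (hψc.toSchwartzMap hψ) ζ = ψ ζ := rfl
  rw [this]
  ring

end FourierSide

/-! ### Identification of the solution -/

/-- Uniqueness for a linear system tested by a space `S` of functions which is stable under the
coefficients `A j` of the system: iterating the integrated system bounds the solution by
`B (K t)^N / N!`. -/
lemma eq_zero_of_tested_system {S : Type*} {N : S → ℝ} (hN : ∀ ψ, 0 ≤ N ψ) {m : ℕ}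
    {A : ℕ → S → S} {C : ℝ} (hC : 0 ≤ C) (hA : ∀ j < m, ∀ ψ, N (A j ψ) ≤ C * N ψ)
    {f : ℕ → S → ℝ → ℂ}
    (hf : ∀ k, k + 1 < m → ∀ ψ, ∀ t, 0 ≤ t → HasDerivWithinAt (f k ψ) (f (k + 1) ψ t) (Ici 0) t)
    (hlast : ∀ ψ, ∀ t, 0 ≤ t → HasDerivWithinAt (f (m - 1) ψ)
      (-∑ j ∈ Finset.range m, f j (A j ψ) t) (Ici 0) t)
    (h0 : ∀ k < m, ∀ ψ, f k ψ 0 = 0) {T B : ℝ} (hB0 : 0 ≤ B)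
    (hB : ∀ k < m, ∀ ψ, ∀ t ∈ Icc 0 T, ‖f k ψ t‖ ≤ B * N ψ) :
    ∀ k < m, ∀ ψ, ∀ t ∈ Icc 0 T, f k ψ t = 0 := by
  set K : ℝ := 1 + m * C with hK
  have hK0 : 0 ≤ K := by positivity
  have key : ∀ i : ℕ, ∀ k < m, ∀ ψ, ∀ t ∈ Icc 0 T,
      ‖f k ψ t‖ ≤ B * N ψ * ((K * t) ^ i / i.factorial) := by
    intro i
    induction i with
    | zero => simpa using hB
    | succ i ih =>
      intro k hk ψ t ht
      obtain ⟨g, hg, hgb⟩ : ∃ g : ℝ → ℂ,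
          (∀ t, 0 ≤ t → HasDerivWithinAt (f k ψ) (g t) (Ici 0) t) ∧
          ∀ t ∈ Icc 0 T, ‖g t‖ ≤ B * N ψ * (K * ((K * t) ^ i / i.factorial)) := by
        rcases Nat.lt_or_ge (k + 1) m with h1 | h1
        · refine ⟨f (k + 1) ψ, hf k h1 ψ, fun t ht => (ih (k + 1) h1 ψ t ht).trans ?_⟩
          have h2 : 0 ≤ (K * t) ^ i / i.factorial := by have := ht.1; positivity
          have h3 : 1 ≤ K := by rw [hK]; have : 0 ≤ m * C := by positivity
                                linarith
          have h4 := mul_le_mul_of_nonneg_right h3 h2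
          rw [one_mul] at h4
          exact mul_le_mul_of_nonneg_left h4 (mul_nonneg hB0 (hN ψ))
        · obtain rfl : k = m - 1 := by omega
          refine ⟨_, hlast ψ, fun t ht => ?_⟩
          rw [norm_neg]
          have h2 : 0 ≤ (K * t) ^ i / i.factorial := by have := ht.1; positivity
          have h3 : ∀ j ∈ Finset.range m, ‖f j (A j ψ) t‖ ≤
              B * (C * N ψ) * ((K * t) ^ i / i.factorial) := fun j hj => by
            have hj := Finset.mem_range.1 hj
            refine (ih j hj _ t ht).trans ?_
            have := hA j hj ψ
            gcongr
          refine (norm_sum_le _ _).trans ((Finset.sum_le_sum h3).trans ?_)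
          rw [Finset.sum_const, Finset.card_range, nsmul_eq_mul]
          have h5 : 0 ≤ B * N ψ * ((K * t) ^ i / i.factorial) :=
            mul_nonneg (mul_nonneg hB0 (hN ψ)) h2
          rw [hK]
          linarith
      have hbd : ∀ s : ℝ, HasDerivAt
          (fun s : ℝ => B * N ψ * ((K * s) ^ (i + 1) / (i + 1).factorial))
          (B * N ψ * (K * ((K * s) ^ i / i.factorial))) s := by
        intro s
        have e1 : HasDerivAt (fun s : ℝ => K * s) K s := by
          simpa using (hasDerivAt_id s).const_mul K
        have e2 := ((e1.pow (i + 1)).div_const ((i + 1).factorial : ℝ)).const_mul (B * N ψ)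
        convert! e2 using 1
        rw [Nat.factorial_succ]
        push_cast
        have : (i.factorial : ℝ) ≠ 0 := by positivity
        have : (i : ℝ) + 1 ≠ 0 := by positivity
        field_simp
      refine image_norm_le_of_norm_deriv_right_le_deriv_boundary' (a := 0) (b := T)
        (fun s hs => ((hg s hs.1).continuousWithinAt).mono Icc_subset_Ici_self)
        (fun s hs => (hg s hs.1).mono (Ici_subset_Ici.2 hs.1)) ?_
        (fun s _ => (hbd s).continuousAt.continuousWithinAt)
        (fun s _ => (hbd s).hasDerivWithinAt)
        (fun s hs => hgb s ⟨hs.1, hs.2.le⟩) ht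
      rw [h0 k hk ψ]
      simp
  intro k hk ψ t ht
  have hlim := (FloorSemiring.tendsto_pow_div_factorial_atTop (K * t)).const_mul (B * N ψ)
  rw [mul_zero] at hlim
  exact norm_le_zero_iff.1 (ge_of_tendsto' hlim fun i => key i k hk ψ t ht)

section Identification

variable {n r m : ℕ} {R₀ R₁ R₂ : DiffOp n}

lemma contDiff_coeff_charPoly (Q : DiffOp n) (k : ℕ) :
    ContDiff ℝ (⊤ : ℕ∞) fun ζ : RSpace n => (charPoly Q ((2 * Real.pi) • ζ)).coeff k := by
  simp only [coeff_charPoly_eq_sum]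
  refine ContDiff.sum fun d _ => contDiff_const.mul (contDiff_prod fun i _ => ContDiff.pow ?_ _)
  refine contDiff_const.mul ?_
  exact Complex.ofRealCLM.contDiff.comp (by fun_prop)

lemma norm_integral_mul_le {ψ w : RSpace n → ℂ} {G : RSpace n → ℝ} {R C : ℝ}
    (hψ : MemLp ψ 2 volume) (hψR : ∀ ζ, R < ‖ζ‖ → ψ ζ = 0)
    (hw : AEStronglyMeasurable w volume) (hG : MemLp G 2 volume)
    (hC : ∀ ζ, ‖ζ‖ ≤ R → ‖w ζ‖ ≤ C * ‖G ζ‖) :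
    Integrable (fun ζ => ψ ζ * w ζ) volume ∧
    ‖∫ ζ, ψ ζ * w ζ‖ ≤
      (eLpNorm ψ 2 volume).toReal * (ENNReal.ofReal C * eLpNorm G 2 volume).toReal := by
  set w' := (Metric.closedBall (0 : RSpace n) R).indicator w with hw'
  have hw'm : AEStronglyMeasurable w' volume := hw.indicator measurableSet_closedBall
  have hle : ∀ ζ, ‖w' ζ‖ ≤ C * ‖G ζ‖ ∨ w' ζ = 0 := by
    intro ζ
    by_cases h : ζ ∈ Metric.closedBall (0 : RSpace n) R
    · left
      rw [hw', indicator_of_mem h]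
      exact hC ζ (by simpa using h)
    · right
      rw [hw', indicator_of_notMem h]
  have hle' : ∀ ζ, ‖w' ζ‖ ≤ |C| * ‖G ζ‖ := by
    intro ζ
    rcases hle ζ with h | h
    · exact h.trans (mul_le_mul_of_nonneg_right (le_abs_self C) (norm_nonneg _))
    · rw [h, norm_zero]; positivity
  have hw'L : MemLp w' 2 volume := hG.of_le_mul hw'm (Eventually.of_forall hle')
  have heq : ∀ ζ, ψ ζ * w' ζ = ψ ζ * w ζ := by
    intro ζ
    by_cases h : ζ ∈ Metric.closedBall (0 : RSpace n) R
    · rw [hw', indicator_of_mem h]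
    · rw [hψR ζ (by simpa using h), zero_mul, zero_mul]
  have h1 : (fun ζ => ψ ζ * (hw'L.toLp w') ζ) =ᵐ[volume] fun ζ => ψ ζ * w ζ := by
    filter_upwards [hw'L.coeFn_toLp] with ζ hζ
    rw [hζ, heq]
  refine ⟨(MemLp.integrable_mul_coe hψ (hw'L.toLp w')).congr h1, ?_⟩
  rw [← integral_congr_ae h1, ← pairing_apply hψ]
  refine (norm_pairing_le hψ _).trans ?_
  refine mul_le_mul_of_nonneg_left ?_ ENNReal.toReal_nonneg
  rw [Lp.norm_toLp]
  refine ENNReal.toReal_mono (ENNReal.mul_ne_top ENNReal.ofReal_ne_top hG.2.ne) ?_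
  have hle'' : ∀ ζ, ‖w' ζ‖ ≤ max C 0 * ‖G ζ‖ := by
    intro ζ
    rcases hle ζ with h | h
    · exact h.trans (mul_le_mul_of_nonneg_right (le_max_left _ _) (norm_nonneg _))
    · rw [h, norm_zero]; positivity
  have := eLpNorm_le_mul_eLpNorm_of_ae_le_mul (p := 2) (μ := volume)
    (Eventually.of_forall hle'')
  rwa [ENNReal.ofReal_max, ENNReal.ofReal_zero, max_eq_left (by simp)] at this

lemma DampedSystem.support_subset (H : DampedSystem r m R₀ R₁ R₂) {d : Option (Fin n) →₀ ℕ}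
    (hd : d ∈ (R₀ + R₁ + R₂).support) :
    d none ≤ m ∧ (d none = m → d = Finsupp.single none m) := by
  have hdeg : d none + ∑ i, d (some i) ≤ m := by
    rcases Finset.mem_union.1 (MvPolynomial.support_add hd) with h | h
    · rcases Finset.mem_union.1 (MvPolynomial.support_add h) with h | h
      · rw [sum_option_degree H.hyp₀.homogeneous h]; have := H.le_order; omega
      · rw [sum_option_degree H.hyp₁.homogeneous h]; exact H.le_order.1
    · rcases H.top with ⟨-, h2, -⟩ | ⟨h1, -⟩
      · rw [h2] at h; simp at h
      · rw [sum_option_degree H.homogeneous₂ h, h1]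
  refine ⟨by omega, fun h => ?_⟩
  have hs : ∑ i, d (some i) = 0 := by omega
  ext o
  cases o with
  | none => simpa using h
  | some i =>
    have := Finset.sum_eq_zero_iff.1 hs i (Finset.mem_univ i)
    simpa using this

lemma DampedSystem.timeCoeff_top (H : DampedSystem r m R₀ R₁ R₂) :
    timeCoeff (R₀ + R₁ + R₂) m = 1 := by
  have h0 : ∀ {P : DiffOp n} {e : ℕ}, P.IsHomogeneous e → e ≠ m → timeCoeff P m = 0 := by
    intro P e hP he
    by_contra hne
    have h1 := sum_option_degree hP (MvPolynomial.mem_support_iff.2 hne)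
    simp at h1
    exact he h1.symm
  have hadd : timeCoeff (R₀ + R₁ + R₂) m = timeCoeff R₀ m + timeCoeff R₁ m + timeCoeff R₂ m := by
    simp [timeCoeff]
  rw [hadd, h0 H.hyp₀.homogeneous (by have := H.le_order; omega)]
  rcases H.top with ⟨h1, h2, h3⟩ | ⟨h1, -, h3, -⟩
  · rw [h2, h1, h3]; simp [timeCoeff]
  · rw [h0 H.hyp₁.homogeneous (by omega), h1, h3]; simp

lemma continuous_solJet_charPoly [NeZero m] (Q : DiffOp n) (a : ℝ) (v : ℕ → ℂ) (k : ℕ) (t : ℝ) :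
    Continuous fun ζ : RSpace n => solJet m (charPoly Q (a • ζ)) v k t := by
  have h1 := continuous_solJet (m := m) (Q := fun ζ : RSpace n => charPoly Q (a • ζ)) (fun j =>
      (continuous_coeff_charPoly Q j).comp (continuous_const_smul a)) v k
  have h2 : Continuous fun ζ : RSpace n => (ζ, t) := by fun_prop
  have h3 := h1.comp h2
  simp only [Function.comp_def] at h3
  exact h3

lemma aestronglyMeasurable_solJet [NeZero m] {Q : DiffOp n} {v : ℕ → RSpace n → ℂ} {a : ℝ}
    (hv : ∀ i < m, AEStronglyMeasurable (v i) volume) (k : ℕ) (t : ℝ) :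
    AEStronglyMeasurable (fun ζ => solJet m (charPoly Q (a • ζ)) (fun i => v i ζ) k t) volume := by
  have h : (fun ζ => solJet m (charPoly Q (a • ζ)) (fun i => v i ζ) k t) = fun ζ =>
      ∑ i ∈ Finset.range m, v i ζ * solJet m (charPoly Q (a • ζ)) (Pi.single i 1) k t := by
    ext ζ
    rw [solJet_eq_sum]
  rw [h]
  refine Finset.aestronglyMeasurable_fun_sum _ fun i hi => ?_
  exact (hv i (Finset.mem_range.1 hi)).mul
    (continuous_solJet_charPoly Q a _ k t).aestronglyMeasurable

end Identification

section IdentificationMain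

variable {n r m : ℕ} {R₀ R₁ R₂ : DiffOp n}

lemma timeDeriv_hasDerivWithinAt {u : ℝ → L2Space n} {N k : ℕ}
    (hu : ContDiffOn ℝ (N : WithTop ℕ∞) u (Ici 0)) (hk : k < N) {t : ℝ} (ht : 0 ≤ t) :
    HasDerivWithinAt (timeDeriv k u) (timeDeriv (k + 1) u t) (Ici 0) t := by
  have h3 := hu.differentiableOn_iteratedDerivWithin (m := k)
    (by exact_mod_cast hk) (uniqueDiffOn_Ici 0)
  have h4 := (h3 t ht).hasDerivWithinAt
  rwa [← iteratedDerivWithin_succ] at h4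

lemma hasDerivAt_integral_solJet [NeZero m] {Q : DiffOp n} {v : ℕ → RSpace n → ℂ} {a R : ℝ}
    (hv : ∀ i < m, MemLp (v i) 2 volume) {ψ : RSpace n → ℂ} (hψ : MemLp ψ 2 volume)
    (hψR : ∀ ζ, R < ‖ζ‖ → ψ ζ = 0) (k : ℕ) (t : ℝ) :
    HasDerivAt (fun t => ∫ ζ, ψ ζ * solJet m (charPoly Q (a • ζ)) (fun i => v i ζ) k t)
      (∫ ζ, ψ ζ * solJet m (charPoly Q (a • ζ)) (fun i => v i ζ) (k + 1) t) t := by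
  set T : ℝ := |t| + 1 with hT
  obtain ⟨C, hC, hCb⟩ := exists_solJet_bound (m := m) (Q := fun ζ : RSpace n => charPoly Q (a • ζ))
    (fun j => (continuous_coeff_charPoly Q j).comp (continuous_const_smul a))
    (isCompact_closedBall (0 : RSpace n) R) T (k + 1)
  have hG : MemLp (fun ζ => ∑ i ∈ Finset.range m, ‖v i ζ‖) 2 volume :=
    memLp_finsetSum _ fun i hi => (hv i (Finset.mem_range.1 hi)).norm
  have hvm : ∀ i < m, AEStronglyMeasurable (v i) volume := fun i hi => (hv i hi).1
  have hts : Ioo (-T) T ∈ 𝓝 t := Ioo_mem_nhds (by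
    have := neg_abs_le t; linarith) (by have := le_abs_self t; linarith)
  have hint : Integrable
      (fun ζ => ψ ζ * solJet m (charPoly Q (a • ζ)) (fun i => v i ζ) k t) volume := by
    obtain ⟨C', hC', hCb'⟩ := exists_solJet_bound (m := m)
      (Q := fun ζ : RSpace n => charPoly Q (a • ζ))
      (fun j => (continuous_coeff_charPoly Q j).comp (continuous_const_smul a))
      (isCompact_closedBall (0 : RSpace n) R) T k
    refine (norm_integral_mul_le hψ hψR (aestronglyMeasurable_solJet hvm k t) hG
      (C := C') fun ζ hζ => ?_).1
    rw [Real.norm_of_nonneg (Finset.sum_nonneg fun i _ => norm_nonneg _)]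
    exact hCb' ζ (by simpa using hζ) t (Ioo_subset_Icc_self (mem_of_mem_nhds hts)) _
  refine (hasDerivAt_integral_of_dominated_loc_of_deriv_le (s := Ioo (-T) T)
    (F := fun t ζ => ψ ζ * solJet m (charPoly Q (a • ζ)) (fun i => v i ζ) k t)
    (F' := fun t ζ => ψ ζ * solJet m (charPoly Q (a • ζ)) (fun i => v i ζ) (k + 1) t)
    (bound := fun ζ => ‖ψ ζ‖ * (C * ∑ i ∈ Finset.range m, ‖v i ζ‖)) hts
    (Eventually.of_forall fun s => hψ.1.mul (aestronglyMeasurable_solJet hvm k s)) hint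
    (hψ.1.mul (aestronglyMeasurable_solJet hvm (k + 1) t)) ?_ ?_ ?_).2
  · refine Eventually.of_forall fun ζ s hs => ?_
    rw [norm_mul]
    by_cases hζ : ‖ζ‖ ≤ R
    · exact mul_le_mul_of_nonneg_left
        (hCb ζ (by simpa using hζ) s (Ioo_subset_Icc_self hs) _) (norm_nonneg _)
    · rw [hψR ζ (not_le.1 hζ)]; simp
  · exact hψ.norm.integrable_mul (hG.const_mul C)
  · exact Eventually.of_forall fun ζ s _ => (isJet_solJet _ _ k s).const_mul _

lemma solJet_top_eq [NeZero m] (H : DampedSystem r m R₀ R₁ R₂) (ξ : RSpace n) (v : ℕ → ℂ) (t : ℝ) :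
    solJet m (charPoly (R₀ + R₁ + R₂) ξ) v m t = -∑ j ∈ Finset.range m,
      (charPoly (R₀ + R₁ + R₂) ξ).coeff j * solJet m (charPoly (R₀ + R₁ + R₂) ξ) v j t := by
  have h1 := congrFun (congrFun (polyAct_solJet (H.monic_charPoly ξ) (H.natDegree_charPoly ξ) v) 0) t
  rw [polyAct_apply (H.natDegree_charPoly ξ).le, Finset.sum_range_succ, H.coeff_charPoly_top] at h1
  simp only [zero_add, one_mul, Pi.zero_apply] at h1
  linear_combination h1

/-- At almost every frequency, the Fourier transform of a solution solves the ordinary differential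
equation. On a fixed ball of frequencies the coefficients of the equation are bounded, so that
`eq_zero_of_tested_system` applies to the difference, tested with functions supported there. -/
lemma DampedSystem.fourier_eq_solJet [NeZero m] (H : DampedSystem r m R₀ R₁ R₂) {s₀ : ℝ}
    {u₀ : ℕ → L2Space n} {u : ℝ → L2Space n}
    (hu : IsCauchySolution m (R₀ + R₁ + R₂) s₀ u₀ u) {T : ℝ} (hT : 0 ≤ T) :
    ((𝓕 (u T) : L2Space n) : RSpace n → ℂ) =ᵐ[volume] fun ζ =>
      solJet m (charPoly (R₀ + R₁ + R₂) ((2 * Real.pi) • ζ))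
        (fun i => (𝓕 (u₀ i) : L2Space n) ζ) 0 T := by
  have hm : 1 ≤ m := by have := H.le_order; omega
  set Q := R₀ + R₁ + R₂ with hQ
  set v : ℕ → RSpace n → ℂ := fun i => ((𝓕 (u₀ i) : L2Space n) : RSpace n → ℂ) with hv
  set y : ℕ → ℝ → RSpace n → ℂ := fun k t ζ =>
    solJet m (charPoly Q ((2 * Real.pi) • ζ)) (fun i => v i ζ) k t with hy
  have hvL : ∀ i < m, MemLp (v i) 2 volume := fun i _ => Lp.memLp _
  have hvm : ∀ i < m, AEStronglyMeasurable (v i) volume := fun i hi => (hvL i hi).1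
  have hym : ∀ k t, AEStronglyMeasurable (y k t) volume := fun k t =>
    aestronglyMeasurable_solJet hvm k t
  set G : RSpace n → ℝ := fun ζ => ∑ i ∈ Finset.range m, ‖v i ζ‖ with hGdef
  have hG : MemLp G 2 volume := memLp_finsetSum _ fun i hi => (hvL i (Finset.mem_range.1 hi)).norm
  have hybd : ∀ (R : ℝ) (k : ℕ), ∃ C, 0 < C ∧ ∀ t ∈ Icc (0 : ℝ) T, ∀ ζ, ‖ζ‖ ≤ R →
      ‖y k t ζ‖ ≤ C * ‖G ζ‖ := by
    intro R k
    obtain ⟨C, hC, hCb⟩ := exists_solJet_bound (m := m)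
      (Q := fun ζ : RSpace n => charPoly Q ((2 * Real.pi) • ζ))
      (fun j => (continuous_coeff_charPoly Q j).comp (continuous_const_smul _))
      (isCompact_closedBall (0 : RSpace n) R) T k
    refine ⟨C, hC, fun t ht ζ hζ => ?_⟩
    rw [Real.norm_of_nonneg (Finset.sum_nonneg fun i _ => norm_nonneg _)]
    exact hCb ζ (by simpa using hζ) t ⟨by linarith [ht.1], ht.2⟩ _
  have hmain : ∀ ψ : RSpace n → ℂ, ContDiff ℝ (⊤ : ℕ∞) ψ → HasCompactSupport ψ →
      ∫ ζ, ψ ζ * (𝓕 (u T) : L2Space n) ζ = ∫ ζ, ψ ζ * y 0 T ζ := by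
    intro ψ hψ hψc
    obtain ⟨R, hR⟩ := hψc.isCompact.isBounded.subset_closedBall (0 : RSpace n)
    let S := {φ : RSpace n → ℂ // ContDiff ℝ (⊤ : ℕ∞) φ ∧ ∀ ζ, R < ‖ζ‖ → φ ζ = 0}
    have hSc : ∀ φ : S, HasCompactSupport φ.1 := fun φ =>
      HasCompactSupport.intro (isCompact_closedBall (0 : RSpace n) R) fun ζ hζ =>
        φ.2.2 ζ (by simpa using hζ)
    have hSL : ∀ φ : S, MemLp φ.1 2 volume := fun φ =>
      memLp_two_of_compactSupport (hSc φ) φ.2.1.continuous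
    let A : ℕ → S → S := fun j φ => ⟨fun ζ => (charPoly Q ((2 * Real.pi) • ζ)).coeff j * φ.1 ζ,
      (contDiff_coeff_charPoly Q j).mul φ.2.1, fun ζ hζ => by
        simp only [φ.2.2 ζ hζ, mul_zero]⟩
    have hcoef : ∀ j, ∃ C : ℝ, ∀ ζ ∈ Metric.closedBall (0 : RSpace n) R,
        ‖(charPoly Q ((2 * Real.pi) • ζ)).coeff j‖ ≤ C := fun j =>
      (isCompact_closedBall (0 : RSpace n) R).exists_bound_of_continuousOn
        (contDiff_coeff_charPoly Q j).continuous.continuousOn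
    choose c hc using hcoef
    set C := ∑ j ∈ Finset.range m, |c j| with hC
    have hC0 : 0 ≤ C := Finset.sum_nonneg fun j _ => abs_nonneg _
    have hA : ∀ j < m, ∀ φ : S, (eLpNorm (A j φ).1 2 volume).toReal ≤
        C * (eLpNorm φ.1 2 volume).toReal := by
      intro j hj φ
      have h1 : ∀ ζ, ‖(A j φ).1 ζ‖ ≤ C * ‖φ.1 ζ‖ := by
        intro ζ
        by_cases hζ : ‖ζ‖ ≤ R
        · simp only [A, norm_mul]
          refine mul_le_mul_of_nonneg_right ?_ (norm_nonneg _)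
          exact (hc j ζ (by simpa using hζ)).trans ((le_abs_self _).trans
            (Finset.single_le_sum (f := fun j => |c j|) (fun j _ => abs_nonneg _)
              (Finset.mem_range.2 hj)))
        · rw [(A j φ).2.2 ζ (not_le.1 hζ), norm_zero]; positivity
      have h2 := eLpNorm_le_mul_eLpNorm_of_ae_le_mul (p := 2) (μ := volume)
        (Eventually.of_forall h1)
      have h3 := ENNReal.toReal_mono (ENNReal.mul_ne_top ENNReal.ofReal_ne_top (hSL φ).2.ne) h2
      rwa [ENNReal.toReal_mul, ENNReal.toReal_ofReal hC0] at h3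
    set f : ℕ → S → ℝ → ℂ := fun k φ t =>
      (∫ ζ, φ.1 ζ * (𝓕 (timeDeriv k u t) : L2Space n) ζ) - ∫ ζ, φ.1 ζ * y k t ζ with hf
    have hyd : ∀ k (φ : S) t, HasDerivAt (fun t => ∫ ζ, φ.1 ζ * y k t ζ)
        (∫ ζ, φ.1 ζ * y (k + 1) t ζ) t := fun k φ t =>
      hasDerivAt_integral_solJet hvL (hSL φ) φ.2.2 k t
    have hud : ∀ k, k + 1 < m → ∀ φ : S, ∀ t, 0 ≤ t → HasDerivWithinAt
        (fun t => ∫ ζ, φ.1 ζ * (𝓕 (timeDeriv k u t) : L2Space n) ζ)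
        (∫ ζ, φ.1 ζ * (𝓕 (timeDeriv (k + 1) u t) : L2Space n) ζ) (Ici 0) t := by
      intro k hk φ t ht
      set F : L2Space n →L[ℝ] ℂ := (pairing (hSL φ) ∘L
        (Lp.fourierTransformₗᵢ (RSpace n) ℂ).toContinuousLinearEquiv.toContinuousLinearMap
        ).restrictScalars ℝ with hF
      have h1 := F.hasFDerivAt.comp_hasDerivWithinAt t
        (timeDeriv_hasDerivWithinAt hu.contDiffOn (show k < m - 1 by omega) ht)
      have h2 : ∀ w, F w = ∫ ζ, φ.1 ζ * (𝓕 w : L2Space n) ζ := fun w => pairing_apply (hSL φ) _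
      simp only [Function.comp_def, h2] at h1
      exact h1
    have hD : ∀ k < m, ∃ D : ℝ, ∀ t ∈ Icc 0 T, ‖timeDeriv k u t‖ ≤ D := by
      intro k hk
      have h1 : ContinuousOn (timeDeriv k u) (Ici 0) :=
        hu.contDiffOn.continuousOn_iteratedDerivWithin
          (by exact_mod_cast (show k ≤ m - 1 by omega)) (uniqueDiffOn_Ici 0)
      exact isCompact_Icc.exists_bound_of_continuousOn (h1.mono Icc_subset_Ici_self)
    choose! D hD using hD
    choose K hK0 hK using hybd R
    set B : ℝ := ∑ k ∈ Finset.range m,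
      (|D k| + (ENNReal.ofReal (K k) * eLpNorm G 2 volume).toReal) with hBdef
    have hzero := eq_zero_of_tested_system (S := S) (N := fun φ => (eLpNorm φ.1 2 volume).toReal)
      (fun φ => ENNReal.toReal_nonneg) hC0 hA (f := f) (T := T) (B := B)
      (fun k hk φ t ht => (hud k hk φ t ht).sub (hyd k φ t).hasDerivWithinAt)
      (fun φ t ht => by
        have h1 := hu.hasDerivWithinAt_fourier hm (fun d hd => H.support_subset hd)
          H.timeCoeff_top φ.2.1 (hSc φ) ht
        have h2 := hyd (m - 1) φ t
        rw [Nat.sub_add_cancel hm] at h2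
        convert! h1.sub h2.hasDerivWithinAt using 1
        have h3 : ∫ ζ, φ.1 ζ * y m t ζ = -∑ j ∈ Finset.range m, ∫ ζ, (A j φ).1 ζ * y j t ζ := by
          rw [← integral_finsetSum, ← integral_neg]
          · refine integral_congr_ae (Eventually.of_forall fun ζ => ?_)
            simp only [hy, A]
            rw [solJet_top_eq H, mul_neg, Finset.mul_sum]
            congr 1
            exact Finset.sum_congr rfl fun j _ => by ring
          · intro j _
            obtain ⟨C', hC', hCb'⟩ := exists_solJet_bound (m := m)
              (Q := fun ζ : RSpace n => charPoly Q ((2 * Real.pi) • ζ))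
              (fun j => (continuous_coeff_charPoly Q j).comp (continuous_const_smul _))
              (isCompact_closedBall (0 : RSpace n) R) t j
            refine (norm_integral_mul_le (hSL (A j φ)) (A j φ).2.2 (hym j t) hG
              (C := C') fun ζ hζ => ?_).1
            rw [Real.norm_of_nonneg (Finset.sum_nonneg fun i _ => norm_nonneg _)]
            exact hCb' ζ (by simpa using hζ) t ⟨by linarith, le_rfl⟩ _
        rw [h3, neg_sub_neg, ← neg_sub, ← Finset.sum_sub_distrib])
      (fun k hk φ => by
        simp only [hf]
        rw [sub_eq_zero]
        refine integral_congr_ae (Eventually.of_forall fun ζ => ?_)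
        simp only [hy]
        rw [solJet_zero _ _ hk, hu.initial k hk])
      (Finset.sum_nonneg fun k _ => add_nonneg (abs_nonneg _) ENNReal.toReal_nonneg)
      (fun k hk φ t ht => by
        simp only [hf]
        refine (norm_sub_le _ _).trans ?_
        have h1 : ‖∫ ζ, φ.1 ζ * (𝓕 (timeDeriv k u t) : L2Space n) ζ‖ ≤
            (eLpNorm φ.1 2 volume).toReal * |D k| := by
          rw [← pairing_apply (hSL φ)]
          refine (norm_pairing_le _ _).trans (mul_le_mul_of_nonneg_left ?_ ENNReal.toReal_nonneg)
          rw [Lp.norm_fourier_eq]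
          exact (hD k hk t ht).trans (le_abs_self _)
        have h2 := (norm_integral_mul_le (hSL φ) φ.2.2 (hym k t) hG (hK k t ht)).2
        have h3 := Finset.single_le_sum (f := fun k =>
          |D k| + (ENNReal.ofReal (K k) * eLpNorm G 2 volume).toReal)
          (fun k _ => add_nonneg (abs_nonneg _) ENNReal.toReal_nonneg) (Finset.mem_range.2 hk)
        have h4 := mul_le_mul_of_nonneg_left h3
          (ENNReal.toReal_nonneg (a := eLpNorm φ.1 2 volume))
        simp only [mul_add] at h4
        rw [mul_comm B]
        exact (add_le_add h1 h2).trans h4)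
      0 (by omega) ⟨ψ, hψ, fun ζ hζ => ?_⟩ T ⟨hT, le_rfl⟩
    · simp only [hf, sub_eq_zero] at hzero
      rw [← hzero]
      simp [timeDeriv]
    · by_contra hne
      have := hR (subset_tsupport _ hne)
      rw [mem_closedBall_zero_iff] at this
      linarith
  have hloc1 : LocallyIntegrable ((𝓕 (u T) : L2Space n) : RSpace n → ℂ) volume :=
    (Lp.memLp _).locallyIntegrable (by norm_num)
  have hloc2 : LocallyIntegrable (y 0 T) volume := by
    rw [locallyIntegrable_iff]
    intro K hK
    obtain ⟨R, hR⟩ := hK.isBounded.subset_closedBall (0 : RSpace n)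
    obtain ⟨C, hC, hCb⟩ := hybd R 0
    have h1 : IntegrableOn (fun ζ => C * ‖G ζ‖) K volume :=
      ((locallyIntegrable_iff.1 (hG.locallyIntegrable (by norm_num)) K hK).norm).const_mul C
    refine Integrable.mono' h1 (hym 0 T).restrict ?_
    refine (ae_restrict_iff' hK.measurableSet).2 (Eventually.of_forall fun ζ hζ => ?_)
    exact hCb T ⟨hT, le_rfl⟩ ζ (by simpa using hR hζ)
  have hae := ae_eq_zero_of_integral_contDiff_smul_eq_zero (hloc1.sub hloc2) fun g hg hgc => by
    have hg' : ContDiff ℝ (⊤ : ℕ∞) fun ζ => (g ζ : ℂ) := Complex.ofRealCLM.contDiff.comp hg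
    have hgc' : HasCompactSupport fun ζ => (g ζ : ℂ) := hgc.comp_left (g := Complex.ofReal) rfl
    have h1 := hmain _ hg' hgc'
    have h2 : ∀ w : RSpace n → ℂ, ∀ ζ, (g ζ : ℂ) * w ζ = g ζ • w ζ := fun w ζ =>
      (Complex.real_smul).symm
    simp only [h2] at h1
    simp only [Pi.sub_apply, smul_sub]
    rw [integral_sub, h1, sub_self]
    · exact hloc1.integrable_smul_left_of_hasCompactSupport hg.continuous hgc
    · exact hloc2.integrable_smul_left_of_hasCompactSupport hg.continuous hgc
  filter_upwards [hae] with ζ hζ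
  exact sub_eq_zero.1 hζ

end IdentificationMain

/-! ### Regularity of the solution with values in `L²` -/

/-- Dominated convergence in `L²`. -/
lemma tendsto_eLpNorm_two_of_dominated {X ι : Type*} [MeasurableSpace X] {μ : Measure X}
    {l : Filter ι} [l.IsCountablyGenerated] {f : ι → X → ℂ} {g : X → ℝ}
    (hm : ∀ᶠ i in l, AEStronglyMeasurable (f i) μ)
    (hb : ∀ᶠ i in l, ∀ᵐ x ∂μ, ‖f i x‖ ≤ g x) (hg : MemLp g 2 μ)
    (hl : ∀ᵐ x ∂μ, Tendsto (fun i => f i x) l (𝓝 0)) :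
    Tendsto (fun i => eLpNorm (f i) 2 μ) l (𝓝 0) := by
  have h1 : Tendsto (fun i => ∫⁻ x, ‖f i x‖ₑ ^ (2 : ℝ) ∂μ) l (𝓝 (∫⁻ _, 0 ∂μ)) := by
    refine tendsto_lintegral_filter_of_dominated_convergence' (fun x => ‖g x‖ₑ ^ (2 : ℝ)) ?_ ?_ ?_ ?_
    · filter_upwards [hm] with i hi
      exact hi.enorm.pow_const _
    · filter_upwards [hb] with i hi
      filter_upwards [hi] with x hx
      refine ENNReal.rpow_le_rpow ?_ (by norm_num)
      rw [enorm_le_iff_norm_le]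
      exact hx.trans (le_abs_self _)
    · have h2 := hg.2
      rw [eLpNorm_eq_lintegral_rpow_enorm_toReal (by norm_num) (by norm_num)] at h2
      simp only [ENNReal.toReal_ofNat] at h2
      exact ((ENNReal.rpow_lt_top_iff_of_pos (by norm_num)).1 h2).ne
    · filter_upwards [hl] with x hx
      have h3 := (ENNReal.continuous_rpow_const (y := 2)).tendsto (‖(0 : ℂ)‖ₑ) |>.comp hx.enorm
      simpa [Function.comp_def] using h3
  simp only [lintegral_zero] at h1
  have h4 := (ENNReal.continuous_rpow_const (y := 1 / 2)).tendsto 0 |>.comp h1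
  simp only [Function.comp_def] at h4
  rw [ENNReal.zero_rpow_of_pos (by norm_num)] at h4
  refine h4.congr fun i => ?_
  rw [eLpNorm_eq_lintegral_rpow_enorm_toReal (by norm_num) (by norm_num)]
  simp

/-- A jet which is dominated in `L²`, locally uniformly in time, is smooth with values in `L²`. -/
lemma contDiffOn_of_dominated {X : Type*} [MeasurableSpace X] {μ : Measure X}
    {y : ℕ → ℝ → X → ℂ} {Y : ℕ → ℝ → Lp ℂ 2 μ} {N : ℕ}
    (hY : ∀ k ≤ N, ∀ t, 0 ≤ t → (Y k t : X → ℂ) =ᵐ[μ] y k t)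
    (hy : ∀ k t x, HasDerivAt (fun t => y k t x) (y (k + 1) t x) t)
    (hbd : ∀ T : ℝ, ∃ G : X → ℝ, MemLp G 2 μ ∧ ∀ k ≤ N, ∀ t ∈ Icc 0 T, ∀ x, ‖y k t x‖ ≤ G x) :
    ContDiffOn ℝ (N : WithTop ℕ∞) (Y 0) (Ici 0) ∧
      ∀ k ≤ N, ∀ t, 0 ≤ t → iteratedDerivWithin k (Y 0) (Ici 0) t = Y k t := by
  have hnear : ∀ {t : ℝ}, 0 ≤ t → ∀ᶠ s in 𝓝[Ici 0] t, s ∈ Icc 0 (t + 1) := by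
    intro t ht
    filter_upwards [self_mem_nhdsWithin, mem_nhdsWithin_of_mem_nhds (Iio_mem_nhds (lt_add_one t))]
      with s hs hs'
    exact ⟨hs, hs'.le⟩
  have hnorm : ∀ {Z : Lp ℂ 2 μ} {f : X → ℂ}, (Z : X → ℂ) =ᵐ[μ] f →
      ‖Z‖ = (eLpNorm f 2 μ).toReal := fun {Z f} h => by rw [Lp.norm_def, eLpNorm_congr_ae h]
  have hmeas : ∀ k ≤ N, ∀ t, 0 ≤ t → AEStronglyMeasurable (y k t) μ := fun k hk t ht =>
    (Lp.aestronglyMeasurable _).congr (hY k hk t ht)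
  have hcont : ∀ k ≤ N, ContinuousOn (Y k) (Ici 0) := by
    intro k hk t ht
    obtain ⟨G, hG, hGb⟩ := hbd (t + 1)
    have htm : t ∈ Icc 0 (t + 1) := ⟨ht, by linarith⟩
    rw [ContinuousWithinAt, tendsto_iff_norm_sub_tendsto_zero]
    have h1 : Tendsto (fun s => eLpNorm (fun x => y k s x - y k t x) 2 μ) (𝓝[Ici 0] t)
        (𝓝 0) := by
      refine tendsto_eLpNorm_two_of_dominated (g := fun x => 2 * G x) ?_ ?_ (hG.const_mul 2) ?_
      · filter_upwards [hnear ht] with s hs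
        exact (hmeas k hk s hs.1).sub (hmeas k hk t ht)
      · filter_upwards [hnear ht] with s hs
        refine Eventually.of_forall fun x => (norm_sub_le _ _).trans ?_
        linarith [hGb k hk s hs x, hGb k hk t htm x]
      · refine Eventually.of_forall fun x => ?_
        have h2 := ((hy k t x).continuousAt.tendsto.mono_left
          (nhdsWithin_le_nhds (s := Ici 0))).sub_const (y k t x)
        rwa [sub_self] at h2
    have h3 := (ENNReal.tendsto_toReal ENNReal.zero_ne_top).comp h1
    refine h3.congr' ?_
    filter_upwards [hnear ht] with s hs
    refine (hnorm ?_).symm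
    filter_upwards [Lp.coeFn_sub (Y k s) (Y k t), hY k hk s hs.1, hY k hk t ht] with x e1 e2 e3
    rw [e1, Pi.sub_apply, e2, e3]
  have hder : ∀ k < N, ∀ t, 0 ≤ t → HasDerivWithinAt (Y k) (Y (k + 1) t) (Ici 0) t := by
    intro k hk t ht
    obtain ⟨G, hG, hGb⟩ := hbd (t + 1)
    have htm : t ∈ Icc 0 (t + 1) := ⟨ht, by linarith⟩
    have hsub : 𝓝[Ici 0 \ {t}] t ≤ 𝓝[Ici 0] t := nhdsWithin_mono _ sdiff_subset
    rw [hasDerivWithinAt_iff_tendsto_slope, tendsto_iff_norm_sub_tendsto_zero]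
    have h1 : Tendsto (fun s => eLpNorm
        (fun x => ((s - t : ℝ) : ℂ)⁻¹ * (y k s x - y k t x) - y (k + 1) t x) 2 μ)
        (𝓝[Ici 0 \ {t}] t) (𝓝 0) := by
      refine tendsto_eLpNorm_two_of_dominated (g := fun x => 2 * G x) ?_ ?_ (hG.const_mul 2) ?_
      · filter_upwards [hsub (hnear ht)] with s hs
        exact (((hmeas k hk.le s hs.1).sub (hmeas k hk.le t ht)).const_mul _).sub
          (hmeas (k + 1) hk t ht)
      · filter_upwards [hsub (hnear ht), self_mem_nhdsWithin] with s hs hst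
        refine Eventually.of_forall fun x => (norm_sub_le _ _).trans ?_
        have h2 := (convex_Icc (0 : ℝ) (t + 1)).norm_image_sub_le_of_norm_hasDerivWithin_le
          (f := fun t => y k t x) (fun τ _ => (hy k τ x).hasDerivWithinAt)
          (fun τ hτ => hGb (k + 1) hk τ hτ x) htm hs
        have h3 : ‖((s - t : ℝ) : ℂ)⁻¹ * (y k s x - y k t x)‖ ≤ G x := by
          have h4 : 0 < ‖s - t‖ := norm_pos_iff.2 (sub_ne_zero.2 hst.2)
          rw [norm_mul, norm_inv, Complex.norm_real, inv_mul_le_iff₀ h4, mul_comm]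
          exact h2
        linarith [hGb (k + 1) hk t htm x]
      · refine Eventually.of_forall fun x => ?_
        have h2 := (hasDerivAt_iff_tendsto_slope.1 (hy k t x)).mono_left
          (nhdsWithin_mono t (show Ici 0 \ {t} ⊆ {t}ᶜ from fun s hs => hs.2))
        have h3 := h2.sub_const (y (k + 1) t x)
        rw [sub_self] at h3
        refine h3.congr fun s => ?_
        rw [slope_def_module, Complex.real_smul, Complex.ofReal_inv]
    have h3 := (ENNReal.tendsto_toReal ENNReal.zero_ne_top).comp h1
    refine h3.congr' ?_
    filter_upwards [hsub (hnear ht)] with s hs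
    refine (hnorm ?_).symm
    rw [slope_def_module]
    filter_upwards [Lp.coeFn_sub ((s - t)⁻¹ • (Y k s - Y k t)) (Y (k + 1) t),
      Lp.coeFn_smul (s - t)⁻¹ (Y k s - Y k t), Lp.coeFn_sub (Y k s) (Y k t),
      hY k hk.le s hs.1, hY k hk.le t ht, hY (k + 1) hk t ht] with x e1 e2 e3 e4 e5 e6
    rw [e1, Pi.sub_apply, e2, Pi.smul_apply, e3, Pi.sub_apply, e4, e5, e6, Complex.real_smul,
      Complex.ofReal_inv]
  have hiter : ∀ k ≤ N, ∀ t, 0 ≤ t → iteratedDerivWithin k (Y 0) (Ici 0) t = Y k t := by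
    intro k
    induction k with
    | zero => intro _ t _; simp
    | succ k ih =>
      intro hk t ht
      rw [iteratedDerivWithin_succ, derivWithin_congr (s := Ici 0) (fun s hs => ih (by omega) s hs)
        (ih (by omega) t ht)]
      exact (hder k hk t ht).derivWithin (uniqueDiffOn_Ici 0 t ht)
  refine ⟨?_, hiter⟩
  rw [contDiffOn_nat_iff_continuousOn_differentiableOn_deriv (uniqueDiffOn_Ici 0)]
  exact ⟨fun k hk => (hcont k hk).congr fun t ht => hiter k hk t ht,
    fun k hk t ht => ((hder k hk t ht).differentiableWithinAt).congr
      (fun s hs => hiter k hk.le s hs) (hiter k hk.le t ht)⟩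

section Regularity

variable {n r m : ℕ} {R₀ R₁ R₂ : DiffOp n}

lemma memLp_weight_fourier {a : ℝ} {f : L2Space n}
    (hf : TemperedDistribution.MemSobolev a 2 (f : 𝓢'(RSpace n, ℂ))) :
    MemLp (fun ζ : RSpace n => (((1 + ‖ζ‖ ^ 2) ^ (a / 2) : ℝ) : ℂ) * (𝓕 f : L2Space n) ζ) 2
      volume := by
  obtain ⟨g, hg⟩ := TemperedDistribution.memSobolev_iff_exists_smulLeftCLM_fourier.1 hf
  rw [Lp.fourier_toTemperedDistribution_eq] at hg
  have hcont : Continuous fun ζ : RSpace n => (((1 + ‖ζ‖ ^ 2) ^ (a / 2) : ℝ) : ℂ) := by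
    refine Complex.continuous_ofReal.comp (Continuous.rpow_const (by fun_prop) fun ζ => Or.inl ?_)
    positivity
  have htg : (fun ζ : RSpace n => (((1 + ‖ζ‖ ^ 2) ^ (a / 2) : ℝ) : ℂ)).HasTemperateGrowth := by
    fun_prop
  refine (memLp_congr_ae ?_).2 (Lp.memLp g)
  have hloc : LocallyIntegrable ((𝓕 f : L2Space n) : RSpace n → ℂ) volume :=
    (Lp.memLp _).locallyIntegrable (by norm_num)
  refine ae_eq_of_integral_contDiff_smul_eq ?_ ((Lp.memLp g).locallyIntegrable (by norm_num)) ?_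
  · exact hloc.continuous_smul hcont
  · intro φ hφ hφc
    have hφ' : ContDiff ℝ (⊤ : ℕ∞) fun ζ => (φ ζ : ℂ) := Complex.ofRealCLM.contDiff.comp hφ
    have hφc' : HasCompactSupport fun ζ => (φ ζ : ℂ) := hφc.comp_left (g := Complex.ofReal) rfl
    have h1 := congrArg (fun T : 𝓢'(RSpace n, ℂ) => T (hφc'.toSchwartzMap hφ')) hg
    simp only [TemperedDistribution.smulLeftCLM_apply_apply, Lp.toTemperedDistribution_apply,
      SchwartzMap.smulLeftCLM_apply_apply htg] at h1
    have h2 : ∀ ζ, (hφc'.toSchwartzMap hφ') ζ = (φ ζ : ℂ) := fun ζ => rfl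
    simp only [h2, smul_eq_mul] at h1
    simp only [Complex.real_smul]
    rw [← h1]
    refine integral_congr_ae (Eventually.of_forall fun ζ => ?_)
    simp only
    ring

/-- Away from zero the weight in a homogeneous norm is dominated by the Sobolev weight of the
data. -/
lemma exists_weight_le {δ : ℝ} (hδ : 0 < δ) {s s₀ : ℝ} {k i : ℕ} (hks : k + s ≤ s₀)
    (hi : (i : ℝ) ≤ s₀) : ∃ C : ℝ, 0 < C ∧ ∀ ζ : RSpace n, δ ≤ ‖(2 * Real.pi) • ζ‖ →
      ‖(2 * Real.pi) • ζ‖ ^ s * (‖(2 * Real.pi) • ζ‖ ^ k / ‖(2 * Real.pi) • ζ‖ ^ i) ≤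
        C * (1 + ‖ζ‖ ^ 2) ^ ((s₀ - i) / 2) := by
  set e : ℝ := s + k - i with he
  have hpi := Real.pi_pos
  refine ⟨(2 * Real.pi) ^ e + δ ^ e, by positivity, fun ζ hζ => ?_⟩
  have hnorm : ‖(2 * Real.pi) • ζ‖ = 2 * Real.pi * ‖ζ‖ := by
    rw [norm_smul, Real.norm_of_nonneg (by positivity)]
  have hρ : 0 < ‖(2 * Real.pi) • ζ‖ := hδ.trans_le hζ
  have h1 : ‖(2 * Real.pi) • ζ‖ ^ s * (‖(2 * Real.pi) • ζ‖ ^ k / ‖(2 * Real.pi) • ζ‖ ^ i) =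
      ‖(2 * Real.pi) • ζ‖ ^ e := by
    rw [he, Real.rpow_sub hρ, Real.rpow_add hρ, Real.rpow_natCast, Real.rpow_natCast]; ring
  rw [h1]
  have hW : 1 ≤ (1 + ‖ζ‖ ^ 2) := by nlinarith [norm_nonneg ζ]
  have hW1 : 1 ≤ (1 + ‖ζ‖ ^ 2) ^ ((s₀ - i) / 2) := Real.one_le_rpow hW (by linarith)
  have hp1 : 0 ≤ (2 * Real.pi) ^ e := by positivity
  have hp2 : 0 ≤ δ ^ e := by positivity
  rcases le_or_gt 0 e with h | h
  · have h2 : ‖ζ‖ ^ e ≤ (1 + ‖ζ‖ ^ 2) ^ ((s₀ - i) / 2) := by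
      have h3 : ‖ζ‖ ≤ (1 + ‖ζ‖ ^ 2) ^ (1 / 2 : ℝ) := by
        rw [← Real.sqrt_eq_rpow]; exact Real.le_sqrt_of_sq_le (by linarith)
      calc ‖ζ‖ ^ e ≤ ((1 + ‖ζ‖ ^ 2) ^ (1 / 2 : ℝ)) ^ e :=
            Real.rpow_le_rpow (norm_nonneg _) h3 h
        _ = (1 + ‖ζ‖ ^ 2) ^ (1 / 2 * e) := by rw [← Real.rpow_mul (by positivity)]
        _ ≤ _ := Real.rpow_le_rpow_of_exponent_le hW (by rw [he]; linarith)
    rw [hnorm, Real.mul_rpow (by positivity) (norm_nonneg _)]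
    nlinarith [mul_le_mul_of_nonneg_left h2 hp1]
  · have h2 : ‖(2 * Real.pi) • ζ‖ ^ e ≤ δ ^ e := Real.rpow_le_rpow_of_nonpos hδ hζ h.le
    nlinarith [mul_le_mul_of_nonneg_left hW1 hp2, mul_nonneg hp1 (zero_le_one.trans hW1)]

end Regularity

section Scaling

variable {n : ℕ}

lemma map_smul_volume {c : ℝ} (hc : 0 < c) :
    Measure.map (fun ξ : RSpace n => c • ξ) volume = ENNReal.ofReal ((c ^ n)⁻¹) • volume := by
  have h := Measure.map_addHaar_smul (volume : Measure (RSpace n)) hc.ne'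
  rw [finrank_euclideanSpace_fin, abs_of_pos (by positivity)] at h
  exact h

lemma ae_comp_smul {c : ℝ} (hc : 0 < c) {p : RSpace n → Prop} (h : ∀ᵐ ξ, p ξ) :
    ∀ᵐ ξ : RSpace n, p (c • ξ) := by
  have h1 : ∀ᵐ ξ ∂(Measure.map (fun ξ : RSpace n => c • ξ) volume), p ξ := by
    rw [map_smul_volume hc]
    exact Measure.ae_smul_measure h _
  exact ae_of_ae_map (by fun_prop) h1

lemma aestronglyMeasurable_comp_smul {E : Type*} [NormedAddCommGroup E] {c : ℝ} (hc : 0 < c)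
    {f : RSpace n → E} (hf : AEStronglyMeasurable f volume) :
    AEStronglyMeasurable (fun ξ => f (c • ξ)) volume := by
  refine AEStronglyMeasurable.comp_measurable (f := fun ξ : RSpace n => c • ξ) (g := f) ?_
    (by fun_prop)
  rw [map_smul_volume hc]
  exact hf.smul_measure _

lemma eLpNorm_comp_smul {E : Type*} [NormedAddCommGroup E] {c : ℝ} (hc : 0 < c)
    {f : RSpace n → E} (hf : AEStronglyMeasurable f volume) :
    eLpNorm (fun ξ => f (c • ξ)) 2 volume =
      ENNReal.ofReal (c ^ (-(n : ℝ) / 2)) * eLpNorm f 2 volume := by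
  have h1 : eLpNorm f 2 (Measure.map (fun ξ : RSpace n => c • ξ) volume) =
      eLpNorm (fun ξ => f (c • ξ)) 2 volume := by
    refine eLpNorm_map_measure ?_ (by fun_prop)
    rw [map_smul_volume hc]
    exact hf.smul_measure _
  rw [← h1, map_smul_volume hc, eLpNorm_smul_measure_of_ne_top (by norm_num), smul_eq_mul]
  congr 1
  rw [ENNReal.ofReal_rpow_of_pos (by positivity)]
  congr 1
  rw [← Real.rpow_natCast, ← Real.rpow_neg hc.le, ← Real.rpow_mul hc.le]
  congr 1
  simp
  ring

lemma memLp_comp_smul {E : Type*} [NormedAddCommGroup E] {c : ℝ} (hc : 0 < c)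
    {f : RSpace n → E} (hf : MemLp f 2 volume) : MemLp (fun ξ => f (c • ξ)) 2 volume := by
  refine ⟨aestronglyMeasurable_comp_smul hc hf.1, ?_⟩
  rw [eLpNorm_comp_smul hc hf.1]
  exact ENNReal.mul_lt_top ENNReal.ofReal_lt_top hf.2

end Scaling

section SolutionRegularity

variable {n r m : ℕ} {R₀ R₁ R₂ : DiffOp n} [NeZero m]

lemma exists_solJet_weight_bound (H : DampedSystem r m R₀ R₁ R₂) {s₀ : ℝ} (hs₀ : (m : ℝ) - 1 ≤ s₀)
    {k : ℕ} (hk : (k : ℝ) ≤ s₀) (T : ℝ) :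
    ∃ C : ℝ, 0 < C ∧ ∀ t ∈ Icc 0 T, ∀ (ζ : RSpace n) (v : ℕ → ℂ),
      ‖solJet m (charPoly (R₀ + R₁ + R₂) ((2 * Real.pi) • ζ)) v k t‖ ≤
        C * ∑ i ∈ Finset.range m, (1 + ‖ζ‖ ^ 2) ^ ((s₀ - i) / 2) * ‖v i‖ := by
  have him : ∀ i < m, (i : ℝ) ≤ s₀ := fun i hi => by
    have : (i : ℝ) + 1 ≤ m := by exact_mod_cast hi
    linarith
  obtain ⟨c, hc, hout⟩ := H.outer_estimate one_pos
  obtain ⟨C₁, hC₁, hC₁b⟩ := hout k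
  obtain ⟨C₂, hC₂, hC₂b⟩ := exists_solJet_bound (m := m)
    (Q := fun ξ : RSpace n => charPoly (R₀ + R₁ + R₂) ξ)
    (fun j => continuous_coeff_charPoly _ j) (isCompact_closedBall (0 : RSpace n) 1) T k
  have hw : ∀ i, ∃ C : ℝ, 0 < C ∧ (i < m → ∀ ζ : RSpace n, 1 ≤ ‖(2 * Real.pi) • ζ‖ →
      ‖(2 * Real.pi) • ζ‖ ^ k / ‖(2 * Real.pi) • ζ‖ ^ i ≤ C * (1 + ‖ζ‖ ^ 2) ^ ((s₀ - i) / 2)) := by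
    intro i
    by_cases hi : i < m
    · obtain ⟨C, hC, h⟩ := exists_weight_le (n := n) one_pos (s := 0) (k := k) (i := i)
        (by linarith) (him i hi)
      refine ⟨C, hC, fun _ ζ hζ => ?_⟩
      have := h ζ hζ
      rwa [Real.rpow_zero, one_mul] at this
    · exact ⟨1, one_pos, fun h => absurd h hi⟩
  choose D hD hDb using hw
  refine ⟨C₂ + C₁ * ∑ i ∈ Finset.range m, D i, ?_, fun t ht ζ v => ?_⟩
  · have : 0 ≤ ∑ i ∈ Finset.range m, D i := Finset.sum_nonneg fun i _ => (hD i).le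
    positivity
  have hDs : 0 ≤ ∑ i ∈ Finset.range m, D i := Finset.sum_nonneg fun i _ => (hD i).le
  set S := ∑ i ∈ Finset.range m, (1 + ‖ζ‖ ^ 2) ^ ((s₀ - i) / 2) * ‖v i‖ with hS
  have hS0 : 0 ≤ S := Finset.sum_nonneg fun i _ => by positivity
  have hW : 1 ≤ (1 + ‖ζ‖ ^ 2) := by nlinarith [norm_nonneg ζ]
  rcases le_total ‖(2 * Real.pi) • ζ‖ 1 with h | h
  · have h1 := hC₂b ((2 * Real.pi) • ζ) (by simpa using h) t ⟨by linarith [ht.1, ht.2], ht.2⟩ v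
    have h2 : ∑ i ∈ Finset.range m, ‖v i‖ ≤ S := Finset.sum_le_sum fun i hi => by
      have := him i (Finset.mem_range.1 hi)
      exact le_mul_of_one_le_left (norm_nonneg _) (Real.one_le_rpow hW (by linarith))
    have h3 : C₂ * ∑ i ∈ Finset.range m, ‖v i‖ ≤ C₂ * S := by gcongr
    have h4 : 0 ≤ C₁ * (∑ i ∈ Finset.range m, D i) * S := by positivity
    linarith
  · have h1 := hC₁b _ h _ (isJet_solJet (m := m) _ v)
      (polyAct_solJet (H.monic_charPoly _) (H.natDegree_charPoly _) v) t ht.1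
    have h2 : ∑ i ∈ Finset.range m, ‖(2 * Real.pi) • ζ‖ ^ k / ‖(2 * Real.pi) • ζ‖ ^ i *
        ‖solJet m (charPoly (R₀ + R₁ + R₂) ((2 * Real.pi) • ζ)) v i 0‖ ≤
        (∑ i ∈ Finset.range m, D i) * S := by
      rw [hS, Finset.mul_sum]
      refine Finset.sum_le_sum fun i hi => ?_
      rw [solJet_zero _ _ (Finset.mem_range.1 hi), ← mul_assoc]
      refine mul_le_mul_of_nonneg_right ?_ (norm_nonneg _)
      refine (hDb i (Finset.mem_range.1 hi) ζ h).trans ?_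
      gcongr
      exact Finset.single_le_sum (f := D) (fun i _ => (hD i).le) hi
    have h3 : C₁ * Real.exp (-c * t) ≤ C₁ := by
      refine mul_le_of_le_one_right hC₁.le ?_
      rw [Real.exp_le_one_iff]
      have := mul_nonneg hc.le ht.1
      linarith
    have h4 : C₁ * Real.exp (-c * t) * ∑ i ∈ Finset.range m,
        ‖(2 * Real.pi) • ζ‖ ^ k / ‖(2 * Real.pi) • ζ‖ ^ i *
        ‖solJet m (charPoly (R₀ + R₁ + R₂) ((2 * Real.pi) • ζ)) v i 0‖ ≤
        C₁ * ((∑ i ∈ Finset.range m, D i) * S) := by gcongr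
    have h5 : 0 ≤ C₂ * S := by positivity
    linarith

/-- A solution is of class `C^k` with values in `L²` for all `k ≤ s₀`, and the Fourier transforms of
its time derivatives solve the ordinary differential equation at each frequency. -/
lemma DampedSystem.regularity (H : DampedSystem r m R₀ R₁ R₂) {s₀ : ℝ}
    (hs₀ : (m : ℝ) - 1 ≤ s₀) {u₀ : ℕ → L2Space n}
    (hu₀ : ∀ j < m, TemperedDistribution.MemSobolev (s₀ - j) 2 (u₀ j : 𝓢'(RSpace n, ℂ)))
    {u : ℝ → L2Space n} (hu : IsCauchySolution m (R₀ + R₁ + R₂) s₀ u₀ u) {N : ℕ}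
    (hN : (N : ℝ) ≤ s₀) :
    ContDiffOn ℝ (N : WithTop ℕ∞) u (Ici 0) ∧ ∀ t, 0 ≤ t →
      hatFn (timeDeriv N u t) =ᵐ[volume] fun ξ =>
        solJet m (charPoly (R₀ + R₁ + R₂) ξ) (fun i => hatFn (u₀ i) ξ) N t := by
  classical
  set Q := R₀ + R₁ + R₂ with hQ
  set v : ℕ → RSpace n → ℂ := fun i => ((𝓕 (u₀ i) : L2Space n) : RSpace n → ℂ) with hv
  set y : ℕ → ℝ → RSpace n → ℂ := fun k t ζ =>
    solJet m (charPoly Q ((2 * Real.pi) • ζ)) (fun i => v i ζ) k t with hy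
  have hym : ∀ k t, AEStronglyMeasurable (y k t) volume := fun k t =>
    aestronglyMeasurable_solJet (fun i _ => Lp.aestronglyMeasurable _) k t
  set G : RSpace n → ℝ := fun ζ =>
    ∑ i ∈ Finset.range m, (1 + ‖ζ‖ ^ 2) ^ ((s₀ - i) / 2) * ‖v i ζ‖ with hG
  have hGL : MemLp G 2 volume := by
    refine memLp_finsetSum _ fun i hi => ?_
    have h1 := (memLp_weight_fourier (hu₀ i (Finset.mem_range.1 hi))).norm
    refine (memLp_congr_ae (Eventually.of_forall fun ζ => ?_)).1 h1
    simp only [norm_mul, Complex.norm_real]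
    rw [Real.norm_of_nonneg (by positivity)]
  have hkb : ∀ T : ℝ, ∀ k : ℕ, ∃ C : ℝ, 0 < C ∧
      (k ≤ N → ∀ t ∈ Icc 0 T, ∀ ζ, ‖y k t ζ‖ ≤ C * G ζ) := by
    intro T k
    by_cases hk : k ≤ N
    · obtain ⟨C, hC, h⟩ := exists_solJet_weight_bound H hs₀ (k := k)
        (le_trans (by exact_mod_cast hk) hN) T
      exact ⟨C, hC, fun _ t ht ζ => h t ht ζ _⟩
    · exact ⟨1, one_pos, fun h => absurd h hk⟩
  have hG0 : ∀ ζ, 0 ≤ G ζ := fun ζ => Finset.sum_nonneg fun i _ => by positivity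
  have hbd : ∀ T : ℝ, ∃ G' : RSpace n → ℝ, MemLp G' 2 volume ∧
      ∀ k ≤ N, ∀ t ∈ Icc 0 T, ∀ ζ, ‖y k t ζ‖ ≤ G' ζ := by
    intro T
    choose C hC hCb using hkb T
    refine ⟨fun ζ => (∑ k ∈ Finset.range (N + 1), C k) * G ζ, hGL.const_mul _,
      fun k hk t ht ζ => (hCb k hk t ht ζ).trans ?_⟩
    exact mul_le_mul_of_nonneg_right (Finset.single_le_sum (f := C) (fun k _ => (hC k).le)
      (Finset.mem_range.2 (by omega))) (hG0 ζ)
  have hyL : ∀ k ≤ N, ∀ t, 0 ≤ t → MemLp (y k t) 2 volume := by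
    intro k hk t ht
    obtain ⟨G', hG', hb⟩ := hbd t
    exact hG'.mono' (hym k t) (Eventually.of_forall fun ζ => hb k hk t ⟨ht, le_rfl⟩ ζ)
  set Y : ℕ → ℝ → L2Space n := fun k t =>
    if h : MemLp (y k t) 2 volume then h.toLp (y k t) else 0 with hYdef
  have hYy : ∀ k ≤ N, ∀ t, 0 ≤ t → (Y k t : RSpace n → ℂ) =ᵐ[volume] y k t := by
    intro k hk t ht
    simp only [hYdef, dif_pos (hyL k hk t ht)]
    exact MemLp.coeFn_toLp _
  obtain ⟨hYN, hYd⟩ := contDiffOn_of_dominated hYy (fun k t ζ => isJet_solJet _ _ k t) hbd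
  set e : L2Space n ≃ₗᵢ[ℂ] L2Space n := Lp.fourierTransformₗᵢ (RSpace n) ℂ with he
  have heu : ∀ t ∈ Ici (0 : ℝ), e (u t) = Y 0 t := by
    intro t ht
    refine Lp.ext ?_
    exact (H.fourier_eq_solJet hu ht).trans (hYy 0 (Nat.zero_le _) t ht).symm
  have huN : ContDiffOn ℝ (N : WithTop ℕ∞) u (Ici 0) := by
    let L : L2Space n →L[ℝ] L2Space n :=
      (e.symm.toContinuousLinearEquiv.toContinuousLinearMap).restrictScalars ℝ
    have h1 := L.contDiff.comp_contDiffOn hYN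
    refine h1.congr fun t ht => ?_
    change u t = e.symm (Y 0 t)
    rw [← heu t ht, e.symm_apply_apply]
  refine ⟨huN, fun t ht => ?_⟩
  have h1 : e (timeDeriv N u t) = Y N t := by
    let L : L2Space n →L[ℝ] L2Space n :=
      (e.toContinuousLinearEquiv.toContinuousLinearMap).restrictScalars ℝ
    have h2 := iteratedDerivWithin_clm_comp L huN ht
    have h3 : iteratedDerivWithin N (fun τ => L (u τ)) (Ici 0) t =
        iteratedDerivWithin N (Y 0) (Ici 0) t :=
      iteratedDerivWithin_congr (fun τ hτ => heu τ hτ) ht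
    rw [h3, hYd N le_rfl t ht] at h2
    exact h2.symm
  have h2 : ((𝓕 (timeDeriv N u t) : L2Space n) : RSpace n → ℂ) =ᵐ[volume] y N t := by
    have h3 := hYy N le_rfl t ht
    rw [← h1] at h3
    exact h3
  have hpi : 0 < (2 * Real.pi)⁻¹ := by positivity
  filter_upwards [ae_comp_smul hpi h2] with ξ hξ
  rw [hatFn, hξ]
  simp only [hy, hv]
  rw [smul_smul, mul_inv_cancel₀ (by positivity), one_smul]
  rfl

end SolutionRegularity

/-! ### The profile -/

section IntegrableData

variable {n : ℕ}

/-- For an integrable function, the `L²` Fourier transform is given by the Fourier integral, which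
is continuous and whose value at zero is the integral of the function. -/
lemma exists_continuous_hatFn {f : L2Space n} (hf : Integrable (f : RSpace n → ℂ) volume) :
    ∃ g : RSpace n → ℂ, Continuous g ∧ (∀ ξ, ‖g ξ‖ ≤ ∫ x, ‖f x‖) ∧ g 0 = ∫ x, f x ∧
      hatFn f =ᵐ[volume] g := by
  set g : RSpace n → ℂ := 𝓕 (f : RSpace n → ℂ) with hg
  have hgc : Continuous g := VectorFourier.fourierIntegral_continuous Real.continuous_fourierChar
    continuous_inner hf
  have hae : ((𝓕 f : L2Space n) : RSpace n → ℂ) =ᵐ[volume] g := by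
    refine ae_eq_of_integral_contDiff_smul_eq ((Lp.memLp _).locallyIntegrable (by norm_num))
      hgc.locallyIntegrable fun φ hφ hφc => ?_
    have hφ' : ContDiff ℝ (⊤ : ℕ∞) fun ζ => (φ ζ : ℂ) := Complex.ofRealCLM.contDiff.comp hφ
    have hφc' : HasCompactSupport fun ζ => (φ ζ : ℂ) := hφc.comp_left (g := Complex.ofReal) rfl
    set Φ : 𝓢(RSpace n, ℂ) := hφc'.toSchwartzMap hφ' with hΦ
    have h1 : ∫ ζ, Φ ζ • (𝓕 f : L2Space n) ζ = ∫ x, (𝓕 Φ) x • f x := by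
      rw [← Lp.toTemperedDistribution_apply, ← Lp.toTemperedDistribution_apply,
        ← Lp.fourier_toTemperedDistribution_eq, TemperedDistribution.fourier_apply]
    have h2 : ∫ x, (𝓕 Φ) x • f x = ∫ ζ, Φ ζ • g ζ := by
      have := VectorFourier.integral_fourierIntegral_smul_eq_flip (μ := volume) (ν := volume)
        (L := innerₗ (RSpace n)) Real.continuous_fourierChar continuous_inner Φ.integrable hf
      rw [SchwartzMap.fourier_coe]
      refine this.trans ?_
      rw [flip_innerₗ]
      rfl
    have h3 : ∀ ζ, Φ ζ = (φ ζ : ℂ) := fun ζ => rfl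
    rw [h2] at h1
    simpa only [h3, smul_eq_mul, Complex.real_smul] using h1
  refine ⟨fun ξ => g ((2 * Real.pi)⁻¹ • ξ), hgc.comp (continuous_const_smul _), fun ξ => ?_, ?_,
    ae_comp_smul (by positivity) hae⟩
  · exact VectorFourier.norm_fourierIntegral_le_integral_norm _ _ _ _ _
  · simp only [smul_zero]
    rw [hg, Real.fourier_eq]
    simp

end IntegrableData

lemma checkEval_eq {p : Polynomial ℂ} {b : ℂ} (hb : p.IsRoot b) :
    checkEval p b = p.derivative.eval b := by
  have h1 : (Polynomial.X - Polynomial.C b) * (p /ₘ (Polynomial.X - Polynomial.C b)) = p :=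
    Polynomial.mul_divByMonic_eq_iff_isRoot.2 hb
  conv_rhs => rw [← h1]
  simp [checkEval]

lemma IsJet.iteratedDeriv_eq {Y : ℕ → ℝ → ℂ} (hY : IsJet Y) (k : ℕ) :
    iteratedDeriv k (Y 0) = Y k := by
  induction k with
  | zero => simp
  | succ k ih =>
    rw [iteratedDeriv_succ, ih]
    exact funext fun t => (hY k t).deriv

section RootSums

lemma tendsto_eval_of_coeff {ι : Type*} {l : Filter ι} {p : ι → Polynomial ℂ} {p₀ : Polynomial ℂ}
    {N : ℕ} (hN : ∀ i, (p i).natDegree ≤ N) (hN₀ : p₀.natDegree ≤ N)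
    (hp : ∀ j, Tendsto (fun i => (p i).coeff j) l (𝓝 (p₀.coeff j))) {z : ι → ℂ} {z₀ : ℂ}
    (hz : Tendsto z l (𝓝 z₀)) : Tendsto (fun i => (p i).eval (z i)) l (𝓝 (p₀.eval z₀)) := by
  have h1 : ∀ i, (p i).eval (z i) = ∑ j ∈ Finset.range (N + 1), (p i).coeff j * z i ^ j :=
    fun i => Polynomial.eval_eq_sum_range' (Nat.lt_succ_of_le (hN i)) _
  rw [Polynomial.eval_eq_sum_range' (Nat.lt_succ_of_le hN₀)]
  simp only [h1]
  exact tendsto_finsetSum _ fun j _ => (hp j).mul (hz.pow j)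

lemma tendsto_derivative_eval_of_coeff {ι : Type*} {l : Filter ι} {p : ι → Polynomial ℂ}
    {p₀ : Polynomial ℂ} {N : ℕ} (hN : ∀ i, (p i).natDegree ≤ N) (hN₀ : p₀.natDegree ≤ N)
    (hp : ∀ j, Tendsto (fun i => (p i).coeff j) l (𝓝 (p₀.coeff j))) {z : ι → ℂ} {z₀ : ℂ}
    (hz : Tendsto z l (𝓝 z₀)) :
    Tendsto (fun i => (p i).derivative.eval (z i)) l (𝓝 (p₀.derivative.eval z₀)) := by
  refine tendsto_eval_of_coeff (N := N)
    (fun i => (Polynomial.natDegree_derivative_le _).trans ((Nat.sub_le _ _).trans (hN i)))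
    ((Polynomial.natDegree_derivative_le _).trans ((Nat.sub_le _ _).trans hN₀)) (fun j => ?_) hz
  simp only [Polynomial.coeff_derivative]
  exact (hp _).mul_const _

/-- Sums over the roots depend continuously on the polynomial, as long as the roots are simple. -/
lemma tendsto_sum_roots {ι : Type*} {l : Filter ι} {p : ι → Polynomial ℂ} {p₀ : Polynomial ℂ}
    {N : ℕ} (hN : ∀ i, (p i).natDegree ≤ N) (hN₀ : p₀.natDegree ≤ N)
    (hp : ∀ j, Tendsto (fun i => (p i).coeff j) l (𝓝 (p₀.coeff j)))
    (hne : ∀ᶠ i in l, p i ≠ 0)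
    (hcard : ∀ᶠ i in l, (p i).roots.toFinset.card = p₀.roots.toFinset.card)
    (hd : ∀ b ∈ p₀.roots.toFinset, p₀.derivative.eval b ≠ 0) {F : ι → ℂ → ℂ} {F₀ : ℂ → ℂ}
    (hF : ∀ b ∈ p₀.roots.toFinset, ∀ z : ι → ℂ, Tendsto z l (𝓝 b) →
      Tendsto (fun i => F i (z i)) l (𝓝 (F₀ b))) :
    Tendsto (fun i => ∑ b ∈ (p i).roots.toFinset, F i b) l
      (𝓝 (∑ b ∈ p₀.roots.toFinset, F₀ b)) := by
  classical
  have hroot : ∀ (i : ι) (b : ℂ), ∃ z : ℂ, (p i).derivative.eval b ≠ 0 →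
      (p i).IsRoot z ∧ ‖z - b‖ * ‖(p i).derivative.eval b‖ ≤ N * ‖(p i).eval b‖ := by
    intro i b
    by_cases h : (p i).derivative.eval b = 0
    · exact ⟨0, fun h' => absurd h h'⟩
    · obtain ⟨z, hz⟩ := exists_root_near (hN i) h
      exact ⟨z, fun _ => hz⟩
  choose z hz using hroot
  have hev : ∀ b ∈ p₀.roots.toFinset, ∀ᶠ i in l, (p i).derivative.eval b ≠ 0 := fun b hb =>
    (tendsto_derivative_eval_of_coeff hN hN₀ hp (tendsto_const_nhds (x := b))).eventually_ne
      (hd b hb)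
  have hlim : ∀ b ∈ p₀.roots.toFinset, Tendsto (fun i => z i b) l (𝓝 b) := by
    intro b hb
    have hb0 : p₀.eval b = 0 :=
      (Polynomial.mem_roots'.1 (Multiset.mem_toFinset.1 hb)).2
    have h1 := ((tendsto_eval_of_coeff hN hN₀ hp (tendsto_const_nhds (x := b))).norm.const_mul
      (N : ℝ)).div (tendsto_derivative_eval_of_coeff hN hN₀ hp
        (tendsto_const_nhds (x := b))).norm (norm_ne_zero_iff.2 (hd b hb))
    rw [hb0, norm_zero, mul_zero, zero_div] at h1
    rw [tendsto_iff_norm_sub_tendsto_zero]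
    refine squeeze_zero' (Eventually.of_forall fun i => norm_nonneg _) ?_ h1
    filter_upwards [hev b hb] with i hi
    exact (le_div_iff₀ (norm_pos_iff.2 hi)).2 (hz i b hi).2
  have hinj : ∀ᶠ i in l, ∀ b ∈ p₀.roots.toFinset, ∀ b' ∈ p₀.roots.toFinset, b ≠ b' →
      z i b ≠ z i b' := by
    rw [eventually_all_finset]
    intro b hb
    rw [eventually_all_finset]
    intro b' hb'
    by_cases h : b = b'
    · exact Eventually.of_forall fun i h' => absurd h h'
    · have h1 : Tendsto (fun i => z i b - z i b') l (𝓝 (b - b')) := (hlim b hb).sub (hlim b' hb')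
      filter_upwards [h1.eventually_ne (sub_ne_zero.2 h)] with i hi _
      exact sub_ne_zero.1 hi
  refine (tendsto_finsetSum p₀.roots.toFinset fun b hb => hF b hb _ (hlim b hb)).congr' ?_
  filter_upwards [hne, hcard, hinj, (eventually_all_finset _).2 hev] with i h0 hc hi hder
  have hinj' : InjOn (z i) (p₀.roots.toFinset : Set ℂ) := fun b hb b' hb' h => by
    by_contra hbb
    exact hi b hb b' hb' hbb h
  have himage : p₀.roots.toFinset.image (z i) = (p i).roots.toFinset := by
    refine Finset.eq_of_subset_of_card_le (fun w hw => ?_) ?_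
    · obtain ⟨b, hb, rfl⟩ := Finset.mem_image.1 hw
      rw [Multiset.mem_toFinset, Polynomial.mem_roots h0]
      exact (hz i b (hder b hb)).1
    · rw [Finset.card_image_of_injOn hinj', hc]
  rw [← himage, Finset.sum_image hinj']

end RootSums

section Gaussian

variable {n : ℕ}

lemma memLp_rpow_mul_exp (hn : 1 ≤ n) {κ c : ℝ} (hκ : 0 < (n : ℝ) / 2 + κ) (hc : 0 < c) :
    MemLp (fun η : RSpace n => ‖η‖ ^ κ * Real.exp (-c * ‖η‖ ^ 2)) 2 volume := by
  have : Nonempty (Fin n) := ⟨⟨0, hn⟩⟩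
  have : Nontrivial (RSpace n) := inferInstance
  have hm : AEStronglyMeasurable (fun η : RSpace n => ‖η‖ ^ κ * Real.exp (-c * ‖η‖ ^ 2)) volume := by
    refine Measurable.aestronglyMeasurable ?_
    exact (measurable_norm.pow_const κ).mul (by fun_prop)
  rw [memLp_two_iff_integrable_sq hm]
  have h1 := (integrable_fun_norm_addHaar (volume : Measure (RSpace n))
    (f := fun y : ℝ => (y ^ κ * Real.exp (-c * y ^ 2)) ^ 2)).2 ?_
  · exact h1
  rw [finrank_euclideanSpace_fin]
  refine (integrableOn_rpow_mul_exp_neg_mul_sq (b := 2 * c) (by positivity)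
    (s := (n : ℝ) - 1 + 2 * κ) (by linarith)).congr_fun (fun y hy => ?_) measurableSet_Ioi
  have hy : 0 < y := hy
  simp only [smul_eq_mul]
  rw [Real.rpow_add hy, mul_pow, ← Real.exp_nat_mul, ← Real.rpow_natCast (y ^ κ) 2,
    ← Real.rpow_mul hy.le, ← Real.rpow_natCast y (n - 1), Nat.cast_sub hn]
  push_cast
  rw [mul_comm κ 2]
  have : (2 : ℝ) * (-c * y ^ 2) = -(2 * c) * y ^ 2 := by ring
  rw [this]
  ring

lemma memLp_pow_mul_rpow_mul_exp (hn : 1 ≤ n) {κ c : ℝ} (hκ : 0 < (n : ℝ) / 2 + κ) (hc : 0 < c)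
    (k : ℕ) :
    MemLp (fun η : RSpace n => (1 + ‖η‖) ^ k * (‖η‖ ^ κ * Real.exp (-c * ‖η‖ ^ 2))) 2 volume := by
  have h1 := (memLp_rpow_mul_exp hn hκ hc).const_mul ((2 : ℝ) ^ (k - 1))
  have h2 := (memLp_rpow_mul_exp hn (κ := κ + k) (by
    have : (0 : ℝ) ≤ k := Nat.cast_nonneg k
    linarith) hc).const_mul ((2 : ℝ) ^ (k - 1))
  have hm : AEStronglyMeasurable
      (fun η : RSpace n => (1 + ‖η‖) ^ k * (‖η‖ ^ κ * Real.exp (-c * ‖η‖ ^ 2))) volume := by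
    refine Measurable.aestronglyMeasurable ?_
    exact Measurable.mul (by fun_prop) ((measurable_norm.pow_const κ).mul (by fun_prop))
  refine (h1.add h2).mono' hm ?_
  have hae : ∀ᵐ η : RSpace n, η ≠ 0 := by
    have : Nonempty (Fin n) := ⟨⟨0, hn⟩⟩
    have : Nontrivial (RSpace n) := inferInstance
    exact Measure.ae_ne volume 0
  filter_upwards [hae] with η hη
  have hη : 0 < ‖η‖ := norm_pos_iff.2 hη
  rw [Real.norm_of_nonneg (by positivity)]
  have h3 := add_pow_le zero_le_one hη.le k
  rw [one_pow] at h3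
  simp only [Pi.add_apply]
  rw [Real.rpow_add hη, Real.rpow_natCast]
  have h4 : 0 ≤ ‖η‖ ^ κ * Real.exp (-c * ‖η‖ ^ 2) := by positivity
  refine (mul_le_mul_of_nonneg_right h3 h4).trans (le_of_eq ?_)
  ring

end Gaussian

section ModeSums

variable {n r m : ℕ} {R₀ R₁ R₂ : DiffOp n}

lemma normalize_mem_sphere {η : RSpace n} (hη : η ≠ 0) :
    ‖η‖⁻¹ • η ∈ Metric.sphere (0 : RSpace n) 1 := by
  rw [mem_sphere_zero_iff_norm, norm_smul, norm_inv, norm_norm,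
    inv_mul_cancel₀ (norm_ne_zero_iff.2 hη)]

lemma continuousAt_normalize {η : RSpace n} (hη : η ≠ 0) :
    ContinuousAt (fun η : RSpace n => ‖η‖⁻¹ • η) η :=
  (continuousAt_id.norm.inv₀ (norm_ne_zero_iff.2 hη)).smul continuousAt_id

/-- The sum over the modes in the direction `η/|η|`; the value at `η = 0` is irrelevant. -/
noncomputable def dirModeSum (r k : ℕ) (R₀ R₁ : DiffOp n) (a θ ν : ℝ) (η : RSpace n) : ℂ :=
  modeSum r k (symbolAt R₀ (‖η‖⁻¹ • η)) (symbolAt R₁ (‖η‖⁻¹ • η)) a θ ν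

namespace DampedSystem

lemma exists_modeSum_bound (H : DampedSystem r m R₀ R₁ R₂) : ∃ c : ℝ, 0 < c ∧
    ∀ k : ℕ, ∃ C : ℝ, 0 < C ∧ ∀ ω ∈ Metric.sphere (0 : RSpace n) 1, ∀ a θ ν : ℝ, 0 ≤ a → 0 ≤ ν →
      ‖modeSum r k (symbolAt R₀ ω) (symbolAt R₁ ω) a θ ν‖ ≤
        C * (1 + a) ^ k * Real.exp (-c * ν) := by
  obtain ⟨δ, c, C₀, -, -, hc, hC₀, hroot, -⟩ := H.low_decomposition
  refine ⟨c, hc, fun k => ⟨(r + 1) * (C₀ ^ k / c), by positivity, fun ω hω a θ ν ha hν => ?_⟩⟩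
  have hterm : ∀ b ∈ (symbolAt R₀ ω).roots.toFinset,
      ‖(Complex.I * b + a * ((symbolAt R₁ ω).eval b / (symbolAt R₀ ω).derivative.eval b)) ^ k *
      Complex.exp (Complex.I * b * θ +
        ν * ((symbolAt R₁ ω).eval b / (symbolAt R₀ ω).derivative.eval b)) /
      (Complex.I ^ r * (symbolAt R₀ ω).derivative.eval b)‖ ≤
      C₀ ^ k / c * ((1 + a) ^ k * Real.exp (-c * ν)) := by
    intro b hb
    obtain ⟨h1, h2, h3, h4, h5⟩ := hroot ω hω b (H.hyp₀.mem_roots.1 hb)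
    set q := (symbolAt R₁ ω).eval b / (symbolAt R₀ ω).derivative.eval b with hq
    have e1 : ‖Complex.I * b + a * q‖ ≤ C₀ * (1 + a) := by
      refine (norm_add_le _ _).trans ?_
      rw [norm_mul, norm_mul, Complex.norm_I, one_mul, Complex.norm_real, Real.norm_of_nonneg ha]
      nlinarith
    have e2 : ‖Complex.exp (Complex.I * b * θ + ν * q)‖ ≤ Real.exp (-c * ν) := by
      rw [Complex.norm_exp, Real.exp_le_exp]
      simp only [Complex.add_re, Complex.re_mul_ofReal, Complex.re_ofReal_mul, Complex.I_mul_re, h3]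
      nlinarith
    rw [norm_div, norm_mul, norm_mul, norm_pow, norm_pow, Complex.norm_I, one_pow, one_mul]
    calc ‖Complex.I * b + a * q‖ ^ k * ‖Complex.exp (Complex.I * b * θ + ν * q)‖ /
          ‖(symbolAt R₀ ω).derivative.eval b‖
        ≤ (C₀ * (1 + a)) ^ k * Real.exp (-c * ν) / c := by gcongr
      _ = _ := by rw [mul_pow]; ring
  refine (norm_sum_le _ _).trans ((Finset.sum_le_sum hterm).trans (le_of_eq ?_))
  rw [Finset.sum_const, H.hyp₀.card_roots hω, nsmul_eq_mul]
  push_cast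
  ring

/-- The corrections of first order in the frequency to the coefficients of the modes are negligible
in diffusive variables. -/
lemma tendsto_modeSum_sub (H : DampedSystem r m R₀ R₁ R₂) {ω : RSpace n}
    (hω : ω ∈ Metric.sphere (0 : RSpace n) 1) (k : ℕ) {a θ : ℝ → ℝ} {ν : ℝ} (hν : 0 ≤ ν)
    (ha : Tendsto a atTop (𝓝 0)) :
    Tendsto (fun t => modeSum r k (symbolAt R₀ ω) (symbolAt R₁ ω) 0 (θ t) ν -
      modeSum r k (symbolAt R₀ ω) (symbolAt R₁ ω) (a t) (θ t) ν) atTop (𝓝 0) := by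
  obtain ⟨δ, c, C₀, -, -, hc, hC₀, hroot, -⟩ := H.low_decomposition
  have hterm : ∀ b ∈ (symbolAt R₀ ω).roots.toFinset, Tendsto (fun t =>
      (Complex.I * b + (0 : ℝ) * ((symbolAt R₁ ω).eval b / (symbolAt R₀ ω).derivative.eval b)) ^ k *
      Complex.exp (Complex.I * b * (θ t) +
        ν * ((symbolAt R₁ ω).eval b / (symbolAt R₀ ω).derivative.eval b)) /
      (Complex.I ^ r * (symbolAt R₀ ω).derivative.eval b) -
      (Complex.I * b + (a t) * ((symbolAt R₁ ω).eval b / (symbolAt R₀ ω).derivative.eval b)) ^ k *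
      Complex.exp (Complex.I * b * (θ t) +
        ν * ((symbolAt R₁ ω).eval b / (symbolAt R₀ ω).derivative.eval b)) /
      (Complex.I ^ r * (symbolAt R₀ ω).derivative.eval b)) atTop (𝓝 0) := by
    intro b hb
    obtain ⟨-, -, h3, h4, -⟩ := hroot ω hω b (H.hyp₀.mem_roots.1 hb)
    set q := (symbolAt R₁ ω).eval b / (symbolAt R₀ ω).derivative.eval b with hq
    set d := Complex.I ^ r * (symbolAt R₀ ω).derivative.eval b with hd
    have haC : Tendsto (fun t => (a t : ℂ)) atTop (𝓝 0) := by
      simpa [Function.comp_def] using (Complex.continuous_ofReal.tendsto 0).comp ha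
    have h1 : Tendsto (fun t => ((Complex.I * b + (0 : ℝ) * q) ^ k -
        (Complex.I * b + a t * q) ^ k) / d) atTop (𝓝 0) := by
      have := ((tendsto_const_nhds (x := (Complex.I * b + (0 : ℝ) * q) ^ k)).sub
        (((haC.mul_const q).const_add (Complex.I * b)).pow k)).div_const d
      simpa using this
    refine squeeze_zero_norm (fun t => ?_) (tendsto_zero_iff_norm_tendsto_zero.1 h1)
    have e1 : ‖Complex.exp (Complex.I * b * (θ t) + ν * q)‖ ≤ 1 := by
      rw [Complex.norm_exp, Real.exp_le_one_iff]
      simp only [Complex.add_re, Complex.re_mul_ofReal, Complex.re_ofReal_mul, Complex.I_mul_re, h3]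
      nlinarith
    have e2 : (Complex.I * b + (0 : ℝ) * q) ^ k * Complex.exp (Complex.I * b * (θ t) + ν * q) / d -
        (Complex.I * b + (a t) * q) ^ k * Complex.exp (Complex.I * b * (θ t) + ν * q) / d =
        ((Complex.I * b + (0 : ℝ) * q) ^ k - (Complex.I * b + a t * q) ^ k) / d *
          Complex.exp (Complex.I * b * (θ t) + ν * q) := by ring
    rw [e2, norm_mul]
    exact mul_le_of_le_one_right (norm_nonneg _) e1
  have h := tendsto_finsetSum _ hterm
  rw [Finset.sum_const_zero] at h
  refine h.congr fun t => ?_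
  rw [Finset.sum_sub_distrib]
  rfl

lemma derivative_ne_zero (H : DampedSystem r m R₀ R₁ R₂) {ω : RSpace n}
    (hω : ω ∈ Metric.sphere (0 : RSpace n) 1) {b : ℂ}
    (hb : b ∈ (symbolAt R₀ ω).roots.toFinset) : (symbolAt R₀ ω).derivative.eval b ≠ 0 := by
  obtain ⟨δ, c, C₀, -, -, hc, -, hroot, -⟩ := H.low_decomposition
  exact norm_pos_iff.1 (hc.trans_le (hroot ω hω b (H.hyp₀.mem_roots.1 hb)).1)

lemma continuousAt_dirModeSum (H : DampedSystem r m R₀ R₁ R₂) (k : ℕ) {a θ ν : RSpace n → ℝ}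
    {η₀ : RSpace n} (hη₀ : η₀ ≠ 0) (ha : ContinuousAt a η₀) (hθ : ContinuousAt θ η₀)
    (hν : ContinuousAt ν η₀) :
    ContinuousAt (fun η => dirModeSum r k R₀ R₁ (a η) (θ η) (ν η) η) η₀ := by
  have hω := normalize_mem_sphere hη₀
  have hne : ∀ᶠ η in 𝓝 η₀, η ≠ 0 := isOpen_ne.mem_nhds hη₀
  have hcoef : ∀ (P : DiffOp n) j, Tendsto (fun η : RSpace n => (symbolAt P (‖η‖⁻¹ • η)).coeff j)
      (𝓝 η₀) (𝓝 ((symbolAt P (‖η₀‖⁻¹ • η₀)).coeff j)) := fun P j =>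
    ((continuous_coeff_symbolAt P j).tendsto _).comp (continuousAt_normalize hη₀)
  have hof : ∀ {f : RSpace n → ℝ}, ContinuousAt f η₀ →
      Tendsto (fun η => (f η : ℂ)) (𝓝 η₀) (𝓝 (f η₀ : ℂ)) := fun hf =>
    (Complex.continuous_ofReal.tendsto _).comp hf
  have hdeg1 : ∀ ω : RSpace n, (symbolAt R₁ ω).natDegree ≤ r + 2 := fun ω =>
    natDegree_complexSymbol_le H.hyp₁.homogeneous _
  have hdeg0 : ∀ ω : RSpace n, (symbolAt R₀ ω).natDegree ≤ r + 1 := fun ω =>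
    natDegree_complexSymbol_le H.hyp₀.homogeneous _
  unfold ContinuousAt dirModeSum modeSum
  refine tendsto_sum_roots (N := r + 1) (fun η => hdeg0 _) (hdeg0 _) (hcoef R₀) ?_ ?_ ?_ ?_
  · exact Eventually.of_forall fun η => H.hyp₀.symbolAt_ne_zero _
  · filter_upwards [hne] with η hη
    rw [H.hyp₀.card_roots (normalize_mem_sphere hη), H.hyp₀.card_roots hω]
  · exact fun b hb => H.derivative_ne_zero hω hb
  · intro b hb z hz
    have hd := H.derivative_ne_zero hω hb
    have h0 := tendsto_derivative_eval_of_coeff (fun η => hdeg0 _) (hdeg0 _) (hcoef R₀) hz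
    have hq := (tendsto_eval_of_coeff (fun η => hdeg1 _) (hdeg1 _) (hcoef R₁) hz).div h0 hd
    have hexp := (Complex.continuous_exp.tendsto _).comp
      (((hz.const_mul Complex.I).mul (hof hθ)).add ((hof hν).mul hq))
    exact ((((hz.const_mul Complex.I).add ((hof ha).mul hq)).pow k).mul hexp).div
      (h0.const_mul (Complex.I ^ r)) (mul_ne_zero (pow_ne_zero _ Complex.I_ne_zero) hd)

lemma measurable_dirModeSum (H : DampedSystem r m R₀ R₁ R₂) (k : ℕ) {a θ ν : RSpace n → ℝ}
    (ha : Continuous a) (hθ : Continuous θ) (hν : Continuous ν) :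
    Measurable (fun η => dirModeSum r k R₀ R₁ (a η) (θ η) (ν η) η) :=
  measurable_of_continuousOn_compl_singleton 0 (continuousOn_of_forall_continuousAt fun _ hη =>
    H.continuousAt_dirModeSum k hη ha.continuousAt hθ.continuousAt hν.continuousAt)

/-- The time derivatives of the profile. -/
lemma rieszProfileDeriv_eq (H : DampedSystem r m R₀ R₁ R₂) (M : ℂ) (k : ℕ) (t : ℝ) {ξ : RSpace n}
    (hξ : ξ ≠ 0) : rieszProfileDeriv r R₀ R₁ M k t ξ = ((‖ξ‖ ^ k / ‖ξ‖ ^ r : ℝ) : ℂ) *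
      (M * dirModeSum r k R₀ R₁ ‖ξ‖ (‖ξ‖ * t) (‖ξ‖ ^ 2 * t) ξ) := by
  set ω : RSpace n := ‖ξ‖⁻¹ • ξ with hω
  have hωS := normalize_mem_sphere hξ
  have hξ0 : 0 < ‖ξ‖ := norm_pos_iff.2 hξ
  set q : ℂ → ℂ := fun b => (symbolAt R₁ ω).eval b / (symbolAt R₀ ω).derivative.eval b with hq
  set Y : ℕ → ℝ → ℂ := ∑ b ∈ (symbolAt R₀ ω).roots.toFinset,
    (((‖ξ‖ ^ (-(r : ℝ)) : ℝ) : ℂ) * M / (Complex.I ^ r * (symbolAt R₀ ω).derivative.eval b)) •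
      expJet (Complex.I * ‖ξ‖ * b + (‖ξ‖ : ℂ) ^ 2 * q b) with hY
  have hYjet : IsJet Y := IsJet.sum fun b _ => (isJet_expJet _).smul _
  have hYapp : ∀ k τ, Y k τ = ∑ b ∈ (symbolAt R₀ ω).roots.toFinset,
      (((‖ξ‖ ^ (-(r : ℝ)) : ℝ) : ℂ) * M / (Complex.I ^ r * (symbolAt R₀ ω).derivative.eval b)) *
      ((Complex.I * ‖ξ‖ * b + (‖ξ‖ : ℂ) ^ 2 * q b) ^ k *
        Complex.exp ((Complex.I * ‖ξ‖ * b + (‖ξ‖ : ℂ) ^ 2 * q b) * τ)) := by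
    intro k τ
    rw [hY, Finset.sum_apply, Finset.sum_apply]
    rfl
  have h0 : (fun τ : ℝ => ((‖ξ‖ ^ (-(r : ℝ)) : ℝ) : ℂ) * profileHat r R₀ R₁ M τ ξ) = Y 0 := by
    ext τ
    rw [hYapp, profileHat]
    simp only [← hω]
    have h1 : (symbolAt R₀ ω).roots = (symbolAt R₀ ω).roots.toFinset.val := by
      rw [Multiset.toFinset_val, (H.hyp₀.simple_roots ω hωS).dedup]
    rw [h1, ← Finset.sum_eq_multiset_sum, Finset.mul_sum, Finset.mul_sum]
    refine Finset.sum_congr (by rw [← h1]) fun b hb => ?_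
    rw [← h1] at hb
    have hroot : (symbolAt R₀ ω).IsRoot b := H.hyp₀.mem_roots.1 hb
    rw [checkEval_eq hroot, hq]
    simp only
    rw [show Complex.I * (‖ξ‖ : ℂ) * b * (τ : ℂ) + (‖ξ‖ : ℂ) ^ 2 * ((symbolAt R₁ ω).eval b /
      (symbolAt R₀ ω).derivative.eval b) * (τ : ℂ) = (Complex.I * ‖ξ‖ * b + (‖ξ‖ : ℂ) ^ 2 *
      ((symbolAt R₁ ω).eval b / (symbolAt R₀ ω).derivative.eval b)) * τ by ring]
    ring
  rw [rieszProfileDeriv, h0, hYjet.iteratedDeriv_eq, hYapp, dirModeSum, modeSum, Finset.mul_sum,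
    Finset.mul_sum]
  refine Finset.sum_congr rfl fun b _ => ?_
  rw [Real.rpow_neg hξ0.le, Real.rpow_natCast]
  have e1 : Complex.I * ‖ξ‖ * b + (‖ξ‖ : ℂ) ^ 2 * q b = ‖ξ‖ * (Complex.I * b + ‖ξ‖ * q b) := by ring
  have e2 : Complex.I * b * ((‖ξ‖ * t : ℝ) : ℂ) + ((‖ξ‖ ^ 2 * t : ℝ) : ℂ) * q b =
      (Complex.I * ‖ξ‖ * b + (‖ξ‖ : ℂ) ^ 2 * q b) * t := by push_cast; ring
  rw [← hω]
  change _ = _ * (M * ((Complex.I * b + ‖ξ‖ * q b) ^ k *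
    Complex.exp (Complex.I * b * ((‖ξ‖ * t : ℝ) : ℂ) + ((‖ξ‖ ^ 2 * t : ℝ) : ℂ) * q b) / _))
  rw [e2, e1, mul_pow]
  push_cast
  ring

end DampedSystem

end ModeSums

/-! ### Diffusive rescaling and the upper bound -/

section Rescaling

variable {n : ℕ}

/-- The diffusive rescaling `ξ = η/√t` of a function of frequency. The weights are such that the
`Ḣ^s` norm is a power of `t` times the `L²` norm of the rescaled function, while the `k`-th time
derivative of the profile becomes bounded in `t`. -/
noncomputable def rescale (r k : ℕ) (s t : ℝ) (F : RSpace n → ℂ) (η : RSpace n) : ℂ :=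
  ((‖η‖ ^ ((k : ℝ) + s - r) * ((‖η‖ / √t) ^ r / (‖η‖ / √t) ^ k) : ℝ) : ℂ) * F ((√t)⁻¹ • η)

lemma ae_ne_zero (hn : 1 ≤ n) : ∀ᵐ η : RSpace n, η ≠ 0 := by
  have : Nonempty (Fin n) := ⟨⟨0, hn⟩⟩
  have : Nontrivial (RSpace n) := inferInstance
  exact Measure.ae_ne volume 0

lemma measurable_rescale_weight (r k : ℕ) (s t : ℝ) : Measurable fun η : RSpace n =>
    ((‖η‖ ^ ((k : ℝ) + s - r) * ((‖η‖ / √t) ^ r / (‖η‖ / √t) ^ k) : ℝ) : ℂ) := by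
  refine Complex.measurable_ofReal.comp ((measurable_norm.pow_const _).mul ?_)
  exact Measurable.div (by fun_prop) (by fun_prop)

lemma aestronglyMeasurable_rescale (r k : ℕ) (s : ℝ) {t : ℝ} (ht : 0 < t) {F : RSpace n → ℂ}
    (hF : AEStronglyMeasurable F volume) : AEStronglyMeasurable (rescale r k s t F) volume :=
  (measurable_rescale_weight r k s t).aestronglyMeasurable.mul
    (aestronglyMeasurable_comp_smul (inv_pos.2 (Real.sqrt_pos.2 ht)) hF)

lemma rescale_sub (r k : ℕ) (s t : ℝ) (F G : RSpace n → ℂ) :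
    rescale r k s t (fun ξ => F ξ - G ξ) = fun η => rescale r k s t F η - rescale r k s t G η := by
  ext η
  simp only [rescale, mul_sub]

lemma measurable_norm_rpow_ofReal (s : ℝ) :
    Measurable fun ξ : RSpace n => ((‖ξ‖ ^ s : ℝ) : ℂ) :=
  Complex.measurable_ofReal.comp (measurable_norm.pow_const s)

lemma aestronglyMeasurable_weighted (s : ℝ) {F : RSpace n → ℂ}
    (hF : AEStronglyMeasurable F volume) : AEStronglyMeasurable (weighted s F) volume :=
  (measurable_norm_rpow_ofReal s).aestronglyMeasurable.mul hF

lemma eLpNorm_rescale (hn : 1 ≤ n) (r k : ℕ) (s : ℝ) {t : ℝ} (ht : 0 < t) {F : RSpace n → ℂ}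
    (hF : AEStronglyMeasurable F volume) :
    eLpNorm (rescale r k s t F) 2 volume =
      ENNReal.ofReal (t ^ ((n : ℝ) / 4 + ((k : ℝ) + s - r) / 2)) *
        eLpNorm (weighted s F) 2 volume := by
  have hst : 0 < √t := Real.sqrt_pos.2 ht
  set κ : ℝ := (k : ℝ) + s - r with hκ
  have h1 : rescale r k s t F =ᵐ[volume]
      ((t ^ (κ / 2) : ℝ) : ℂ) • fun η => weighted s F ((√t)⁻¹ • η) := by
    filter_upwards [ae_ne_zero hn] with η hη
    have hσ : 0 < ‖η‖ := norm_pos_iff.2 hη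
    have hnorm : ‖(√t)⁻¹ • η‖ = ‖η‖ / √t := by
      rw [norm_smul, Real.norm_of_nonneg (by positivity), inv_mul_eq_div]
    have hρ : 0 < ‖η‖ / √t := by positivity
    simp only [rescale, Pi.smul_apply, weighted, hnorm, smul_eq_mul, ← mul_assoc]
    congr 1
    rw [← Complex.ofReal_mul, ← hκ]
    congr 1
    have h2 : (‖η‖ / √t) ^ s = (‖η‖ / √t) ^ κ * ((‖η‖ / √t) ^ r / (‖η‖ / √t) ^ k) := by
      rw [← Real.rpow_natCast, ← Real.rpow_natCast, ← Real.rpow_sub hρ, ← Real.rpow_add hρ, hκ]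
      congr 1
      ring
    have h3 : ‖η‖ ^ κ = t ^ (κ / 2) * (‖η‖ / √t) ^ κ := by
      rw [Real.div_rpow hσ.le hst.le, Real.sqrt_eq_rpow, ← Real.rpow_mul ht.le,
        one_div_mul_eq_div, mul_div_cancel₀ _ (by positivity)]
    rw [h2, h3, mul_assoc]
  rw [eLpNorm_congr_ae h1, eLpNorm_const_smul,
    eLpNorm_comp_smul (inv_pos.2 hst) (aestronglyMeasurable_weighted s hF), ← mul_assoc]
  congr 1
  rw [← ofReal_norm, Complex.norm_real, Real.norm_of_nonneg (by positivity),
    ← ENNReal.ofReal_mul (by positivity)]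
  congr 1
  rw [Real.sqrt_eq_rpow, ← Real.rpow_neg ht.le, ← Real.rpow_mul ht.le, ← Real.rpow_add ht]
  congr 1
  ring

lemma dotNorm_eq_rescale (hn : 1 ≤ n) (r k : ℕ) (s : ℝ) {t : ℝ} (ht : 0 < t) {F : RSpace n → ℂ}
    (hF : AEStronglyMeasurable F volume) :
    dotNorm s F = t ^ (-(n : ℝ) / 4 - ((k : ℝ) + s - r) / 2) *
      (eLpNorm (rescale r k s t F) 2 volume).toReal := by
  rw [eLpNorm_rescale hn r k s ht hF, ENNReal.toReal_mul, ENNReal.toReal_ofReal (by positivity),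
    ← mul_assoc, ← Real.rpow_add ht, dotNorm]
  ring_nf
  simp

lemma tendsto_rpow_div_one_add_rpow (b : ℝ) :
    Tendsto (fun t : ℝ => t ^ b / (1 + t) ^ b) atTop (𝓝 1) := by
  have h1 : Tendsto (fun t : ℝ => 1 - (1 + t)⁻¹) atTop (𝓝 (1 - 0)) :=
    tendsto_const_nhds.sub (tendsto_inv_atTop_zero.comp
      (tendsto_atTop_add_const_left _ _ tendsto_id))
  rw [sub_zero] at h1
  have h2 := h1.rpow_const (p := b) (Or.inl one_ne_zero)
  rw [Real.one_rpow] at h2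
  refine h2.congr' ?_
  filter_upwards [eventually_gt_atTop (0 : ℝ)] with t ht
  rw [← Real.div_rpow ht.le (by positivity)]
  congr 1
  field_simp
  ring

end Rescaling

section UpperBound

variable {n r m : ℕ} {R₀ R₁ R₂ : DiffOp n}

/-- The Fourier transforms of initial data in `H^{s₀-i} ∩ L¹`. -/
structure FourierData (n m : ℕ) (s₀ : ℝ) (g : ℕ → RSpace n → ℂ) : Prop where
  continuous : ∀ i < m, Continuous (g i)
  bounded : ∃ V : ℝ, 0 < V ∧ ∀ i < m, ∀ ξ, ‖g i ξ‖ ≤ V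
  memLp : ∀ i < m, MemLp (fun ξ : RSpace n =>
    (1 + ‖(2 * Real.pi)⁻¹ • ξ‖ ^ 2) ^ ((s₀ - i) / 2) * ‖g i ξ‖) 2 volume

/-- The weight which controls the solution at high frequencies. -/
noncomputable def dataWeight (m : ℕ) (s₀ : ℝ) (g : ℕ → RSpace n → ℂ) (ξ : RSpace n) : ℝ :=
  ∑ i ∈ Finset.range m, (1 + ‖(2 * Real.pi)⁻¹ • ξ‖ ^ 2) ^ ((s₀ - i) / 2) * ‖g i ξ‖

lemma FourierData.memLp_dataWeight {s₀ : ℝ} {g : ℕ → RSpace n → ℂ} (hg : FourierData n m s₀ g) :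
    MemLp (dataWeight m s₀ g) 2 volume :=
  memLp_finsetSum _ fun i hi => hg.memLp i (Finset.mem_range.1 hi)

lemma dataWeight_nonneg (m : ℕ) (s₀ : ℝ) (g : ℕ → RSpace n → ℂ) (ξ : RSpace n) :
    0 ≤ dataWeight m s₀ g ξ := Finset.sum_nonneg fun _ _ => by positivity

/-- The Fourier transform of the `k`-th time derivative of the solution with data `g`. -/
noncomputable def solHat (m : ℕ) [NeZero m] (Q : DiffOp n) (g : ℕ → RSpace n → ℂ) (k : ℕ) (t : ℝ)
    (ξ : RSpace n) : ℂ :=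
  solJet m (charPoly Q ξ) (fun i => g i ξ) k t

/-- The mass of the initial data which governs the asymptotic behaviour: the limit of the amplitudes
of the slow modes as the frequency tends to zero. For a homogeneous operator of order `e`, the only
coefficient of the characteristic polynomial at zero frequency is that of `λ^e`. -/
noncomputable def mass (m : ℕ) (Q : DiffOp n) (g : ℕ → RSpace n → ℂ) : ℂ :=
  ∑ i ∈ Finset.range m, (charPoly Q 0).coeff (i + 1) * g i 0

variable [NeZero m]

lemma aestronglyMeasurable_solHat {Q : DiffOp n} {g : ℕ → RSpace n → ℂ}
    (hg : ∀ i < m, Continuous (g i)) (k : ℕ) (t : ℝ) :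
    AEStronglyMeasurable (solHat m Q g k t) volume := by
  have h := aestronglyMeasurable_solJet (Q := Q) (a := 1)
    (fun i hi => (hg i hi).aestronglyMeasurable) k t
  simp only [one_smul] at h
  exact h

namespace DampedSystem

variable {s₀ : ℝ} {g : ℕ → RSpace n → ℂ}

/-- Exponential decay at frequencies bounded away from zero. -/
lemma exists_solHat_bound (H : DampedSystem r m R₀ R₁ R₂) (hs₀ : (m : ℝ) - 1 ≤ s₀) {δ : ℝ}
    (hδ : 0 < δ) {k : ℕ} {s : ℝ} (hks : k + s ≤ s₀) (g : ℕ → RSpace n → ℂ) :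
    ∃ c C : ℝ, 0 < c ∧ 0 < C ∧ ∀ ξ : RSpace n, δ ≤ ‖ξ‖ → ∀ t, 0 ≤ t →
      ‖ξ‖ ^ s * ‖solHat m (R₀ + R₁ + R₂) g k t ξ‖ ≤ C * Real.exp (-c * t) * dataWeight m s₀ g ξ := by
  obtain ⟨c, hc, hout⟩ := H.outer_estimate hδ
  obtain ⟨C, hC, hk⟩ := hout k
  have hw : ∀ i, ∃ D : ℝ, 0 < D ∧ (i < m → ∀ ξ : RSpace n, δ ≤ ‖ξ‖ → ‖ξ‖ ^ s * (‖ξ‖ ^ k / ‖ξ‖ ^ i) ≤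
      D * (1 + ‖(2 * Real.pi)⁻¹ • ξ‖ ^ 2) ^ ((s₀ - i) / 2)) := by
    intro i
    by_cases hi : i < m
    · have h1 : (i : ℝ) + 1 ≤ m := by exact_mod_cast hi
      obtain ⟨D, hD, h⟩ := exists_weight_le (n := n) hδ hks (i := i) (by linarith)
      refine ⟨D, hD, fun _ ξ hξ => ?_⟩
      have h2 : (2 * Real.pi) • (2 * Real.pi)⁻¹ • ξ = ξ := by
        rw [smul_smul, mul_inv_cancel₀ (by positivity), one_smul]
      have h3 := h ((2 * Real.pi)⁻¹ • ξ)
      rw [h2] at h3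
      exact h3 hξ
    · exact ⟨1, one_pos, fun h => absurd h hi⟩
  choose D hD hDb using hw
  have hDs : 0 ≤ ∑ i ∈ Finset.range m, D i := Finset.sum_nonneg fun i _ => (hD i).le
  refine ⟨c, C * (1 + ∑ i ∈ Finset.range m, D i), hc, by positivity, fun ξ hξ t ht => ?_⟩
  have h1 := hk ξ hξ _ (isJet_solJet (m := m) _ fun i => g i ξ)
    (polyAct_solJet (H.monic_charPoly _) (H.natDegree_charPoly _) _) t ht
  have h2 : ‖ξ‖ ^ s * ∑ i ∈ Finset.range m, ‖ξ‖ ^ k / ‖ξ‖ ^ i *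
      ‖solJet m (charPoly (R₀ + R₁ + R₂) ξ) (fun i => g i ξ) i 0‖ ≤
      (1 + ∑ i ∈ Finset.range m, D i) * dataWeight m s₀ g ξ := by
    rw [dataWeight, Finset.mul_sum, Finset.mul_sum]
    refine Finset.sum_le_sum fun i hi => ?_
    rw [solJet_zero _ _ (Finset.mem_range.1 hi), ← mul_assoc, ← mul_assoc]
    refine mul_le_mul_of_nonneg_right ?_ (norm_nonneg _)
    refine (hDb i (Finset.mem_range.1 hi) ξ hξ).trans ?_
    gcongr
    have := Finset.single_le_sum (f := D) (fun i _ => (hD i).le) hi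
    linarith
  have h3 : ‖ξ‖ ^ s * ‖solHat m (R₀ + R₁ + R₂) g k t ξ‖ ≤ ‖ξ‖ ^ s * _ :=
    mul_le_mul_of_nonneg_left h1 (by positivity)
  refine h3.trans ?_
  calc _ = C * Real.exp (-c * t) * (‖ξ‖ ^ s * ∑ i ∈ Finset.range m, ‖ξ‖ ^ k / ‖ξ‖ ^ i *
      ‖solJet m (charPoly (R₀ + R₁ + R₂) ξ) (fun i => g i ξ) i 0‖) := by ring
    _ ≤ C * Real.exp (-c * t) * ((1 + ∑ i ∈ Finset.range m, D i) * dataWeight m s₀ g ξ) := by gcongr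
    _ = _ := by ring

lemma memLp_weighted_solHat (H : DampedSystem r m R₀ R₁ R₂) (hs₀ : (m : ℝ) - 1 ≤ s₀)
    (hg : FourierData n m s₀ g) {k : ℕ} {s : ℝ} (hs : 0 ≤ s) (hks : k + s ≤ s₀) {t : ℝ}
    (ht : 0 ≤ t) : MemLp (weighted s (solHat m (R₀ + R₁ + R₂) g k t)) 2 volume := by
  obtain ⟨c, C, hc, hC, hb⟩ := H.exists_solHat_bound hs₀ one_pos hks g
  obtain ⟨C', hC', hb'⟩ := exists_solJet_bound (m := m)
    (Q := fun ξ : RSpace n => charPoly (R₀ + R₁ + R₂) ξ)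
    (fun j => continuous_coeff_charPoly _ j) (isCompact_closedBall (0 : RSpace n) 1) t k
  refine (hg.memLp_dataWeight.const_mul (C + C')).mono'
    (aestronglyMeasurable_weighted s (aestronglyMeasurable_solHat hg.continuous k t))
    (Eventually.of_forall fun ξ => ?_)
  rw [weighted, norm_mul, Complex.norm_real, Real.norm_of_nonneg (by positivity)]
  have hW := dataWeight_nonneg m s₀ g ξ
  rcases le_total 1 ‖ξ‖ with h | h
  · refine (hb ξ h t ht).trans ?_
    have h1 : Real.exp (-c * t) ≤ 1 := Real.exp_le_one_iff.2 (by nlinarith)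
    gcongr
    nlinarith
  · have h1 := hb' ξ (by simpa using h) t ⟨by linarith, le_rfl⟩ fun i => g i ξ
    have h2 : ∑ i ∈ Finset.range m, ‖g i ξ‖ ≤ dataWeight m s₀ g ξ := by
      refine Finset.sum_le_sum fun i hi => ?_
      have h3 : (i : ℝ) + 1 ≤ m := by exact_mod_cast Finset.mem_range.1 hi
      exact le_mul_of_one_le_left (norm_nonneg _) (Real.one_le_rpow
        (by nlinarith [norm_nonneg ((2 * Real.pi)⁻¹ • ξ)]) (by linarith))
    calc ‖ξ‖ ^ s * ‖solHat m (R₀ + R₁ + R₂) g k t ξ‖ ≤ 1 * (C' * dataWeight m s₀ g ξ) := by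
          gcongr
          · exact Real.rpow_le_one (norm_nonneg _) h hs
          · exact h1.trans (by gcongr)
      _ ≤ (C + C') * dataWeight m s₀ g ξ := by nlinarith

end DampedSystem

end UpperBound

section DiffusiveLimit

variable {n r m : ℕ} {R₀ R₁ R₂ : DiffOp n}

/-- The profile in diffusive variables, without the corrections which vanish as `t → ∞`. -/
noncomputable def limitProfile (r k : ℕ) (R₀ R₁ : DiffOp n) (M : ℂ) (s t : ℝ) (η : RSpace n) : ℂ :=
  ((‖η‖ ^ ((k : ℝ) + s - r) : ℝ) : ℂ) *
    (M * dirModeSum r k R₀ R₁ 0 (‖η‖ * √t) (‖η‖ ^ 2) η)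

namespace DampedSystem

lemma measurable_limitProfile (H : DampedSystem r m R₀ R₁ R₂) (k : ℕ) (M : ℂ) (s t : ℝ) :
    Measurable (limitProfile r k R₀ R₁ M s t) :=
  (measurable_norm_rpow_ofReal _).mul ((H.measurable_dirModeSum k (a := fun _ => 0)
    (θ := fun η => ‖η‖ * √t) (ν := fun η => ‖η‖ ^ 2) (by fun_prop) (by fun_prop)
    (by fun_prop)).const_mul M)

lemma rescale_rieszProfileDeriv (H : DampedSystem r m R₀ R₁ R₂) (M : ℂ) (k : ℕ) (s : ℝ) {t : ℝ}
    (ht : 0 < t) {η : RSpace n} (hη : η ≠ 0) :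
    rescale r k s t (rieszProfileDeriv r R₀ R₁ M k t) η = ((‖η‖ ^ ((k : ℝ) + s - r) : ℝ) : ℂ) *
      (M * dirModeSum r k R₀ R₁ (‖η‖ / √t) (‖η‖ * √t) (‖η‖ ^ 2) η) := by
  have hst : 0 < √t := Real.sqrt_pos.2 ht
  have hσ : 0 < ‖η‖ := norm_pos_iff.2 hη
  have hnorm : ‖(√t)⁻¹ • η‖ = ‖η‖ / √t := by
    rw [norm_smul, Real.norm_of_nonneg (by positivity), inv_mul_eq_div]
  have hρ : 0 < ‖η‖ / √t := by positivity
  have hdir : (‖η‖ / √t)⁻¹ • (√t)⁻¹ • η = ‖η‖⁻¹ • η := by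
    rw [smul_smul]
    congr 1
    field_simp
  have hθ : ‖η‖ / √t * t = ‖η‖ * √t := by
    rw [div_mul_eq_mul_div, div_eq_iff hst.ne', mul_assoc, Real.mul_self_sqrt ht.le]
  have hν : (‖η‖ / √t) ^ 2 * t = ‖η‖ ^ 2 := by
    rw [div_pow, Real.sq_sqrt ht.le, div_mul_cancel₀ _ ht.ne']
  rw [rescale, H.rieszProfileDeriv_eq M k t (smul_ne_zero (by positivity) hη)]
  simp only [dirModeSum, hnorm, hdir, hθ, hν]
  rw [← mul_assoc, ← Complex.ofReal_mul]
  congr 3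
  field_simp

lemma aestronglyMeasurable_rieszProfileDeriv (H : DampedSystem r m R₀ R₁ R₂) (hn : 1 ≤ n) (M : ℂ)
    (k : ℕ) (t : ℝ) : AEStronglyMeasurable (rieszProfileDeriv r R₀ R₁ M k t) volume := by
  have h1 : Measurable fun ξ : RSpace n => ((‖ξ‖ ^ k / ‖ξ‖ ^ r : ℝ) : ℂ) *
      (M * dirModeSum r k R₀ R₁ ‖ξ‖ (‖ξ‖ * t) (‖ξ‖ ^ 2 * t) ξ) :=
    (Complex.measurable_ofReal.comp (Measurable.div (by fun_prop) (by fun_prop))).mul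
      ((H.measurable_dirModeSum k (a := fun η => ‖η‖) (θ := fun η => ‖η‖ * t)
      (ν := fun η => ‖η‖ ^ 2 * t) (by fun_prop) (by fun_prop) (by fun_prop)).const_mul M)
  refine h1.aestronglyMeasurable.congr ?_
  filter_upwards [ae_ne_zero hn] with ξ hξ
  exact (H.rieszProfileDeriv_eq M k t hξ).symm

lemma exists_rescale_profile_bound (H : DampedSystem r m R₀ R₁ R₂) (hn : 1 ≤ n) (M : ℂ) {k : ℕ}
    {s : ℝ} (hκ : (r : ℝ) < n / 2 + k + s) : ∃ G : RSpace n → ℝ, MemLp G 2 volume ∧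
      ∀ a : ℝ, 0 ≤ a → a ≤ 1 → ∀ (θ : ℝ) (η : RSpace n), η ≠ 0 →
        ‖((‖η‖ ^ ((k : ℝ) + s - r) : ℝ) : ℂ) * (M * dirModeSum r k R₀ R₁ (a * ‖η‖) θ (‖η‖ ^ 2) η)‖ ≤
          G η := by
  obtain ⟨c, hc, h⟩ := H.exists_modeSum_bound
  obtain ⟨C, hC, hb⟩ := h k
  refine ⟨_, (memLp_pow_mul_rpow_mul_exp hn (κ := (k : ℝ) + s - r) (by linarith) hc k).const_mul
    (‖M‖ * C), fun a ha ha1 θ η hη => ?_⟩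
  have h1 := hb _ (normalize_mem_sphere hη) (a * ‖η‖) θ (‖η‖ ^ 2) (by positivity) (by positivity)
  have h2 : C * (1 + a * ‖η‖) ^ k * Real.exp (-c * ‖η‖ ^ 2) ≤
      C * (1 + ‖η‖) ^ k * Real.exp (-c * ‖η‖ ^ 2) := by
    gcongr
    exact mul_le_of_le_one_left (norm_nonneg _) ha1
  rw [norm_mul, norm_mul, Complex.norm_real, Real.norm_of_nonneg (by positivity)]
  calc ‖η‖ ^ ((k : ℝ) + s - r) * (‖M‖ * ‖dirModeSum r k R₀ R₁ (a * ‖η‖) θ (‖η‖ ^ 2) η‖)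
      ≤ ‖η‖ ^ ((k : ℝ) + s - r) * (‖M‖ * (C * (1 + ‖η‖) ^ k * Real.exp (-c * ‖η‖ ^ 2))) := by
        gcongr
        exact h1.trans h2
    _ = _ := by ring

/-- In diffusive variables the profile may be replaced by its limit. -/
lemma tendsto_limitProfile_sub_profile (H : DampedSystem r m R₀ R₁ R₂) (hn : 1 ≤ n) (M : ℂ)
    {k : ℕ} {s : ℝ} (hκ : (r : ℝ) < n / 2 + k + s) :
    Tendsto (fun t => eLpNorm (fun η => limitProfile r k R₀ R₁ M s t η -
      rescale r k s t (rieszProfileDeriv r R₀ R₁ M k t) η) 2 volume) atTop (𝓝 0) := by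
  obtain ⟨G, hG, hb⟩ := H.exists_rescale_profile_bound hn M hκ
  refine tendsto_eLpNorm_two_of_dominated (g := fun η => 2 * G η) ?_ ?_ (hG.const_mul 2) ?_
  · filter_upwards [eventually_gt_atTop (0 : ℝ)] with t ht
    exact (H.measurable_limitProfile k M s t).aestronglyMeasurable.sub
      (aestronglyMeasurable_rescale r k s ht (H.aestronglyMeasurable_rieszProfileDeriv hn M k t))
  · filter_upwards [eventually_ge_atTop (1 : ℝ)] with t ht
    filter_upwards [ae_ne_zero hn] with η hη
    rw [H.rescale_rieszProfileDeriv M k s (by linarith) hη]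
    have hst : 1 ≤ √t := Real.one_le_sqrt.2 ht
    have h0 := hb 0 le_rfl zero_le_one (‖η‖ * √t) η hη
    have h1 := hb (√t)⁻¹ (by positivity) (inv_le_one_of_one_le₀ hst) (‖η‖ * √t) η hη
    rw [zero_mul] at h0
    rw [inv_mul_eq_div] at h1
    refine (norm_sub_le _ _).trans ?_
    rw [limitProfile]
    linarith
  · filter_upwards [ae_ne_zero hn] with η hη
    have h1 := H.tendsto_modeSum_sub (normalize_mem_sphere hη) k (a := fun t => ‖η‖ / √t)
      (θ := fun t => ‖η‖ * √t) (ν := ‖η‖ ^ 2) (by positivity) (tendsto_div_sqrt_atTop _)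
    have h2 := h1.const_mul (((‖η‖ ^ ((k : ℝ) + s - r) : ℝ) : ℂ) * M)
    rw [mul_zero] at h2
    refine h2.congr' ?_
    filter_upwards [eventually_gt_atTop (0 : ℝ)] with t ht
    rw [H.rescale_rieszProfileDeriv M k s ht hη, limitProfile, dirModeSum, dirModeSum]
    ring

lemma memLp_weighted_rieszProfileDeriv (H : DampedSystem r m R₀ R₁ R₂) (hn : 1 ≤ n) (M : ℂ)
    {k : ℕ} {s : ℝ} (hκ : (r : ℝ) < n / 2 + k + s) {t : ℝ} (ht : 0 < t) :
    MemLp (weighted s (rieszProfileDeriv r R₀ R₁ M k t)) 2 volume := by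
  obtain ⟨c, hc, h⟩ := H.exists_modeSum_bound
  obtain ⟨C, hC, hb⟩ := h k
  refine ((memLp_pow_mul_rpow_mul_exp hn (κ := (k : ℝ) + s - r) (by linarith)
    (mul_pos hc ht) k).const_mul (‖M‖ * C)).mono'
    (aestronglyMeasurable_weighted s (H.aestronglyMeasurable_rieszProfileDeriv hn M k t)) ?_
  filter_upwards [ae_ne_zero hn] with ξ hξ
  have hξ0 : 0 < ‖ξ‖ := norm_pos_iff.2 hξ
  have h1 := hb _ (normalize_mem_sphere hξ) ‖ξ‖ (‖ξ‖ * t) (‖ξ‖ ^ 2 * t) (by positivity)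
    (by positivity)
  rw [weighted, H.rieszProfileDeriv_eq M k t hξ, ← mul_assoc, ← Complex.ofReal_mul, norm_mul,
    norm_mul, Complex.norm_real, Real.norm_of_nonneg (by positivity)]
  have h2 : ‖ξ‖ ^ s * (‖ξ‖ ^ k / ‖ξ‖ ^ r) = ‖ξ‖ ^ ((k : ℝ) + s - r) := by
    rw [← Real.rpow_natCast, ← Real.rpow_natCast, ← Real.rpow_sub hξ0, ← Real.rpow_add hξ0]
    congr 1
    ring
  have h3 : -c * (‖ξ‖ ^ 2 * t) = -(c * t) * ‖ξ‖ ^ 2 := by ring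
  rw [h3] at h1
  rw [h2]
  calc ‖ξ‖ ^ ((k : ℝ) + s - r) * (‖M‖ * ‖dirModeSum r k R₀ R₁ ‖ξ‖ (‖ξ‖ * t) (‖ξ‖ ^ 2 * t) ξ‖)
      ≤ ‖ξ‖ ^ ((k : ℝ) + s - r) * (‖M‖ * (C * (1 + ‖ξ‖) ^ k * Real.exp (-(c * t) * ‖ξ‖ ^ 2))) := by
        gcongr
        exact h1
    _ = _ := by ring

variable [NeZero m] {s₀ : ℝ} {g : ℕ → RSpace n → ℂ}

/-- Contributions of frequencies bounded away from zero are negligible. -/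
lemma tendsto_rescale_outer (H : DampedSystem r m R₀ R₁ R₂) (hn : 1 ≤ n)
    (hs₀ : (m : ℝ) - 1 ≤ s₀) (hg : FourierData n m s₀ g) {k : ℕ} {s : ℝ} (hks : k + s ≤ s₀) {δ : ℝ}
    (hδ : 0 < δ) : Tendsto (fun t => eLpNorm (rescale r k s t
      ((Metric.closedBall (0 : RSpace n) δ)ᶜ.indicator (solHat m (R₀ + R₁ + R₂) g k t))) 2 volume)
      atTop (𝓝 0) := by
  obtain ⟨c, C, hc, hC, hb⟩ := H.exists_solHat_bound hs₀ hδ hks g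
  set W := dataWeight m s₀ g with hW
  have hWL : MemLp W 2 volume := hg.memLp_dataWeight
  set e : ℝ := (n : ℝ) / 4 + ((k : ℝ) + s - r) / 2 with he
  have h1 : Tendsto (fun t : ℝ => t ^ e * (C * Real.exp (-c * t))) atTop (𝓝 0) := by
    have := (tendsto_rpow_mul_exp_neg_mul_atTop_nhds_zero e c hc).const_mul C
    rw [mul_zero] at this
    exact this.congr fun t => by ring
  have h2 : Tendsto (fun t : ℝ => ENNReal.ofReal (t ^ e * (C * Real.exp (-c * t))) *
      eLpNorm W 2 volume) atTop (𝓝 0) := by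
    have := ENNReal.Tendsto.mul_const (b := eLpNorm W 2 volume) (ENNReal.tendsto_ofReal h1)
      (Or.inr hWL.2.ne)
    rwa [ENNReal.ofReal_zero, zero_mul] at this
  refine tendsto_of_tendsto_of_tendsto_of_le_of_le' tendsto_const_nhds h2
    (Eventually.of_forall fun _ => zero_le) ?_
  filter_upwards [eventually_gt_atTop (0 : ℝ)] with t ht
  rw [eLpNorm_rescale hn r k s ht ((aestronglyMeasurable_solHat hg.continuous k t).indicator
    Metric.isClosed_closedBall.measurableSet.compl), ENNReal.ofReal_mul (by positivity), mul_assoc,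
    ← he]
  gcongr
  refine (eLpNorm_le_mul_eLpNorm_of_ae_le_mul (c := C * Real.exp (-c * t)) (g := W) ?_ 2)
  refine Eventually.of_forall fun ξ => ?_
  have hWξ := dataWeight_nonneg m s₀ g ξ
  rw [Real.norm_of_nonneg hWξ]
  by_cases hξ : ξ ∈ Metric.closedBall (0 : RSpace n) δ
  · rw [weighted, indicator_of_notMem (by simpa using hξ), mul_zero, norm_zero]
    positivity
  · rw [weighted, indicator_of_mem (by simpa using hξ), norm_mul, Complex.norm_real,
      Real.norm_of_nonneg (by positivity)]
    exact hb ξ (by simpa using (not_le.1 (by simpa using hξ)).le) t ht.le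

/-- In diffusive variables, the part of the solution at low frequencies is asymptotic to the limit
profile. -/
lemma exists_tendsto_rescale_inner (H : DampedSystem r m R₀ R₁ R₂) (hn : 1 ≤ n)
    (hg : FourierData n m s₀ g) {k : ℕ} {s : ℝ} (hs : 0 ≤ s) (hκ : (r : ℝ) < n / 2 + k + s) :
    ∃ δ : ℝ, 0 < δ ∧ Tendsto (fun t => eLpNorm (fun η => rescale r k s t
      ((Metric.closedBall (0 : RSpace n) δ).indicator (solHat m (R₀ + R₁ + R₂) g k t)) η -
      limitProfile r k R₀ R₁ (mass m (R₀ + R₁ + R₂) g) s t η) 2 volume) atTop (𝓝 0) := by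
  set Q := R₀ + R₁ + R₂ with hQ
  set M := mass m Q g with hM
  obtain ⟨δ, c, hδ, hδ1, hc, hlow⟩ := H.low_estimate
  obtain ⟨C, hC, hlow⟩ := hlow k
  obtain ⟨V, hV, hVb⟩ := hg.bounded
  obtain ⟨G, hG, hGb⟩ := H.exists_rescale_profile_bound hn M hκ
  -- The exponentially decaying part of the bound at low frequencies is absorbed by a Gaussian.
  obtain ⟨D, hD⟩ : ∃ D : ℝ, ∀ᶠ t : ℝ in atTop,
      t ^ (((k : ℝ) - r) / 2) * Real.exp (-(c / 2) * t) ≤ D :=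
    ⟨1, (tendsto_rpow_mul_exp_neg_mul_atTop_nhds_zero (((k : ℝ) - r) / 2) (c / 2)
      (by positivity)).eventually_le_const one_pos⟩
  set G₁ : RSpace n → ℝ := fun η => ‖η‖ ^ ((k : ℝ) + s - r) * Real.exp (-c * ‖η‖ ^ 2) with hG₁
  set G₂ : RSpace n → ℝ := fun η => ‖η‖ ^ s * Real.exp (-(c / 2) * ‖η‖ ^ 2) with hG₂
  have hn' : (1 : ℝ) ≤ n := by exact_mod_cast hn
  have hGG : MemLp (fun η => (C * V * (G₁ η + D * G₂ η)) + G η) 2 volume :=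
    (((memLp_rpow_mul_exp hn (by linarith) hc).add ((memLp_rpow_mul_exp hn (by linarith)
      (by positivity)).const_mul D)).const_mul (C * V)).add hG
  refine ⟨δ, hδ, tendsto_eLpNorm_two_of_dominated ?_ ?_ hGG ?_⟩
  · filter_upwards [eventually_gt_atTop (0 : ℝ)] with t ht
    exact (aestronglyMeasurable_rescale r k s ht ((aestronglyMeasurable_solHat hg.continuous k
      t).indicator Metric.isClosed_closedBall.measurableSet)).sub
      (H.measurable_limitProfile k M s t).aestronglyMeasurable
  · filter_upwards [eventually_gt_atTop (0 : ℝ), hD] with t ht hDt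
    filter_upwards [ae_ne_zero hn] with η hη
    have hσ : 0 < ‖η‖ := norm_pos_iff.2 hη
    have hst : 0 < √t := Real.sqrt_pos.2 ht
    have hD0 : 0 ≤ D := le_trans (by positivity) hDt
    have hnorm : ‖(√t)⁻¹ • η‖ = ‖η‖ / √t := by
      rw [norm_smul, Real.norm_of_nonneg (by positivity), inv_mul_eq_div]
    have hprof := hGb 0 le_rfl zero_le_one (‖η‖ * √t) η hη
    rw [zero_mul] at hprof
    refine (norm_sub_le _ _).trans (add_le_add ?_ hprof)
    have hG₁0 : 0 ≤ G₁ η := by positivity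
    have hG₂0 : 0 ≤ G₂ η := by positivity
    rw [rescale]
    by_cases hη' : (√t)⁻¹ • η ∈ Metric.closedBall (0 : RSpace n) δ
    · rw [indicator_of_mem hη', norm_mul, Complex.norm_real, Real.norm_of_nonneg (by positivity)]
      rw [mem_closedBall_zero_iff, hnorm] at hη'
      set ρ : ℝ := ‖η‖ / √t with hρ
      have hρ0 : 0 < ρ := by positivity
      have hξ : (√t)⁻¹ • η = ρ • (‖η‖⁻¹ • η) := by
        rw [smul_smul, hρ]
        congr 1
        field_simp
      have hρt : ρ ^ 2 * t = ‖η‖ ^ 2 := by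
        rw [hρ, div_pow, Real.sq_sqrt ht.le, div_mul_cancel₀ _ ht.ne']
      have h1 := hlow _ (normalize_mem_sphere hη) ρ hρ0 hη'
        _ (isJet_solJet (m := m) (charPoly Q (ρ • (‖η‖⁻¹ • η))) fun i => g i ((√t)⁻¹ • η))
        (polyAct_solJet (H.monic_charPoly _) (H.natDegree_charPoly _) _) V
        (fun i hi => by rw [solJet_zero _ _ hi]; exact hVb i hi _) t ht.le
      rw [← hξ] at h1
      have e1 : -c * ρ ^ 2 * t = -c * ‖η‖ ^ 2 := by rw [mul_assoc, hρt]
      have e2 : Real.exp (-c * t) ≤ Real.exp (-(c / 2) * t) * Real.exp (-(c / 2) * ‖η‖ ^ 2) := by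
        rw [← Real.exp_add, Real.exp_le_exp, ← hρt]
        have : ρ ^ 2 ≤ 1 := pow_le_one₀ hρ0.le (hη'.trans hδ1)
        have : ρ ^ 2 * t ≤ t := mul_le_of_le_one_left ht.le this
        nlinarith
      have e3 : ‖η‖ ^ ((k : ℝ) + s - r) * (ρ ^ r / ρ ^ k) = ‖η‖ ^ s * t ^ (((k : ℝ) - r) / 2) := by
        rw [← Real.rpow_natCast, ← Real.rpow_natCast, ← Real.rpow_sub hρ0, hρ,
          Real.div_rpow hσ.le hst.le, Real.sqrt_eq_rpow, ← Real.rpow_mul ht.le, div_eq_mul_inv,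
          ← Real.rpow_neg ht.le, ← mul_assoc, ← Real.rpow_add hσ]
        congr 2 <;> ring
      have e4 : ρ ^ r / ρ ^ k * (ρ ^ k / ρ ^ r) = 1 := by field_simp
      rw [e1] at h1
      calc ‖η‖ ^ ((k : ℝ) + s - r) * (ρ ^ r / ρ ^ k) * ‖solHat m Q g k t ((√t)⁻¹ • η)‖
          ≤ ‖η‖ ^ ((k : ℝ) + s - r) * (ρ ^ r / ρ ^ k) * (C * V * (ρ ^ k / ρ ^ r *
            Real.exp (-c * ‖η‖ ^ 2) + Real.exp (-(c / 2) * t) * Real.exp (-(c / 2) * ‖η‖ ^ 2))) := by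
            refine mul_le_mul_of_nonneg_left (h1.trans ?_) (by positivity)
            gcongr
        _ = C * V * (‖η‖ ^ ((k : ℝ) + s - r) * (ρ ^ r / ρ ^ k * (ρ ^ k / ρ ^ r)) *
            Real.exp (-c * ‖η‖ ^ 2) + (‖η‖ ^ ((k : ℝ) + s - r) * (ρ ^ r / ρ ^ k)) *
            (Real.exp (-(c / 2) * t) * Real.exp (-(c / 2) * ‖η‖ ^ 2))) := by ring
        _ = C * V * (G₁ η + (t ^ (((k : ℝ) - r) / 2) * Real.exp (-(c / 2) * t)) * G₂ η) := by
            rw [e4, e3, hG₁, hG₂]; ring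
        _ ≤ C * V * (G₁ η + D * G₂ η) := by gcongr
    · rw [indicator_of_notMem hη', mul_zero, norm_zero]
      positivity
  · filter_upwards [ae_ne_zero hn] with η hη
    have hσ : 0 < ‖η‖ := norm_pos_iff.2 hη
    have hξlim : Tendsto (fun t : ℝ => (‖η‖ / √t) • (‖η‖⁻¹ • η)) atTop (𝓝 0) := by
      have := (tendsto_div_sqrt_atTop ‖η‖).smul_const (‖η‖⁻¹ • η)
      rwa [zero_smul] at this
    have h1 := H.tendsto_diffusive (normalize_mem_sphere hη) hσ k
      (Y := fun t => solJet m (charPoly Q ((‖η‖ / √t) • (‖η‖⁻¹ • η)))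
        fun i => g i ((‖η‖ / √t) • (‖η‖⁻¹ • η)))
      (fun t => isJet_solJet _ _)
      (fun t => polyAct_solJet (H.monic_charPoly _) (H.natDegree_charPoly _) _)
      (v := fun i => g i 0) (fun i hi => by
        simp only [solJet_zero _ _ hi]
        exact ((hg.continuous i hi).tendsto 0).comp hξlim)
    have h2 := h1.const_mul ((‖η‖ ^ ((k : ℝ) + s - r) : ℝ) : ℂ)
    rw [mul_zero] at h2
    refine h2.congr' ?_
    filter_upwards [eventually_gt_atTop (0 : ℝ),
      (tendsto_div_sqrt_atTop ‖η‖).eventually_le_const hδ] with t ht htδ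
    have hξ : (√t)⁻¹ • η = (‖η‖ / √t) • (‖η‖⁻¹ • η) := by
      rw [smul_smul]
      congr 1
      field_simp
    have hmem : (√t)⁻¹ • η ∈ Metric.closedBall (0 : RSpace n) δ := by
      rw [mem_closedBall_zero_iff, norm_smul, Real.norm_of_nonneg (by positivity), inv_mul_eq_div]
      exact htδ
    rw [rescale, indicator_of_mem hmem, limitProfile, solHat, hξ, hM, mass, dirModeSum]
    push_cast
    ring

/-- In diffusive variables, the solution is asymptotic to the limit profile. -/
lemma tendsto_rescale_solHat (H : DampedSystem r m R₀ R₁ R₂) (hn : 1 ≤ n)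
    (hs₀ : (m : ℝ) - 1 ≤ s₀) (hg : FourierData n m s₀ g) {k : ℕ} {s : ℝ} (hs : 0 ≤ s)
    (hks : k + s ≤ s₀) (hκ : (r : ℝ) < n / 2 + k + s) :
    Tendsto (fun t => eLpNorm (fun η => rescale r k s t (solHat m (R₀ + R₁ + R₂) g k t) η -
      limitProfile r k R₀ R₁ (mass m (R₀ + R₁ + R₂) g) s t η) 2 volume) atTop (𝓝 0) := by
  obtain ⟨δ, hδ, h1⟩ := H.exists_tendsto_rescale_inner hn hg hs hκ
  have h2 := h1.add (H.tendsto_rescale_outer hn hs₀ hg hks hδ)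
  rw [add_zero] at h2
  refine tendsto_of_tendsto_of_tendsto_of_le_of_le' tendsto_const_nhds h2
    (Eventually.of_forall fun _ => zero_le) ?_
  filter_upwards [eventually_gt_atTop (0 : ℝ)] with t ht
  have hm := aestronglyMeasurable_solHat (Q := R₀ + R₁ + R₂) hg.continuous k t
  have hB : MeasurableSet (Metric.closedBall (0 : RSpace n) δ) :=
    Metric.isClosed_closedBall.measurableSet
  refine le_trans (le_of_eq ?_) (eLpNorm_add_le ((aestronglyMeasurable_rescale r k s ht
    (hm.indicator hB)).sub (H.measurable_limitProfile k _ s t).aestronglyMeasurable)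
    (aestronglyMeasurable_rescale r k s ht (hm.indicator hB.compl)) (by norm_num))
  congr 1
  ext η
  have h3 := congrFun (indicator_self_add_compl (Metric.closedBall (0 : RSpace n) δ)
    (solHat m (R₀ + R₁ + R₂) g k t)) ((√t)⁻¹ • η)
  simp only [Pi.add_apply] at h3
  simp only [Pi.add_apply, rescale]
  rw [← h3]
  ring

/-- The solution is asymptotic to the profile, to leading order in `t`. -/
lemma isLittleO_dotNorm_sub_profile (H : DampedSystem r m R₀ R₁ R₂) (hn : 1 ≤ n)
    (hs₀ : (m : ℝ) - 1 ≤ s₀) (hg : FourierData n m s₀ g) {k : ℕ} {s : ℝ} (hs : 0 ≤ s)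
    (hks : k + s ≤ s₀) (hκ : (r : ℝ) < n / 2 + k + s) :
    (fun t => dotNorm s (fun ξ => solHat m (R₀ + R₁ + R₂) g k t ξ -
      rieszProfileDeriv r R₀ R₁ (mass m (R₀ + R₁ + R₂) g) k t ξ)) =o[atTop]
      (fun t : ℝ => (1 + t) ^ (-(n : ℝ) / 4 - ((k : ℝ) + s - r) / 2)) := by
  set Q := R₀ + R₁ + R₂ with hQ
  set M := mass m Q g with hM
  have h1 := (H.tendsto_rescale_solHat hn hs₀ hg hs hks hκ).add
    (H.tendsto_limitProfile_sub_profile hn M hκ)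
  rw [add_zero] at h1
  have h2 : Tendsto (fun t => eLpNorm (rescale r k s t (fun ξ => solHat m Q g k t ξ -
      rieszProfileDeriv r R₀ R₁ M k t ξ)) 2 volume) atTop (𝓝 0) := by
    refine tendsto_of_tendsto_of_tendsto_of_le_of_le' tendsto_const_nhds h1
      (Eventually.of_forall fun _ => zero_le) ?_
    filter_upwards [eventually_gt_atTop (0 : ℝ)] with t ht
    have hm1 := aestronglyMeasurable_rescale r k s ht
      (aestronglyMeasurable_solHat (Q := Q) hg.continuous k t)
    have hm2 := (H.measurable_limitProfile k M s t).aestronglyMeasurable (μ := volume)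
    have hm3 := aestronglyMeasurable_rescale r k s ht
      (H.aestronglyMeasurable_rieszProfileDeriv hn M k t)
    refine le_trans (le_of_eq ?_) (eLpNorm_add_le (hm1.sub hm2) (hm2.sub hm3) (by norm_num))
    rw [rescale_sub]
    congr 1
    ext η
    simp only [Pi.add_apply]
    ring
  have h3 := ((ENNReal.tendsto_toReal ENNReal.zero_ne_top).comp h2).mul
    (tendsto_rpow_div_one_add_rpow (-(n : ℝ) / 4 - ((k : ℝ) + s - r) / 2))
  simp only [ENNReal.toReal_zero, zero_mul] at h3
  refine isLittleO_of_tendsto' ?_ (h3.congr' ?_)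
  · filter_upwards [eventually_gt_atTop (0 : ℝ)] with t ht h0
    have : (0 : ℝ) < (1 + t) ^ (-(n : ℝ) / 4 - ((k : ℝ) + s - r) / 2) := by positivity
    exact absurd h0 this.ne'
  · filter_upwards [eventually_gt_atTop (0 : ℝ)] with t ht
    have hm : AEStronglyMeasurable (fun ξ => solHat m Q g k t ξ - rieszProfileDeriv r R₀ R₁ M k t ξ)
        volume := (aestronglyMeasurable_solHat hg.continuous k t).sub
      (H.aestronglyMeasurable_rieszProfileDeriv hn M k t)
    rw [dotNorm_eq_rescale hn r k s ht hm]
    simp only [Function.comp_def]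
    ring

end DampedSystem

end DiffusiveLimit

/-! ### The lower bound -/

section Oscillation

lemma isProbabilityMeasure_Icc_one_two :
    IsProbabilityMeasure (volume.restrict (Icc (1 : ℝ) 2)) :=
  ⟨by rw [Measure.restrict_apply_univ, Real.volume_Icc]; norm_num⟩

/-- The Riemann–Lebesgue lemma on the interval `[1, 2]`. -/
lemma tendsto_integral_oscillation {β : ℝ} (hβ : β ≠ 0) {f : ℝ → ℂ} :
    Tendsto (fun l : ℝ => ∫ τ in Icc (1 : ℝ) 2, Complex.exp (Complex.I * (β * (τ * l))) * f τ) atTop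
      (𝓝 0) := by
  have h1 := Real.tendsto_integral_exp_smul_cocompact ((Icc (1 : ℝ) 2).indicator f)
  have h2 : Tendsto (fun l : ℝ => -(β / (2 * Real.pi)) * l) atTop (cocompact ℝ) :=
    (tendsto_cocompact_mul_left (inv_mul_cancel₀ (neg_ne_zero.2
      (div_ne_zero hβ (by positivity))))).comp (tendsto_id'.2 atTop_le_cocompact)
  refine (h1.comp h2).congr fun l => ?_
  rw [← integral_indicator measurableSet_Icc]
  simp only [Function.comp_def]
  congr 1
  ext τ
  by_cases hτ : τ ∈ Icc (1 : ℝ) 2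
  · rw [indicator_of_mem hτ, indicator_of_mem hτ, Circle.smul_def, Real.fourierChar_apply,
      smul_eq_mul]
    congr 2
    push_cast
    have : (Real.pi : ℂ) ≠ 0 := by exact_mod_cast Real.pi_ne_zero
    field_simp
  · rw [indicator_of_notMem hτ, indicator_of_notMem hτ, smul_zero]

/-- A sum of modes with distinct frequencies does not become small in mean square, since its product
with the inverse of one of the modes has an average close to the coefficient of that mode. -/
lemma exists_eLpNorm_oscillation_bound {S : Finset ℂ} (hS : ∀ b ∈ S, b.im = 0) (A q : ℂ → ℂ)
    (κ : ℝ) {b₀ : ℂ} (hb₀ : b₀ ∈ S) (hA : A b₀ ≠ 0) :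
    ∃ ε : ℝ, 0 < ε ∧ ∀ᶠ l : ℝ in atTop, ENNReal.ofReal ε ≤
      eLpNorm (fun τ : ℝ => ((τ ^ κ : ℝ) : ℂ) *
        ∑ b ∈ S, A b * Complex.exp (Complex.I * b * (τ * l) + τ ^ 2 * q b)) 2
        (volume.restrict (Icc (1 : ℝ) 2)) := by
  classical
  have hprob := isProbabilityMeasure_Icc_one_two
  set μ : Measure ℝ := volume.restrict (Icc (1 : ℝ) 2) with hμ
  set f : ℝ → ℝ → ℂ := fun l τ => ((τ ^ κ : ℝ) : ℂ) *
    ∑ b ∈ S, A b * Complex.exp (Complex.I * b * (τ * l) + τ ^ 2 * q b) with hf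
  set φ : ℝ → ℝ → ℂ := fun l τ => ((τ ^ (-κ) : ℝ) : ℂ) *
    Complex.exp (-(Complex.I * b₀ * (τ * l) + τ ^ 2 * q b₀)) with hφ
  set T : ℂ → ℝ → ℝ → ℂ := fun b l τ => A b * (Complex.exp (Complex.I * ((b - b₀) * (τ * l))) *
    Complex.exp (τ ^ 2 * (q b - q b₀))) with hT
  obtain ⟨K, hK, hφK⟩ : ∃ K : ℝ, 0 < K ∧ ∀ l, ∀ τ ∈ Icc (1 : ℝ) 2, ‖φ l τ‖ ≤ K := by
    refine ⟨2 ^ |κ| * Real.exp (4 * ‖q b₀‖), by positivity, fun l τ hτ => ?_⟩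
    have hτ0 : 0 < τ := by linarith [hτ.1]
    rw [hφ, norm_mul, Complex.norm_real, Real.norm_of_nonneg (by positivity)]
    gcongr
    · calc τ ^ (-κ) ≤ τ ^ |κ| := Real.rpow_le_rpow_of_exponent_le hτ.1 (neg_le_abs κ)
        _ ≤ 2 ^ |κ| := Real.rpow_le_rpow hτ0.le hτ.2 (abs_nonneg κ)
    · rw [Complex.norm_exp, Real.exp_le_exp]
      have h1 : (Complex.I * b₀ * (τ * l)).re = 0 := by
        rw [← Complex.ofReal_mul, Complex.re_mul_ofReal, Complex.I_mul_re, hS b₀ hb₀]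
        simp
      have h2 : ((τ : ℂ) ^ 2 * q b₀).re = τ ^ 2 * (q b₀).re := by
        rw [← Complex.ofReal_pow, Complex.re_ofReal_mul]
      rw [Complex.neg_re, Complex.add_re, h1, h2, zero_add]
      have h3 : |τ ^ 2 * (q b₀).re| ≤ 4 * ‖q b₀‖ := by
        rw [abs_mul, abs_of_nonneg (by positivity)]
        gcongr
        · nlinarith [hτ.1, hτ.2]
        · exact Complex.abs_re_le_norm _
      exact (neg_le_abs _).trans h3
  have hTint : ∀ b l, Integrable (T b l) μ := fun b l => by
    have : Continuous (T b l) := by fun_prop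
    exact this.integrableOn_Icc
  have hprod : ∀ l, ∀ τ ∈ Icc (1 : ℝ) 2, φ l τ * f l τ = ∑ b ∈ S, T b l τ := by
    intro l τ hτ
    have hτ0 : 0 < τ := by linarith [hτ.1]
    have h1 : ((τ ^ (-κ) : ℝ) : ℂ) * ((τ ^ κ : ℝ) : ℂ) = 1 := by
      rw [← Complex.ofReal_mul, ← Real.rpow_add hτ0, neg_add_cancel, Real.rpow_zero,
        Complex.ofReal_one]
    simp only [hφ, hf, hT]
    rw [Finset.mul_sum, Finset.mul_sum]
    refine Finset.sum_congr rfl fun b _ => ?_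
    have h2 : Complex.exp (Complex.I * ((b - b₀) * (τ * l))) * Complex.exp (τ ^ 2 * (q b - q b₀)) =
        Complex.exp (-(Complex.I * b₀ * (τ * l) + τ ^ 2 * q b₀)) *
          Complex.exp (Complex.I * b * (τ * l) + τ ^ 2 * q b) := by
      rw [← Complex.exp_add, ← Complex.exp_add]
      congr 1
      ring
    rw [h2]
    linear_combination (Complex.exp (-(Complex.I * b₀ * (τ * l) + τ ^ 2 * q b₀)) * A b *
      Complex.exp (Complex.I * b * (τ * l) + τ ^ 2 * q b)) * h1
  have hlim : Tendsto (fun l => ∫ τ, φ l τ * f l τ ∂μ) atTop (𝓝 (A b₀)) := by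
    have h1 : ∀ b ∈ S, Tendsto (fun l => ∫ τ, T b l τ ∂μ) atTop
        (𝓝 (if b = b₀ then A b₀ else 0)) := by
      intro b hb
      split_ifs with h
      · have h2 : ∀ l, ∫ τ, T b l τ ∂μ = A b₀ := fun l => by
          simp [hT, h]
        simp only [h2]
        exact tendsto_const_nhds
      · have h2 : (b - b₀ : ℂ) = ((b.re - b₀.re : ℝ) : ℂ) := by
          apply Complex.ext <;> simp [hS b hb, hS b₀ hb₀]
        have h3 : b.re - b₀.re ≠ 0 := fun h0 =>
          h (sub_eq_zero.1 (by rw [h2, h0, Complex.ofReal_zero]))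
        have h4 := (tendsto_integral_oscillation h3
          (f := fun τ => Complex.exp (τ ^ 2 * (q b - q b₀)))).const_mul (A b)
        rw [mul_zero] at h4
        refine h4.congr fun l => ?_
        rw [← integral_const_mul]
        simp only [hT, h2, hμ]
    have h2 := tendsto_finsetSum S h1
    rw [Finset.sum_ite_eq' S b₀ (fun _ => A b₀), if_pos hb₀] at h2
    refine h2.congr fun l => ?_
    rw [← integral_finsetSum S fun b _ => hTint b l]
    exact (setIntegral_congr_fun measurableSet_Icc (hprod l)).symm
  have hA0 : 0 < ‖A b₀‖ := norm_pos_iff.2 hA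
  refine ⟨‖A b₀‖ / 2 / K, by positivity, ?_⟩
  filter_upwards [hlim.norm.eventually_const_le (half_lt_self hA0)] with l hl
  have hfm : AEStronglyMeasurable (f l) μ := by
    refine Measurable.aestronglyMeasurable ?_
    exact (Complex.measurable_ofReal.comp (measurable_id.pow_const κ)).mul (by fun_prop)
  have h1 : ENNReal.ofReal (‖A b₀‖ / 2) ≤ ENNReal.ofReal K * eLpNorm (f l) 2 μ := by
    calc ENNReal.ofReal (‖A b₀‖ / 2) ≤ ENNReal.ofReal ‖∫ τ, φ l τ * f l τ ∂μ‖ :=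
          ENNReal.ofReal_le_ofReal hl
      _ ≤ eLpNorm (fun τ => φ l τ * f l τ) 1 μ := by
          rw [ofReal_norm, eLpNorm_one_eq_lintegral_enorm]
          exact enorm_integral_le_lintegral_enorm _
      _ ≤ ENNReal.ofReal K * eLpNorm (f l) 1 μ := by
          refine eLpNorm_le_mul_eLpNorm_of_ae_le_mul ?_ 1
          rw [hμ]
          filter_upwards [ae_restrict_mem measurableSet_Icc] with τ hτ
          rw [norm_mul]
          gcongr
          exact hφK l τ hτ
      _ ≤ ENNReal.ofReal K * eLpNorm (f l) 2 μ := by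
          gcongr
          exact eLpNorm_le_eLpNorm_of_exponent_le (by norm_num) hfm
  rw [ENNReal.ofReal_div_of_pos hK]
  exact ENNReal.div_le_of_le_mul' h1

end Oscillation

section LowerBound

lemma eLpNorm_two_rpow_two {X : Type*} [MeasurableSpace X] (μ : Measure X) (f : X → ℂ) :
    eLpNorm f 2 μ ^ (2 : ℝ) = ∫⁻ x, ‖f x‖ₑ ^ (2 : ℝ) ∂μ := by
  simpa using eLpNorm_nnreal_pow_eq_lintegral (f := f) (μ := μ) (p := 2) (by norm_num)

variable {n r m : ℕ} {R₀ R₁ R₂ : DiffOp n}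

/-- Averages over dilations with factors in `[1, 2]` are controlled by the norm: a dilation by
`τ ≥ 1` does not increase it. -/
lemma lintegral_dilation_le (F : RSpace n → ℂ) (hF : Measurable F) :
    ∫⁻ η, eLpNorm (fun τ : ℝ => F (τ • η)) 2 (volume.restrict (Icc (1 : ℝ) 2)) ^ (2 : ℝ) ≤
      eLpNorm F 2 volume ^ (2 : ℝ) := by
  have hprob := isProbabilityMeasure_Icc_one_two
  simp only [eLpNorm_two_rpow_two]
  have hm : Measurable fun x : RSpace n × ℝ => ‖F (x.2 • x.1)‖ₑ ^ (2 : ℝ) :=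
    (hF.comp (by fun_prop)).enorm.pow_const _
  rw [lintegral_lintegral_swap hm.aemeasurable]
  calc ∫⁻ τ in Icc (1 : ℝ) 2, ∫⁻ η : RSpace n, ‖F (τ • η)‖ₑ ^ (2 : ℝ)
      ≤ ∫⁻ _ in Icc (1 : ℝ) 2, ∫⁻ η, ‖F η‖ₑ ^ (2 : ℝ) := by
        refine setLIntegral_mono' measurableSet_Icc fun τ hτ => ?_
        have hτ0 : 0 < τ := by linarith [hτ.1]
        rw [← eLpNorm_two_rpow_two volume fun η => F (τ • η), ← eLpNorm_two_rpow_two volume F,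
          eLpNorm_comp_smul hτ0 hF.aestronglyMeasurable]
        refine ENNReal.rpow_le_rpow (mul_le_of_le_one_left zero_le ?_) (by norm_num)
        rw [ENNReal.ofReal_le_one]
        refine Real.rpow_le_one_of_one_le_of_nonpos hτ.1 ?_
        have : (0 : ℝ) ≤ n := Nat.cast_nonneg n
        linarith
    _ = _ := by rw [lintegral_const, measure_univ, mul_one]

namespace DampedSystem

/-- The directions with a mode that contributes to the `k`-th time derivative form an open set. -/
lemma eventually_exists_root (H : DampedSystem r m R₀ R₁ R₂) {k : ℕ} {ω : RSpace n}
    (hω : ω ∈ Metric.sphere (0 : RSpace n) 1) {b : ℂ} (hb : (symbolAt R₀ ω).IsRoot b)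
    (hbk : b ^ k ≠ 0) : ∀ᶠ η in 𝓝 ω, η ≠ 0 ∧
      ∃ b ∈ (symbolAt R₀ (‖η‖⁻¹ • η)).roots.toFinset, b ^ k ≠ 0 := by
  have hω1 : ‖ω‖ = 1 := by simpa using hω
  have hω0 : ω ≠ 0 := norm_ne_zero_iff.1 (by rw [hω1]; exact one_ne_zero)
  have hdir : ‖ω‖⁻¹ • ω = ω := by rw [hω1, inv_one, one_smul]
  have hne : ∀ᶠ η in 𝓝 ω, η ≠ 0 := isOpen_ne.mem_nhds hω0
  have hdeg0 : ∀ ω : RSpace n, (symbolAt R₀ ω).natDegree ≤ r + 1 := fun ω =>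
    natDegree_complexSymbol_le H.hyp₀.homogeneous _
  have h1 : Tendsto (fun η : RSpace n => ∑ b ∈ (symbolAt R₀ (‖η‖⁻¹ • η)).roots.toFinset,
      ((‖b ^ k‖ : ℝ) : ℂ)) (𝓝 ω)
      (𝓝 (∑ b ∈ (symbolAt R₀ ω).roots.toFinset, ((‖b ^ k‖ : ℝ) : ℂ))) := by
    refine tendsto_sum_roots (N := r + 1) (fun η => hdeg0 _) (hdeg0 _) (fun j => ?_) ?_ ?_ ?_ ?_
    · have h2 := ((continuous_coeff_symbolAt R₀ j).tendsto (‖ω‖⁻¹ • ω)).comp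
        (continuousAt_normalize hω0)
      rw [hdir] at h2
      exact h2
    · exact Eventually.of_forall fun η => H.hyp₀.symbolAt_ne_zero _
    · filter_upwards [hne] with η hη
      rw [H.hyp₀.card_roots (normalize_mem_sphere hη), H.hyp₀.card_roots hω]
    · exact fun b hb => H.derivative_ne_zero hω hb
    · exact fun b _ z hz => (Complex.continuous_ofReal.tendsto _).comp (hz.pow k).norm
  have h2 : ∑ b ∈ (symbolAt R₀ ω).roots.toFinset, ((‖b ^ k‖ : ℝ) : ℂ) ≠ 0 := by
    rw [← Complex.ofReal_sum, Complex.ofReal_ne_zero]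
    exact (Finset.sum_pos' (f := fun b : ℂ => ‖b ^ k‖) (fun b _ => norm_nonneg _)
      ⟨b, H.hyp₀.mem_roots.2 hb, norm_pos_iff.2 hbk⟩).ne'
  filter_upwards [hne, h1.eventually_ne h2] with η hη hs
  refine ⟨hη, ?_⟩
  by_contra! hall
  exact hs (Finset.sum_eq_zero fun b hb => by rw [hall b hb]; simp)

/-- On a ray, the limit profile is a sum of modes with frequencies proportional to `√t`. -/
lemma exists_limitProfile_ray_bound (H : DampedSystem r m R₀ R₁ R₂) {M : ℂ} (hM : M ≠ 0) {k : ℕ}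
    (s : ℝ) {η : RSpace n} (hη : η ≠ 0) {b : ℂ}
    (hb : b ∈ (symbolAt R₀ (‖η‖⁻¹ • η)).roots.toFinset) (hbk : b ^ k ≠ 0) :
    ∃ ε : ℝ, 0 < ε ∧ ∀ᶠ t : ℝ in atTop, ENNReal.ofReal ε ≤
      eLpNorm (fun τ : ℝ => limitProfile r k R₀ R₁ M s t (τ • η)) 2
        (volume.restrict (Icc (1 : ℝ) 2)) := by
  set ω := ‖η‖⁻¹ • η with hω
  have hωS := normalize_mem_sphere hη
  have hσ : 0 < ‖η‖ := norm_pos_iff.2 hη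
  set κ : ℝ := (k : ℝ) + s - r with hκ
  obtain ⟨ε, hε, h⟩ := exists_eLpNorm_oscillation_bound (S := (symbolAt R₀ ω).roots.toFinset)
    (fun b hb => H.hyp₀.real_roots ω hωS b (H.hyp₀.mem_roots.1 hb))
    (fun b => ((‖η‖ ^ κ : ℝ) : ℂ) * (M * ((Complex.I * b) ^ k /
      (Complex.I ^ r * (symbolAt R₀ ω).derivative.eval b))))
    (fun b => (‖η‖ : ℂ) ^ 2 * ((symbolAt R₁ ω).eval b / (symbolAt R₀ ω).derivative.eval b)) κ hb
    (by
      refine mul_ne_zero (Complex.ofReal_ne_zero.2 (by positivity)) (mul_ne_zero hM (div_ne_zero ?_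
        (mul_ne_zero (pow_ne_zero _ Complex.I_ne_zero) (H.derivative_ne_zero hωS hb))))
      rw [mul_pow]
      exact mul_ne_zero (pow_ne_zero _ Complex.I_ne_zero) hbk)
  have hlim : Tendsto (fun t : ℝ => ‖η‖ * √t) atTop atTop :=
    Real.tendsto_sqrt_atTop.const_mul_atTop hσ
  refine ⟨ε, hε, ?_⟩
  filter_upwards [hlim.eventually h] with t ht
  refine ht.trans (le_of_eq (eLpNorm_congr_ae ?_))
  filter_upwards [ae_restrict_mem measurableSet_Icc] with τ hτ
  have hτ0 : 0 < τ := by linarith [hτ.1]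
  have hnorm : ‖τ • η‖ = τ * ‖η‖ := by rw [norm_smul, Real.norm_of_nonneg hτ0.le]
  have hdir : (τ * ‖η‖)⁻¹ • τ • η = ω := by
    rw [smul_smul, hω]
    congr 1
    field_simp
  simp only [limitProfile, dirModeSum, modeSum, hnorm, hdir]
  rw [Real.mul_rpow hτ0.le hσ.le, Finset.mul_sum, Finset.mul_sum, Finset.mul_sum]
  refine Finset.sum_congr rfl fun b _ => ?_
  have e1 : Complex.I * b * (τ * ((‖η‖ * √t : ℝ) : ℂ)) + τ ^ 2 * ((‖η‖ : ℂ) ^ 2 *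
      ((symbolAt R₁ ω).eval b / (symbolAt R₀ ω).derivative.eval b)) =
      Complex.I * b * ((τ * ‖η‖ * √t : ℝ) : ℂ) + (((τ * ‖η‖) ^ 2 : ℝ) : ℂ) *
      ((symbolAt R₁ ω).eval b / (symbolAt R₀ ω).derivative.eval b) := by
    push_cast
    ring
  rw [e1]
  push_cast
  ring

/-- The limit profile does not become small in `L²`: by Fatou's lemma it is enough to consider its
averages over dilations at a fixed point, which are bounded below by
`exists_limitProfile_ray_bound`. -/
lemma exists_limitProfile_lower_bound (H : DampedSystem r m R₀ R₁ R₂) {M : ℂ} (hM : M ≠ 0) {k : ℕ}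
    (s : ℝ) {ω : RSpace n} (hω : ω ∈ Metric.sphere (0 : RSpace n) 1) {b : ℂ}
    (hb : (symbolAt R₀ ω).IsRoot b) (hbk : b ^ k ≠ 0) :
    ∃ c : ℝ, 0 < c ∧ ∀ᶠ t : ℝ in atTop,
      ENNReal.ofReal c ≤ eLpNorm (limitProfile r k R₀ R₁ M s t) 2 volume := by
  by_contra! hcon
  -- Otherwise the norms tend to zero along a sequence of times, which contradicts Fatou's lemma.
  have h1 : ∀ j : ℕ, ∃ t : ℝ, (j : ℝ) ≤ t ∧
      eLpNorm (limitProfile r k R₀ R₁ M s t) 2 volume < ENNReal.ofReal (1 / ((j : ℝ) + 1)) := by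
    intro j
    obtain ⟨t, ht1, ht2⟩ := ((hcon (1 / ((j : ℝ) + 1)) (by positivity)).and_eventually
      (eventually_ge_atTop (j : ℝ))).exists
    exact ⟨t, ht2, ht1⟩
  choose t htj htN using h1
  have httop : Tendsto t atTop atTop := tendsto_atTop_mono htj tendsto_natCast_atTop_atTop
  set J : ℕ → RSpace n → ENNReal := fun j η =>
    eLpNorm (fun τ : ℝ => limitProfile r k R₀ R₁ M s (t j) (τ • η)) 2
      (volume.restrict (Icc (1 : ℝ) 2)) ^ (2 : ℝ) with hJ
  have hprob := isProbabilityMeasure_Icc_one_two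
  have hJm : ∀ j, Measurable (J j) := by
    intro j
    have h2 : J j = fun η => ∫⁻ τ in Icc (1 : ℝ) 2,
        ‖limitProfile r k R₀ R₁ M s (t j) (τ • η)‖ₑ ^ (2 : ℝ) := by
      ext η
      exact eLpNorm_two_rpow_two _ _
    rw [h2]
    have h3 : Measurable fun x : RSpace n × ℝ =>
        ‖limitProfile r k R₀ R₁ M s (t j) (x.2 • x.1)‖ₑ ^ (2 : ℝ) :=
      ((H.measurable_limitProfile k M s (t j)).comp (by fun_prop)).enorm.pow_const _
    exact h3.lintegral_prod_right'
  have hJ0 : Tendsto (fun j => ∫⁻ η, J j η) atTop (𝓝 0) := by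
    have h2 : Tendsto (fun j : ℕ => ENNReal.ofReal (1 / ((j : ℝ) + 1)) ^ (2 : ℝ)) atTop (𝓝 0) := by
      have h3 := ENNReal.tendsto_ofReal (tendsto_one_div_add_atTop_nhds_zero_nat (𝕜 := ℝ))
      have h4 := ((ENNReal.continuous_rpow_const (y := 2)).tendsto _).comp h3
      rw [ENNReal.ofReal_zero, ENNReal.zero_rpow_of_pos (by norm_num)] at h4
      exact h4
    refine tendsto_of_tendsto_of_tendsto_of_le_of_le tendsto_const_nhds h2 (fun _ => zero_le)
      fun j => ?_
    exact (lintegral_dilation_le _ (H.measurable_limitProfile k M s (t j))).trans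
      (ENNReal.rpow_le_rpow (htN j).le (by norm_num))
  have hfatou := lintegral_liminf_le (μ := (volume : Measure (RSpace n))) (u := atTop) hJm
  rw [hJ0.liminf_eq] at hfatou
  have hae := (lintegral_eq_zero_iff (Measurable.liminf hJm)).1 (le_antisymm hfatou zero_le)
  have hpos := Measure.measure_pos_of_mem_nhds (volume : Measure (RSpace n))
    (H.eventually_exists_root hω hb hbk)
  refine hpos.ne' (measure_mono_null ?_ (ae_iff.1 hae))
  rintro η ⟨hη, b', hb', hbk'⟩
  obtain ⟨ε, hε, hev⟩ := H.exists_limitProfile_ray_bound hM s hη hb' hbk'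
  have h5 : ENNReal.ofReal ε ^ (2 : ℝ) ≤ liminf (fun j => J j η) atTop := by
    refine le_liminf_of_le (by isBoundedDefault) ?_
    filter_upwards [httop.eventually hev] with j hj
    exact ENNReal.rpow_le_rpow hj (by norm_num)
  have h6 : 0 < ENNReal.ofReal ε ^ (2 : ℝ) :=
    ENNReal.rpow_pos (ENNReal.ofReal_pos.2 hε) ENNReal.ofReal_ne_top
  exact (h6.trans_le h5).ne'

variable [NeZero m] {s₀ : ℝ} {g : ℕ → RSpace n → ℂ}

/-- The decay rate is optimal. -/
lemma exists_dotNorm_lower_bound (H : DampedSystem r m R₀ R₁ R₂) (hn : 1 ≤ n)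
    (hs₀ : (m : ℝ) - 1 ≤ s₀) (hg : FourierData n m s₀ g) {k : ℕ} {s : ℝ} (hs : 0 ≤ s)
    (hks : k + s ≤ s₀) (hκ : (r : ℝ) < n / 2 + k + s) (hM : mass m (R₀ + R₁ + R₂) g ≠ 0)
    {ω : RSpace n} (hω : ω ∈ Metric.sphere (0 : RSpace n) 1) {b : ℂ}
    (hb : (symbolAt R₀ ω).IsRoot b) (hbk : b ^ k ≠ 0) :
    ∃ c : ℝ, 0 < c ∧ ∀ᶠ t : ℝ in atTop,
      c * (1 + t) ^ (-(n : ℝ) / 4 - ((k : ℝ) + s - r) / 2) ≤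
        dotNorm s (solHat m (R₀ + R₁ + R₂) g k t) := by
  obtain ⟨c, hc, hlow⟩ := H.exists_limitProfile_lower_bound hM s hω hb hbk
  have hlim := H.tendsto_rescale_solHat hn hs₀ hg hs hks hκ
  refine ⟨c / 4, by positivity, ?_⟩
  filter_upwards [hlow, hlim.eventually_le_const (ENNReal.ofReal_pos.2 (half_pos hc)),
    eventually_gt_atTop (0 : ℝ), (tendsto_rpow_div_one_add_rpow
      (-(n : ℝ) / 4 - ((k : ℝ) + s - r) / 2)).eventually_const_le one_half_lt_one] with t h1 h2 ht h3
  have hm := aestronglyMeasurable_solHat (Q := R₀ + R₁ + R₂) hg.continuous k t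
  have hF := aestronglyMeasurable_rescale r k s ht hm
  have hG := (H.measurable_limitProfile k (mass m (R₀ + R₁ + R₂) g) s t).aestronglyMeasurable
    (μ := volume)
  set F := rescale r k s t (solHat m (R₀ + R₁ + R₂) g k t) with hFdef
  have hfin : eLpNorm F 2 volume ≠ ⊤ := by
    rw [hFdef, eLpNorm_rescale hn r k s ht hm]
    exact (ENNReal.mul_lt_top ENNReal.ofReal_lt_top
      (H.memLp_weighted_solHat hs₀ hg hs hks ht.le).2).ne
  have h4 : ENNReal.ofReal c ≤ eLpNorm F 2 volume + ENNReal.ofReal (c / 2) := by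
    refine h1.trans ?_
    have h5 := eLpNorm_sub_le hF (hF.sub hG) (p := 2) (by norm_num)
    rw [sub_sub_cancel] at h5
    exact h5.trans (add_le_add le_rfl h2)
  have h6 : c / 2 ≤ (eLpNorm F 2 volume).toReal := by
    have h7 := ENNReal.toReal_mono (ENNReal.add_ne_top.2 ⟨hfin, ENNReal.ofReal_ne_top⟩) h4
    rw [ENNReal.toReal_add hfin ENNReal.ofReal_ne_top, ENNReal.toReal_ofReal hc.le,
      ENNReal.toReal_ofReal (by positivity)] at h7
    linarith
  rw [dotNorm_eq_rescale hn r k s ht hm]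
  have h8 : (0 : ℝ) < (1 + t) ^ (-(n : ℝ) / 4 - ((k : ℝ) + s - r) / 2) := by positivity
  rw [le_div_iff₀ h8] at h3
  calc c / 4 * (1 + t) ^ (-(n : ℝ) / 4 - ((k : ℝ) + s - r) / 2)
      = (1 / 2 * (1 + t) ^ (-(n : ℝ) / 4 - ((k : ℝ) + s - r) / 2)) * (c / 2) := by ring
    _ ≤ _ := by gcongr

end DampedSystem

end LowerBound

/-! ### The asymptotic profile of a solution -/

section Profile

variable {n r m : ℕ} {R₀ R₁ R₂ : DiffOp n}

lemma exists_fourierData {s₀ : ℝ} {u₀ : ℕ → L2Space n}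
    (hu₀ : ∀ j < m, TemperedDistribution.MemSobolev (s₀ - j) 2 (u₀ j : 𝓢'(RSpace n, ℂ)))
    (hint : ∀ j < m, Integrable (u₀ j : RSpace n → ℂ) volume) :
    ∃ g : ℕ → RSpace n → ℂ, FourierData n m s₀ g ∧ (∀ i < m, hatFn (u₀ i) =ᵐ[volume] g i) ∧
      ∀ i < m, g i 0 = ∫ x, (u₀ i : RSpace n → ℂ) x := by
  choose! g hgc hgb hg0 hgae using fun i (hi : i < m) => exists_continuous_hatFn (hint i hi)
  refine ⟨g, ⟨hgc, ⟨1 + ∑ i ∈ Finset.range m, ∫ x, ‖(u₀ i : RSpace n → ℂ) x‖, ?_, ?_⟩, ?_⟩, hgae,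
    hg0⟩
  · have : 0 ≤ ∑ i ∈ Finset.range m, ∫ x, ‖(u₀ i : RSpace n → ℂ) x‖ :=
      Finset.sum_nonneg fun i _ => integral_nonneg fun x => norm_nonneg _
    positivity
  · intro i hi ξ
    have := Finset.single_le_sum (f := fun i => ∫ x, ‖(u₀ i : RSpace n → ℂ) x‖)
      (fun i _ => integral_nonneg fun x => norm_nonneg _) (Finset.mem_range.2 hi)
    linarith [hgb i hi ξ]
  · intro i hi
    have h1 := memLp_comp_smul (c := (2 * Real.pi)⁻¹) (by positivity)
      (memLp_weight_fourier (hu₀ i hi)).norm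
    refine (memLp_congr_ae ?_).1 h1
    filter_upwards [hgae i hi] with ξ hξ
    rw [← hξ, norm_mul, Complex.norm_real, Real.norm_of_nonneg (by positivity), hatFn]

lemma dotNorm_congr_ae {s : ℝ} {F G : RSpace n → ℂ} (h : F =ᵐ[volume] G) :
    dotNorm s F = dotNorm s G := by
  rw [dotNorm, dotNorm, eLpNorm_congr_ae]
  filter_upwards [h] with ξ hξ
  rw [weighted, weighted, hξ]

namespace DampedSystem

lemma mass_eq (H : DampedSystem r m R₀ R₁ R₂) (g : ℕ → RSpace n → ℂ) :
    mass m (R₀ + R₁ + R₂) g = timeCoeff R₀ (r + 1) * g r 0 + timeCoeff R₁ (r + 2) * g (r + 1) 0 +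
      if r + 2 < m then timeCoeff R₂ (r + 3) * g (r + 2) 0 else 0 := by
  obtain ⟨hm, -⟩ := H.le_order
  have h1 : ∀ i, (charPoly (R₀ + R₁ + R₂) 0).coeff (i + 1) * g i 0 =
      (if i = r then timeCoeff R₀ (r + 1) * g i 0 else 0) +
      (if i = r + 1 then timeCoeff R₁ (r + 2) * g i 0 else 0) +
      (if i = r + 2 then timeCoeff R₂ (r + 3) * g i 0 else 0) := by
    intro i
    rw [charPoly_add, charPoly_add, Polynomial.coeff_add, Polynomial.coeff_add,
      coeff_charPoly_zero H.hyp₀.homogeneous, coeff_charPoly_zero H.hyp₁.homogeneous,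
      coeff_charPoly_zero H.homogeneous₂]
    simp only [Nat.add_right_cancel_iff, show r + 2 = r + 1 + 1 from rfl,
      show r + 3 = r + 2 + 1 from rfl, add_mul, ite_mul, zero_mul]
  rw [mass]
  simp only [h1, Finset.sum_add_distrib, Finset.sum_ite_eq', Finset.mem_range]
  rw [if_pos (show r < m by omega), if_pos (show r + 1 < m by omega)]

lemma exists_root_pow_ne_zero (H : DampedSystem r m R₀ R₁ R₂) (hn : 1 ≤ n) {k : ℕ}
    (hk : k = 0 ∨ ∃ ξ' ∈ Metric.sphere (0 : RSpace n) 1, ∃ b : ℂ,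
      b ≠ 0 ∧ (symbolAt R₀ ξ').IsRoot b) :
    ∃ ω ∈ Metric.sphere (0 : RSpace n) 1, ∃ b : ℂ, (symbolAt R₀ ω).IsRoot b ∧ b ^ k ≠ 0 := by
  rcases hk with rfl | ⟨ω, hω, b, hb, hroot⟩
  · have : Nonempty (Fin n) := ⟨⟨0, hn⟩⟩
    have : Nontrivial (RSpace n) := inferInstance
    obtain ⟨ω, hω⟩ := NormedSpace.sphere_nonempty (E := RSpace n) (x := 0) (r := 1) |>.2 zero_le_one
    have h1 : 0 < (symbolAt R₀ ω).roots.toFinset.card := by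
      rw [H.hyp₀.card_roots hω]
      omega
    obtain ⟨b, hb⟩ := Finset.card_pos.1 h1
    exact ⟨ω, hω, b, H.hyp₀.mem_roots.1 hb, by rw [pow_zero]; exact one_ne_zero⟩
  · exact ⟨ω, hω, b, hroot, pow_ne_zero k hb⟩

/-- The asymptotics of solutions, for lower order terms of one or two orders. -/
theorem hasAsymptoticProfile (H : DampedSystem r m R₀ R₁ R₂) (hn : 1 ≤ n) {s₀ : ℝ}
    (hs₀ : (m : ℝ) - 1 ≤ s₀) {u₀ : ℕ → L2Space n}
    (hu₀ : ∀ j < m, TemperedDistribution.MemSobolev (s₀ - j) 2 (u₀ j : 𝓢'(RSpace n, ℂ)))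
    (hint : ∀ j < m, Integrable (u₀ j : RSpace n → ℂ) volume) {u : ℝ → L2Space n}
    (hu : IsCauchySolution m (R₀ + R₁ + R₂) s₀ u₀ u) {M : ℂ}
    (hM : M = timeCoeff R₀ (r + 1) * (∫ x, (u₀ r : RSpace n → ℂ) x) +
      timeCoeff R₁ (r + 2) * (∫ x, (u₀ (r + 1) : RSpace n → ℂ) x) +
      if r + 2 < m then timeCoeff R₂ (r + 3) * ∫ x, (u₀ (r + 2) : RSpace n → ℂ) x else 0) :
    HasAsymptoticProfile r R₀ R₁ M s₀ u := by
  obtain ⟨hm, -⟩ := H.le_order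
  have : NeZero m := ⟨by omega⟩
  obtain ⟨g, hg, hgae, hg0⟩ := exists_fourierData hu₀ hint
  have hmass : M = mass m (R₀ + R₁ + R₂) g := by
    rw [hM, H.mass_eq, hg0 r (by omega), hg0 (r + 1) (by omega)]
    split_ifs with h
    · rw [hg0 (r + 2) h]
    · rfl
  intro k s hs hks hrn
  have hκ : (r : ℝ) < n / 2 + k + s := hrn
  obtain ⟨hreg, hsol⟩ := H.regularity hs₀ hu₀ hu (N := k) (by linarith)
  have hsol' : ∀ t, 0 ≤ t → hatFn (timeDeriv k u t) =ᵐ[volume] solHat m (R₀ + R₁ + R₂) g k t := by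
    intro t ht
    have hall : ∀ᵐ ξ, ∀ i ∈ Finset.range m, hatFn (u₀ i) ξ = g i ξ :=
      (eventually_all_finset _).2 fun i hi => hgae i (Finset.mem_range.1 hi)
    filter_upwards [hsol t ht, hall] with ξ h1 h2
    rw [h1, solHat, solJet_eq_sum, solJet_eq_sum]
    exact Finset.sum_congr rfl fun i hi => by rw [h2 i hi]
  have hdiff : ∀ t, 0 ≤ t → (fun ξ => hatFn (timeDeriv k u t) ξ -
      rieszProfileDeriv r R₀ R₁ M k t ξ) =ᵐ[volume] fun ξ => solHat m (R₀ + R₁ + R₂) g k t ξ -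
      rieszProfileDeriv r R₀ R₁ M k t ξ := fun t ht => by
    filter_upwards [hsol' t ht] with ξ hξ
    rw [hξ]
  refine ⟨hreg, fun t ht => ?_, ?_, fun hM0 hroot => ?_⟩
  · refine (memLp_congr_ae ?_).1 ((H.memLp_weighted_solHat hs₀ hg hs hks ht.le).sub
      (H.memLp_weighted_rieszProfileDeriv hn M hκ ht))
    filter_upwards [hsol' t ht.le] with ξ hξ
    simp only [Pi.sub_apply, weighted, hξ, mul_sub]
  · have h1 := H.isLittleO_dotNorm_sub_profile hn hs₀ hg hs hks hκ
    rw [← hmass] at h1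
    refine h1.congr' ?_ EventuallyEq.rfl
    filter_upwards [eventually_ge_atTop (0 : ℝ)] with t ht
    exact (dotNorm_congr_ae (hdiff t ht)).symm
  · obtain ⟨ω, hω, b, hb, hbk⟩ := H.exists_root_pow_ne_zero hn hroot
    obtain ⟨c, hc, h1⟩ := H.exists_dotNorm_lower_bound hn hs₀ hg hs hks hκ
      (by rwa [← hmass]) hω hb hbk
    refine ⟨c, hc, ?_⟩
    filter_upwards [h1, eventually_ge_atTop (0 : ℝ)] with t h2 ht
    rwa [dotNorm_congr_ae (hsol' t ht)]

end DampedSystem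

end Profile
theorem theorem3 (n m : ℕ) (hn : 1 ≤ n) (hm : 2 ≤ m)
    (Pm Pm1 : DiffOp n)
    (hPm : IsStrictlyHyperbolic Pm m) (hPm_monic : timeCoeff Pm m = 1)
    (hPm1 : IsStrictlyHyperbolic Pm1 (m - 1))
    (hint : ∀ ξ' ∈ Metric.sphere (0 : RSpace n) 1,
      StrictlyInterlace (m - 1) (symbolAt Pm1 ξ') (symbolAt Pm ξ'))
    (s₀ : ℝ) (hs₀ : (m : ℝ) - 1 ≤ s₀) (u₀ : ℕ → L2Space n)
    (hu₀_sobolev : ∀ j < m,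
      TemperedDistribution.MemSobolev (s₀ - j) 2 (u₀ j : 𝓢'(RSpace n, ℂ)))
    (hu₀_integrable : ∀ j < m, Integrable (u₀ j : RSpace n → ℂ) volume) :
    (∀ u : ℝ → L2Space n, IsCauchySolution m (Pm + Pm1) s₀ u₀ u →
      HasAsymptoticProfile (m - 2) Pm1 Pm
        (∫ x, ((u₀ (m - 1) : RSpace n → ℂ) x
          + timeCoeff Pm1 (m - 1) * (u₀ (m - 2) : RSpace n → ℂ) x)) s₀ u) ∧
    (∀ Pm2 : DiffOp n, 3 ≤ m → IsStrictlyHyperbolic Pm2 (m - 2) →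
      (∀ ξ' ∈ Metric.sphere (0 : RSpace n) 1,
        StrictlyInterlace (m - 2) (symbolAt Pm2 ξ') (symbolAt Pm1 ξ')) →
      ∀ u : ℝ → L2Space n, IsCauchySolution m (Pm + Pm1 + Pm2) s₀ u₀ u →
        HasAsymptoticProfile (m - 3) Pm2 Pm1
          (∫ x, ((u₀ (m - 1) : RSpace n → ℂ) x
            + timeCoeff Pm1 (m - 1) * (u₀ (m - 2) : RSpace n → ℂ) x
            + timeCoeff Pm2 (m - 2) * (u₀ (m - 3) : RSpace n → ℂ) x)) s₀ u) := by
  refine ⟨fun u hu => ?_, fun Pm2 hm3 hPm2 hint2 u hu => ?_⟩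
  · obtain ⟨r, rfl⟩ : ∃ r, m = r + 2 := ⟨m - 2, by omega⟩
    have H : DampedSystem r (r + 2) Pm1 Pm 0 :=
      ⟨hPm1, hPm, hint, Or.inl ⟨rfl, rfl, hPm_monic⟩⟩
    have hQ : Pm + Pm1 = Pm1 + Pm + 0 := by rw [add_zero, add_comm]
    rw [hQ] at hu
    refine H.hasAsymptoticProfile hn hs₀ hu₀_sobolev hu₀_integrable hu ?_
    rw [if_neg (lt_irrefl _), hPm_monic]
    change ∫ x, ((u₀ (r + 1) : RSpace n → ℂ) x +
      timeCoeff Pm1 (r + 1) * (u₀ r : RSpace n → ℂ) x) = _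
    rw [integral_add (hu₀_integrable _ (by omega)) ((hu₀_integrable _ (by omega)).const_mul _),
      integral_const_mul]
    ring
  · obtain ⟨r, rfl⟩ : ∃ r, m = r + 3 := ⟨m - 3, by omega⟩
    have H : DampedSystem r (r + 3) Pm2 Pm1 Pm :=
      ⟨hPm2, hPm1, hint2, Or.inr ⟨rfl, hPm, hPm_monic, hint⟩⟩
    have hQ : Pm + Pm1 + Pm2 = Pm2 + Pm1 + Pm := by ring
    rw [hQ] at hu
    refine H.hasAsymptoticProfile hn hs₀ hu₀_sobolev hu₀_integrable hu ?_
    rw [if_pos (by omega), hPm_monic]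
    change ∫ x, ((u₀ (r + 2) : RSpace n → ℂ) x + timeCoeff Pm1 (r + 2) *
      (u₀ (r + 1) : RSpace n → ℂ) x + timeCoeff Pm2 (r + 1) * (u₀ r : RSpace n → ℂ) x) = _
    have h0 := hu₀_integrable r (by omega)
    have h1 := hu₀_integrable (r + 1) (by omega)
    have h2 := hu₀_integrable (r + 2) (by omega)
    have h3 : Integrable (fun x => (u₀ (r + 2) : RSpace n → ℂ) x +
        timeCoeff Pm1 (r + 2) * (u₀ (r + 1) : RSpace n → ℂ) x) volume := h2.add (h1.const_mul _)
    rw [integral_add h3 (h0.const_mul _), integral_add h2 (h1.const_mul _),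
      integral_const_mul, integral_const_mul]
    ring
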